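/- **Notation.** Let $\mathbb K$ be a field of characteristic $0$ and $R=\mathbb K[[\hbar]]$. $FL_n$ denotes the part of the free Lie algebra over $R$ on $n$ generators which is homogeneous of degree $1$ in each generator, and $\mathrm{Part}_\alpha(n)$ the set of $\alpha$-tuples of nonnegative integers with sum $n$. Let $\omega=(B_{pq})_{p,q\ge 0}$ be a family with $B_{pq}(x_1,\dots,x_p|y_1,\dots,y_q)\in FL_{p+q}$, such that $B_{10}(x)=B_{01}(x)=x$, $B_{p0}=B_{0p}=0$ for $p\ne1$, $B_{11}(x,y)=c[x,y]$ for some $c\in R$, and, for all $p,q,r>0$, $$\sum_{\alpha>0}\ \sum_{(p_\beta)\in \mathrm{Part}_\alpha(p),\,(q_\beta)\in \mathrm{Part}_\alpha(q)} B_{\alpha r}\big(B_{p_1q_1}(x_1,\dots,x_{p_1}|y_1,\dots,y_{q_1}),\dots,B_{p_\alpha q_\alpha}(\dots,x_p|\dots,y_q)\,\big|\,z_1,\dots,z_r\big)$$ $$=\sum_{\alpha>0}\ \sum_{(q_\beta)\in \mathrm{Part}_\alpha(q),\,(r_\beta)\in \mathrm{Part}_\alpha(r)} B_{p\alpha}\big(x_1,\dots,x_p\,\big|\,B_{q_1r_1}(y_1,\dots,y_{q_1}|z_1,\dots,z_{r_1}),\dots,B_{q_\alpha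 r_\alpha}(\dots,y_q|\dots,z_r)\big).$$ Let $\omega^\vee=(B^\vee_{pq})$ with $B^\vee_{pq}(x_1,\dots,x_p|y_1,\dots,y_q)=B_{pq}(x_p,\dots,x_1|y_q,\dots,y_1)$. For a Lie algebra $\mathfrak g$ over $\mathbb K$, $\mathrm{Sh}^\omega(\mathfrak g)$ is the space $T(\mathfrak g)[[\hbar]]$, where $x_1\otimes\cdots\otimes x_n$ is written $(x_1\ldots x_n)$, with the product $$(x_1\ldots x_n)\cdot(y_1\ldots y_m)=\sum_{k\ge0}\ \sum_{(p_i)\in\mathrm{Part}_k(n),\,(q_i)\in\mathrm{Part}_k(m)}\big(B_{p_1q_1}(x_1\ldots x_{p_1}|y_1\ldots y_{q_1})\ \ldots\ B_{p_kq_k}(\ldots x_n|\ldots y_m)\big),$$ the coproduct $\Delta((x_1\ldots x_n))=\sum_{i=0}^n(x_1\ldots x_i)\otimes(x_{i+1}\ldots x_n)$, and the antipode $S$ defined by $S(1)=1$ and $S((x_1\ldots x_n))=-\sum_{i=0}^{n-1}S((x_1\ldots x_i))\cdot(x_{i+1}\ldots x_n)$ for $n\ge 1$. All tensor products of these spaces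 are $\hbar$-adically completed. Let $\mathrm{conc}$ be the concatenation of words, $\mathrm{conc}^{(k)}$ and $m^{(k)}$ the $k$-fold concatenation and the $k$-fold product of $\mathrm{Sh}^\omega$, $\Psi((x_1\ldots x_n))=(x_n\ldots x_1)$, and $\mathrm{pr}_{\mathfrak g}$ the projection on words of length $1$. **The elements.** Let $\mathfrak a,\mathfrak b$ be Lie algebras over $\mathbb K$ and $r\in\mathfrak a\otimes\mathfrak b$. Define $\rho_n=\rho_n(r)\in \mathrm{Sh}^\omega(\mathfrak a)\otimes\mathfrak b$ ($n\ge1$) and $R'_n=R'_n(r)\in\mathrm{Sh}^\omega(\mathfrak a)\otimes\mathrm{Sh}^{\omega^\vee}(\mathfrak b)$ ($n\ge0$) inductively by $R'_0=1$, $\rho_1=r$, $$R'_n=\sum_{k\ge1}\ \sum_{\substack{n_1,\dots,n_k>0\\ n_1+\cdots+n_k=n}}\big(m^{(k)}_{\mathrm{Sh}^\omega(\mathfrak a)}\otimes\mathrm{conc}^{(k)}\big)\big(\rho_{n_1}^{(1,k+1)}\cdots\rho_{n_k}^{(k,2k)}\big)\qquad(n\ge 1),$$ $$\rho_n=(h\otimes\mathrm{id})\Big(\sum_{0<j<n}(\mathrm{id}\otimes\mathrm{id}\otimes\mathrm{pr}_{\mathfrak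 b})\big(R_j'^{(13)}R_{n-j}'^{(23)}\big)\Big)\qquad(n\ge2),$$ where the product is that of $\mathrm{Sh}^\omega(\mathfrak a)\otimes\mathrm{Sh}^\omega(\mathfrak a)\otimes\mathrm{Sh}^{\omega^\vee}(\mathfrak b)$, and $h(u\otimes v)=\frac1{k-1}\mathrm{conc}(u\otimes v)$ if $u,v$ are words of total length $k\ge2$ (and $h(u\otimes v)=0$ if $k<2$; such terms do not occur). Set $R_n=R^\omega_n(r)=(\mathrm{id}\otimes\Psi)(R'_n)\in\mathrm{Sh}^\omega(\mathfrak a)\otimes\mathrm{Sh}^\omega(\mathfrak b)$. **Proposition.** (1) *The formulas are universal.* For all integers $k\ge 0$ and $n_1,\dots,n_k\ge 0$ there is an element $\lambda_{n_1,\dots,n_k}$ of $(\bigotimes_{i=1}^kFL_{n_i})\otimes FL_{n_1+\cdots+n_k}$, depending only on $\omega$, with $\lambda_1=x_1\otimes y_1$, such that for all $\mathfrak a,\mathfrak b$, every $r=\sum_{i\in I}a_i\otimes b_i$ ($I$ finite) and every $n\ge1$, $$\rho_n(r)=\sum_{k\geq 1}\ \sum_{\substack{n_1,\dots,n_k>0\\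 n_1+\cdots+n_k=n}}\kappa(r)(\lambda_{n_1,\dots,n_k}),$$ where $$\kappa(r)(P_1\otimes\cdots\otimes P_k\otimes Q)=\sum_{i_1,\dots,i_n\in I}\big(P_1(a_{i_1},\dots,a_{i_{n_1}})\ \ldots\ P_k(\dots,a_{i_n})\big)\otimes Q(b_{i_1},\dots,b_{i_n}).$$ (2) $R_0=1$ and $R_1=r$, and for all $n\ge0$ $$(\Delta\otimes\mathrm{id})(R_n)=\sum_{k=0}^nR_k^{(13)}R_{n-k}^{(23)},\qquad(\mathrm{id}\otimes\Delta)(R_n)=\sum_{k=0}^nR_k^{(13)}R_{n-k}^{(12)}$$ in $\mathrm{Sh}^\omega(\mathfrak a)\otimes\mathrm{Sh}^\omega(\mathfrak a)\otimes\mathrm{Sh}^\omega(\mathfrak b)$ and $\mathrm{Sh}^\omega(\mathfrak a)\otimes\mathrm{Sh}^\omega(\mathfrak b)\otimes\mathrm{Sh}^\omega(\mathfrak b)$, respectively. (3) The antipode $S$ of $\mathrm{Sh}^\omega(\mathfrak b)$ is bijective, and $(S_{\mathrm{Sh}^\omega(\mathfrak a)}\otimes\mathrm{id})(R_n)=(\mathrm{id}\otimes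 S^{-1}_{\mathrm{Sh}^\omega(\mathfrak b)})(R_n)$ for all $n\ge0$. -/

import Mathlib

open scoped TensorProduct PowerSeries

noncomputable section

namespace ShuffleHopf

/-! ### Multilinear parts of free Lie algebras -/

section FreeLie

universe u v

/-- The iterated bracket attached to a bracketed word. -/
def lieMonomial (R : Type u) [CommRing R] {X : Type v} : FreeMagma X → FreeLieAlgebra R X
  | .of i => FreeLieAlgebra.of R i
  | .mul a b => ⁅lieMonomial R a, lieMonomial R b⁆

/-- The letters of a bracketed word, with multiplicity. -/
def leaves {X : Type v} : FreeMagma X → Multiset X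
  | .of i => {i}
  | .mul a b => leaves a + leaves b

/-- `FL R X`: the part of the free Lie algebra on the finite set `X` of generators which is
homogeneous of degree `1` in each generator. It is spanned by the iterated brackets in which
each generator occurs exactly once. -/
def FL (R : Type u) [CommRing R] (X : Type v) [Fintype X] : Submodule R (FreeLieAlgebra R X) :=
  Submodule.span R (lieMonomial R '' {w | leaves w = (Finset.univ : Finset X).val})

theorem lift_lieMonomial_update_of_notMem {R : Type u} [CommRing R] {X : Type v} {L : Type*}
    [LieRing L] [LieAlgebra R L] [DecidableEq X] (w : FreeMagma X) (x : X → L) (i : X) (c : L)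
    (h : i ∉ leaves w) :
    FreeLieAlgebra.lift R (Function.update x i c) (lieMonomial R w)
      = FreeLieAlgebra.lift R x (lieMonomial R w) := by
  induction w using FreeMagma.rec with
  | of j =>
    have hj : j ≠ i := by
      rintro rfl
      exact h (by simp [leaves])
    simp [lieMonomial, FreeLieAlgebra.lift_of_apply, Function.update_of_ne hj]
  | mul a b iha ihb =>
    simp only [leaves, Multiset.mem_add, not_or] at h
    simp only [lieMonomial, LieHom.map_lie]
    rw [iha h.1, ihb h.2]

theorem lift_lieMonomial_update {R : Type u} [CommRing R] {X : Type v} {L : Type*}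
    [LieRing L] [LieAlgebra R L] [DecidableEq X] (w : FreeMagma X) (x : X → L) (i : X)
    (hn : (leaves w).Nodup) (h : i ∈ leaves w) :
    ∃ f : L →ₗ[R] L, ∀ c,
      FreeLieAlgebra.lift R (Function.update x i c) (lieMonomial R w) = f c := by
  induction w using FreeMagma.rec with
  | of j =>
    simp only [leaves, Multiset.mem_singleton] at h
    subst h
    exact ⟨LinearMap.id, fun c => by simp [lieMonomial, FreeLieAlgebra.lift_of_apply]⟩
  | mul a b iha ihb =>
    simp only [leaves] at h hn
    obtain ⟨hna, hnb, hd⟩ := Multiset.nodup_add.mp hn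
    rcases Multiset.mem_add.mp h with ha | hb
    · obtain ⟨f, hf⟩ := iha hna ha
      have hb : i ∉ leaves b := Multiset.disjoint_left.mp hd ha
      refine ⟨-((LieAlgebra.ad R L (FreeLieAlgebra.lift R x (lieMonomial R b)) :
        Module.End R L) ∘ₗ f), fun c => ?_⟩
      simp only [lieMonomial, LieHom.map_lie]
      rw [hf, lift_lieMonomial_update_of_notMem b x i c hb]
      simp
    · obtain ⟨f, hf⟩ := ihb hnb hb
      have ha : i ∉ leaves a := fun ha => Multiset.disjoint_left.mp hd ha hb
      refine ⟨(LieAlgebra.ad R L (FreeLieAlgebra.lift R x (lieMonomial R a)) :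
        Module.End R L) ∘ₗ f, fun c => ?_⟩
      simp only [lieMonomial, LieHom.map_lie]
      rw [hf, lift_lieMonomial_update_of_notMem a x i c ha]
      simp

theorem lift_update_of_mem_FL {R : Type u} [CommRing R] {X : Type v} [Fintype X] {L : Type*}
    [LieRing L] [LieAlgebra R L] [DecidableEq X] (P : FreeLieAlgebra R X) (hP : P ∈ FL R X)
    (x : X → L) (i : X) :
    ∃ f : L →ₗ[R] L, ∀ c, FreeLieAlgebra.lift R (Function.update x i c) P = f c := by
  refine Submodule.span_induction (p := fun P _ => ∃ f : L →ₗ[R] L, ∀ c,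
    FreeLieAlgebra.lift R (Function.update x i c) P = f c) ?_ ?_ ?_ ?_ hP
  · rintro _ ⟨w, hw, rfl⟩
    have hw' : leaves w = (Finset.univ : Finset X).val := hw
    exact lift_lieMonomial_update w x i (hw' ▸ Finset.univ.nodup)
      (hw' ▸ Finset.mem_val.mpr (Finset.mem_univ i))
  · exact ⟨0, fun c => by simp⟩
  · rintro P Q _ _ ⟨f, hf⟩ ⟨g, hg⟩
    exact ⟨f + g, fun c => by simp [hf, hg]⟩
  · rintro r P _ ⟨f, hf⟩
    exact ⟨r • f, fun c => by simp [hf]⟩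

/-- The evaluation `x ↦ P(x)` of `P ∈ FL R X` at elements of a Lie algebra over `R`. -/
def evalFL {R : Type u} [CommRing R] {X : Type v} [Fintype X] (L : Type*) [LieRing L]
    [LieAlgebra R L] (P : FL R X) : MultilinearMap R (fun _ : X => L) L where
  toFun x := FreeLieAlgebra.lift R x (P : FreeLieAlgebra R X)
  map_update_add' x i c d := by
    obtain ⟨f, hf⟩ := lift_update_of_mem_FL (P : FreeLieAlgebra R X) P.2 x i
    rw [hf, hf, hf, map_add]
  map_update_smul' x i r c := by
    obtain ⟨f, hf⟩ := lift_update_of_mem_FL (P : FreeLieAlgebra R X) P.2 x i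
    rw [hf, hf, map_smul]

/-- Renaming of generators. -/
def relabel {R : Type u} [CommRing R] {X Y : Type v} (e : X → Y) :
    FreeLieAlgebra R X →ₗ⁅R⁆ FreeLieAlgebra R Y :=
  FreeLieAlgebra.lift R fun i => FreeLieAlgebra.of R (e i)

theorem relabel_lieMonomial {R : Type u} [CommRing R] {X Y : Type v} (e : X → Y)
    (w : FreeMagma X) :
    relabel e (lieMonomial R w) = lieMonomial R (FreeMagma.map e w) := by
  induction w using FreeMagma.rec with
  | of j => exact FreeLieAlgebra.lift_of_apply _ j
  | mul a b iha ihb =>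
    change relabel e ⁅lieMonomial R a, lieMonomial R b⁆ =
      ⁅lieMonomial R (FreeMagma.map e a), lieMonomial R (FreeMagma.map e b)⁆
    rw [LieHom.map_lie, iha, ihb]

theorem leaves_map {X Y : Type v} (e : X → Y) (w : FreeMagma X) :
    leaves (FreeMagma.map e w) = (leaves w).map e := by
  induction w using FreeMagma.rec with
  | of j => exact (Multiset.map_singleton e j).symm
  | mul a b iha ihb =>
    change leaves (FreeMagma.map e a) + leaves (FreeMagma.map e b) = _
    rw [iha, ihb, leaves, Multiset.map_add]

theorem relabel_mem_FL {R : Type u} [CommRing R] {X Y : Type v} [Fintype X] [Fintype Y]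
    (e : X ≃ Y) (P : FreeLieAlgebra R X) (hP : P ∈ FL R X) : relabel e P ∈ FL R Y := by
  refine Submodule.span_induction (p := fun P _ => relabel e P ∈ FL R Y) ?_ ?_ ?_ ?_ hP
  · rintro _ ⟨w, hw, rfl⟩
    rw [relabel_lieMonomial]
    refine Submodule.subset_span ⟨_, ?_, rfl⟩
    have hw' : leaves w = (Finset.univ : Finset X).val := hw
    change leaves _ = _
    rw [leaves_map, hw', ← Finset.map_univ_equiv e]
    rfl
  · simp
  · intro P Q _ _ h1 h2
    rw [map_add]
    exact add_mem h1 h2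
  · intro r P _ h
    rw [map_smul]
    exact Submodule.smul_mem _ r h

end FreeLie

/-! ### Partitions -/

/-- `Part α n`: the `α`-tuples of nonnegative integers with sum `n`. -/
abbrev Part (α n : ℕ) : Type := {P : Fin α → ℕ // P ∈ Finset.Nat.antidiagonalTuple α n}

/-- The decomposition of `{1, …, n}` into consecutive blocks of sizes `P 0, P 1, …`. -/
def Part.blocks {α n : ℕ} (P : Part α n) : (Σ β : Fin α, Fin (P.1 β)) ≃ Fin n :=
  finSigmaFinEquiv.trans (finCongr (Finset.Nat.mem_antidiagonalTuple.mp P.2))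

/-! ### The set `𝓑(R)` -/

section Families

universe u

/-- Families `(B_{pq})` with `B_{pq}` in `FL_{p+q}(R)`, the `p + q` generators being divided
into `x_1, …, x_p` (the left summand) and `y_1, …, y_q` (the right summand). -/
abbrev LieFamily (R : Type u) [CommRing R] : Type u := ∀ p q : ℕ, FL R (Fin p ⊕ Fin q)

namespace LieFamily

variable {R : Type u} [CommRing R]

/-- The Lie polynomial `B_{pq}(x_1, …, x_p | y_1, …, y_q)`. -/
def app (ω : LieFamily R) {L : Type*} [LieRing L] [LieAlgebra R L] {p q : ℕ}
    (x : Fin p → L) (y : Fin q → L) : L :=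
  FreeLieAlgebra.lift R (Sum.elim x y) (ω p q : FreeLieAlgebra R (Fin p ⊕ Fin q))

/-- The sequence
`B_{p_1 q_1}(x_1, …, x_{p_1} | y_1, …, y_{q_1}), …, B_{p_α q_α}(…, x_p | …, y_q)`. -/
def blockApp (ω : LieFamily R) {L : Type*} [LieRing L] [LieAlgebra R L] {p q α : ℕ}
    (P : Part α p) (Q : Part α q) (x : Fin p → L) (y : Fin q → L) (β : Fin α) : L :=
  ω.app (fun i => x (P.blocks ⟨β, i⟩)) (fun i => y (Q.blocks ⟨β, i⟩))

/-- `ω ∈ 𝓑(R)`. In the sums over `α`, the terms with `α > p + q` (resp. `α > q + r`) are omitted: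
they involve some `B_{00} = 0` and vanish. -/
structure IsShuffleFamily (ω : LieFamily R) : Prop where
  one_zero : (ω 1 0 : FreeLieAlgebra R (Fin 1 ⊕ Fin 0)) = FreeLieAlgebra.of R (Sum.inl 0)
  zero_one : (ω 0 1 : FreeLieAlgebra R (Fin 0 ⊕ Fin 1)) = FreeLieAlgebra.of R (Sum.inr 0)
  left_zero : ∀ p, p ≠ 1 → ω p 0 = 0
  right_zero : ∀ q, q ≠ 1 → ω 0 q = 0
  one_one : ∃ c : R, (ω 1 1 : FreeLieAlgebra R (Fin 1 ⊕ Fin 1)) =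
    c • ⁅FreeLieAlgebra.of R (Sum.inl 0 : Fin 1 ⊕ Fin 1), FreeLieAlgebra.of R (Sum.inr 0)⁆
  assoc : ∀ p q r : ℕ, 0 < p → 0 < q → 0 < r →
    let x : Fin p → FreeLieAlgebra R (Fin p ⊕ Fin q ⊕ Fin r) :=
      fun i => FreeLieAlgebra.of R (Sum.inl i)
    let y : Fin q → FreeLieAlgebra R (Fin p ⊕ Fin q ⊕ Fin r) :=
      fun i => FreeLieAlgebra.of R (Sum.inr (Sum.inl i))
    let z : Fin r → FreeLieAlgebra R (Fin p ⊕ Fin q ⊕ Fin r) :=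
      fun i => FreeLieAlgebra.of R (Sum.inr (Sum.inr i))
    ∑ α ∈ Finset.Icc 1 (p + q), ∑ P : Part α p, ∑ Q : Part α q,
        ω.app (ω.blockApp P Q x y) z =
      ∑ α ∈ Finset.Icc 1 (q + r), ∑ Q : Part α q, ∑ S : Part α r,
        ω.app x (ω.blockApp Q S y z)

/-- The opposite family `ω^∨`:
`B^∨_{pq}(x_1, …, x_p | y_1, …, y_q) = B_{pq}(x_p, …, x_1 | y_q, …, y_1)`. -/
def vee (ω : LieFamily R) : LieFamily R := fun p q =>
  ⟨relabel (Equiv.sumCongr Fin.revPerm Fin.revPerm) (ω p q : FreeLieAlgebra R (Fin p ⊕ Fin q)),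
    relabel_mem_FL (Equiv.sumCongr Fin.revPerm Fin.revPerm) _ (ω p q).2⟩

end LieFamily

end Families

/-! ### Formal series with coefficients in a vector space

For a `K`-algebra `V` (only its vector space structure matters here), `V⟦X⟧` is `V[[ħ]]`, the
variable `X` being `ħ`. The completed tensor product of `V[[ħ]]` and `W[[ħ]]` is
`(V ⊗ W)[[ħ]]`. -/

section Series

variable {K : Type*} [Field K]
variable {V : Type*} [Ring V] [Algebra K V] {W : Type*} [Ring W] [Algebra K W]

/-- The inclusion of `V` in `V[[ħ]]` as constant series. -/
def const : V →ₗ[K] V⟦X⟧ where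
  toFun v := PowerSeries.C v
  map_add' := map_add _
  map_smul' a v := by
    ext n
    rw [PowerSeries.coeff_C, RingHom.id_apply, PowerSeries.coeff_smul, PowerSeries.coeff_C]
    split_ifs <;> simp

/-- The natural map `K[[ħ]] ⊗ V → V[[ħ]]`. -/
def toSeries : K⟦X⟧ ⊗[K] V →ₗ[K] V⟦X⟧ :=
  TensorProduct.lift <| LinearMap.mk₂ K
    (fun f v => PowerSeries.mk fun n => PowerSeries.coeff n f • v)
    (fun f g v => by ext n; simp [add_smul])
    (fun a f v => by
      ext n
      rw [PowerSeries.coeff_smul, PowerSeries.coeff_mk, PowerSeries.coeff_mk,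
        PowerSeries.coeff_smul, smul_assoc])
    (fun f v w => by ext n; simp)
    (fun a f v => by
      ext n
      rw [PowerSeries.coeff_smul, PowerSeries.coeff_mk, PowerSeries.coeff_mk, smul_comm])

/-- The coefficientwise extension `V[[ħ]] → W[[ħ]]` of a linear map `V → W`. -/
def mapSer (f : V →ₗ[K] W) : V⟦X⟧ →ₗ[K] W⟦X⟧ where
  toFun v := PowerSeries.mk fun n => f (PowerSeries.coeff n v)
  map_add' v w := by ext n; simp
  map_smul' a v := by ext n; simp

/-- The `K[[ħ]]`-linear, `ħ`-adically continuous extension `V[[ħ]] → W[[ħ]]` of a `K`-linear map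
`V → W[[ħ]]`. -/
def hExt (f : V →ₗ[K] W⟦X⟧) : V⟦X⟧ →ₗ[K] W⟦X⟧ where
  toFun v := PowerSeries.mk fun n => ∑ ij ∈ Finset.HasAntidiagonal.antidiagonal n,
    PowerSeries.coeff ij.2 (f (PowerSeries.coeff ij.1 v))
  map_add' v w := by ext n; simp [Finset.sum_add_distrib]
  map_smul' a v := by ext n; simp [Finset.smul_sum]

/-- The natural map from `V[[ħ]] ⊗ W[[ħ]]` to its completion `(V ⊗ W)[[ħ]]`. -/
def hTensor : V⟦X⟧ ⊗[K] W⟦X⟧ →ₗ[K] (V ⊗[K] W)⟦X⟧ :=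
  TensorProduct.lift <| LinearMap.mk₂ K
    (fun v w => PowerSeries.mk fun n => ∑ ij ∈ Finset.HasAntidiagonal.antidiagonal n,
      PowerSeries.coeff ij.1 v ⊗ₜ[K] PowerSeries.coeff ij.2 w)
    (fun v v' w => by ext n; simp [TensorProduct.add_tmul, Finset.sum_add_distrib])
    (fun a v w => by ext n; simp [TensorProduct.smul_tmul', Finset.smul_sum])
    (fun v w w' => by ext n; simp [TensorProduct.tmul_add, Finset.sum_add_distrib])
    (fun a v w => by ext n; simp [Finset.smul_sum])

/-- The tensor product of two (deformed) multiplications. -/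
def tensorMul (μ : V ⊗[K] V →ₗ[K] V⟦X⟧) (ν : W ⊗[K] W →ₗ[K] W⟦X⟧) :
    (V ⊗[K] W) ⊗[K] (V ⊗[K] W) →ₗ[K] (V ⊗[K] W)⟦X⟧ :=
  hTensor ∘ₗ TensorProduct.map μ ν ∘ₗ (TensorProduct.tensorTensorTensorComm K V W V W).toLinearMap

/-- The extension of a (deformed) multiplication to `V[[ħ]]`. -/
def hMul (μ : V ⊗[K] V →ₗ[K] V⟦X⟧) : V⟦X⟧ ⊗[K] V⟦X⟧ →ₗ[K] V⟦X⟧ :=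
  hExt μ ∘ₗ hTensor

end Series

/-! ### Linear maps out of tensor algebras -/

section Words

variable {K : Type*} [Field K] {M : Type*} [AddCommGroup M] [Module K M]
variable {V : Type*} [AddCommGroup V] [Module K V]

/-- The linear map `T(M) → V` given by `x_1 ⊗ ⋯ ⊗ x_n ↦ f_n(x_1, …, x_n)` (it depends linearly on
the family `f`). -/
def wordLift : (∀ n : ℕ, MultilinearMap K (fun _ : Fin n => M) V) →ₗ[K]
    (TensorAlgebra K M →ₗ[K] V) :=
  LinearMap.lcomp K V (TensorAlgebra.equivDirectSum (R := K) (M := M)).toLinearMap ∘ₗ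
    (DFinsupp.lsum K (M := fun n => ⨂[K]^n M) (N := V)).toLinearMap ∘ₗ
      LinearMap.pi fun n => (PiTensorProduct.lift (R := K) (s := fun _ : Fin n => M)
        (E := V)).toLinearMap ∘ₗ LinearMap.proj n

theorem wordLift_tprod (f : ∀ n : ℕ, MultilinearMap K (fun _ : Fin n => M) V) (n : ℕ)
    (x : Fin n → M) : wordLift f (TensorAlgebra.tprod K M n x) = f n x := by
  have h : TensorAlgebra.equivDirectSum (TensorAlgebra.tprod K M n x) =
      DirectSum.of (fun n => ⨂[K]^n M) n (PiTensorProduct.tprod K x) :=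
    TensorAlgebra.toDirectSum_tensorPower_tprod x
  simp only [wordLift, LinearMap.comp_apply, LinearMap.lcomp_apply, AlgEquiv.toLinearMap_apply]
  rw [h]
  erw [DFinsupp.lsum_single]
  simp

/-- The linear map `T(M) ⊗ T(M) → V` given by
`(x_1 ⊗ ⋯ ⊗ x_n) ⊗ (y_1 ⊗ ⋯ ⊗ y_m) ↦ f_{nm}(x_1, …, x_n | y_1, …, y_m)`. -/
def wordLift₂ (f : ∀ n m : ℕ, MultilinearMap K (fun _ : Fin n ⊕ Fin m => M) V) :
    TensorAlgebra K M ⊗[K] TensorAlgebra K M →ₗ[K] V :=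
  TensorProduct.lift <| wordLift fun n =>
    wordLift.compMultilinearMap (MultilinearMap.pi fun m => (f n m).currySum)

theorem wordLift₂_tprod (f : ∀ n m : ℕ, MultilinearMap K (fun _ : Fin n ⊕ Fin m => M) V)
    (n m : ℕ) (x : Fin n → M) (y : Fin m → M) :
    wordLift₂ f (TensorAlgebra.tprod K M n x ⊗ₜ[K] TensorAlgebra.tprod K M m y) =
      f n m (Sum.elim x y) := by
  rw [wordLift₂, TensorProduct.lift.tmul, wordLift_tprod]
  rw [LinearMap.compMultilinearMap_apply, wordLift_tprod]
  rfl

variable (K M)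

/-- The deconcatenation coproduct
`(x_1 … x_n) ↦ ∑_{i = 0}^n (x_1 … x_i) ⊗ (x_{i+1} … x_n)`. -/
def decon : TensorAlgebra K M →ₗ[K] TensorAlgebra K M ⊗[K] TensorAlgebra K M :=
  wordLift fun n => ∑ i : Fin (n + 1),
    ((TensorAlgebra.tprod K M i).domCoprod (TensorAlgebra.tprod K M (n - i))).domDomCongr
      (finSumFinEquiv.trans (finCongr (Nat.add_sub_of_le (Nat.le_of_lt_succ i.2))))

/-- The map `Ψ : (x_1 … x_n) ↦ (x_n … x_1)`. -/
def wordRev : TensorAlgebra K M →ₗ[K] TensorAlgebra K M :=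
  wordLift fun n => (TensorAlgebra.tprod K M n).domDomCongr Fin.revPerm

/-- The projection of `T(M)` on `M`, parallel to the tensors of degree `≠ 1`. -/
def prOne : TensorAlgebra K M →ₗ[K] TensorAlgebra K M :=
  wordLift fun n => if n = 1 then TensorAlgebra.tprod K M n else 0

/-- Multiplication by `1 / (n - 1)` on the tensors of degree `n ≥ 2`, zero on the tensors of
degree `0` and `1`. -/
def degWeight : TensorAlgebra K M →ₗ[K] TensorAlgebra K M :=
  wordLift fun n => if 2 ≤ n then ((n : K) - 1)⁻¹ • TensorAlgebra.tprod K M n else 0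

/-- The concatenation product of words. -/
def conc : TensorAlgebra K M ⊗[K] TensorAlgebra K M →ₗ[K] TensorAlgebra K M :=
  LinearMap.mul' K (TensorAlgebra K M)

end Words

/-! ### The Hopf algebra `Sh^ω(𝔤)`

Its underlying space is `T(𝔤)[[ħ]]`; its coproduct is the coefficientwise extension of `decon`. -/

section Shuffle

variable {K : Type*} [Field K]

/-- The multilinear map `(x | y) ↦ B_{pq}(x_1, …, x_p | y_1, …, y_q)` on `𝔤`, with values in
`K[[ħ]] ⊗ 𝔤`, viewed as words of length one in `K[[ħ]] ⊗ T(𝔤)`. -/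
def letterApp (ω : LieFamily K⟦X⟧) (𝔤 : Type*) [LieRing 𝔤] [LieAlgebra K 𝔤] (p q : ℕ) :
    MultilinearMap K (fun _ : Fin p ⊕ Fin q => 𝔤) (K⟦X⟧ ⊗[K] TensorAlgebra K 𝔤) :=
  (LinearMap.lTensor K⟦X⟧ (TensorAlgebra.ι K (M := 𝔤))).compMultilinearMap <|
    ((evalFL (K⟦X⟧ ⊗[K] 𝔤) (ω p q)).restrictScalars K).compLinearMap
      fun _ => TensorProduct.mk K K⟦X⟧ 𝔤 1

/-- The multilinear map
`(x | y) ↦ ∑_k ∑_{(p_i), (q_i)} (B_{p_1q_1}(x_1 … x_{p_1} | y_1 … y_{q_1}) ⋯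
B_{p_kq_k}(… x_n | … y_m))`. The terms with `k > n + m` are omitted; they vanish if
`B_{00} = 0`. -/
def shuffleWord (ω : LieFamily K⟦X⟧) (𝔤 : Type*) [LieRing 𝔤] [LieAlgebra K 𝔤] (n m : ℕ) :
    MultilinearMap K (fun _ : Fin n ⊕ Fin m => 𝔤) (K⟦X⟧ ⊗[K] TensorAlgebra K 𝔤) :=
  ∑ k ∈ Finset.range (n + m + 1), ∑ P : Part k n, ∑ Q : Part k m,
    ((MultilinearMap.mkPiAlgebraFin K k (K⟦X⟧ ⊗[K] TensorAlgebra K 𝔤)).compMultilinearMap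
      fun β => letterApp ω 𝔤 (P.1 β) (Q.1 β)).domDomCongr
        ((Equiv.sigmaSumDistrib _ _).trans (Equiv.sumCongr P.blocks Q.blocks))

/-- The product of `Sh^ω(𝔤)`, restricted to `T(𝔤) ⊗ T(𝔤)`. -/
def shMul (ω : LieFamily K⟦X⟧) (𝔤 : Type*) [LieRing 𝔤] [LieAlgebra K 𝔤] :
    TensorAlgebra K 𝔤 ⊗[K] TensorAlgebra K 𝔤 →ₗ[K] (TensorAlgebra K 𝔤)⟦X⟧ :=
  toSeries ∘ₗ wordLift₂ (shuffleWord ω 𝔤)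

/-- The antipode on words of length `n`: `S(1) = 1` and
`S((x_1 … x_n)) = - ∑_{i = 0}^{n-1} S((x_1 … x_i)) (x_{i+1} … x_n)` for `n > 0`. -/
def antipodeWord (ω : LieFamily K⟦X⟧) (𝔤 : Type*) [LieRing 𝔤] [LieAlgebra K 𝔤] :
    (n : ℕ) → MultilinearMap K (fun _ : Fin n => 𝔤) (TensorAlgebra K 𝔤)⟦X⟧
  | 0 => MultilinearMap.constOfIsEmpty K _ 1
  | n + 1 => -∑ i : Fin (n + 1),
      ((hMul (shMul ω 𝔤) ∘ₗ LinearMap.lTensor _ const).compMultilinearMap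
        ((antipodeWord ω 𝔤 i).domCoprod (TensorAlgebra.tprod K 𝔤 (n + 1 - i)))).domDomCongr
          (finSumFinEquiv.trans (finCongr (Nat.add_sub_of_le i.2.le)))
termination_by n => n
decreasing_by exact i.2

/-- The antipode of `Sh^ω(𝔤)`, restricted to `T(𝔤)`. -/
def antipode (ω : LieFamily K⟦X⟧) (𝔤 : Type*) [LieRing 𝔤] [LieAlgebra K 𝔤] :
    TensorAlgebra K 𝔤 →ₗ[K] (TensorAlgebra K 𝔤)⟦X⟧ :=
  wordLift (antipodeWord ω 𝔤)

end Shuffle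

/-! ### The elements `R_n` -/

section RMatrix

variable {K : Type*} [Field K] {𝔞 : Type*} [LieRing 𝔞] [LieAlgebra K 𝔞]
  {𝔟 : Type*} [LieRing 𝔟] [LieAlgebra K 𝔟]

variable (K) in
/-- `u ⊗ v ↦ u ⊗ 1 ⊗ v`. -/
def ins13 (U V W : Type*) [Ring U] [Algebra K U] [Ring V] [Algebra K V] [Ring W] [Algebra K W] :
    U ⊗[K] W →ₗ[K] U ⊗[K] (V ⊗[K] W) :=
  LinearMap.lTensor U (TensorProduct.mk K V W 1)

variable (K) in
/-- `v ⊗ w ↦ 1 ⊗ v ⊗ w`. -/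
def ins23 (U V W : Type*) [Ring U] [Algebra K U] [Ring V] [Algebra K V] [Ring W] [Algebra K W] :
    V ⊗[K] W →ₗ[K] U ⊗[K] (V ⊗[K] W) :=
  TensorProduct.mk K U (V ⊗[K] W) 1

variable (K) in
/-- `u ⊗ v ↦ u ⊗ v ⊗ 1`. -/
def ins12 (U V W : Type*) [Ring U] [Algebra K U] [Ring V] [Algebra K V] [Ring W] [Algebra K W] :
    U ⊗[K] V →ₗ[K] U ⊗[K] (V ⊗[K] W) :=
  LinearMap.lTensor U ((TensorProduct.mk K V W).flip 1)

/-- The product of two elements of `Sh^ω(𝔞) ⊗ (T(𝔟)[[ħ]], concatenation)`. -/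
def mixedMul (ω : LieFamily K⟦X⟧)
    (u v : (TensorAlgebra K 𝔞 ⊗[K] TensorAlgebra K 𝔟)⟦X⟧) :
    (TensorAlgebra K 𝔞 ⊗[K] TensorAlgebra K 𝔟)⟦X⟧ :=
  hMul (tensorMul (shMul ω 𝔞) (const ∘ₗ conc K 𝔟)) (u ⊗ₜ[K] v)

/-- The product of two elements of `Sh^ω(𝔞) ⊗ Sh^ω(𝔞) ⊗ Sh^{ω'}(𝔟)`. -/
def mulAAB (ω ω' : LieFamily K⟦X⟧)
    (u v : (TensorAlgebra K 𝔞 ⊗[K] (TensorAlgebra K 𝔞 ⊗[K] TensorAlgebra K 𝔟))⟦X⟧) :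
    (TensorAlgebra K 𝔞 ⊗[K] (TensorAlgebra K 𝔞 ⊗[K] TensorAlgebra K 𝔟))⟦X⟧ :=
  hMul (tensorMul (shMul ω 𝔞) (tensorMul (shMul ω 𝔞) (shMul ω' 𝔟))) (u ⊗ₜ[K] v)

/-- The product of two elements of `Sh^ω(𝔞) ⊗ Sh^{ω'}(𝔟) ⊗ Sh^{ω'}(𝔟)`. -/
def mulABB (ω ω' : LieFamily K⟦X⟧)
    (u v : (TensorAlgebra K 𝔞 ⊗[K] (TensorAlgebra K 𝔟 ⊗[K] TensorAlgebra K 𝔟))⟦X⟧) :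
    (TensorAlgebra K 𝔞 ⊗[K] (TensorAlgebra K 𝔟 ⊗[K] TensorAlgebra K 𝔟))⟦X⟧ :=
  hMul (tensorMul (shMul ω 𝔞) (tensorMul (shMul ω' 𝔟) (shMul ω' 𝔟))) (u ⊗ₜ[K] v)

/-- The elements `R'_n` attached to a sequence `ρ_1, ρ_2, …`: the sum, over `k` and over the
`k`-tuples of positive integers `(n_1, …, n_k)` with sum `n`, of
`(m^{(k)} ⊗ conc^{(k)})(ρ_{n_1}^{(1,k+1)} ⋯ ρ_{n_k}^{(k,2k)})`. For `n = 0`, only `k = 0`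
contributes, and the result is `1`. -/
def rPrimeOf (ω : LieFamily K⟦X⟧)
    (ρ : ℕ → (TensorAlgebra K 𝔞 ⊗[K] TensorAlgebra K 𝔟)⟦X⟧) (n : ℕ) :
    (TensorAlgebra K 𝔞 ⊗[K] TensorAlgebra K 𝔟)⟦X⟧ :=
  ∑ k ∈ Finset.range (n + 1),
    ∑ P ∈ (Finset.Nat.antidiagonalTuple k n).filter (fun P => ∀ i, 0 < P i),
      (List.ofFn fun i => ρ (P i)).foldr (mixedMul ω) 1

/-- The right hand side of the recursion for `ρ_n`, `n ≥ 2`: the element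
`∑_{0 < j < n} (id ⊗ id ⊗ pr_𝔟)(R'_j^{(13)} R'_{n-j}^{(23)})` of `Sh^ω(𝔞) ⊗ Sh^ω(𝔞) ⊗ 𝔟`, where
the product is that of `Sh^ω(𝔞) ⊗ Sh^ω(𝔞) ⊗ Sh^{ω^∨}(𝔟)`, is mapped to `Sh^ω(𝔞) ⊗ 𝔟` by
concatenating the first two factors and dividing the component of degree `k` in `𝔞`
by `k - 1`. -/
def rhoStep (ω : LieFamily K⟦X⟧)
    (ρ : ℕ → (TensorAlgebra K 𝔞 ⊗[K] TensorAlgebra K 𝔟)⟦X⟧) (n : ℕ) :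
    (TensorAlgebra K 𝔞 ⊗[K] TensorAlgebra K 𝔟)⟦X⟧ :=
  mapSer
    (TensorProduct.map (degWeight K 𝔞 ∘ₗ conc K 𝔞) (prOne K 𝔟) ∘ₗ
      (TensorProduct.assoc K (TensorAlgebra K 𝔞) (TensorAlgebra K 𝔞)
        (TensorAlgebra K 𝔟)).symm.toLinearMap)
    (∑ j ∈ Finset.Ioo 0 n,
      mulAAB ω ω.vee (mapSer (ins13 K _ _ _) (rPrimeOf ω ρ j))
        (mapSer (ins23 K _ _ _) (rPrimeOf ω ρ (n - j))))

/-- The inclusion of `𝔞 ⊗ 𝔟` in `Sh^ω(𝔞) ⊗ Sh^ω(𝔟)`. -/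
def inclR (r : 𝔞 ⊗[K] 𝔟) : (TensorAlgebra K 𝔞 ⊗[K] TensorAlgebra K 𝔟)⟦X⟧ :=
  const (K := K) (TensorProduct.map (TensorAlgebra.ι K) (TensorAlgebra.ι K) r)

/-- The elements `ρ_n(r)` of `Sh^ω(𝔞) ⊗ 𝔟`: `ρ_1(r) = r`, and for `n ≥ 2`, `ρ_n(r)` is given by
the preceding recursion in terms of `ρ_1(r), …, ρ_{n-1}(r)`. The index `0` is not used. -/
def rho (ω : LieFamily K⟦X⟧) (r : 𝔞 ⊗[K] 𝔟) :
    (n : ℕ) → (TensorAlgebra K 𝔞 ⊗[K] TensorAlgebra K 𝔟)⟦X⟧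
  | 0 => 0
  | 1 => inclR r
  | n + 2 => rhoStep ω (fun j => if _h : j < n + 2 then rho ω r j else 0) (n + 2)
termination_by n => n

/-- The elements `R'_n(r)` of `Sh^ω(𝔞) ⊗ Sh^{ω^∨}(𝔟)`. -/
def rPrime (ω : LieFamily K⟦X⟧) (r : 𝔞 ⊗[K] 𝔟) (n : ℕ) :
    (TensorAlgebra K 𝔞 ⊗[K] TensorAlgebra K 𝔟)⟦X⟧ :=
  rPrimeOf ω (rho ω r) n

/-- The elements `R^ω_n(r) = (id ⊗ Ψ)(R'_n(r))` of `Sh^ω(𝔞) ⊗ Sh^ω(𝔟)`. -/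
def rMat (ω : LieFamily K⟦X⟧) (r : 𝔞 ⊗[K] 𝔟) (n : ℕ) :
    (TensorAlgebra K 𝔞 ⊗[K] TensorAlgebra K 𝔟)⟦X⟧ :=
  mapSer (LinearMap.lTensor _ (wordRev K 𝔟)) (rPrime ω r n)

/-- `Δ ⊗ id`. -/
def comulLeft (R : (TensorAlgebra K 𝔞 ⊗[K] TensorAlgebra K 𝔟)⟦X⟧) :
    (TensorAlgebra K 𝔞 ⊗[K] (TensorAlgebra K 𝔞 ⊗[K] TensorAlgebra K 𝔟))⟦X⟧ :=
  mapSer ((TensorProduct.assoc K _ _ _).toLinearMap ∘ₗ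
    LinearMap.rTensor (TensorAlgebra K 𝔟) (decon K 𝔞)) R

/-- `id ⊗ Δ`. -/
def comulRight (R : (TensorAlgebra K 𝔞 ⊗[K] TensorAlgebra K 𝔟)⟦X⟧) :
    (TensorAlgebra K 𝔞 ⊗[K] (TensorAlgebra K 𝔟 ⊗[K] TensorAlgebra K 𝔟))⟦X⟧ :=
  mapSer (LinearMap.lTensor (TensorAlgebra K 𝔞) (decon K 𝔟)) R

/-- `f ⊗ id`, for the `K[[ħ]]`-linear endomorphism of `T(𝔞)[[ħ]]` extending
`f : T(𝔞) → T(𝔞)[[ħ]]`. -/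
def applyLeft (f : TensorAlgebra K 𝔞 →ₗ[K] (TensorAlgebra K 𝔞)⟦X⟧)
    (R : (TensorAlgebra K 𝔞 ⊗[K] TensorAlgebra K 𝔟)⟦X⟧) :
    (TensorAlgebra K 𝔞 ⊗[K] TensorAlgebra K 𝔟)⟦X⟧ :=
  hExt (hTensor ∘ₗ TensorProduct.map f const) R

/-- `id ⊗ f`, for the `K[[ħ]]`-linear endomorphism of `T(𝔟)[[ħ]]` extending
`f : T(𝔟) → T(𝔟)[[ħ]]`. -/
def applyRight (f : TensorAlgebra K 𝔟 →ₗ[K] (TensorAlgebra K 𝔟)⟦X⟧)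
    (R : (TensorAlgebra K 𝔞 ⊗[K] TensorAlgebra K 𝔟)⟦X⟧) :
    (TensorAlgebra K 𝔞 ⊗[K] TensorAlgebra K 𝔟)⟦X⟧ :=
  hExt (hTensor ∘ₗ TensorProduct.map const f) R

end RMatrix

/-! ### Universal formulas -/

section Universal

variable (K : Type*) [Field K]

/-- The space `(⨂_i FL_{n_i}) ⊗ FL_{n_1 + ⋯ + n_k}` over `K[[ħ]]`, where the generators of
the last factor are indexed by the pairs `(i, a)` with `1 ≤ i ≤ k` and `1 ≤ a ≤ n_i`. The space
`F_{n_1, …, n_k}` is its space of coinvariants under `∏_i 𝔖_{n_i}`. -/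
abbrev UnivSpace {k : ℕ} (n : Fin k → ℕ) : Type _ :=
  (⨂[K⟦X⟧] i : Fin k, FL K⟦X⟧ (Fin (n i))) ⊗[K⟦X⟧] FL K⟦X⟧ (Σ i : Fin k, Fin (n i))

/-- The generator of `FL_1`, when `X` has exactly one element `x`. -/
def genFL (R : Type*) [CommRing R] {X : Type*} [Fintype X] (x : X) (h : ∀ y : X, y = x) :
    FL R X :=
  ⟨FreeLieAlgebra.of R x, Submodule.subset_span ⟨FreeMagma.of x, by
    have hx : (Finset.univ : Finset X) = {x} := by
      ext y
      simp [h y]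
    change leaves _ = _
    rw [hx]
    rfl, rfl⟩⟩

/-- The element `x_1 ⊗ y_1`, for `k = 1` and `n_1 = 1`. -/
def univOne : UnivSpace K (fun _ : Fin 1 => 1) :=
  (PiTensorProduct.tprod K⟦X⟧ fun _ => genFL K⟦X⟧ 0 fun y => Subsingleton.elim y 0) ⊗ₜ
    genFL K⟦X⟧ ⟨0, 0⟩ fun y => by
      obtain ⟨i, a⟩ := y
      obtain rfl := Subsingleton.elim i 0
      obtain rfl := Subsingleton.elim a 0
      rfl

variable {K}
variable {𝔞 : Type*} [LieRing 𝔞] [LieAlgebra K 𝔞] {𝔟 : Type*} [LieRing 𝔟] [LieAlgebra K 𝔟]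

/-- The value `P(a_1, …, a_n)` of `P ∈ FL_n` at elements of `𝔤`, in `K[[ħ]] ⊗ 𝔤`; it is linear
in `P`. -/
def polyApp {X : Type*} [Fintype X] {𝔤 : Type*} [LieRing 𝔤] [LieAlgebra K 𝔤] (a : X → 𝔤) :
    FL K⟦X⟧ X →ₗ[K⟦X⟧] K⟦X⟧ ⊗[K] 𝔤 :=
  (FreeLieAlgebra.lift K⟦X⟧ fun i => (1 : K⟦X⟧) ⊗ₜ[K] a i).toLinearMap ∘ₗ (FL K⟦X⟧ X).subtype

/-- `P_1 ⊗ ⋯ ⊗ P_k ⊗ Q ↦ (P_1(a_{11}, …, a_{1n_1}) ⋯ P_k(a_{k1}, …, a_{kn_k})) ⊗ Q(b_{11}, …)`. -/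
def kappaTerm {k : ℕ} (n : Fin k → ℕ) (a : (Σ i : Fin k, Fin (n i)) → 𝔞)
    (b : (Σ i : Fin k, Fin (n i)) → 𝔟) :
    UnivSpace K n →ₗ[K⟦X⟧] K⟦X⟧ ⊗[K] (TensorAlgebra K 𝔞 ⊗[K] TensorAlgebra K 𝔟) :=
  TensorProduct.lift <|
    (LinearMap.mul K⟦X⟧ (K⟦X⟧ ⊗[K] (TensorAlgebra K 𝔞 ⊗[K] TensorAlgebra K 𝔟))).compl₁₂
      (PiTensorProduct.lift <|
        (MultilinearMap.mkPiAlgebraFin K⟦X⟧ k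
          (K⟦X⟧ ⊗[K] (TensorAlgebra K 𝔞 ⊗[K] TensorAlgebra K 𝔟))).compLinearMap fun i =>
            (((TensorProduct.mk K (TensorAlgebra K 𝔞) (TensorAlgebra K 𝔟)).flip 1) ∘ₗ
              TensorAlgebra.ι K).baseChange K⟦X⟧ ∘ₗ polyApp fun j => a ⟨i, j⟩)
      (((TensorProduct.mk K (TensorAlgebra K 𝔞) (TensorAlgebra K 𝔟) 1) ∘ₗ
        TensorAlgebra.ι K).baseChange K⟦X⟧ ∘ₗ polyApp b)

/-- The map `κ(r) : F_{n_1, …, n_k} → Sh^ω(𝔞) ⊗ 𝔟` for `r = ∑_{i ∈ I} a_i ⊗ b_i`, computed on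
representatives of coinvariants: it sends `P_1 ⊗ ⋯ ⊗ P_k ⊗ Q` to the sum, over all families of
indices in `I`, of `(P_1(a_{i_1}, …) ⋯ P_k(…, a_{i_{n_1 + ⋯ + n_k}})) ⊗ Q(b_{i_1}, …)`. -/
def kappa {I : Type} [Fintype I] (a : I → 𝔞) (b : I → 𝔟) {k : ℕ} (n : Fin k → ℕ)
    (z : UnivSpace K n) : (TensorAlgebra K 𝔞 ⊗[K] TensorAlgebra K 𝔟)⟦X⟧ :=
  ∑ s : (Σ i : Fin k, Fin (n i)) → I, toSeries (kappaTerm n (a ∘ s) (b ∘ s) z)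

end Universal

end ShuffleHopf

end

/-! Write `R` for `K⟦X⟧`. Everything is first done over `R`, without completion, on the tensor
algebra of `L = R ⊗ 𝔤`, and is then carried to `T(𝔤)[[ħ]]`.

With deconcatenation, a tensor algebra is cofree among coalgebras graded by word length: a coalgebra
morphism into it is determined by its component of degree one, and every linear map that kills the
unit is such a component (`coalgHom_ext`, `cofreeHom`). The product of `Sh^ω` is the coalgebra
morphism with degree one component `B_{pq}`. Hence its associativity reduces to the defining
identity of `ω` (`ProductDatum.mulHom_assoc`, `shuffleβ_assoc`), and the antipode is a geometric
series for convolution. The antipode of the opposite bialgebra is the inverse of the antipode.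

The elements `R'_n` are gathered into a series `G = ∑ R'_n X^n`, whose variable is not `ħ`. If `ρ =
∑ ρ_n X^n`, then `G = 1 + ρ G` for concatenation in the second factor. Since `ρ` has length one
there, such a series is automatically comultiplicative: `(id ⊗ Δ)(G) = G^{(12)} G^{(13)}`
(`geometric_comul`). Conversely, a comultiplicative series with trivial counit is the geometric
series of its degree one part (`geometric_of_comul`). Reversal of words `Ψ` identifies `Sh^{ω^∨}`
with `Sh^ω` as algebras and exchanges the two halves of the coproduct, which gives the stated order
`R^{(13)} R^{(12)}`.

The other coproduct formula, `(Δ ⊗ id)(G) = G^{(13)} G^{(23)}`, is an equality of two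
comultiplicative series, so only their degree one parts in the second factor have to agree. In
degree `n` this reads `(Δ ⊗ id)(ρ_n) = ρ_n^{(13)} + ρ_n^{(23)} + σ_n`, where `σ_n` depends on lower
degrees only. If the formula holds below `n`, coassociativity makes `σ_n` a 2-cocycle of the cobar
complex of the first factor (`cocycle_prod1323`). That complex has an explicit contracting homotopy,
concatenation divided by `k - 1` in degree `k` (`barBoundary_comul_word`, `shHomotopy`), and `ρ_n`
is defined as its value on `σ_n`. This closes the induction (`comul_geometric`).

For the antipodes, `(S ⊗ id)(G)` is a left inverse of `G` by the first coproduct formula, and `(id ⊗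
S⁻¹)(G)` is a right inverse by the second; hence they coincide (`antipode_eq_skew_series`).

A `SeriesModel` records a map from an algebra over `R` to `V[[ħ]]` which respects a deformed
product. Such maps send the solution over `R` to the elements of the statement (`mixedΦ_rhoR`,
`shΦ_matSer`), and the identities follow.

Universality holds because the recursion uses only operations natural in Lie algebras: an induction
yields a formula in free Lie algebras, multilinear in `n` letters (`IsUniv.rhoR`), and a multilinear
word of brackets is cut into blocks to give elements of `UnivSpace` (`exists_blocks`,
`exists_sum_kappa`). -/

noncomputable section

namespace ShuffleHopf

open TensorProduct TensorAlgebra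

/-! ### Shortcut instances -/

section Shortcuts

variable {R : Type*} [CommRing R]

scoped instance {M : Type*} [AddCommGroup M] [Module R M] : Algebra R (TensorAlgebra R M) :=
  TensorAlgebra.instAlgebra

scoped instance {M : Type*} [AddCommGroup M] [Module R M] : Module R (TensorAlgebra R M) :=
  Algebra.toModule

variable {A B : Type*} [AddCommMonoid A] [Module R A] [AddCommMonoid B] [Module R B]

scoped instance : ZeroHomClass (A →ₗ[R] B) A B := AddMonoidHomClass.toZeroHomClass

scoped instance : AddHomClass (A →ₗ[R] B) A B := AddMonoidHomClass.toAddHomClass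

scoped instance : ZeroHomClass (A ≃ₗ[R] B) A B := AddMonoidHomClass.toZeroHomClass

scoped instance : AddHomClass (A ≃ₗ[R] B) A B := AddMonoidHomClass.toAddHomClass

end Shortcuts

/-! ### Tensor algebras over a commutative ring as coalgebras -/

section WordCoalgebra

variable {R : Type*} [CommRing R] {M : Type*} [AddCommGroup M] [Module R M]

/-- Induction on tensors by left multiplication by letters. -/
theorem left_induction {p : TensorAlgebra R M → Prop} (one : p 1)
    (add : ∀ u v, p u → p v → p (u + v)) (smul : ∀ (a : R) u, p u → p (a • u))
    (letter_mul : ∀ x v, p v → p (ι R x * v)) (u : TensorAlgebra R M) : p u := by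
  -- The strengthened claim is stable under products in `u`: two left multiplications compose.
  suffices h : ∀ v, p v → p (u * v) by simpa using h 1 one
  induction u using TensorAlgebra.induction with
  | algebraMap r =>
    intro v hv
    rw [← Algebra.smul_def]
    exact smul r v hv
  | ι x => exact letter_mul x
  | mul a b ha hb =>
    intro v hv
    rw [mul_assoc]
    exact ha _ (hb v hv)
  | add a b ha hb =>
    intro v hv
    rw [add_mul]
    exact add _ _ (ha v hv) (hb v hv)

variable (R) in
/-- The word with given letters. -/
def word (l : List M) : TensorAlgebra R M := (l.map (ι R)).prod

@[simp]
theorem word_nil : word R ([] : List M) = 1 := rfl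

@[simp]
theorem word_cons (x : M) (l : List M) : word R (x :: l) = ι R x * word R l := by
  simp [word]

theorem word_append (l l' : List M) : word R (l ++ l') = word R l * word R l' := by
  simp [word]

theorem word_ofFn {n : ℕ} (x : Fin n → M) : word R (List.ofFn x) = tprod R M n x := by
  rw [word, tprod_apply, List.map_ofFn]
  rfl

variable (R M) in
theorem span_word : Submodule.span R (Set.range (word R : List M → TensorAlgebra R M)) = ⊤ := by
  refine eq_top_iff.mpr fun u _ => ?_
  induction u using left_induction with
  | one => exact Submodule.subset_span ⟨[], rfl⟩
  | add u v hu hv => exact add_mem (hu trivial) (hv trivial)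
  | smul a u hu => exact Submodule.smul_mem _ _ (hu trivial)
  | letter_mul x v hv =>
    refine Submodule.span_induction (p := fun v _ => ι R x * v ∈ _) ?_ ?_ ?_ ?_ (hv trivial)
    · rintro _ ⟨l, rfl⟩
      exact Submodule.subset_span ⟨x :: l, word_cons x l⟩
    · simp
    · intro a b _ _ ha hb
      rw [mul_add]
      exact add_mem ha hb
    · intro a b _ hb
      rw [mul_smul_comm]
      exact Submodule.smul_mem _ _ hb

theorem linearMap_ext_word {N : Type*} [AddCommMonoid N] [Module R N]
    {f g : TensorAlgebra R M →ₗ[R] N} (h : ∀ l, f (word R l) = g (word R l)) : f = g :=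
  LinearMap.ext_on (span_word R M) (by rintro _ ⟨l, rfl⟩; exact h l)

/-- The action of a letter in the recursive definition of deconcatenation. -/
def comulStep : M →ₗ[R] Module.End R
    (TensorAlgebra R M × (TensorAlgebra R M ⊗[R] TensorAlgebra R M)) where
  -- The state is the pair `(v, Δ v)`: the rule `Δ(x v) = 1 ⊗ x v + (x ⊗ 1) Δ v` needs `v` itself
  -- besides `Δ v`.
  toFun x := ((LinearMap.mulLeft R (ι R x)) ∘ₗ LinearMap.fst R _ _).prod
    (TensorProduct.mk R _ _ 1 ∘ₗ (LinearMap.mulLeft R (ι R x)) ∘ₗ LinearMap.fst R _ _ +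
      LinearMap.mulLeft R (ι R x ⊗ₜ[R] (1 : TensorAlgebra R M)) ∘ₗ LinearMap.snd R _ _)
  map_add' x y := by
    ext : 1 <;> ext <;> simp [add_mul, add_tmul, tmul_add]
  map_smul' a x := by
    ext : 1 <;> ext <;> simp [smul_tmul']

theorem comulStep_apply (x : M)
    (p : TensorAlgebra R M × (TensorAlgebra R M ⊗[R] TensorAlgebra R M)) :
    comulStep x p = (ι R x * p.1, 1 ⊗ₜ (ι R x * p.1) + (ι R x ⊗ₜ 1) * p.2) := rfl

/-- Deconcatenation of words. -/
def comulT : TensorAlgebra R M →ₗ[R] TensorAlgebra R M ⊗[R] TensorAlgebra R M :=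
  LinearMap.snd R _ _ ∘ₗ (LinearMap.applyₗ ((1 : TensorAlgebra R M), (1 : TensorAlgebra R M ⊗[R] TensorAlgebra R M))) ∘ₗ
    (TensorAlgebra.lift R (comulStep (R := R) (M := M))).toLinearMap

@[simp]
theorem comulT_one : comulT (1 : TensorAlgebra R M) = 1 ⊗ₜ 1 := by
  simp [comulT, Algebra.TensorProduct.one_def]

theorem comulT_ι_mul (x : M) (v : TensorAlgebra R M) :
    comulT (ι R x * v) = 1 ⊗ₜ (ι R x * v) + (ι R x ⊗ₜ 1) * comulT v := by
  have h : ∀ v : TensorAlgebra R M,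
      (TensorAlgebra.lift R (comulStep (R := R) (M := M)) v (1, 1)).1 = v := by
    intro v
    induction v using left_induction with
    | one => simp
    | add u v hu hv => simp [hu, hv]
    | smul a u hu => simp [hu]
    | letter_mul x v hv => simp [comulStep_apply, hv]
  simp [comulT, comulStep_apply, h]

theorem comulT_ι (x : M) : comulT (ι R x) = 1 ⊗ₜ ι R x + ι R x ⊗ₜ 1 := by
  have h := comulT_ι_mul x (1 : TensorAlgebra R M)
  simpa using h

/-- Deconcatenation is not multiplicative for concatenation, so the tensor algebra is only a
coalgebra here; the compatible products live on `Sh`. All axioms follow from the first-letter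
recursion `comulT_ι_mul`. -/
instance : Coalgebra R (TensorAlgebra R M) where
  comul := comulT
  counit := algebraMapInv.toLinearMap
  coassoc := by
    ext u
    induction u using left_induction with
    | one => simp
    | add u v hu hv => simp only [map_add, hu, hv]
    | smul a u hu => simp only [map_smul, hu]
    | letter_mul x v hv =>
      simp only [LinearMap.comp_apply, LinearEquiv.coe_coe, comulT_ι_mul, map_add] at hv ⊢
      simp only [LinearMap.rTensor_tmul, comulT_one, assoc_tmul, LinearMap.lTensor_tmul,
        comulT_ι_mul]
      have h1 : ∀ w : TensorAlgebra R M ⊗[R] TensorAlgebra R M,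
          TensorProduct.assoc R _ _ _ (LinearMap.rTensor _ comulT ((ι R x ⊗ₜ[R] 1) * w)) =
            1 ⊗ₜ ((ι R x ⊗ₜ[R] 1) * w) + (ι R x ⊗ₜ[R] (1 ⊗ₜ[R] 1)) *
              TensorProduct.assoc R _ _ _ (LinearMap.rTensor _ comulT w) := by
        intro w
        induction w using TensorProduct.induction_on with
        | zero => simp
        | add a b ha hb => simp only [mul_add, map_add, ha, hb, tmul_add]; abel
        | tmul a b =>
          simp only [Algebra.TensorProduct.tmul_mul_tmul, one_mul, LinearMap.rTensor_tmul,
            comulT_ι_mul, add_tmul, map_add, assoc_tmul]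
          congr 1
          generalize comulT a = w
          induction w using TensorProduct.induction_on with
          | zero => simp
          | add a b ha hb => simp only [mul_add, map_add, ha, hb, add_tmul]
          | tmul a b => simp [Algebra.TensorProduct.tmul_mul_tmul]
      have h2 : ∀ w : TensorAlgebra R M ⊗[R] TensorAlgebra R M,
          LinearMap.lTensor _ comulT ((ι R x ⊗ₜ[R] 1) * w) =
            (ι R x ⊗ₜ[R] (1 ⊗ₜ[R] 1)) * LinearMap.lTensor _ comulT w := by
        intro w
        induction w using TensorProduct.induction_on with
        | zero => simp
        | add a b ha hb => simp only [mul_add, map_add, ha, hb]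
        | tmul a b =>
          simp [Algebra.TensorProduct.tmul_mul_tmul, ← Algebra.TensorProduct.one_def]
      rw [h1, h2, hv, tmul_add]
      abel
  rTensor_counit_comp_comul := by
    ext u
    induction u using left_induction with
    | one => simp
    | add u v hu hv => simp only [map_add, hu, hv]
    | smul a u hu => simp only [map_smul, hu]
    | letter_mul x v hv =>
      simp only [LinearMap.comp_apply, comulT_ι_mul, map_add] at hv ⊢
      generalize comulT v = w
      have h1 : LinearMap.rTensor _ (algebraMapInv (R := R) (M := M)).toLinearMap
          ((ι R x ⊗ₜ[R] 1) * w) = 0 := by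
        induction w using TensorProduct.induction_on with
        | zero => simp
        | add a b ha hb => simp only [mul_add, map_add, ha, hb, add_zero]
        | tmul a b => simp [Algebra.TensorProduct.tmul_mul_tmul, algebraMapInv]
      rw [h1]
      simp
  lTensor_counit_comp_comul := by
    ext u
    induction u using left_induction with
    | one => simp
    | add u v hu hv => simp only [map_add, hu, hv]
    | smul a u hu => simp only [map_smul, hu]
    | letter_mul x v hv =>
      simp only [LinearMap.comp_apply, comulT_ι_mul, map_add] at hv ⊢
      have h1 : ∀ w, LinearMap.lTensor _ (algebraMapInv (R := R) (M := M)).toLinearMap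
          ((ι R x ⊗ₜ[R] 1) * w) = (ι R x ⊗ₜ[R] 1) * LinearMap.lTensor _ (algebraMapInv (R := R) (M := M)).toLinearMap w := by
        intro w
        induction w using TensorProduct.induction_on with
        | zero => simp
        | add a b ha hb => simp only [mul_add, map_add, ha, hb]
        | tmul a b => simp [Algebra.TensorProduct.tmul_mul_tmul]
      rw [h1, hv]
      simp [algebraMapInv, Algebra.TensorProduct.tmul_mul_tmul]

theorem comul_eq_comulT (u : TensorAlgebra R M) : Coalgebra.comul (R := R) u = comulT u := rfl

theorem counit_eq_algebraMapInv (u : TensorAlgebra R M) :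
    Coalgebra.counit (R := R) u = algebraMapInv u := rfl

@[simp]
theorem counit_one_T : Coalgebra.counit (R := R) (1 : TensorAlgebra R M) = 1 := by
  simp [counit_eq_algebraMapInv]

theorem counit_ι_mul (x : M) (v : TensorAlgebra R M) :
    Coalgebra.counit (R := R) (ι R x * v) = 0 := by
  simp [counit_eq_algebraMapInv, algebraMapInv]

theorem counit_mul_T (u v : TensorAlgebra R M) :
    Coalgebra.counit (R := R) (u * v) =
      Coalgebra.counit (R := R) u * Coalgebra.counit (R := R) v := by
  simp [counit_eq_algebraMapInv]

/-- A cut of `u v` falls inside `u` or inside `v`. The cut between them is counted in both sums,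
whence the correction term. -/
theorem comulT_mul (u v : TensorAlgebra R M) :
    comulT (u * v) = comulT u * (1 ⊗ₜ v) + (u ⊗ₜ 1) * comulT v - u ⊗ₜ v := by
  induction u using left_induction with
  | one => simp [Algebra.TensorProduct.tmul_mul_tmul, ← Algebra.TensorProduct.one_def]
  | add a b ha hb =>
    simp only [add_mul, map_add, ha, hb, add_tmul]
    abel
  | smul a u hu =>
    simp only [smul_mul_assoc, map_smul, hu, ← smul_tmul', smul_add, smul_sub]
  | letter_mul x w hw =>
    rw [mul_assoc, comulT_ι_mul, comulT_ι_mul, hw, add_mul, mul_sub, mul_add]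
    simp only [Algebra.TensorProduct.tmul_mul_tmul, one_mul, ← mul_assoc]
    abel

theorem comulT_word (l : List M) : comulT (word R l) =
    ∑ i ∈ Finset.range (l.length + 1), word R (l.take i) ⊗ₜ word R (l.drop i) := by
  induction l with
  | nil => simp
  | cons x l ih =>
    rw [word_cons, comulT_ι_mul, ih, Finset.mul_sum, List.length_cons,
      Finset.sum_range_succ' _ (l.length + 1)]
    simp [Algebra.TensorProduct.tmul_mul_tmul, add_comm]

theorem counit_word (l : List M) :
    Coalgebra.counit (R := R) (word R l) = if l = [] then 1 else 0 := by
  cases l <;> simp [counit_ι_mul]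

/-- The projection on words of length one. -/
def prL : TensorAlgebra R M →ₗ[R] M :=
  -- The algebra morphism to the trivial square-zero extension of `R` by `M` kills all words of
  -- length at least two, so its second component is the projection. That extension needs a right
  -- action of `R`, taken here from the left one.
  letI : Module Rᵐᵒᵖ M := Module.compHom _ ((RingHom.id R).fromOpposite mul_comm)
  haveI : IsCentralScalar R M := ⟨fun _ _ => rfl⟩
  (TrivSqZeroExt.sndHom R M) ∘ₗ toTrivSqZeroExt.toLinearMap

@[simp]
theorem prL_one : prL (1 : TensorAlgebra R M) = 0 := by
  let _ : Module Rᵐᵒᵖ M := Module.compHom _ ((RingHom.id R).fromOpposite mul_comm)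
  have _ : IsCentralScalar R M := ⟨fun _ _ => rfl⟩
  change TrivSqZeroExt.snd (toTrivSqZeroExt (1 : TensorAlgebra R M)) = 0
  rw [map_one, TrivSqZeroExt.snd_one]

theorem prL_ι_mul (x : M) (v : TensorAlgebra R M) :
    prL (ι R x * v) = Coalgebra.counit (R := R) v • x := by
  let _ : Module Rᵐᵒᵖ M := Module.compHom _ ((RingHom.id R).fromOpposite mul_comm)
  have _ : IsCentralScalar R M := ⟨fun _ _ => rfl⟩
  have h : (TrivSqZeroExt.fstHom R R M).comp toTrivSqZeroExt = algebraMapInv (R := R) (M := M) := by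
    ext x
    simp [algebraMapInv]
  have h' : TrivSqZeroExt.fst (toTrivSqZeroExt v : TrivSqZeroExt R M) = algebraMapInv v := by
    rw [← h]; rfl
  simp [prL, h', counit_eq_algebraMapInv]

@[simp]
theorem prL_ι (x : M) : prL (ι R x) = x := by
  have := prL_ι_mul (R := R) x 1
  simpa using this

variable (R M) in
/-- The projection of the tensor algebra on its component of degree one. -/
def prT : TensorAlgebra R M →ₗ[R] TensorAlgebra R M := ι R ∘ₗ prL

@[simp]
theorem prT_one : prT R M 1 = 0 := by simp [prT]

theorem prT_ι_mul (x : M) (v : TensorAlgebra R M) :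
    prT R M (ι R x * v) = Coalgebra.counit (R := R) v • ι R x := by
  simp [prT, prL_ι_mul]

theorem prT_prT (u : TensorAlgebra R M) : prT R M (prT R M u) = prT R M u := by
  simp [prT]

theorem counit_prT (u : TensorAlgebra R M) : Coalgebra.counit (R := R) (prT R M u) = 0 := by
  have := counit_ι_mul (R := R) (prL u) 1
  simpa [prT] using this

theorem comulT_prT_mul (u v : TensorAlgebra R M) :
    comulT (prT R M u * v) = 1 ⊗ₜ (prT R M u * v) + (prT R M u ⊗ₜ 1) * comulT v :=
  comulT_ι_mul _ _

variable (R M) in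
/-- The left inverse of the deconcatenation coproduct on words of length at least two. -/
def recompose : TensorAlgebra R M ⊗[R] TensorAlgebra R M →ₗ[R] TensorAlgebra R M :=
  LinearMap.mul' R _ ∘ₗ LinearMap.rTensor _ (prT R M)

/-- A tensor is recovered from its counit and from its first letters. -/
theorem recompose_comulT (u : TensorAlgebra R M) :
    u = Coalgebra.counit (R := R) u • (1 : TensorAlgebra R M) + recompose R M (comulT u) := by
  induction u using left_induction with
  | one => simp [recompose]
  | add u v hu hv =>
    simp only [map_add, add_smul]
    nth_rewrite 1 [hu, hv]
    abel
  | smul a u hu =>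
    simp only [map_smul, smul_assoc]
    nth_rewrite 1 [hu]
    rw [smul_add]
  | letter_mul x v hv =>
    rw [comulT_ι_mul, counit_ι_mul, zero_smul, zero_add, map_add]
    have h : recompose R M ((1 : TensorAlgebra R M) ⊗ₜ[R] (ι R x * v)) = 0 := by simp [recompose]
    rw [h, zero_add]
    -- Only the part of `w` with empty first factor survives, since the first factor must end up of
    -- length one; the counit axiom then returns `v`.
    have h2 : ∀ w : TensorAlgebra R M ⊗[R] TensorAlgebra R M,
        recompose R M ((ι R x ⊗ₜ 1) * w) =
          ι R x * TensorProduct.lid R _ (LinearMap.rTensor _ (Coalgebra.counit (R := R)) w) := by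
      intro w
      induction w using TensorProduct.induction_on with
      | zero => simp
      | add a b ha hb => simp only [mul_add, map_add, ha, hb]
      | tmul a b => simp [recompose, Algebra.TensorProduct.tmul_mul_tmul, prT_ι_mul]
    rw [h2, ← comul_eq_comulT, Coalgebra.rTensor_counit_comul]
    simp

variable (R M) in
/-- Reversal of words. -/
def revT : TensorAlgebra R M →ₗ[R] TensorAlgebra R M :=
  (MulOpposite.opLinearEquiv R).symm.toLinearMap ∘ₗ
    (TensorAlgebra.lift R ((MulOpposite.opLinearEquiv R).toLinearMap ∘ₗ ι R (M := M))).toLinearMap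

@[simp]
theorem revT_one : revT R M 1 = 1 := by simp [revT]

@[simp]
theorem revT_ι (x : M) : revT R M (ι R x) = ι R x := by simp [revT]

theorem revT_mul (u v : TensorAlgebra R M) : revT R M (u * v) = revT R M v * revT R M u := by
  simp [revT]

theorem revT_word (l : List M) : revT R M (word R l) = word R l.reverse := by
  induction l with
  | nil => simp
  | cons x l ih => simp [revT_mul, ih, word_append]

@[simp]
theorem revT_revT (u : TensorAlgebra R M) : revT R M (revT R M u) = u := by
  have h : revT R M ∘ₗ revT R M = LinearMap.id := linearMap_ext_word fun l => by simp [revT_word]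
  exact LinearMap.congr_fun h u

theorem counit_revT (u : TensorAlgebra R M) :
    Coalgebra.counit (R := R) (revT R M u) = Coalgebra.counit (R := R) u := by
  have h : Coalgebra.counit (R := R) ∘ₗ revT R M = Coalgebra.counit :=
    linearMap_ext_word fun l => by simp [revT_word, counit_word]
  exact LinearMap.congr_fun h u

theorem prT_word (l : List M) :
    prT R M (word R l) = if l.length = 1 then word R l else 0 := by
  rcases l with _ | ⟨x, _ | ⟨y, l⟩⟩ 
  · simp
  · simp [prT]
  · simp only [word_cons, prT_ι_mul, counit_ι_mul, zero_smul]
    simp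

theorem prT_revT (u : TensorAlgebra R M) : prT R M (revT R M u) = prT R M u := by
  have h : prT R M ∘ₗ revT R M = prT R M := linearMap_ext_word fun l => by
    rw [LinearMap.comp_apply, revT_word, prT_word, prT_word, List.length_reverse]
    split_ifs with h
    · obtain ⟨x, rfl⟩ := List.length_eq_one_iff.mp h
      rfl
    · rfl
  exact LinearMap.congr_fun h u

/-- Reversing a word reverses both pieces of each cut and exchanges them, so `Ψ` is an anti-morphism
of coalgebras. -/
theorem comulT_revT (u : TensorAlgebra R M) :
    comulT (revT R M u) = TensorProduct.comm R _ _
      (TensorProduct.map (revT R M) (revT R M) (comulT u)) := by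
  induction u using left_induction with
  | one => simp
  | add u v hu hv => simp only [map_add, hu, hv]
  | smul a u hu => simp only [map_smul, hu]
  | letter_mul x v hv =>
    rw [revT_mul, revT_ι, comulT_mul, hv, comulT_ι, comulT_ι_mul]
    simp only [mul_add, Algebra.TensorProduct.tmul_mul_tmul, one_mul, mul_one, map_add,
      TensorProduct.map_tmul, revT_one, revT_mul, revT_ι, comm_tmul]
    have h : ∀ w : TensorAlgebra R M ⊗[R] TensorAlgebra R M,
        TensorProduct.comm R _ _ (TensorProduct.map (revT R M) (revT R M) w) * (1 ⊗ₜ ι R x) =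
          TensorProduct.comm R _ _ (TensorProduct.map (revT R M) (revT R M) ((ι R x ⊗ₜ 1) * w)) := by
      intro w
      induction w using TensorProduct.induction_on with
      | zero => simp
      | add a b ha hb => simp only [mul_add, add_mul, map_add, ha, hb]
      | tmul a b => simp [Algebra.TensorProduct.tmul_mul_tmul, revT_mul]
    rw [h]
    abel

end WordCoalgebra

end ShuffleHopf

end

noncomputable section

namespace ShuffleHopf

open TensorProduct TensorAlgebra WithConv

/-! ### Conilpotent coalgebras and convolution -/

section WordGraded

/-- Coalgebras graded by the length of words, with a one-dimensional component of degree zero. -/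
class WordGraded (R C : Type*) [CommRing R] [AddCommGroup C] [Module R C] [Coalgebra R C] where
  unit : C
  words : ℕ → Set C
  span_words : Submodule.span R (⋃ n, words n) = ⊤
  words_zero : words 0 ⊆ {unit}
  comul_words : ∀ n, ∀ x ∈ words n, Coalgebra.comul (R := R) x ∈ Submodule.span R
    {z | ∃ i j a b, i + j = n ∧ a ∈ words i ∧ b ∈ words j ∧ z = a ⊗ₜ[R] b}
  component : C →ₗ[R] ℕ →₀ C
  component_words : ∀ n, ∀ x ∈ words n, component x = Finsupp.single n x

variable {R : Type*} [CommRing R] {M : Type*} [AddCommGroup M] [Module R M]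
variable {C : Type*} [AddCommGroup C] [Module R C] [Coalgebra R C] [WordGraded R C]
variable {C' : Type*} [AddCommGroup C'] [Module R C'] [Coalgebra R C'] [WordGraded R C']

open WordGraded

variable (R M) in
/-- The decomposition of tensors by length, as polynomials. -/
def lengthPoly : TensorAlgebra R M →ₐ[R] Polynomial (TensorAlgebra R M) :=
  TensorAlgebra.lift R
    (((Polynomial.monomial 1 : TensorAlgebra R M →ₗ[TensorAlgebra R M] _).restrictScalars R) ∘ₗ
      ι R)

theorem lengthPoly_word (l : List M) :
    lengthPoly R M (word R l) = Polynomial.monomial l.length (word R l) := by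
  induction l with
  | nil => simp
  | cons x l ih =>
    rw [word_cons, map_mul, ih]
    simp [lengthPoly, Polynomial.monomial_mul_monomial, add_comm]

/-- The component map comes from `lengthPoly`, which marks every letter with one power of a
polynomial variable. -/
instance : WordGraded R (TensorAlgebra R M) where
  unit := 1
  words n := {u | ∃ l : List M, l.length = n ∧ u = word R l}
  span_words := by
    rw [← span_word R M]
    congr 1
    ext u
    simp [eq_comm]
  words_zero := by
    rintro _ ⟨l, hl, rfl⟩
    rw [List.length_eq_zero_iff.mp hl]
    rfl
  comul_words := by
    rintro n _ ⟨l, rfl, rfl⟩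
    rw [comul_eq_comulT, comulT_word]
    refine Submodule.sum_mem _ fun i hi => Submodule.subset_span
      ⟨(l.take i).length, (l.drop i).length, _, _, ?_, ⟨_, rfl, rfl⟩, ⟨_, rfl, rfl⟩, rfl⟩
    rw [← List.length_append, List.take_append_drop]
  component := (Polynomial.lsum fun n => Finsupp.lsingle n) ∘ₗ (lengthPoly R M).toLinearMap
  component_words := by
    rintro n _ ⟨l, rfl, rfl⟩
    simp [lengthPoly_word, Polynomial.lsum_apply, Polynomial.sum_monomial_index]

@[simp]
theorem unit_tensorAlgebra : (unit R : TensorAlgebra R M) = 1 := rfl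

/-- Products are maps out of `T ⊗ T`, and associativity compares maps out of `T ⊗ T ⊗ T`; cofreeness
has to apply to these sources, graded by total length. -/
instance : WordGraded R (C ⊗[R] C') where
  unit := unit R ⊗ₜ unit R
  words n := {z | ∃ i j a b, i + j = n ∧ a ∈ words R i ∧ b ∈ words R j ∧ z = a ⊗ₜ[R] b}
  span_words := by
    refine eq_top_iff.mpr ?_
    rw [← TensorProduct.map₂_mk_top_top_eq_top, ← span_words (R := R) (C := C),
      ← span_words (R := R) (C := C'), Submodule.map₂_span_span]
    refine Submodule.span_mono ?_
    rintro _ ⟨a, ha, b, hb, rfl⟩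
    obtain ⟨i, hi⟩ := Set.mem_iUnion.mp ha
    obtain ⟨j, hj⟩ := Set.mem_iUnion.mp hb
    exact Set.mem_iUnion.mpr ⟨i + j, i, j, a, b, rfl, hi, hj, rfl⟩
  words_zero := by
    rintro _ ⟨i, j, a, b, hij, ha, hb, rfl⟩
    obtain ⟨rfl, rfl⟩ := Nat.add_eq_zero_iff.mp hij
    rw [Set.mem_singleton_iff.mp (words_zero ha), Set.mem_singleton_iff.mp (words_zero hb)]
    rfl
  comul_words := by
    rintro n _ ⟨i, j, a, b, rfl, ha, hb, rfl⟩
    rw [TensorProduct.comul_tmul]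
    have h1 := comul_words i a ha
    have h2 := comul_words j b hb
    generalize Coalgebra.comul (R := R) a = u at h1
    generalize Coalgebra.comul (R := R) b = v at h2
    induction h1 using Submodule.span_induction with
    | zero => simp
    | add x y _ _ hx hy => rw [add_tmul, map_add]; exact add_mem hx hy
    | smul r x _ hx => rw [← smul_tmul', map_smul]; exact Submodule.smul_mem _ _ hx
    | mem x hx =>
      induction h2 using Submodule.span_induction with
      | zero => simp
      | add x y _ _ hx hy => rw [tmul_add, map_add]; exact add_mem hx hy
      | smul r x _ hx => rw [tmul_smul, map_smul]; exact Submodule.smul_mem _ _ hx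
      | mem y hy =>
        obtain ⟨i1, i2, a1, a2, rfl, h1, h2, rfl⟩ := hx
        obtain ⟨j1, j2, b1, b2, rfl, h3, h4, rfl⟩ := hy
        refine Submodule.subset_span ⟨i1 + j1, i2 + j2, a1 ⊗ₜ b1, a2 ⊗ₜ b2, by ring,
          ⟨i1, j1, a1, b1, rfl, h1, h3, rfl⟩, ⟨i2, j2, a2, b2, rfl, h2, h4, rfl⟩, rfl⟩
  component := Finsupp.lmapDomain _ R (fun p : ℕ × ℕ => p.1 + p.2) ∘ₗ
    (finsuppTensorFinsupp R R C C' ℕ ℕ).toLinearMap ∘ₗ TensorProduct.map component component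
  component_words := by
    rintro n _ ⟨i, j, a, b, rfl, ha, hb, rfl⟩
    simp [component_words i a ha, component_words j b hb]

@[simp]
theorem unit_tensorProduct : (unit R : C ⊗[R] C') = unit R ⊗ₜ unit R := rfl

theorem linearMap_ext_words {N : Type*} [AddCommMonoid N] [Module R N] {f g : C →ₗ[R] N}
    (h : ∀ n, ∀ x ∈ words R n, f x = g x) : f = g :=
  LinearMap.ext_on (span_words (R := R) (C := C)) fun x hx => by
    obtain ⟨n, hn⟩ := Set.mem_iUnion.mp hx
    exact h n x hn

variable {A : Type*} [Ring A] [Algebra R A]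

/-- Orders of vanishing add up under convolution: when a word of length below `m + n` is cut, either
the first piece is shorter than `m` or the second is shorter than `n`. -/
theorem convMul_eq_zero {f g : WithConv (C →ₗ[R] A)} {m n : ℕ}
    (hf : ∀ k < m, ∀ x ∈ words R k, f x = 0) (hg : ∀ k < n, ∀ x ∈ words R k, g x = 0) :
    ∀ k < m + n, ∀ x ∈ words R k, (f * g) x = 0 := by
  intro k hk x hx
  rw [LinearMap.convMul_apply, ← LinearMap.comp_apply, ← LinearMap.mem_ker]
  refine Submodule.span_le.mpr ?_ (comul_words k x hx)
  rintro _ ⟨i, j, a, b, rfl, ha, hb, rfl⟩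
  rw [SetLike.mem_coe, LinearMap.mem_ker, LinearMap.comp_apply, map_tmul, LinearMap.mul'_apply]
  rcases lt_or_ge i m with h | h
  · change f a * _ = 0
    rw [hf i h a ha, zero_mul]
  · change _ * g b = 0
    rw [hg j (by omega) b hb, mul_zero]

theorem words_lt_one {f : WithConv (C →ₗ[R] A)} (hf : f (unit R) = 0) :
    ∀ k < 1, ∀ x ∈ words R k, f x = 0 := by
  intro k hk x hx
  obtain rfl := Nat.lt_one_iff.mp hk
  rw [Set.mem_singleton_iff.mp (words_zero hx), hf]

/-- A linear map with `d = f * d`, where `f` vanishes on the unit, is zero. -/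
theorem eq_zero_of_eq_convMul {f d : WithConv (C →ₗ[R] A)} (hf : f (unit R) = 0)
    (h : d = f * d) : d = 0 := by
  have key : ∀ n, ∀ k < n, ∀ x ∈ words R k, d x = 0 := by
    intro n
    induction n with
    | zero => simp
    | succ n ih =>
      intro k hk x hx
      rw [h]
      exact convMul_eq_zero (words_lt_one hf) ih k (by omega) x hx
  apply WithConv.ofConv_injective
  exact linearMap_ext_words fun n x hx => key (n + 1) n (by omega) x hx

theorem convMul_recursion_unique {f d e : WithConv (C →ₗ[R] A)} (hf : f (unit R) = 0)
    (hd : d = 1 + f * d) (he : e = 1 + f * e) : d = e := by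
  refine sub_eq_zero.mp (eq_zero_of_eq_convMul hf ?_)
  nth_rewrite 1 [hd, he]
  rw [mul_sub]
  abel

/-- The convolution inverse of `1 - f`, if `f` vanishes on the unit. -/
def convGeom (f : WithConv (C →ₗ[R] A)) : WithConv (C →ₗ[R] A) :=
  -- On words of length `n` the powers above `n` vanish once `f` kills the unit, so this truncation
  -- is then the whole geometric series; it makes the definition unconditional.
  toConv ((Finsupp.lsum R fun n => ∑ k ∈ Finset.range (n + 1), (f ^ k).ofConv) ∘ₗ component)

/-- Since `f ^ m` vanishes on words shorter than `m`, the partial sum with `n` terms is already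
exact below length `n`. -/
theorem convGeom_sub_eq_zero {f : WithConv (C →ₗ[R] A)} (hf : f (unit R) = 0) (n : ℕ) :
    ∀ k < n, ∀ x ∈ words R k, (convGeom f - ∑ k ∈ Finset.range n, f ^ k) x = 0 := by
  intro k hk x hx
  have hpow : ∀ m, ∀ k < m, ∀ x ∈ words R k, (f ^ m) x = 0 := by
    intro m
    induction m with
    | zero => simp
    | succ m ih =>
      rw [pow_succ']
      intro k hk x hx
      exact convMul_eq_zero (words_lt_one hf) ih k (by omega) x hx
  have h1 : convGeom f x = ∑ m ∈ Finset.range (k + 1), (f ^ m) x := by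
    change (Finsupp.lsum R _) (component x) = _
    rw [component_words k x hx]
    simp
  have h2 : (∑ m ∈ Finset.range n, f ^ m) x = ∑ m ∈ Finset.range n, (f ^ m) x := by
    change (∑ m ∈ Finset.range n, f ^ m).ofConv x = _
    simp
  change convGeom f x - (∑ m ∈ Finset.range n, f ^ m) x = 0
  rw [h1, h2, sub_eq_zero]
  refine Finset.sum_subset (by intro m; simp; omega) fun m _ hm => hpow m k ?_ x hx
  simpa using hm

theorem convGeom_eq {f : WithConv (C →ₗ[R] A)} (hf : f (unit R) = 0) :
    convGeom f = 1 + f * convGeom f := by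
  apply WithConv.ofConv_injective
  refine linearMap_ext_words fun n x hx => ?_
  have h1 := convGeom_sub_eq_zero hf (n + 2) n (by omega) x hx
  have h2 := convMul_eq_zero (words_lt_one hf) (convGeom_sub_eq_zero hf (n + 1)) n (by omega) x hx
  -- The finite sums satisfy the recursion exactly when the outer one has one term more than the
  -- inner one. What is left is a difference of remainders, which vanish on words of length `n` by
  -- `h1` and `h2`.
  have h3 : convGeom f = 1 + f * convGeom f + ((convGeom f - ∑ k ∈ Finset.range (n + 2), f ^ k) -
      f * (convGeom f - ∑ k ∈ Finset.range (n + 1), f ^ k)) := by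
    rw [Finset.sum_range_succ', mul_sub, Finset.mul_sum]
    simp only [pow_succ', pow_zero]
    abel
  have h4 : ((convGeom f - ∑ k ∈ Finset.range (n + 2), f ^ k) -
      f * (convGeom f - ∑ k ∈ Finset.range (n + 1), f ^ k)) x = 0 := by
    change (convGeom f - ∑ k ∈ Finset.range (n + 2), f ^ k) x -
      (f * (convGeom f - ∑ k ∈ Finset.range (n + 1), f ^ k)) x = 0
    rw [h1, h2, sub_zero]
  change convGeom f x = (1 + f * convGeom f) x
  nth_rewrite 1 [h3]
  exact (congrArg (fun z => (1 + f * convGeom f) x + z) h4).trans (add_zero _)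

theorem one_sub_mul_convGeom {f : WithConv (C →ₗ[R] A)} (hf : f (unit R) = 0) :
    (1 - f) * convGeom f = 1 := by
  rw [sub_mul, one_mul, sub_eq_iff_eq_add]
  exact convGeom_eq hf

/-- The one-sided inverse is two-sided: the defect `d = convGeom f * (1 - f) - 1` satisfies `d = f *
d`, and such a map is zero. -/
theorem convGeom_mul_one_sub {f : WithConv (C →ₗ[R] A)} (hf : f (unit R) = 0) :
    convGeom f * (1 - f) = 1 := by
  have h : convGeom f * (1 - f) - 1 = 0 := by
    refine eq_zero_of_eq_convMul hf ?_
    have := one_sub_mul_convGeom hf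
    rw [sub_mul, one_mul, sub_eq_iff_eq_add] at this
    nth_rewrite 1 [this]
    rw [add_mul, one_mul, mul_sub f (convGeom f * (1 - f)) 1, mul_one, mul_assoc]
    abel
  exact sub_eq_zero.mp h

end WordGraded

/-! ### Coalgebra morphisms to tensor algebras -/

section Cofree

variable {R : Type*} [CommRing R] {M : Type*} [AddCommGroup M] [Module R M]
variable {C : Type*} [AddCommGroup C] [Module R C] [Coalgebra R C] [WordGraded R C]

open WordGraded

/-- A coalgebra morphism to a tensor algebra is determined by its component of degree one. -/
theorem coalgHom_eq_recursion (f : C →ₗc[R] TensorAlgebra R M) :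
    toConv f.toLinearMap =
      1 + toConv (prT R M ∘ₗ f.toLinearMap) * toConv f.toLinearMap := by
  apply WithConv.ofConv_injective
  ext x
  change f x = algebraMap R _ (Coalgebra.counit (R := R) x) +
    LinearMap.mul' R _ (TensorProduct.map (prT R M ∘ₗ f.toLinearMap) f.toLinearMap
      (Coalgebra.comul (R := R) x))
  have h1 : comulT (f x) = TensorProduct.map f.toLinearMap f.toLinearMap
      (Coalgebra.comul (R := R) x) := (CoalgHomClass.map_comp_comul_apply f x).symm
  have h2 : Coalgebra.counit (R := R) (f x) = Coalgebra.counit (R := R) x :=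
    CoalgHomClass.counit_comp_apply f x
  rw [recompose_comulT (f x), h1, h2, Algebra.algebraMap_eq_smul_one]
  congr 1
  rw [recompose, LinearMap.comp_apply, LinearMap.rTensor, ← LinearMap.comp_apply (TensorProduct.map _ _),
    ← TensorProduct.map_comp, LinearMap.id_comp]

/-- The uniqueness half of cofreeness: both morphisms solve the recursion of `coalgHom_eq_recursion`
with the same coefficient, which kills the unit. This reduces the identities between products below
to degree one. -/
theorem coalgHom_ext {f g : C →ₗc[R] TensorAlgebra R M} (hf : prL (f (unit R)) = 0)
    (h : ∀ x, prL (f x) = prL (g x)) : f = g := by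
  have hfg : prT R M ∘ₗ f.toLinearMap = prT R M ∘ₗ g.toLinearMap := by
    ext x
    exact congrArg (ι R) (h x)
  have key : toConv f.toLinearMap = toConv g.toLinearMap := by
    refine convMul_recursion_unique (f := toConv (prT R M ∘ₗ f.toLinearMap)) ?_
      (coalgHom_eq_recursion f) ?_
    · change ι R (prL (f (unit R))) = 0
      rw [hf, map_zero]
    · rw [hfg]
      exact coalgHom_eq_recursion g
  ext x
  exact LinearMap.congr_fun (WithConv.toConv_injective key) x

/-- Postcomposition with an algebra morphism, as a morphism of convolution algebras. -/
def convPostcomp {A B : Type*} [Ring A] [Algebra R A] [Ring B] [Algebra R B] (j : A →ₐ[R] B) :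
    WithConv (C →ₗ[R] A) →+* WithConv (C →ₗ[R] B) where
  toFun f := toConv (j.toLinearMap ∘ₗ f.ofConv)
  map_one' := by
    apply WithConv.ofConv_injective
    ext x
    exact j.commutes _
  map_mul' f g := by
    apply WithConv.ofConv_injective
    exact LinearMap.algHom_comp_convMul_distrib j f g
  map_zero' := by
    apply WithConv.ofConv_injective
    ext x
    exact map_zero j
  map_add' f g := by
    apply WithConv.ofConv_injective
    ext x
    exact map_add j _ _

variable (φ : C →ₗ[R] M)

/-- The linear map underlying the coalgebra morphism to a tensor algebra with a given component of
degree one. -/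
def cofreeLin : C →ₗ[R] TensorAlgebra R M := (convGeom (toConv (ι R ∘ₗ φ))).ofConv

variable {φ}

theorem cofreeLin_eq (hφ : φ (unit R) = 0) : toConv (cofreeLin φ) =
    1 + toConv (ι R ∘ₗ φ) * toConv (cofreeLin φ) :=
  convGeom_eq (by change ι R (φ (unit R)) = 0; rw [hφ, map_zero])

theorem counit_ι_convMul (g : WithConv (C →ₗ[R] TensorAlgebra R M)) (x : C) :
    Coalgebra.counit (R := R) ((toConv (ι R ∘ₗ φ) * g) x) = 0 := by
  rw [LinearMap.convMul_apply]
  generalize Coalgebra.comul (R := R) x = w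
  induction w using TensorProduct.induction_on with
  | zero => simp
  | add a b ha hb => simp only [map_add, ha, hb, add_zero]
  | tmul a b => simp [counit_ι_mul]

theorem counit_cofreeLin (hφ : φ (unit R) = 0) (x : C) :
    Coalgebra.counit (R := R) (cofreeLin φ x) = Coalgebra.counit (R := R) x := by
  have h : cofreeLin φ x = (1 + toConv (ι R ∘ₗ φ) * toConv (cofreeLin φ)) x :=
    congrArg (fun f : WithConv (C →ₗ[R] TensorAlgebra R M) => f x) (cofreeLin_eq hφ)
  rw [h]
  change Coalgebra.counit (R := R) (algebraMap R (TensorAlgebra R M) (Coalgebra.counit (R := R) x) +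
    (toConv (ι R ∘ₗ φ) * toConv (cofreeLin φ)) x) = _
  rw [map_add, counit_ι_convMul, add_zero, Algebra.algebraMap_eq_smul_one, map_smul,
    counit_one_T, smul_eq_mul, mul_one]

/-- In the recursion `G = 1 + φ * G`, the projection to one letter leaves `φ` on the first half of
the coproduct and only the counit of `G` on the second. -/
theorem prL_cofreeLin (hφ : φ (unit R) = 0) (x : C) : prL (cofreeLin φ x) = φ x := by
  have h : cofreeLin φ x = (1 + toConv (ι R ∘ₗ φ) * toConv (cofreeLin φ)) x :=
    congrArg (fun f : WithConv (C →ₗ[R] TensorAlgebra R M) => f x) (cofreeLin_eq hφ)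
  rw [h]
  change prL (algebraMap R (TensorAlgebra R M) (Coalgebra.counit (R := R) x) +
    (toConv (ι R ∘ₗ φ) * toConv (cofreeLin φ)) x) = _
  rw [map_add, Algebra.algebraMap_eq_smul_one, map_smul, prL_one, smul_zero, zero_add,
    LinearMap.convMul_apply]
  have h2 : ∀ w : C ⊗[R] C, prL (LinearMap.mul' R _ (TensorProduct.map (ι R ∘ₗ φ) (cofreeLin φ) w)) =
      φ (TensorProduct.rid R C (LinearMap.lTensor C (Coalgebra.counit (R := R)) w)) := by
    intro w
    induction w using TensorProduct.induction_on with
    | zero => simp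
    | add a b ha hb => simp only [map_add, ha, hb]
    | tmul a b => simp [prL_ι_mul, counit_cofreeLin hφ]
  refine (h2 _).trans ?_
  rw [Coalgebra.lTensor_counit_comul]
  simp

/-- The first-letter recursion for deconcatenation, written in the convolution algebra of maps to `T
⊗ T`. There the embeddings of the two factors are ring morphisms, and the coproduct of a geometric
series can be computed algebraically. -/
theorem comulT_ι_convMul (g : WithConv (C →ₗ[R] TensorAlgebra R M)) :
    toConv (comulT ∘ₗ (toConv (ι R ∘ₗ φ) * g).ofConv) =
      convPostcomp Algebra.TensorProduct.includeRight (toConv (ι R ∘ₗ φ) * g) +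
      convPostcomp Algebra.TensorProduct.includeLeft (toConv (ι R ∘ₗ φ)) *
        toConv (comulT ∘ₗ g.ofConv) := by
  apply WithConv.ofConv_injective
  ext x
  change comulT ((toConv (ι R ∘ₗ φ) * g) x) =
    (1 : TensorAlgebra R M) ⊗ₜ ((toConv (ι R ∘ₗ φ) * g) x) + LinearMap.mul' R _
      (TensorProduct.map ((Algebra.TensorProduct.includeLeft (R := R) (S := R) (A := TensorAlgebra R M)
        (B := TensorAlgebra R M)).toLinearMap ∘ₗ (ι R ∘ₗ φ)) (comulT ∘ₗ g.ofConv)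
          (Coalgebra.comul (R := R) x))
  rw [LinearMap.convMul_apply]
  generalize Coalgebra.comul (R := R) x = w
  induction w using TensorProduct.induction_on with
  | zero => simp
  | add a b ha hb =>
    simp only [map_add, ha, hb, tmul_add]
    abel
  | tmul a b => simp [comulT_ι_mul]

/-- Put `F = Δ ∘ G`. The recursion for `G` gives `(1 - j1 f) F = j2 G`, and `j1 G` is a left inverse
of `1 - j1 f`. Hence `F = j1 G * j2 G`, which is `(G ⊗ G) ∘ Δ`. -/
theorem comulT_cofreeLin (hφ : φ (unit R) = 0) (x : C) :
    comulT (cofreeLin φ x) =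
      TensorProduct.map (cofreeLin φ) (cofreeLin φ) (Coalgebra.comul (R := R) x) := by
  set f : WithConv (C →ₗ[R] TensorAlgebra R M) := toConv (ι R ∘ₗ φ)
  have hf : f (unit R) = 0 := by change ι R (φ (unit R)) = 0; rw [hφ, map_zero]
  set G := toConv (cofreeLin φ)
  have hG : G = 1 + f * G := cofreeLin_eq hφ
  let j1 : WithConv (C →ₗ[R] TensorAlgebra R M) →+* _ := convPostcomp
    (Algebra.TensorProduct.includeLeft (R := R) (S := R) (A := TensorAlgebra R M)
      (B := TensorAlgebra R M))
  let j2 : WithConv (C →ₗ[R] TensorAlgebra R M) →+* _ := convPostcomp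
    (Algebra.TensorProduct.includeRight (R := R) (A := TensorAlgebra R M)
      (B := TensorAlgebra R M))
  have h1 : toConv (comulT ∘ₗ G.ofConv) = j2 G + j1 f * toConv (comulT ∘ₗ G.ofConv) := by
    have h2 : toConv (comulT ∘ₗ G.ofConv) = 1 + toConv (comulT ∘ₗ (f * G).ofConv) := by
      nth_rewrite 1 [hG]
      apply WithConv.ofConv_injective
      ext x
      change comulT (algebraMap R _ (Coalgebra.counit (R := R) x) + (f * G) x) =
        algebraMap R _ (Coalgebra.counit (R := R) x) + comulT ((f * G) x)
      rw [map_add, Algebra.algebraMap_eq_smul_one, Algebra.algebraMap_eq_smul_one, map_smul,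
        comulT_one, ← Algebra.TensorProduct.one_def]
    have h3 : j2 G = 1 + j2 (f * G) := by
      nth_rewrite 1 [hG]
      rw [map_add, map_one]
    rw [h3, add_assoc, ← comulT_ι_convMul, ← h2]
  have h4 : (1 - j1 f) * toConv (comulT ∘ₗ G.ofConv) = j2 G := by
    rw [sub_mul, one_mul, sub_eq_iff_eq_add]
    exact h1
  have h5 : j1 G * (1 - j1 f) = 1 := by
    rw [← map_one j1, ← map_sub, ← map_mul]
    exact congrArg j1 (convGeom_mul_one_sub hf)
  have h6 : toConv (comulT ∘ₗ G.ofConv) = j1 G * j2 G := by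
    rw [← h4, ← mul_assoc, h5, one_mul]
  have h7 := congrArg (fun f : WithConv (C →ₗ[R] _) => f x) h6
  refine h7.trans ?_
  change (j1 G * j2 G) x = _
  rw [LinearMap.convMul_apply]
  generalize Coalgebra.comul (R := R) x = w
  induction w using TensorProduct.induction_on with
  | zero => simp
  | add a b ha hb => simp only [map_add, ha, hb]
  | tmul a b =>
    change ((cofreeLin φ a) ⊗ₜ[R] 1) * (1 ⊗ₜ[R] (cofreeLin φ b)) = _
    simp [Algebra.TensorProduct.tmul_mul_tmul]

/-- The coalgebra morphism to a tensor algebra with a given component of degree one. -/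
def cofreeHom (φ : C →ₗ[R] M) (hφ : φ (unit R) = 0) : C →ₗc[R] TensorAlgebra R M where
  toLinearMap := cofreeLin φ
  counit_comp := LinearMap.ext fun x => counit_cofreeLin hφ x
  map_comp_comul := LinearMap.ext fun x => (comulT_cofreeLin hφ x).symm

end Cofree

end ShuffleHopf

end

noncomputable section

namespace ShuffleHopf

open TensorProduct TensorAlgebra WithConv WordGraded

/-! ### Products on tensor algebras which are coalgebra morphisms -/

section CofreeMul

variable {R : Type*} [CommRing R] {M : Type*} [AddCommGroup M] [Module R M]

theorem comul_map_rev (w : TensorAlgebra R M ⊗[R] TensorAlgebra R M) :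
    Coalgebra.comul (R := R) (TensorProduct.map (revT R M) (revT R M) w) =
      TensorProduct.comm R _ _ (TensorProduct.map (TensorProduct.map (revT R M) (revT R M))
        (TensorProduct.map (revT R M) (revT R M)) (Coalgebra.comul (R := R) w)) := by
  induction w using TensorProduct.induction_on with
  | zero => simp
  | add a b ha hb => simp only [map_add, ha, hb]
  | tmul a b =>
    rw [map_tmul, TensorProduct.comul_tmul, TensorProduct.comul_tmul, comul_eq_comulT,
      comul_eq_comulT, comul_eq_comulT, comul_eq_comulT, comulT_revT, comulT_revT]
    generalize comulT a = u
    generalize comulT b = v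
    induction u using TensorProduct.induction_on with
    | zero => simp
    | add a b ha hb => simp only [map_add, add_tmul, ha, hb]
    | tmul a a' =>
      induction v using TensorProduct.induction_on with
      | zero => simp
      | add a b ha hb => simp only [map_add, tmul_add, ha, hb]
      | tmul b b' => simp

theorem comul_comm (w : TensorAlgebra R M ⊗[R] TensorAlgebra R M) :
    Coalgebra.comul (R := R) (TensorProduct.comm R _ _ w) =
      TensorProduct.map (TensorProduct.comm R _ _).toLinearMap
        (TensorProduct.comm R _ _).toLinearMap (Coalgebra.comul (R := R) w) := by
  induction w using TensorProduct.induction_on with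
  | zero => simp
  | add a b ha hb => simp only [map_add, ha, hb]
  | tmul a b =>
    rw [comm_tmul, TensorProduct.comul_tmul, TensorProduct.comul_tmul]
    generalize Coalgebra.comul (R := R) a = u
    generalize Coalgebra.comul (R := R) b = v
    induction u using TensorProduct.induction_on with
    | zero => simp
    | add a b ha hb => simp only [map_add, add_tmul, tmul_add, ha, hb]
    | tmul a a' =>
      induction v using TensorProduct.induction_on with
      | zero => simp
      | add a b ha hb => simp only [map_add, add_tmul, tmul_add, ha, hb]
      | tmul b b' => simp

variable {β : TensorAlgebra R M ⊗[R] TensorAlgebra R M →ₗ[R] M}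

theorem cofreeLin_one_tmul_one (hβ : β (1 ⊗ₜ 1) = 0) : cofreeLin β (1 ⊗ₜ 1) = 1 := by
  have h := congrArg (fun f : WithConv (_ →ₗ[R] TensorAlgebra R M) => f (1 ⊗ₜ 1))
    (cofreeLin_eq (φ := β) hβ)
  refine h.trans ?_
  change algebraMap R _ (Coalgebra.counit (R := R) ((1 : TensorAlgebra R M) ⊗ₜ[R] (1 : TensorAlgebra R M))) +
    (toConv (ι R ∘ₗ β) * toConv (cofreeLin β)) (1 ⊗ₜ 1) = 1
  rw [LinearMap.convMul_apply, TensorProduct.comul_tmul, comul_eq_comulT, comulT_one]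
  simp [hβ]

/-- Conjugating the product by reversal exchanges the halves of the coproduct twice, so the result
is again a coalgebra morphism; its degree one component identifies it, because reversal fixes single
letters. -/
theorem cofreeLin_rev (hβ : β (1 ⊗ₜ 1) = 0) (x y : TensorAlgebra R M) :
    cofreeLin (β ∘ₗ TensorProduct.map (revT R M) (revT R M)) (x ⊗ₜ y) =
      revT R M (cofreeLin β (revT R M x ⊗ₜ revT R M y)) := by
  let f : TensorAlgebra R M ⊗[R] TensorAlgebra R M →ₗc[R] TensorAlgebra R M :=
    { toLinearMap := revT R M ∘ₗ cofreeLin β ∘ₗ TensorProduct.map (revT R M) (revT R M)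
      counit_comp := by
        ext x y
        simp [counit_revT, counit_cofreeLin (φ := β) hβ]
      map_comp_comul := by
        refine LinearMap.ext fun w => ?_
        simp only [LinearMap.comp_apply]
        rw [comul_eq_comulT, comulT_revT, comulT_cofreeLin (φ := β) hβ, comul_map_rev]
        generalize Coalgebra.comul (R := R) w = v
        induction v using TensorProduct.induction_on with
        | zero => simp
        | add a b ha hb => simp only [map_add, ha, hb]
        | tmul a b => simp }
  have hf : f = cofreeHom (β ∘ₗ TensorProduct.map (revT R M) (revT R M)) (by simpa using hβ) := by
    have hpr : ∀ w, prL (f w) = β (TensorProduct.map (revT R M) (revT R M) w) := by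
      intro w
      have := congrArg prL (prT_revT (cofreeLin β (TensorProduct.map (revT R M) (revT R M) w)))
      simp only [prT, LinearMap.comp_apply, prL_ι] at this
      exact this.trans (prL_cofreeLin (φ := β) hβ _)
    refine coalgHom_ext ?_ fun w => ?_
    · rw [hpr]
      simpa using hβ
    · rw [hpr]
      exact (prL_cofreeLin (φ := β ∘ₗ TensorProduct.map (revT R M) (revT R M))
        (by simpa using hβ) w).symm
  exact (congrArg (fun g : _ →ₗc[R] TensorAlgebra R M => g (x ⊗ₜ y)) hf).symm

theorem cofreeLin_comm (hβ : β (1 ⊗ₜ 1) = 0) (x y : TensorAlgebra R M) :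
    cofreeLin (β ∘ₗ (TensorProduct.comm R _ _).toLinearMap) (x ⊗ₜ y) =
      cofreeLin β (y ⊗ₜ x) := by
  let f : TensorAlgebra R M ⊗[R] TensorAlgebra R M →ₗc[R] TensorAlgebra R M :=
    { toLinearMap := cofreeLin β ∘ₗ (TensorProduct.comm R _ _).toLinearMap
      counit_comp := by
        ext x y
        simp [counit_cofreeLin (φ := β) hβ, mul_comm]
      map_comp_comul := by
        refine LinearMap.ext fun w => ?_
        simp only [LinearMap.comp_apply, LinearEquiv.coe_coe]
        rw [comul_eq_comulT, comulT_cofreeLin (φ := β) hβ, comul_comm]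
        generalize Coalgebra.comul (R := R) w = v
        induction v using TensorProduct.induction_on with
        | zero => simp
        | add a b ha hb => simp only [map_add, ha, hb]
        | tmul a b => simp }
  have hf : f = cofreeHom (β ∘ₗ (TensorProduct.comm R _ _).toLinearMap) (by simpa using hβ) := by
    have hpr : ∀ w, prL (f w) = β (TensorProduct.comm R _ _ w) :=
      fun w => prL_cofreeLin (φ := β) hβ _
    refine coalgHom_ext ?_ fun w => ?_
    · rw [hpr]
      simpa using hβ
    · rw [hpr]
      exact (prL_cofreeLin (φ := β ∘ₗ (TensorProduct.comm R _ _).toLinearMap)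
        (by simpa using hβ) w).symm
  exact (congrArg (fun g : _ →ₗc[R] TensorAlgebra R M => g (x ⊗ₜ y)) hf).symm

/-- Multiplication by the empty word is a coalgebra endomorphism with the same degree one component
as the identity. -/
theorem cofreeLin_one_tmul (h : ∀ y, β (1 ⊗ₜ y) = prL y)
    (y : TensorAlgebra R M) : cofreeLin β (1 ⊗ₜ y) = y := by
  have hβ : β (1 ⊗ₜ 1) = 0 := by rw [h, prL_one]
  let f : TensorAlgebra R M →ₗc[R] TensorAlgebra R M :=
    { toLinearMap := cofreeLin β ∘ₗ TensorProduct.mk R _ _ 1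
      counit_comp := by
        ext y
        simp [counit_cofreeLin hβ]
      map_comp_comul := by
        refine LinearMap.ext fun w => ?_
        simp only [LinearMap.comp_apply, mk_apply]
        refine Eq.trans ?_ (comulT_cofreeLin hβ _).symm
        rw [TensorProduct.comul_tmul]
        generalize Coalgebra.comul (R := R) w = v
        rw [comul_eq_comulT, comulT_one]
        induction v using TensorProduct.induction_on with
        | zero => simp
        | add a b ha hb => simp only [map_add, tmul_add, ha, hb]
        | tmul a b => simp }
  have hf : f = CoalgHom.id R _ := by
    have hpr : ∀ w, prL (f w) = prL w :=
      fun w => (prL_cofreeLin hβ _).trans (h w)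
    exact coalgHom_ext (by rw [hpr]; simp) hpr
  exact congrArg (fun g : _ →ₗc[R] TensorAlgebra R M => g y) hf

theorem cofreeLin_tmul_one (h : ∀ x, β (x ⊗ₜ 1) = prL x)
    (y : TensorAlgebra R M) : cofreeLin β (y ⊗ₜ 1) = y := by
  have hβ : β (1 ⊗ₜ 1) = 0 := by rw [h, prL_one]
  let f : TensorAlgebra R M →ₗc[R] TensorAlgebra R M :=
    { toLinearMap := cofreeLin β ∘ₗ (TensorProduct.mk R _ _).flip 1
      counit_comp := by
        ext y
        simp [counit_cofreeLin hβ]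
      map_comp_comul := by
        refine LinearMap.ext fun w => ?_
        simp only [LinearMap.comp_apply, mk_apply, LinearMap.flip_apply]
        refine Eq.trans ?_ (comulT_cofreeLin hβ _).symm
        rw [TensorProduct.comul_tmul]
        generalize Coalgebra.comul (R := R) w = v
        rw [comul_eq_comulT, comulT_one]
        induction v using TensorProduct.induction_on with
        | zero => simp
        | add a b ha hb => simp only [map_add, add_tmul, ha, hb]
        | tmul a b => simp }
  have hf : f = CoalgHom.id R _ := by
    have hpr : ∀ w, prL (f w) = prL w :=
      fun w => (prL_cofreeLin hβ _).trans (h w)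
    exact coalgHom_ext (by rw [hpr]; simp) hpr
  exact congrArg (fun g : _ →ₗc[R] TensorAlgebra R M => g y) hf

end CofreeMul

/-- The degree one component of a product on the tensor algebra of `M` which makes it a bialgebra
with unit `1` for the deconcatenation coproduct. -/
structure ProductDatum (R M : Type*) [CommRing R] [AddCommGroup M] [Module R M] where
  β : TensorAlgebra R M ⊗[R] TensorAlgebra R M →ₗ[R] M
  one_tmul : ∀ y, β (1 ⊗ₜ y) = prL y
  tmul_one : ∀ x, β (x ⊗ₜ 1) = prL x
  assoc : ∀ x y z, β (cofreeLin β (x ⊗ₜ y) ⊗ₜ z) = β (x ⊗ₜ cofreeLin β (y ⊗ₜ z))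

namespace ProductDatum

variable {R M : Type*} [CommRing R] [AddCommGroup M] [Module R M] (D : ProductDatum R M)

theorem β_one : D.β (1 ⊗ₜ 1) = 0 := by rw [D.one_tmul, prL_one]

/-- The product, as a coalgebra morphism. -/
def mulHom : TensorAlgebra R M ⊗[R] TensorAlgebra R M →ₗc[R] TensorAlgebra R M :=
  cofreeHom D.β D.β_one

theorem prL_mulHom (w : TensorAlgebra R M ⊗[R] TensorAlgebra R M) : prL (D.mulHom w) = D.β w :=
  prL_cofreeLin D.β_one w

theorem mulHom_one_one : D.mulHom (1 ⊗ₜ 1) = 1 := cofreeLin_one_tmul_one D.β_one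

theorem mulHom_one_tmul (y : TensorAlgebra R M) : D.mulHom (1 ⊗ₜ y) = y :=
  cofreeLin_one_tmul D.one_tmul y

theorem mulHom_tmul_one (y : TensorAlgebra R M) : D.mulHom (y ⊗ₜ 1) = y :=
  cofreeLin_tmul_one D.tmul_one y

/-- Both bracketings are coalgebra morphisms on the triple tensor product, and the axiom `assoc`
says that their degree one components agree. -/
theorem mulHom_assoc (x y z : TensorAlgebra R M) :
    D.mulHom (D.mulHom (x ⊗ₜ y) ⊗ₜ z) = D.mulHom (x ⊗ₜ D.mulHom (y ⊗ₜ z)) := by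
  let f : (TensorAlgebra R M ⊗[R] TensorAlgebra R M) ⊗[R] TensorAlgebra R M →ₗc[R]
      TensorAlgebra R M :=
    D.mulHom.comp (Coalgebra.TensorProduct.map D.mulHom (CoalgHom.id R _))
  let g : (TensorAlgebra R M ⊗[R] TensorAlgebra R M) ⊗[R] TensorAlgebra R M →ₗc[R]
      TensorAlgebra R M :=
    (D.mulHom.comp (Coalgebra.TensorProduct.map (CoalgHom.id R _) D.mulHom)).comp
      (Coalgebra.TensorProduct.assoc R R (TensorAlgebra R M) (TensorAlgebra R M)
        (TensorAlgebra R M)).toCoalgHom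
  have hfg : f = g := by
    refine coalgHom_ext (M := M)
      (C := (TensorAlgebra R M ⊗[R] TensorAlgebra R M) ⊗[R] TensorAlgebra R M) ?_ fun w => ?_
    · change prL (D.mulHom (D.mulHom (1 ⊗ₜ 1) ⊗ₜ 1)) = 0
      rw [mulHom_one_one, mulHom_one_one, prL_one]
    · induction w using TensorProduct.induction_on with
      | zero => simp
      | add a b ha hb => simp only [map_add, ha, hb]
      | tmul w z =>
        induction w using TensorProduct.induction_on with
        | zero => simp
        | add a b ha hb => simp only [map_add, add_tmul, ha, hb]
        | tmul x y =>
          change prL (D.mulHom (D.mulHom (x ⊗ₜ y) ⊗ₜ z)) = prL (D.mulHom (x ⊗ₜ D.mulHom (y ⊗ₜ z)))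
          rw [prL_mulHom, prL_mulHom]
          exact D.assoc x y z
  exact congrArg (fun g : _ →ₗc[R] TensorAlgebra R M => g ((x ⊗ₜ y) ⊗ₜ z)) hfg

/-- The datum obtained by reversing words. -/
def rev : ProductDatum R M where
  β := D.β ∘ₗ TensorProduct.map (revT R M) (revT R M)
  one_tmul y := by
    have := congrArg prL (prT_revT y)
    simp only [prT, LinearMap.comp_apply, prL_ι] at this
    simp [D.one_tmul, this]
  tmul_one y := by
    have := congrArg prL (prT_revT y)
    simp only [prT, LinearMap.comp_apply, prL_ι] at this
    simp [D.tmul_one, this]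
  assoc x y z := by
    rw [cofreeLin_rev D.β_one, cofreeLin_rev D.β_one]
    simp [D.assoc]

theorem rev_mulHom (x y : TensorAlgebra R M) :
    D.rev.mulHom (x ⊗ₜ y) = revT R M (D.mulHom (revT R M x ⊗ₜ revT R M y)) :=
  cofreeLin_rev D.β_one x y

/-- The datum of the opposite product. -/
def op : ProductDatum R M where
  β := D.β ∘ₗ (TensorProduct.comm R _ _).toLinearMap
  one_tmul y := by simp [D.tmul_one]
  tmul_one y := by simp [D.one_tmul]
  assoc x y z := by
    rw [cofreeLin_comm D.β_one, cofreeLin_comm D.β_one]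
    simp [D.assoc]

theorem op_mulHom (x y : TensorAlgebra R M) : D.op.mulHom (x ⊗ₜ y) = D.mulHom (y ⊗ₜ x) :=
  cofreeLin_comm D.β_one x y

end ProductDatum

/-! ### The bialgebra attached to a product datum -/

section Sh

variable {R M : Type*} [CommRing R] [AddCommGroup M] [Module R M]

/-- The tensor algebra of `M` with the product given by `D` and the deconcatenation coproduct. -/
def Sh (_ : ProductDatum R M) : Type _ := TensorAlgebra R M

variable (D : ProductDatum R M)

/-- The linear structure, the coproduct and the grading are inherited from the tensor algebra. The
product is not, which is the reason for a separate type. -/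
instance : AddCommGroup (Sh D) := inferInstanceAs (AddCommGroup (TensorAlgebra R M))

instance : Module R (Sh D) := inferInstanceAs (Module R (TensorAlgebra R M))

instance : Coalgebra R (Sh D) := inferInstanceAs (Coalgebra R (TensorAlgebra R M))

instance : WordGraded R (Sh D) := inferInstanceAs (WordGraded R (TensorAlgebra R M))

namespace Sh

variable {D}

/-- The identity, from the tensor algebra to `Sh D`. -/
def ofT : TensorAlgebra R M ≃ₗ[R] Sh D := LinearEquiv.refl R _

end Sh

instance : Ring (Sh D) :=
  { (inferInstance : AddCommGroup (Sh D)) with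
    mul := fun x y => Sh.ofT (D.mulHom (Sh.ofT.symm x ⊗ₜ Sh.ofT.symm y))
    one := Sh.ofT (1 : TensorAlgebra R M)
    mul_assoc := fun x y z => D.mulHom_assoc x y z
    one_mul := fun x => D.mulHom_one_tmul x
    mul_one := fun x => D.mulHom_tmul_one x
    left_distrib := fun x y z =>
      (congrArg D.mulHom (tmul_add x y z)).trans (map_add D.mulHom _ _)
    right_distrib := fun x y z =>
      (congrArg D.mulHom (add_tmul x y z)).trans (map_add D.mulHom _ _)
    zero_mul := fun x => (congrArg D.mulHom (zero_tmul _ x)).trans (map_zero D.mulHom)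
    mul_zero := fun x => (congrArg D.mulHom (tmul_zero _ x)).trans (map_zero D.mulHom) }

namespace Sh

variable {D}

theorem ofT_one : (ofT 1 : Sh D) = 1 := rfl

end Sh

instance : Algebra R (Sh D) :=
  Algebra.ofModule
    (fun r x y => (congrArg D.mulHom (smul_tmul' r (Sh.ofT.symm x) (Sh.ofT.symm y)).symm).trans
      (map_smul D.mulHom r _))
    (fun r x y => (congrArg D.mulHom (tmul_smul r (Sh.ofT.symm x) (Sh.ofT.symm y))).trans
      (map_smul D.mulHom r _))

namespace Sh

variable {D}

theorem comul_ofT (x : TensorAlgebra R M) : Coalgebra.comul (R := R) (ofT x : Sh D) =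
    TensorProduct.map ofT.toLinearMap ofT.toLinearMap (comulT x) :=
  (LinearMap.congr_fun (TensorProduct.map_id (R := R) (M := TensorAlgebra R M)
    (N := TensorAlgebra R M)) (comulT x)).symm

theorem counit_ofT (x : TensorAlgebra R M) : Coalgebra.counit (R := R) (ofT x : Sh D) =
    Coalgebra.counit (R := R) x := rfl

/-- This is the compatibility of `D.mulHom` with coproducts, the coproduct of `T ⊗ T` being formed
with the middle factors exchanged. -/
theorem comul_mul (x y : Sh D) : Coalgebra.comul (R := R) (x * y) =
    Coalgebra.comul (R := R) x * Coalgebra.comul (R := R) y := by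
  have h1 : Coalgebra.comul (R := R) (x * y) =
      TensorProduct.map (LinearMap.mul' R (Sh D)) (LinearMap.mul' R (Sh D))
        (tensorTensorTensorComm R (Sh D) (Sh D) (Sh D) (Sh D)
          (Coalgebra.comul (R := R) x ⊗ₜ Coalgebra.comul (R := R) y)) := by
    have h0 : Coalgebra.comul (R := R) (D.mulHom (ofT.symm x ⊗ₜ[R] ofT.symm y)) =
        TensorProduct.map D.mulHom.toLinearMap D.mulHom.toLinearMap
          (tensorTensorTensorComm R (TensorAlgebra R M) (TensorAlgebra R M) (TensorAlgebra R M)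
            (TensorAlgebra R M) (Coalgebra.comul (R := R) (ofT.symm x) ⊗ₜ
              Coalgebra.comul (R := R) (ofT.symm y))) := by
      refine (CoalgHomClass.map_comp_comul_apply D.mulHom
        (ofT.symm x ⊗ₜ[R] ofT.symm y)).symm.trans ?_
      rw [TensorProduct.comul_tmul, AlgebraTensorModule.tensorTensorTensorComm_eq]
      rfl
    have hm : LinearMap.mul' R (Sh D) = D.mulHom.toLinearMap :=
      TensorProduct.ext' fun _ _ => rfl
    rw [hm]
    exact h0
  rw [h1]
  generalize Coalgebra.comul (R := R) x = u
  generalize Coalgebra.comul (R := R) y = v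
  induction u using TensorProduct.induction_on with
  | zero => simp
  | add a b ha hb => simp only [map_add, add_mul, add_tmul, ha, hb]
  | tmul a a' =>
    induction v using TensorProduct.induction_on with
    | zero => simp
    | add a b ha hb => simp only [map_add, mul_add, tmul_add, ha, hb]
    | tmul b b' => simp

theorem counit_mul (x y : Sh D) : Coalgebra.counit (R := R) (x * y) =
    Coalgebra.counit (R := R) x * Coalgebra.counit (R := R) y := by
  have h : Coalgebra.counit (R := R) (x * y) =
    Coalgebra.counit (R := R) (ofT.symm x ⊗ₜ[R] ofT.symm y) :=
    CoalgHomClass.counit_comp_apply D.mulHom _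
  rw [h, TensorProduct.counit_tmul, smul_eq_mul, mul_comm]
  rfl

end Sh

instance : Bialgebra R (Sh D) :=
  Bialgebra.mk' R (Sh D) counit_one_T (fun {x y} => Sh.counit_mul x y)
    (comulT_one.trans rfl) (fun {x y} => Sh.comul_mul x y)

/-- The convolution inverse of the identity. -/
def shAntipode : WithConv (Sh D →ₗ[R] Sh D) := convGeom (1 - toConv LinearMap.id)

/-- This allows the identity, written `1 - (1 - id)`, to be inverted by a convolution geometric
series. -/
theorem one_sub_id_unit : (1 - toConv LinearMap.id : WithConv (Sh D →ₗ[R] Sh D)) (unit R) = 0 := by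
  change algebraMap R (Sh D) (Coalgebra.counit (R := R) (1 : Sh D)) - 1 = 0
  rw [Bialgebra.counit_one, map_one, sub_self]

theorem shAntipode_mul : shAntipode D * toConv LinearMap.id = 1 := by
  have h := convGeom_mul_one_sub (one_sub_id_unit D)
  rwa [sub_sub_cancel] at h

theorem mul_shAntipode : toConv LinearMap.id * shAntipode D = 1 := by
  have h := one_sub_mul_convGeom (one_sub_id_unit D)
  rwa [sub_sub_cancel] at h

instance : HopfAlgebra R (Sh D) where
  antipode := (shAntipode D).ofConv
  mul_antipode_rTensor_comul := congrArg ofConv (shAntipode_mul D)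
  mul_antipode_lTensor_comul := congrArg ofConv (mul_shAntipode D)

/-- Applying the anti-multiplicative `S` to the skew identity `x₍₂₎ s(x₍₁₎) = ε(x)` shows that `S ∘
s` is a left convolution inverse of `S`. The identity is a right inverse of `S`, so the two
coincide. -/
theorem antipode_apply_of_skew {H : Type*} [Ring H] [HopfAlgebra R H] (s : H →ₗ[R] H)
    (hs : ∀ x, LinearMap.mul' R H (TensorProduct.comm R _ _
      (LinearMap.rTensor _ s (Coalgebra.comul (R := R) x))) =
        algebraMap R _ (Coalgebra.counit (R := R) x)) (x : H) :
    HopfAlgebra.antipode R (s x) = x := by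
  have h : toConv (HopfAlgebra.antipode R ∘ₗ s) * toConv (HopfAlgebra.antipode R (A := H)) = 1 := by
    apply WithConv.ofConv_injective
    ext x
    change (toConv (HopfAlgebra.antipode R ∘ₗ s) * toConv (HopfAlgebra.antipode R (A := H))) x =
      algebraMap R _ (Coalgebra.counit (R := R) x)
    have h1 : HopfAlgebra.antipode R (algebraMap R H (Coalgebra.counit (R := R) x)) =
        algebraMap R H (Coalgebra.counit (R := R) x) := by
      rw [Algebra.algebraMap_eq_smul_one, map_smul, HopfAlgebra.antipode_one]
    rw [LinearMap.convMul_apply, ← h1, ← hs]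
    generalize Coalgebra.comul (R := R) x = u
    induction u using TensorProduct.induction_on with
    | zero => simp
    | add a b ha hb => simp only [map_add, ha, hb]
    | tmul a b => simp [HopfAlgebra.antipode_mul_antidistrib]
  have key := left_inv_eq_right_inv h LinearMap.antipode_mul_id
  exact LinearMap.congr_fun (WithConv.toConv_injective key) x

/-- The identity, from `Sh D` to `Sh D.op`. -/
def toOp : Sh D ≃ₗ[R] Sh D.op := LinearEquiv.refl R (TensorAlgebra R M)

theorem toOp_symm_mul (x y : Sh D.op) :
    (toOp D).symm (x * y) = (toOp D).symm y * (toOp D).symm x :=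
  D.op_mulHom _ _

theorem comul_toOp (x : Sh D) : Coalgebra.comul (R := R) (toOp D x) =
    TensorProduct.map (toOp D).toLinearMap (toOp D).toLinearMap (Coalgebra.comul (R := R) x) :=
  (LinearMap.congr_fun (TensorProduct.map_id (R := R) (M := TensorAlgebra R M)
    (N := TensorAlgebra R M)) (comulT (Sh.ofT.symm x))).symm

theorem counit_toOp (x : Sh D) :
    Coalgebra.counit (R := R) (toOp D x) = Coalgebra.counit (R := R) x := rfl

/-- The inverse of the antipode of `Sh D`. -/
def skewAntipode : Sh D →ₗ[R] Sh D :=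
  (toOp D).symm.toLinearMap ∘ₗ HopfAlgebra.antipode R ∘ₗ (toOp D).toLinearMap

/-- The opposite of a product datum is again one, so `Sh D.op` already has an antipode; its defining
identity, read in `Sh D`, is the skew one. -/
theorem mul_skewAntipode (x : Sh D) :
    LinearMap.mul' R (Sh D) (TensorProduct.comm R _ _
      (LinearMap.rTensor _ (skewAntipode D) (Coalgebra.comul (R := R) x))) =
        algebraMap R _ (Coalgebra.counit (R := R) x) := by
  have h := congrArg (toOp D).symm
    (HopfAlgebra.mul_antipode_rTensor_comul_apply (R := R) (toOp D x))
  rw [comul_toOp, counit_toOp] at h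
  refine Eq.trans ?_ (h.trans ?_)
  · generalize Coalgebra.comul (R := R) x = u
    induction u using TensorProduct.induction_on with
    | zero => simp
    | add a b ha hb => simp only [map_add, ha, hb]
    | tmul a b => simp [toOp_symm_mul, skewAntipode]
  · rw [Algebra.algebraMap_eq_smul_one, Algebra.algebraMap_eq_smul_one, map_smul]
    rfl

theorem antipode_skewAntipode (x : Sh D) :
    HopfAlgebra.antipode R (skewAntipode D x) = x :=
  antipode_apply_of_skew _ (mul_skewAntipode D) x

/-- The argument of `antipode_skewAntipode` with the roles exchanged: in `Sh D.op`, the antipode of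
`Sh D` is the skew one. -/
theorem skewAntipode_antipode (x : Sh D) :
    skewAntipode D (HopfAlgebra.antipode R x) = x := by
  have h := antipode_apply_of_skew (H := Sh D.op)
    ((toOp D).toLinearMap ∘ₗ HopfAlgebra.antipode R ∘ₗ (toOp D).symm.toLinearMap) (fun x => by
      obtain ⟨x, rfl⟩ := (toOp D).surjective x
      apply (toOp D).symm.injective
      have h := HopfAlgebra.mul_antipode_rTensor_comul_apply (R := R) x
      rw [comul_toOp, counit_toOp]
      refine Eq.trans ?_ (h.trans ?_)
      · generalize Coalgebra.comul (R := R) x = u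
        induction u using TensorProduct.induction_on with
        | zero => simp
        | add a b ha hb => simp only [map_add, ha, hb]
        | tmul a b => simp [toOp_symm_mul]
      · rw [Algebra.algebraMap_eq_smul_one, Algebra.algebraMap_eq_smul_one, map_smul]
        rfl) (toOp D x)
  exact congrArg (toOp D).symm h

end Sh

end ShuffleHopf

end

noncomputable section

namespace ShuffleHopf

open TensorProduct TensorAlgebra

/-! ### Power series with coefficients in noncommutative rings -/

section NoncommSeries

variable {S : Type*} [Ring S]

theorem series_eq_zero {ρ d : PowerSeries S} (hρ : PowerSeries.coeff 0 ρ = 0) (h : d = ρ * d) :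
    d = 0 := by
  have key : ∀ n, ∀ m < n, PowerSeries.coeff m d = 0 := by
    intro n
    induction n with
    | zero => simp
    | succ n ih =>
      intro m hm
      rw [h, PowerSeries.coeff_mul]
      refine Finset.sum_eq_zero fun p hp => ?_
      rw [Finset.HasAntidiagonal.mem_antidiagonal] at hp
      rcases Nat.eq_zero_or_pos p.1 with h1 | h1
      · rw [h1, hρ, zero_mul]
      · rw [ih p.2 (by omega), mul_zero]
  ext n
  simpa using key (n + 1) n (by omega)

theorem series_mul_one_sub {ρ G : PowerSeries S} (hρ : PowerSeries.coeff 0 ρ = 0)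
    (h : G = 1 + ρ * G) : G * (1 - ρ) = 1 := by
  refine sub_eq_zero.mp (series_eq_zero hρ ?_)
  nth_rewrite 1 [h]
  rw [add_mul, one_mul, mul_sub ρ (G * (1 - ρ)) 1, mul_one, mul_assoc]
  abel

/-- A coefficient of a geometric series depends only on the coefficients of the ratio up to the same
degree. An induction on the degree can therefore be run on the ratios alone. -/
theorem coeff_eq_of_recursion {ρ ρ' G G' : PowerSeries S} (hρ : PowerSeries.coeff 0 ρ = 0)
    (hρ' : PowerSeries.coeff 0 ρ' = 0) (h : G = 1 + ρ * G) (h' : G' = 1 + ρ' * G') {n : ℕ}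
    (hn : ∀ m < n, PowerSeries.coeff m ρ = PowerSeries.coeff m ρ') :
    ∀ m < n, PowerSeries.coeff m G = PowerSeries.coeff m G' := by
  intro m
  induction m using Nat.strong_induction_on with
  | _ m ih =>
    intro hm
    rw [h, h', map_add, map_add, PowerSeries.coeff_mul, PowerSeries.coeff_mul]
    congr 1
    refine Finset.sum_congr rfl fun p hp => ?_
    rw [Finset.HasAntidiagonal.mem_antidiagonal] at hp
    rcases Nat.eq_zero_or_pos p.1 with h1 | h1
    · rw [h1, hρ, hρ', zero_mul, zero_mul]
    · rw [hn p.1 (by omega), ih p.2 (by omega) (by omega)]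

theorem coeff_mul_of_vanish_left {d g : PowerSeries S} {n : ℕ}
    (hd : ∀ m < n, PowerSeries.coeff m d = 0) :
    PowerSeries.coeff n (d * g) = PowerSeries.coeff n d * PowerSeries.coeff 0 g := by
  rw [PowerSeries.coeff_mul, Finset.sum_eq_single (n, 0)]
  · rintro ⟨i, j⟩ hp hne
    rw [Finset.HasAntidiagonal.mem_antidiagonal] at hp
    have : i ≠ n := fun h => hne (by ext <;> simp at hp ⊢ <;> omega)
    simp only at hp ⊢
    rw [hd i (by omega), zero_mul]
  · intro h
    simp at h

theorem coeff_mul_of_vanish_right {d g : PowerSeries S} {n : ℕ}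
    (hd : ∀ m < n, PowerSeries.coeff m d = 0) :
    PowerSeries.coeff n (g * d) = PowerSeries.coeff 0 g * PowerSeries.coeff n d := by
  rw [PowerSeries.coeff_mul, Finset.sum_eq_single (0, n)]
  · rintro ⟨i, j⟩ hp hne
    rw [Finset.HasAntidiagonal.mem_antidiagonal] at hp
    have : j ≠ n := fun h => hne (by ext <;> simp at hp ⊢ <;> omega)
    simp only at hp ⊢
    rw [hd j (by omega), mul_zero]
  · intro h
    simp at h

/-- The coefficientwise extension of a linear map to power series. -/
def serL {R V W : Type*} [CommRing R] [Ring V] [Algebra R V] [Ring W] [Algebra R W]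
    (f : V →ₗ[R] W) (G : PowerSeries V) : PowerSeries W :=
  PowerSeries.mk fun n => f (PowerSeries.coeff n G)

@[simp]
theorem coeff_serL {R V W : Type*} [CommRing R] [Ring V] [Algebra R V] [Ring W] [Algebra R W]
    (f : V →ₗ[R] W) (G : PowerSeries V) (n : ℕ) :
    PowerSeries.coeff n (serL f G) = f (PowerSeries.coeff n G) := by simp [serL]

theorem serL_add {R V W : Type*} [CommRing R] [Ring V] [Algebra R V] [Ring W] [Algebra R W]
    (f : V →ₗ[R] W) (F G : PowerSeries V) : serL f (F + G) = serL f F + serL f G := by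
  ext n; simp

/-- An identity between coefficients extends to products of series. -/
theorem serL_mul_eq {R V₁ V₂ W U : Type*} [CommRing R] [Ring V₁] [Algebra R V₁]
    [Ring W] [Algebra R W] [Ring U] [Algebra R U] [Ring V₂] [Algebra R V₂]
    (D : W →ₗ[R] U) (f : V₁ →ₗ[R] W) (g : V₂ →ₗ[R] W) (f' : V₁ →ₗ[R] U) (g' : V₂ →ₗ[R] U)
    (h : ∀ u v, D (f u * g v) = f' u * g' v) (F : PowerSeries V₁) (G : PowerSeries V₂) :
    serL D (serL f F * serL g G) = serL f' F * serL g' G := by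
  ext n
  simp only [coeff_serL, PowerSeries.coeff_mul, map_sum, h]

/-- The coefficientwise extension of an algebra morphism to power series. -/
def serA {R V W : Type*} [CommRing R] [Ring V] [Algebra R V] [Ring W] [Algebra R W]
    (f : V →ₐ[R] W) : PowerSeries V →+* PowerSeries W :=
  PowerSeries.map (f : V →+* W)

@[simp]
theorem coeff_serA {R V W : Type*} [CommRing R] [Ring V] [Algebra R V] [Ring W] [Algebra R W]
    (f : V →ₐ[R] W) (G : PowerSeries V) (n : ℕ) :
    PowerSeries.coeff n (serA f G) = f (PowerSeries.coeff n G) := by simp [serA]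

theorem commute_serA {R S₁ S₂ S₃ : Type*} [CommRing R] [Ring S₁] [Ring S₂] [Ring S₃]
    [Algebra R S₁] [Algebra R S₂] [Algebra R S₃] (f : S₁ →ₐ[R] S₃) (g : S₂ →ₐ[R] S₃)
    (h : ∀ x y, Commute (f x) (g y)) (F : PowerSeries S₁) (G : PowerSeries S₂) :
    serA f F * serA g G = serA g G * serA f F := by
  ext n
  rw [PowerSeries.coeff_mul, PowerSeries.coeff_mul, ← Finset.Nat.sum_antidiagonal_swap]
  refine Finset.sum_congr rfl fun p _ => ?_
  simp only [coeff_serA, Prod.fst_swap, Prod.snd_swap]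
  exact h _ _

theorem serL_algHom {R V W : Type*} [CommRing R] [Ring V] [Algebra R V] [Ring W] [Algebra R W]
    (f : V →ₐ[R] W) (G : PowerSeries V) :
    serL f.toLinearMap G = serA f G := by
  ext n
  simp

theorem serL_comp {R U V W : Type*} [CommRing R] [Ring V] [Algebra R V] [Ring W] [Algebra R W]
    [Ring U] [Algebra R U] (g : V →ₗ[R] W) (f : U →ₗ[R] V) (G : PowerSeries U) :
    serL g (serL f G) = serL (g ∘ₗ f) G := by
  ext n
  simp

theorem serL_id {R V : Type*} [CommRing R] [Ring V] [Algebra R V] (G : PowerSeries V) :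
    serL (LinearMap.id : V →ₗ[R] V) G = G := by
  ext n
  simp

theorem serL_one {R V W : Type*} [CommRing R] [Ring V] [Algebra R V] [Ring W] [Algebra R W]
    (f : V →ₗ[R] W) (h : f 1 = 1) : serL f 1 = 1 := by
  ext n
  rw [coeff_serL, PowerSeries.coeff_one, PowerSeries.coeff_one]
  split_ifs <;> simp [h]

end NoncommSeries

/-! ### Geometric series in `E ⊗ T(M)` -/

section Geometric

variable {R : Type*} [CommRing R] {E : Type*} [Ring E] [Algebra R E]
variable {M : Type*} [AddCommGroup M] [Module R M]

variable (R E) in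
/-- `e ⊗ x ↦ e ⊗ x ⊗ 1`. -/
def emb12 (B : Type*) [Ring B] [Algebra R B] : E ⊗[R] B →ₐ[R] E ⊗[R] (B ⊗[R] B) :=
  Algebra.TensorProduct.map (AlgHom.id R E) Algebra.TensorProduct.includeLeft

variable (R E) in
/-- `e ⊗ x ↦ e ⊗ 1 ⊗ x`. -/
def emb13 (B : Type*) [Ring B] [Algebra R B] : E ⊗[R] B →ₐ[R] E ⊗[R] (B ⊗[R] B) :=
  Algebra.TensorProduct.map (AlgHom.id R E) Algebra.TensorProduct.includeRight

@[simp]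
theorem emb12_tmul {B : Type*} [Ring B] [Algebra R B] (e : E) (x : B) :
    emb12 R E B (e ⊗ₜ x) = e ⊗ₜ (x ⊗ₜ 1) := rfl

@[simp]
theorem emb13_tmul {B : Type*} [Ring B] [Algebra R B] (e : E) (x : B) :
    emb13 R E B (e ⊗ₜ x) = e ⊗ₜ (1 ⊗ₜ x) := rfl

theorem comulT_pr_mul (u v : E ⊗[R] TensorAlgebra R M) :
    LinearMap.lTensor E comulT (LinearMap.lTensor E (prT R M) u * v) =
      emb13 R E _ (LinearMap.lTensor E (prT R M) u * v) +
        emb12 R E _ (LinearMap.lTensor E (prT R M) u) * LinearMap.lTensor E comulT v := by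
  induction u using TensorProduct.induction_on with
  | zero => simp
  | add a b ha hb =>
    simp only [map_add, add_mul, ha, hb]
    abel
  | tmul e x =>
    induction v using TensorProduct.induction_on with
    | zero => simp
    | add a b ha hb =>
      simp only [map_add, mul_add, ha, hb]
      abel
    | tmul e' y =>
      simp only [LinearMap.lTensor_tmul, Algebra.TensorProduct.tmul_mul_tmul, comulT_prT_mul,
        emb12_tmul, emb13_tmul, tmul_add]

/-- A geometric series in `E ⊗ T(M)` whose ratio has degree one in `M` is comultiplicative. -/
theorem geometric_comul {ρ G : PowerSeries (E ⊗[R] TensorAlgebra R M)}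
    (h0 : PowerSeries.coeff 0 ρ = 0) (hpr : serL (LinearMap.lTensor E (prT R M)) ρ = ρ)
    (hG : G = 1 + ρ * G) :
    serL (LinearMap.lTensor E comulT) G =
      serA (emb12 R E (TensorAlgebra R M)) G *
        serA (emb13 R E (TensorAlgebra R M)) G := by
  set j1 := serA (emb12 R E (TensorAlgebra R M))
  set j2 := serA (emb13 R E (TensorAlgebra R M))
  set Δ := serL (LinearMap.lTensor E (comulT (R := R) (M := M)))
  -- The ratio has a single letter: a cut comes before that letter, or after it and hence inside
  -- `G`.
  have h1 : Δ (ρ * G) = j2 (ρ * G) + j1 ρ * Δ G := by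
    ext n
    have hc : ∀ m, PowerSeries.coeff m ρ =
        LinearMap.lTensor E (prT R M) (PowerSeries.coeff m ρ) := fun m => by
      nth_rewrite 1 [← hpr]
      simp
    simp only [Δ, j1, j2, map_add, coeff_serL, PowerSeries.coeff_mul, map_sum,
      coeff_serA, ← Finset.sum_add_distrib]
    refine Finset.sum_congr rfl fun p _ => ?_
    rw [hc p.1, comulT_pr_mul]
  have h2 : Δ 1 = 1 := serL_one _ (by simp [Algebra.TensorProduct.one_def])
  have h3 : (1 - j1 ρ) * Δ G = j2 G := by
    have h4 : Δ G = j2 G + j1 ρ * Δ G := by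
      nth_rewrite 1 [hG]
      nth_rewrite 2 [hG]
      have hadd : Δ (1 + ρ * G) = Δ 1 + Δ (ρ * G) := serL_add _ _ _
      rw [hadd, h1, h2, map_add, map_one, add_assoc]
    rw [sub_mul, one_mul, sub_eq_iff_eq_add]
    exact h4
  -- As for `comulT_cofreeLin`: `(1 - j1 ρ) Δ G = j2 G` is multiplied by the left inverse `j1 G`.
  rw [← h3, ← mul_assoc]
  have h5 : j1 G * (1 - j1 ρ) = 1 := by
    rw [← map_one j1, ← map_sub, ← map_mul, series_mul_one_sub h0 hG]
  rw [h5, one_mul]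

variable (R E) in
/-- `id ⊗ ηε`, an algebra morphism. -/
def counitRight (B : Type*) [Ring B] [Bialgebra R B] : E ⊗[R] B →ₐ[R] E ⊗[R] B :=
  Algebra.TensorProduct.map (AlgHom.id R E) ((Algebra.ofId R B).comp (Bialgebra.counitAlgHom R B))

@[simp]
theorem counitRight_tmul {B : Type*} [Ring B] [Bialgebra R B] (e : E) (x : B) :
    counitRight R E B (e ⊗ₜ x) = e ⊗ₜ algebraMap R B (Coalgebra.counit (R := R) x) := rfl

variable (R E M) in
/-- `id ⊗ ηε` on `E ⊗ T(M)`. -/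
def counitRightT : E ⊗[R] TensorAlgebra R M →ₗ[R] E ⊗[R] TensorAlgebra R M :=
  LinearMap.lTensor E (Algebra.linearMap R _ ∘ₗ Coalgebra.counit)

/-- A comultiplicative series in `E ⊗ T(M)` is the geometric series of its component of degree one
in `M`. -/
theorem geometric_of_comul {G : PowerSeries (E ⊗[R] TensorAlgebra R M)}
    (hG : serL (LinearMap.lTensor E comulT) G =
      serA (emb12 R E (TensorAlgebra R M)) G *
        serA (emb13 R E (TensorAlgebra R M)) G)
    (hε : serL (counitRightT R E M) G = 1) :
    G = 1 + serL (LinearMap.lTensor E (prT R M)) G * G := by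
  have h1 : G = serL (counitRightT R E M) G +
      serL (LinearMap.lTensor E (recompose R M)) (serL (LinearMap.lTensor E comulT) G) := by
    ext n
    simp only [map_add, coeff_serL]
    generalize PowerSeries.coeff n G = u
    induction u using TensorProduct.induction_on with
    | zero => simp
    | add a b ha hb =>
      simp only [map_add]
      nth_rewrite 1 [ha, hb]
      abel
    | tmul e x =>
      simp only [counitRightT, LinearMap.lTensor_tmul, LinearMap.comp_apply, ← tmul_add]
      congr 1
      rw [Algebra.linearMap_apply, Algebra.algebraMap_eq_smul_one]
      exact recompose_comulT x
  -- Recomposition keeps one-letter words in the first copy and concatenates, turning `G^{(12)}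
  -- G^{(13)}` into `pr(G) G`.
  have h2 : ∀ u v : E ⊗[R] TensorAlgebra R M, LinearMap.lTensor E (recompose R M)
      (emb12 R E _ u * emb13 R E _ v) = LinearMap.lTensor E (prT R M) u * v := by
    intro u v
    induction u using TensorProduct.induction_on with
    | zero => simp
    | add a b ha hb => simp only [map_add, add_mul, ha, hb]
    | tmul e x =>
      induction v using TensorProduct.induction_on with
      | zero => simp
      | add a b ha hb => simp only [map_add, mul_add, ha, hb]
      | tmul e' y => simp [recompose, Algebra.TensorProduct.tmul_mul_tmul]
  rw [hε, hG] at h1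
  refine h1.trans (congrArg (1 + ·) ?_)
  ext n
  simp only [coeff_serL, PowerSeries.coeff_mul, coeff_serA, map_sum, h2]

theorem counitRightT_geometric {ρ G : PowerSeries (E ⊗[R] TensorAlgebra R M)}
    (hpr : serL (LinearMap.lTensor E (prT R M)) ρ = ρ) (hG : G = 1 + ρ * G) :
    serL (counitRightT R E M) G = 1 := by
  have hc : ∀ m, PowerSeries.coeff m ρ =
      LinearMap.lTensor E (prT R M) (PowerSeries.coeff m ρ) := fun m => by
    nth_rewrite 1 [← hpr]
    simp
  rw [hG, serL_add, serL_one _ (by simp [counitRightT, Algebra.TensorProduct.one_def])]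
  convert add_zero (1 : PowerSeries (E ⊗[R] TensorAlgebra R M)) using 2
  ext n
  simp only [coeff_serL, PowerSeries.coeff_mul, map_sum, map_zero]
  refine Finset.sum_eq_zero fun p _ => ?_
  rw [hc]
  generalize PowerSeries.coeff p.1 ρ = u
  generalize PowerSeries.coeff p.2 G = v
  induction u using TensorProduct.induction_on with
  | zero => simp
  | add a b ha hb => simp only [map_add, add_mul, ha, hb, add_zero]
  | tmul e x =>
    induction v using TensorProduct.induction_on with
    | zero => simp
    | add a b ha hb => simp only [map_add, mul_add, ha, hb, add_zero]
    | tmul e' y =>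
      simp [counitRightT, Algebra.TensorProduct.tmul_mul_tmul, counit_mul_T, counit_prT]

end Geometric

end ShuffleHopf

end

noncomputable section

namespace ShuffleHopf

open TensorProduct TensorAlgebra

/-! ### The coproduct of a geometric series -/

section Legs

variable {R : Type*} [CommRing R] {E F F' : Type*} [Ring E] [Algebra R E] [Ring F] [Algebra R F]
  [Ring F'] [Algebra R F']

/-- The extension of an algebra morphism to tensor products with a given algebra. -/
def leg (f : E →ₐ[R] F) (N : Type*) [Ring N] [Algebra R N] : E ⊗[R] N →ₐ[R] F ⊗[R] N :=
  Algebra.TensorProduct.map f (AlgHom.id R N)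

@[simp]
theorem leg_tmul (f : E →ₐ[R] F) {N : Type*} [Ring N] [Algebra R N] (e : E) (x : N) :
    leg f N (e ⊗ₜ x) = f e ⊗ₜ x := rfl

theorem leg_eq_rTensor (f : E →ₐ[R] F) (N : Type*) [Ring N] [Algebra R N] (u : E ⊗[R] N) :
    leg f N u = LinearMap.rTensor N f.toLinearMap u := rfl

theorem leg_leg (g : F →ₐ[R] F') (f : E →ₐ[R] F) {N : Type*} [Ring N] [Algebra R N]
    (u : E ⊗[R] N) : leg g N (leg f N u) = leg (g.comp f) N u := by
  induction u using TensorProduct.induction_on with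
  | zero => simp
  | add a b ha hb => simp only [map_add, ha, hb]
  | tmul e x => rfl

theorem serA_leg_leg (g : F →ₐ[R] F') (f : E →ₐ[R] F) {N : Type*} [Ring N] [Algebra R N]
    (G : PowerSeries (E ⊗[R] N)) :
    serA (leg g N) (serA (leg f N) G) = serA (leg (g.comp f) N) G := by
  ext n
  simp only [coeff_serA, leg_leg]

theorem lTensor_leg (f : E →ₐ[R] F) {N N' : Type*} [Ring N] [Algebra R N] [Ring N'] [Algebra R N']
    (φ : N →ₗ[R] N') (u : E ⊗[R] N) :
    LinearMap.lTensor F φ (leg f N u) = leg f N' (LinearMap.lTensor E φ u) := by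
  induction u using TensorProduct.induction_on with
  | zero => simp
  | add a b ha hb => simp only [map_add, ha, hb]
  | tmul e x => rfl

variable (R E) in
/-- `id ⊗ Δ`, an algebra morphism. -/
def comulR (B : Type*) [Ring B] [Bialgebra R B] : E ⊗[R] B →ₐ[R] E ⊗[R] (B ⊗[R] B) :=
  Algebra.TensorProduct.map (AlgHom.id R E) (Bialgebra.comulAlgHom R B)

variable {B : Type*} [Ring B] [Bialgebra R B]

@[simp]
theorem comulR_tmul (e : E) (x : B) :
    comulR R E B (e ⊗ₜ x) = e ⊗ₜ Coalgebra.comul (R := R) x := rfl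

theorem comulR_leg (f : E →ₐ[R] F) (u : E ⊗[R] B) :
    comulR R F B (leg f B u) = leg f (B ⊗[R] B) (comulR R E B u) := by
  induction u using TensorProduct.induction_on with
  | zero => simp
  | add a b ha hb => simp only [map_add, ha, hb]
  | tmul e x => simp

theorem emb12_leg (f : E →ₐ[R] F) (u : E ⊗[R] B) :
    emb12 R F B (leg f B u) = leg f (B ⊗[R] B) (emb12 R E B u) := by
  induction u using TensorProduct.induction_on with
  | zero => simp
  | add a b ha hb => simp only [map_add, ha, hb]
  | tmul e x => simp

theorem emb13_leg (f : E →ₐ[R] F) (u : E ⊗[R] B) :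
    emb13 R F B (leg f B u) = leg f (B ⊗[R] B) (emb13 R E B u) := by
  induction u using TensorProduct.induction_on with
  | zero => simp
  | add a b ha hb => simp only [map_add, ha, hb]
  | tmul e x => simp

theorem counitRight_leg (f : E →ₐ[R] F) (u : E ⊗[R] B) :
    counitRight R F B (leg f B u) = leg f B (counitRight R E B u) := by
  induction u using TensorProduct.induction_on with
  | zero => simp
  | add a b ha hb => simp only [map_add, ha, hb]
  | tmul e x => simp

/-- A series in `E ⊗ B` with `(id ⊗ Δ)(G) = G^{(12)} G^{(13)}`. -/
def IsComultiplicative (G : PowerSeries (E ⊗[R] B)) : Prop :=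
  serA (comulR R E B) G = serA (emb12 R E B) G * serA (emb13 R E B) G

theorem IsComultiplicative.leg {G : PowerSeries (E ⊗[R] B)} (hG : IsComultiplicative G)
    (f : E →ₐ[R] F) : serA (comulR R F B) (serA (leg f B) G) =
      serA (emb12 R F B) (serA (ShuffleHopf.leg f B) G) *
        serA (emb13 R F B) (serA (ShuffleHopf.leg f B) G) := by
  have h1 : serA (comulR R F B) (serA (ShuffleHopf.leg f B) G) =
      serA (ShuffleHopf.leg f _) (serA (comulR R E B) G) := by
    ext n; simp only [coeff_serA, comulR_leg]
  have h2 : serA (emb12 R F B) (serA (ShuffleHopf.leg f B) G) =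
      serA (ShuffleHopf.leg f _) (serA (emb12 R E B) G) := by
    ext n; simp only [coeff_serA, emb12_leg]
  have h3 : serA (emb13 R F B) (serA (ShuffleHopf.leg f B) G) =
      serA (ShuffleHopf.leg f _) (serA (emb13 R E B) G) := by
    ext n; simp only [coeff_serA, emb13_leg]
  rw [h1, h2, h3, hG, map_mul]

/-- The product of the images of a comultiplicative series under two commuting algebra morphisms is
comultiplicative. -/
theorem IsComultiplicative.mul {G : PowerSeries (E ⊗[R] B)} (hG : IsComultiplicative G)
    (f g : E →ₐ[R] F) (hfg : ∀ x y, Commute (f x) (g y)) :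
    IsComultiplicative (serA (ShuffleHopf.leg f B) G * serA (ShuffleHopf.leg g B) G) := by
  have hc : serA (emb13 R F B) (serA (ShuffleHopf.leg f B) G) *
      serA (emb12 R F B) (serA (ShuffleHopf.leg g B) G) =
      serA (emb12 R F B) (serA (ShuffleHopf.leg g B) G) *
      serA (emb13 R F B) (serA (ShuffleHopf.leg f B) G) := by
    have h := commute_serA ((emb13 R F B).comp (ShuffleHopf.leg f B))
      ((emb12 R F B).comp (ShuffleHopf.leg g B)) (fun x y => by
        induction x using TensorProduct.induction_on with
        | zero => simp
        | add a b ha hb => rw [map_add]; exact ha.add_left hb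
        | tmul e x =>
          induction y using TensorProduct.induction_on with
          | zero => simp
          | add a b ha hb => rw [map_add]; exact ha.add_right hb
          | tmul e' y =>
            simp only [AlgHom.comp_apply, leg_tmul, emb12_tmul, emb13_tmul, Commute, SemiconjBy,
              Algebra.TensorProduct.tmul_mul_tmul, (hfg e e').eq, one_mul, mul_one]) G G
    exact h
  -- Only the two inner factors have to change places. They sit in different copies of `B` and have
  -- commuting components in `F`.
  rw [IsComultiplicative, map_mul, hG.leg f, hG.leg g, map_mul, map_mul]
  simp only [mul_assoc]
  rw [← mul_assoc (serA (emb13 R F B) (serA (ShuffleHopf.leg f B) G)), hc]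
  simp only [mul_assoc]

variable {M : Type*} [AddCommGroup M] [Module R M]

/-- An identification, as a coalgebra with unit, of a bialgebra with a tensor algebra. -/
structure CofreeIso (R M B : Type*) [CommRing R] [AddCommGroup M] [Module R M] [Ring B]
    [Bialgebra R B] where
  e : TensorAlgebra R M ≃ₗ[R] B
  comul_e : ∀ x, Coalgebra.comul (R := R) (e x) =
    TensorProduct.map e.toLinearMap e.toLinearMap (comulT x)
  e_one : e 1 = 1
  counit_e : ∀ x, Coalgebra.counit (R := R) (e x) = Coalgebra.counit (R := R) x

variable (θ : CofreeIso R M B)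

theorem comulR_lTensor_e (u : E ⊗[R] TensorAlgebra R M) :
    comulR R E B (LinearMap.lTensor E θ.e.toLinearMap u) =
      LinearMap.lTensor E (TensorProduct.map θ.e.toLinearMap θ.e.toLinearMap)
        (LinearMap.lTensor E comulT u) := by
  induction u using TensorProduct.induction_on with
  | zero => simp
  | add a b ha hb => simp only [map_add, ha, hb]
  | tmul e x => simp [θ.comul_e]

theorem emb_lTensor_e (u v : E ⊗[R] TensorAlgebra R M) :
    emb12 R E B (LinearMap.lTensor E θ.e.toLinearMap u) *
        emb13 R E B (LinearMap.lTensor E θ.e.toLinearMap v) =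
      LinearMap.lTensor E (TensorProduct.map θ.e.toLinearMap θ.e.toLinearMap)
        (emb12 R E _ u * emb13 R E _ v) := by
  induction u using TensorProduct.induction_on with
  | zero => simp
  | add a b ha hb => simp only [map_add, add_mul, ha, hb]
  | tmul e x =>
    induction v using TensorProduct.induction_on with
    | zero => simp
    | add a b ha hb => simp only [map_add, mul_add, ha, hb]
    | tmul e' y => simp [Algebra.TensorProduct.tmul_mul_tmul]

/-- In `G^{(12)} G^{(13)}` the `B` components lie in different copies and meet only units.
Comultiplicativity thus depends on `B` only as a coalgebra with unit, and may be tested with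
concatenation in place of the product of `B`. -/
theorem isComultiplicative_e_iff (G : PowerSeries (E ⊗[R] TensorAlgebra R M)) :
    IsComultiplicative (serL (LinearMap.lTensor E θ.e.toLinearMap) G) ↔
      serL (LinearMap.lTensor E comulT) G =
        serA (emb12 R E (TensorAlgebra R M)) G * serA (emb13 R E (TensorAlgebra R M)) G := by
  have h1 : serA (comulR R E B) (serL (LinearMap.lTensor E θ.e.toLinearMap) G) =
      serL (LinearMap.lTensor E (TensorProduct.map θ.e.toLinearMap θ.e.toLinearMap))
        (serL (LinearMap.lTensor E comulT) G) := by
    ext n; simp only [coeff_serL, coeff_serA, comulR_lTensor_e]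
  have h2 : serA (emb12 R E B) (serL (LinearMap.lTensor E θ.e.toLinearMap) G) *
        serA (emb13 R E B) (serL (LinearMap.lTensor E θ.e.toLinearMap) G) =
      serL (LinearMap.lTensor E (TensorProduct.map θ.e.toLinearMap θ.e.toLinearMap))
        (serA (emb12 R E (TensorAlgebra R M)) G * serA (emb13 R E (TensorAlgebra R M)) G) := by
    ext n
    simp only [coeff_serL, coeff_serA, PowerSeries.coeff_mul, map_sum, emb_lTensor_e]
  rw [IsComultiplicative, h1, h2]
  refine ⟨fun h => ?_, fun h => by rw [h]⟩
  have hs : ∀ G' : PowerSeries (E ⊗[R] (TensorAlgebra R M ⊗[R] TensorAlgebra R M)),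
      serL (LinearMap.lTensor E (TensorProduct.map θ.e.symm.toLinearMap θ.e.symm.toLinearMap))
        (serL (LinearMap.lTensor E (TensorProduct.map θ.e.toLinearMap θ.e.toLinearMap)) G') =
          G' := by
    intro G'
    rw [serL_comp, ← LinearMap.lTensor_comp, ← TensorProduct.map_comp]
    simp [serL_id]
  rw [← hs (serL _ G), h, hs]

end Legs

/-! ### The cocycle condition in the first factor and its solution by a homotopy. -/

section Core

variable {R : Type*} [CommRing R] {A : Type*} [Ring A] [Bialgebra R A]
variable {M : Type*} [AddCommGroup M] [Module R M] {B : Type*} [Ring B] [Bialgebra R B]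

local notation "inL" => (Algebra.TensorProduct.includeLeft : A →ₐ[R] A ⊗[R] A)
local notation "inR" => (Algebra.TensorProduct.includeRight : A →ₐ[R] A ⊗[R] A)

variable (R A) in
/-- The projection on the augmentation ideal. -/
def augProj : A →ₗ[R] A := LinearMap.id - Algebra.linearMap R A ∘ₗ Coalgebra.counit

variable (R A) in
/-- `Δ ⊗ id`. -/
def coprodL : A ⊗[R] A →ₐ[R] (A ⊗[R] A) ⊗[R] A := leg (Bialgebra.comulAlgHom R A) A

variable (R A) in
/-- `id ⊗ Δ`. -/
def coprodR : A ⊗[R] A →ₐ[R] (A ⊗[R] A) ⊗[R] A :=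
  (Algebra.TensorProduct.assoc R R R A A A).symm.toAlgHom.comp (comulR R A A)

variable (R A) in
/-- `a ⊗ b ↦ a ⊗ b ⊗ 1`. -/
def slot12 : A ⊗[R] A →ₐ[R] (A ⊗[R] A) ⊗[R] A := Algebra.TensorProduct.includeLeft

variable (R A) in
/-- `a ⊗ b ↦ 1 ⊗ a ⊗ b`. -/
def slot23 : A ⊗[R] A →ₐ[R] (A ⊗[R] A) ⊗[R] A :=
  (Algebra.TensorProduct.assoc R R R A A A).symm.toAlgHom.comp Algebra.TensorProduct.includeRight

theorem coprodL_comp_inL : (coprodL R A).comp inL =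
    (slot12 R A).comp (Bialgebra.comulAlgHom R A) := by
  ext a; simp [coprodL, slot12]

theorem coprodL_comp_inR : (coprodL R A).comp inR = (slot23 R A).comp inR := by
  ext a
  simp [coprodL, slot23, Algebra.TensorProduct.one_def]

theorem coprodR_comp_inL : (coprodR R A).comp inL = (slot12 R A).comp inL := by
  ext a
  simp [coprodR, slot12, Algebra.TensorProduct.one_def]

theorem coprodR_comp_inR : (coprodR R A).comp inR =
    (slot23 R A).comp (Bialgebra.comulAlgHom R A) := by
  ext a; simp [coprodR, slot23]

theorem slot12_comp_inR : (slot12 R A).comp inR = (slot23 R A).comp inL := by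
  ext a; simp [slot12, slot23]

variable (R A B) in
/-- A contracting homotopy, in low degree, for the coproduct of `A`. -/
structure CoHomotopy where
  h : A ⊗[R] A →ₗ[R] A
  k : (A ⊗[R] A) ⊗[R] A →ₗ[R] A ⊗[R] A
  eq : ((Bialgebra.comulAlgHom R A).toLinearMap ∘ₗ h - (inL).toLinearMap ∘ₗ h -
      (inR).toLinearMap ∘ₗ h - LinearMap.id) ∘ₗ TensorProduct.map (augProj R A) (augProj R A) =
    (k ∘ₗ ((coprodL R A).toLinearMap - (coprodR R A).toLinearMap + (slot12 R A).toLinearMap -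
      (slot23 R A).toLinearMap)) ∘ₗ TensorProduct.map (augProj R A) (augProj R A)

variable (H : CoHomotopy R A)

/-- The cocycle condition makes the right side of the homotopy identity vanish on `σ`; the left side
then says that `σ` is the coboundary of its image under the homotopy. The homotopy identity holds
only on the augmentation ideals, whence the first hypothesis. -/
theorem CoHomotopy.solve {N : Type*} [Ring N] [Algebra R N] (σ : (A ⊗[R] A) ⊗[R] N)
    (hσ : LinearMap.rTensor N (TensorProduct.map (augProj R A) (augProj R A)) σ = σ)
    (hc : leg (coprodL R A) N σ + leg (slot12 R A) N σ =
      leg (coprodR R A) N σ + leg (slot23 R A) N σ) :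
    leg (Bialgebra.comulAlgHom R A) N (LinearMap.rTensor N H.h σ) =
      leg inL N (LinearMap.rTensor N H.h σ) + leg inR N (LinearMap.rTensor N H.h σ) + σ := by
  have h2 : LinearMap.rTensor N ((coprodL R A).toLinearMap - (coprodR R A).toLinearMap +
      (slot12 R A).toLinearMap - (slot23 R A).toLinearMap) σ = 0 := by
    rw [LinearMap.rTensor_sub, LinearMap.rTensor_add, LinearMap.rTensor_sub]
    change leg (coprodL R A) N σ - leg (coprodR R A) N σ + leg (slot12 R A) N σ -
      leg (slot23 R A) N σ = 0
    rw [sub_add_eq_add_sub, hc]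
    abel
  have h1 := congrArg (fun f => LinearMap.rTensor N f σ) H.eq
  simp only [LinearMap.rTensor_comp, LinearMap.comp_apply, hσ] at h1
  rw [h2, map_zero] at h1
  simp only [LinearMap.rTensor_comp, LinearMap.comp_apply, LinearMap.rTensor_sub,
    LinearMap.sub_apply, ← leg_eq_rTensor, LinearMap.rTensor_id, LinearMap.id_apply] at h1
  rw [← sub_eq_zero, ← h1]
  abel

variable (θ : CofreeIso R M B)

/-- The product `G^{(13)} G^{(23)}`. -/
def prod1323 (G : PowerSeries (A ⊗[R] B)) : PowerSeries ((A ⊗[R] A) ⊗[R] B) :=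
  serA (leg inL B) G * serA (leg inR B) G

/-- The right hand side of the recursion for the components of degree one. -/
def sigma (G : PowerSeries (A ⊗[R] TensorAlgebra R M)) (n : ℕ) :
    (A ⊗[R] A) ⊗[R] TensorAlgebra R M :=
  LinearMap.lTensor (A ⊗[R] A) (prT R M ∘ₗ θ.e.symm.toLinearMap)
    (∑ j ∈ Finset.Ioo 0 n,
      leg inL B (LinearMap.lTensor A θ.e.toLinearMap (PowerSeries.coeff j G)) *
      leg inR B (LinearMap.lTensor A θ.e.toLinearMap (PowerSeries.coeff (n - j) G)))

theorem sum_range_eq_Ioo {V : Type*} [AddCommMonoid V] (f : ℕ → V) {n : ℕ} (hn : 1 ≤ n) :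
    ∑ j ∈ Finset.range (n + 1), f j = f n + f 0 + ∑ j ∈ Finset.Ioo 0 n, f j := by
  obtain ⟨n, rfl⟩ := Nat.exists_eq_succ_of_ne_zero (by omega : n ≠ 0)
  rw [Finset.sum_range_succ, Finset.sum_range_succ']
  have : Finset.Ioo 0 (n + 1) = (Finset.range n).map ⟨Nat.succ, Nat.succ_injective⟩ := by
    ext j
    simp only [Finset.mem_Ioo, Finset.mem_map, Finset.mem_range, Function.Embedding.coeFn_mk]
    constructor
    · rintro ⟨h1, h2⟩
      exact ⟨j - 1, by omega, by simp; omega⟩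
    · rintro ⟨i, hi, rfl⟩
      simp; omega
  rw [this, Finset.sum_map]
  simp only [Nat.succ_eq_add_one, Function.Embedding.coeFn_mk]
  abel

theorem coeff_prod1323 {G : PowerSeries (A ⊗[R] B)} (h0 : PowerSeries.coeff 0 G = 1) {n : ℕ}
    (hn : 1 ≤ n) : PowerSeries.coeff n (prod1323 G) =
      leg inL B (PowerSeries.coeff n G) + leg inR B (PowerSeries.coeff n G) +
      ∑ j ∈ Finset.Ioo 0 n,
        leg inL B (PowerSeries.coeff j G) * leg inR B (PowerSeries.coeff (n - j) G) := by
  rw [prod1323, PowerSeries.coeff_mul, Finset.Nat.sum_antidiagonal_eq_sum_range_succ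
    (fun i j => PowerSeries.coeff i (serA (leg inL B) G) *
      PowerSeries.coeff j (serA (leg inR B) G)), Nat.succ_eq_add_one, sum_range_eq_Ioo _ hn]
  simp [h0]

theorem leg_comp_apply {E F F' : Type*} [Ring E] [Algebra R E] [Ring F] [Algebra R F]
    [Ring F'] [Algebra R F'] {g : F →ₐ[R] F'} {f : E →ₐ[R] F} {F₁ : Type*} [Ring F₁]
    [Algebra R F₁] {g₁ : F₁ →ₐ[R] F'} {f₁ : E →ₐ[R] F₁} (h : g.comp f = g₁.comp f₁)
    {N : Type*} [Ring N] [Algebra R N] (u : E ⊗[R] N) :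
    leg g N (leg f N u) = leg g₁ N (leg f₁ N u) := by
  rw [leg_leg, leg_leg, h]

/-- The cocycle identity for the product `G^{(13)} G^{(23)}`, when the coproduct of `G` is known in
lower degree. -/
theorem cocycle_prod1323 {G : PowerSeries (A ⊗[R] B)} (h0 : PowerSeries.coeff 0 G = 1) {n : ℕ}
    (hn : ∀ m < n, PowerSeries.coeff m (serA (leg (Bialgebra.comulAlgHom R A) B) G) =
      PowerSeries.coeff m (prod1323 G)) :
    leg (coprodL R A) B (PowerSeries.coeff n (prod1323 G)) -
        leg (slot12 R A) B (leg (Bialgebra.comulAlgHom R A) B (PowerSeries.coeff n G) -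
          PowerSeries.coeff n (prod1323 G)) =
      leg (coprodR R A) B (PowerSeries.coeff n (prod1323 G)) -
        leg (slot23 R A) B (leg (Bialgebra.comulAlgHom R A) B (PowerSeries.coeff n G) -
          PowerSeries.coeff n (prod1323 G)) := by
  set Δ := Bialgebra.comulAlgHom R A
  set P := prod1323 G with hP
  set δ := serA (leg Δ B) G - P
  -- The defect `δ` of multiplicativity starts in degree `n`, so its product with a series of
  -- constant term `1` has the coefficient of `δ` itself in degree `n`.
  have hδ : ∀ m < n, PowerSeries.coeff m δ = 0 := fun m hm => by
    simp only [δ, map_sub]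
    rw [hn m hm, sub_self]
  have hδn : leg Δ B (PowerSeries.coeff n G) - PowerSeries.coeff n P = PowerSeries.coeff n δ := by
    simp [δ]
  have hG : serA (leg Δ B) G = P + δ := by simp [δ]
  set g1 := serA (leg (slot12 R A) B) (serA (leg inL B) G)
  set g3 := serA (leg (slot23 R A) B) (serA (leg inR B) G)
  have hL : serA (leg (coprodL R A) B) P =
      serA (leg (slot12 R A) B) P * g3 + serA (leg (slot12 R A) B) δ * g3 := by
    rw [← add_mul, ← map_add, ← hG, hP, prod1323, map_mul]
    simp only [g3, serA_leg_leg, coprodL_comp_inL, coprodL_comp_inR, Δ]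
  have hR : serA (leg (coprodR R A) B) P =
      g1 * serA (leg (slot23 R A) B) P + g1 * serA (leg (slot23 R A) B) δ := by
    rw [← mul_add, ← map_add, ← hG, hP, prod1323, map_mul]
    simp only [g1, serA_leg_leg, coprodR_comp_inL, coprodR_comp_inR, Δ]
  -- Both sides are the triple product `G^{(14)} G^{(24)} G^{(34)}`.
  have hX : serA (leg (slot12 R A) B) P * g3 = g1 * serA (leg (slot23 R A) B) P := by
    rw [hP, prod1323, map_mul, map_mul]
    simp only [g1, g3, serA_leg_leg, slot12_comp_inR, mul_assoc]
  have hδ' : ∀ (f : A ⊗[R] A →ₐ[R] (A ⊗[R] A) ⊗[R] A), ∀ m < n,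
      PowerSeries.coeff m (serA (leg f B) δ) = 0 := fun f m hm => by
    rw [coeff_serA, hδ m hm, map_zero]
  have hL' := congrArg (PowerSeries.coeff n) hL
  have hR' := congrArg (PowerSeries.coeff n) hR
  rw [map_add, coeff_mul_of_vanish_left (hδ' _)] at hL'
  rw [map_add, coeff_mul_of_vanish_right (hδ' _)] at hR'
  have h1 : PowerSeries.coeff 0 g1 = 1 := by simp only [g1, coeff_serA, h0, map_one]
  have h3 : PowerSeries.coeff 0 g3 = 1 := by simp only [g3, coeff_serA, h0, map_one]
  rw [h3, mul_one, coeff_serA, coeff_serA] at hL'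
  rw [h1, one_mul, coeff_serA, coeff_serA] at hR'
  rw [hδn, hL', hR', hX]
  abel

variable (R A) in
/-- `ηε ⊗ id`, an algebra morphism. -/
def counitLeft (N : Type*) [Ring N] [Algebra R N] : A ⊗[R] N →ₐ[R] A ⊗[R] N :=
  leg ((Algebra.ofId R A).comp (Bialgebra.counitAlgHom R A)) N

/-- The product of two elements of the augmentation ideal. -/
theorem augProj_inL_mul_inR {N : Type*} [Ring N] [Algebra R N] (u v : A ⊗[R] N)
    (hu : counitLeft R A N u = 0) (hv : counitLeft R A N v = 0) :
    LinearMap.rTensor N (TensorProduct.map (augProj R A) (augProj R A))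
      (leg inL N u * leg inR N v) = leg inL N u * leg inR N v := by
  -- The embeddings put the `A` components in separate slots, so projecting the product to the
  -- augmentation ideals projects each factor.
  have key : ∀ u v : A ⊗[R] N,
      LinearMap.rTensor N (TensorProduct.map (augProj R A) (augProj R A))
        (leg inL N u * leg inR N v) =
      leg inL N (u - counitLeft R A N u) * leg inR N (v - counitLeft R A N v) := by
    intro u v
    induction u using TensorProduct.induction_on with
    | zero => simp
    | add a b ha hb =>
      rw [map_add, add_mul, map_add, ha, hb, ← add_mul, ← map_add, map_add (counitLeft R A N)]
      congr 2
      abel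
    | tmul a x =>
      induction v using TensorProduct.induction_on with
      | zero => simp
      | add b c hb hc =>
        rw [map_add, mul_add, map_add, hb, hc, ← mul_add, ← map_add, map_add (counitLeft R A N)]
        congr 2
        abel
      | tmul b y =>
        simp [counitLeft, augProj, Algebra.TensorProduct.tmul_mul_tmul, ← sub_tmul,
          Algebra.ofId_apply]
  rw [key, hu, hv, sub_zero, sub_zero]

end Core

end ShuffleHopf

end

noncomputable section

namespace ShuffleHopf

open TensorProduct TensorAlgebra

/-! ### Induction on the degree for the coproduct of the first factor. -/

section CoreInduction

variable {R : Type*} [CommRing R] {A : Type*} [Ring A] [Bialgebra R A]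
variable {M : Type*} [AddCommGroup M] [Module R M] {B : Type*} [Ring B] [Bialgebra R B]

local notation "inL" => (Algebra.TensorProduct.includeLeft : A →ₐ[R] A ⊗[R] A)
local notation "inR" => (Algebra.TensorProduct.includeRight : A →ₐ[R] A ⊗[R] A)

theorem lTensor_symm_comp_e {E : Type*} [Ring E] [Algebra R E] (θ : CofreeIso R M B)
    {N : Type*} [AddCommGroup N] [Module R N] (φ : TensorAlgebra R M →ₗ[R] N)
    (u : E ⊗[R] TensorAlgebra R M) :
    LinearMap.lTensor E (φ ∘ₗ θ.e.symm.toLinearMap) (LinearMap.lTensor E θ.e.toLinearMap u) =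
      LinearMap.lTensor E φ u := by
  rw [← LinearMap.comp_apply, ← LinearMap.lTensor_comp, LinearMap.comp_assoc]
  simp

theorem lTensor_e_comp_symm {E : Type*} [Ring E] [Algebra R E] (θ : CofreeIso R M B)
    (u : E ⊗[R] B) :
    LinearMap.lTensor E θ.e.toLinearMap (LinearMap.lTensor E θ.e.symm.toLinearMap u) = u := by
  rw [← LinearMap.comp_apply, ← LinearMap.lTensor_comp]
  simp

theorem counitRight_lTensor_e {E : Type*} [Ring E] [Algebra R E] (θ : CofreeIso R M B)
    (u : E ⊗[R] TensorAlgebra R M) :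
    counitRight R E B (LinearMap.lTensor E θ.e.toLinearMap u) =
      LinearMap.lTensor E θ.e.toLinearMap (counitRightT R E M u) := by
  induction u using TensorProduct.induction_on with
  | zero => simp
  | add a b ha hb => simp only [map_add, ha, hb]
  | tmul e x =>
    simp [counitRightT, θ.counit_e, Algebra.algebraMap_eq_smul_one, θ.e_one]

theorem serA_counitRight_eq_one {θ : CofreeIso R M B} {ρ G : PowerSeries (A ⊗[R] TensorAlgebra R M)}
    (hpr : serL (LinearMap.lTensor A (prT R M)) ρ = ρ) (hG : G = 1 + ρ * G) :
    serA (counitRight R A B) (serL (LinearMap.lTensor A θ.e.toLinearMap) G) = 1 := by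
  have h : serA (counitRight R A B) (serL (LinearMap.lTensor A θ.e.toLinearMap) G) =
      serL (LinearMap.lTensor A θ.e.toLinearMap) (serL (counitRightT R A M) G) := by
    ext n; simp only [coeff_serL, coeff_serA, counitRight_lTensor_e]
  rw [h, counitRightT_geometric hpr hG,
    serL_one _ (by simp [Algebra.TensorProduct.one_def, θ.e_one])]

/-- The ratio of a geometric series is its component of degree one. -/
theorem serL_prT_geometric {ρ G : PowerSeries (A ⊗[R] TensorAlgebra R M)}
    (h0 : PowerSeries.coeff 0 ρ = 0) (hpr : serL (LinearMap.lTensor A (prT R M)) ρ = ρ)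
    (hG : G = 1 + ρ * G) : serL (LinearMap.lTensor A (prT R M)) G = ρ := by
  have h := geometric_of_comul (geometric_comul h0 hpr hG) (counitRightT_geometric hpr hG)
  have h1 : (serL (LinearMap.lTensor A (prT R M)) G - ρ) * G = 0 := by
    rw [sub_mul, sub_eq_zero]
    exact add_left_cancel (h.symm.trans hG)
  have h2 := congrArg (· * (1 - ρ)) h1
  simp only [mul_assoc, series_mul_one_sub h0 hG, mul_one, zero_mul] at h2
  exact sub_eq_zero.mp h2

theorem coeff_zero_geometric {S : Type*} [Ring S] {ρ G : PowerSeries S}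
    (h0 : PowerSeries.coeff 0 ρ = 0) (hG : G = 1 + ρ * G) : PowerSeries.coeff 0 G = 1 := by
  rw [hG, map_add, PowerSeries.coeff_mul]
  simp [h0]

theorem counitLeft_lTensor {N N' : Type*} [Ring N] [Algebra R N] [Ring N'] [Algebra R N']
    (φ : N →ₗ[R] N') (u : A ⊗[R] N) :
    counitLeft R A N' (LinearMap.lTensor A φ u) = LinearMap.lTensor A φ (counitLeft R A N u) :=
  (lTensor_leg _ φ u).symm

theorem counitLeft_geometric {N : Type*} [Ring N] [Algebra R N] {ρ G : PowerSeries (A ⊗[R] N)}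
    (hε : ∀ n, counitLeft R A N (PowerSeries.coeff n ρ) = 0) (hG : G = 1 + ρ * G) :
    serA (counitLeft R A N) G = 1 := by
  have h : serA (counitLeft R A N) ρ = 0 := by
    ext n; simp [hε]
  rw [hG, map_add, map_mul, h, zero_mul, add_zero, map_one]

variable (H : CoHomotopy R A) (θ : CofreeIso R M B)

/-- If the components of degree one in `M` satisfy the recursion given by the homotopy, then the
geometric series is multiplicative for the coproduct of `A`. -/
theorem comul_geometric {ρ G : PowerSeries (A ⊗[R] TensorAlgebra R M)}
    (h0 : PowerSeries.coeff 0 ρ = 0) (hpr : serL (LinearMap.lTensor A (prT R M)) ρ = ρ)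
    (hG : G = 1 + ρ * G)
    (hε : ∀ n, counitLeft R A (TensorAlgebra R M) (PowerSeries.coeff n ρ) = 0)
    (h1 : leg (Bialgebra.comulAlgHom R A) (TensorAlgebra R M) (PowerSeries.coeff 1 ρ) =
      leg inL (TensorAlgebra R M) (PowerSeries.coeff 1 ρ) +
        leg inR (TensorAlgebra R M) (PowerSeries.coeff 1 ρ))
    (hrec : ∀ n, 2 ≤ n → PowerSeries.coeff n ρ = LinearMap.rTensor _ H.h (sigma θ G n)) :
    serA (leg (Bialgebra.comulAlgHom R A) B) (serL (LinearMap.lTensor A θ.e.toLinearMap) G) =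
      prod1323 (serL (LinearMap.lTensor A θ.e.toLinearMap) G) := by
  set Δ := Bialgebra.comulAlgHom R A with hΔ
  set GB := serL (LinearMap.lTensor A θ.e.toLinearMap) G with hGB
  have hG0 : PowerSeries.coeff 0 G = 1 := coeff_zero_geometric h0 hG
  have hGB0 : PowerSeries.coeff 0 GB = 1 := by
    rw [hGB, coeff_serL, hG0]
    simp [Algebra.TensorProduct.one_def, θ.e_one]
  have hcom : IsComultiplicative GB :=
    (isComultiplicative_e_iff θ G).2 (geometric_comul h0 hpr hG)
  have hcom2 : IsComultiplicative (prod1323 GB) := hcom.mul inL inR fun x y => by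
    simp [Commute, SemiconjBy, Algebra.TensorProduct.tmul_mul_tmul]
  -- The product `G^{(13)} G^{(23)}` is formed with the product of `B`, then viewed again with
  -- values in the tensor algebra, where geometric series refer to concatenation.
  set G2 := serL (LinearMap.lTensor (A ⊗[R] A) θ.e.symm.toLinearMap) (prod1323 GB) with hG2
  have hG2e : serL (LinearMap.lTensor (A ⊗[R] A) θ.e.toLinearMap) G2 = prod1323 GB := by
    ext n; simp only [hG2, coeff_serL, lTensor_e_comp_symm]
  have hcoun : serA (counitRight R (A ⊗[R] A) B) (prod1323 GB) = 1 := by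
    have hc : ∀ f : A →ₐ[R] A ⊗[R] A, serA (counitRight R (A ⊗[R] A) B) (serA (leg f B) GB) = 1 := by
      intro f
      have : serA (counitRight R (A ⊗[R] A) B) (serA (leg f B) GB) =
          serA (leg f B) (serA (counitRight R A B) GB) := by
        ext n; simp only [coeff_serA, counitRight_leg]
      rw [this, serA_counitRight_eq_one hpr hG, map_one]
    rw [prod1323, map_mul, hc, hc, one_mul]
  -- Being comultiplicative, the product is the geometric series of its degree one part. The same
  -- holds for `(Δ ⊗ id)(G)` with ratio `(Δ ⊗ id)(ρ)`, so the theorem reduces to an equality of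
  -- ratios.
  have hrec2 : G2 = 1 + serL (LinearMap.lTensor (A ⊗[R] A) (prT R M)) G2 * G2 := by
    refine geometric_of_comul ((isComultiplicative_e_iff θ G2).1 (by rwa [hG2e])) ?_
    have h : serL (LinearMap.lTensor (A ⊗[R] A) θ.e.toLinearMap)
        (serL (counitRightT R (A ⊗[R] A) M) G2) = 1 := by
      rw [← hcoun, ← hG2e]
      ext n; simp only [coeff_serL, coeff_serA, counitRight_lTensor_e]
    have h' := congrArg (serL (LinearMap.lTensor (A ⊗[R] A)
      ((LinearMap.id : TensorAlgebra R M →ₗ[R] _) ∘ₗ θ.e.symm.toLinearMap))) h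
    rw [serL_one _ (by simp [Algebra.TensorProduct.one_def, (LinearEquiv.symm_apply_eq θ.e).2 θ.e_one.symm])] at h'
    rw [← h']
    ext n; simp only [coeff_serL, lTensor_symm_comp_e, LinearMap.lTensor_id, LinearMap.id_apply]
  set ρ2 := serL (LinearMap.lTensor (A ⊗[R] A) (prT R M)) G2 with hρ2
  set π := LinearMap.lTensor (A ⊗[R] A) (prT R M ∘ₗ θ.e.symm.toLinearMap) with hπ
  have hρ2n : ∀ n, PowerSeries.coeff n ρ2 = π (PowerSeries.coeff n (prod1323 GB)) := fun n => by
    rw [hρ2, hG2, coeff_serL, coeff_serL, hπ, LinearMap.lTensor_comp, LinearMap.comp_apply]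
  have hprG := serL_prT_geometric h0 hpr hG
  have hleg : ∀ (f : A →ₐ[R] A ⊗[R] A) n, π (leg f B (PowerSeries.coeff n GB)) =
      leg f _ (PowerSeries.coeff n ρ) := fun f n => by
    rw [hπ, lTensor_leg, hGB, coeff_serL, lTensor_symm_comp_e, ← hprG, coeff_serL]
  set G1 := serA (leg Δ (TensorAlgebra R M)) G with hG1
  set ρ1 := serA (leg Δ (TensorAlgebra R M)) ρ with hρ1
  have hrec1 : G1 = 1 + ρ1 * G1 := by
    rw [hG1]
    nth_rewrite 1 [hG]
    rw [map_add, map_mul, map_one]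
  have hρ10 : PowerSeries.coeff 0 ρ1 = 0 := by rw [hρ1, coeff_serA, h0, map_zero]
  have hρ20 : PowerSeries.coeff 0 ρ2 = 0 := by
    have h : PowerSeries.coeff 0 (prod1323 GB) = 1 := by
      rw [prod1323, PowerSeries.coeff_mul, Finset.HasAntidiagonal.antidiagonal_zero, Finset.sum_singleton,
        coeff_serA, coeff_serA, hGB0, map_one, map_one, one_mul]
    rw [hρ2n, h]
    simp [hπ, Algebra.TensorProduct.one_def, (LinearEquiv.symm_apply_eq θ.e).2 θ.e_one.symm]
  have hsum : ∀ n, 1 ≤ n → PowerSeries.coeff n ρ2 = leg inL _ (PowerSeries.coeff n ρ) +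
      leg inR _ (PowerSeries.coeff n ρ) + sigma θ G n := fun n hn => by
    rw [hρ2n, coeff_prod1323 hGB0 hn, map_add, map_add, hleg, hleg]
    simp only [sigma, hGB, coeff_serL, hπ]
  have hG1B : ∀ m, PowerSeries.coeff m (serA (leg Δ B) GB) =
      LinearMap.lTensor _ θ.e.toLinearMap (PowerSeries.coeff m G1) := fun m => by
    rw [hG1, coeff_serA, coeff_serA, hGB, coeff_serL, lTensor_leg]
  have hG2B : ∀ m, PowerSeries.coeff m (prod1323 GB) =
      LinearMap.lTensor _ θ.e.toLinearMap (PowerSeries.coeff m G2) := fun m => by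
    rw [← hG2e, coeff_serL]
  have key : ∀ n, PowerSeries.coeff n ρ1 = PowerSeries.coeff n ρ2 := by
    intro n
    induction n using Nat.strong_induction_on with
    | _ n ih =>
      rcases Nat.lt_or_ge n 2 with hn | hn
      · interval_cases n
        · rw [hρ10, hρ20]
        · rw [hsum 1 le_rfl, hρ1, coeff_serA, h1]
          have hI : Finset.Ioo 0 1 = ∅ := rfl
          rw [sigma, hI, Finset.sum_empty, map_zero, add_zero]
      have hlow := coeff_eq_of_recursion hρ10 hρ20 hrec1 hrec2 ih
      -- Equality of the ratios below `n` gives the coproduct formula below `n`, as the cocycle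
      -- identity requires.
      have hcoc := cocycle_prod1323 (n := n) hGB0 fun m hm => by
        rw [← hΔ, hG1B, hG2B, hlow m hm]
      have hcoc' := congrArg (LinearMap.lTensor ((A ⊗[R] A) ⊗[R] A)
        (prT R M ∘ₗ θ.e.symm.toLinearMap)) hcoc
      have hGBρ : LinearMap.lTensor A (prT R M ∘ₗ θ.e.symm.toLinearMap) (PowerSeries.coeff n GB) =
          PowerSeries.coeff n ρ := by
        rw [hGB, coeff_serL, lTensor_symm_comp_e, ← hprG, coeff_serL]
      simp only [map_sub, lTensor_leg, hGBρ] at hcoc'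
      rw [← hπ, ← hρ2n, hsum n (by omega)] at hcoc'
      simp only [map_add] at hcoc'
      have e1 := leg_comp_apply (N := TensorAlgebra R M) (coprodL_comp_inL (R := R) (A := A)) (PowerSeries.coeff n ρ)
      have e2 := leg_comp_apply (N := TensorAlgebra R M) (coprodL_comp_inR (R := R) (A := A)) (PowerSeries.coeff n ρ)
      have e3 := leg_comp_apply (N := TensorAlgebra R M) (coprodR_comp_inL (R := R) (A := A)) (PowerSeries.coeff n ρ)
      have e4 := leg_comp_apply (N := TensorAlgebra R M) (coprodR_comp_inR (R := R) (A := A)) (PowerSeries.coeff n ρ)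
      have e5 := leg_comp_apply (N := TensorAlgebra R M) (slot12_comp_inR (R := R) (A := A)) (PowerSeries.coeff n ρ)
      -- By coassociativity and the placement of units, all terms in `ρ_n` cancel; the identity that
      -- remains concerns `σ_n` alone.
      rw [e1, e2, e3, e4, e5] at hcoc'
      have hc : leg (coprodL R A) _ (sigma θ G n) + leg (slot12 R A) _ (sigma θ G n) =
          leg (coprodR R A) _ (sigma θ G n) + leg (slot23 R A) _ (sigma θ G n) := by
        rw [← sub_eq_zero] at hcoc' ⊢
        rw [← hcoc']
        abel
      have hσ : LinearMap.rTensor _ (TensorProduct.map (augProj R A) (augProj R A))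
          (sigma θ G n) = sigma θ G n := by
        rw [sigma, ← LinearMap.comp_apply, LinearMap.rTensor_comp_lTensor,
          ← LinearMap.lTensor_comp_rTensor, LinearMap.comp_apply, map_sum]
        congr 1
        refine Finset.sum_congr rfl fun j hj => ?_
        rw [Finset.mem_Ioo] at hj
        -- Only the indices `0 < j < n` occur in `σ_n`; the coefficients of `G` in positive degree
        -- are killed by the counit of `A`, so `σ_n` is reduced.
        have hz : ∀ m, 1 ≤ m → counitLeft R A B
            (LinearMap.lTensor A θ.e.toLinearMap (PowerSeries.coeff m G)) = 0 := by
          intro m hm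
          rw [counitLeft_lTensor, ← coeff_serA, counitLeft_geometric hε hG,
            PowerSeries.coeff_one, if_neg (by omega), map_zero]
        exact augProj_inL_mul_inR _ _ (hz _ (by omega)) (hz _ (by omega))
      have hsol := H.solve (sigma θ G n) hσ hc
      rw [← hrec n hn] at hsol
      rw [hsum n (by omega), hρ1, coeff_serA]
      exact hsol
  have h12 : G1 = G2 := by
    ext n
    exact coeff_eq_of_recursion hρ10 hρ20 hrec1 hrec2 (n := n + 1) (fun m _ => key m) n (by omega)
  ext n
  rw [hG1B, hG2B, h12]

end CoreInduction

end ShuffleHopf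

end

noncomputable section

namespace ShuffleHopf

open TensorProduct TensorAlgebra WithConv WordGraded

/-! ### The contracting homotopy -/

section Homotopy

variable {R M : Type*} [CommRing R] [AddCommGroup M] [Module R M]

/-- Multiplication of the words of length `n` by `c n`. -/
def weight {C : Type*} [AddCommGroup C] [Module R C] [Coalgebra R C] [WordGraded R C]
    (c : ℕ → R) : C →ₗ[R] C :=
  Finsupp.lsum R (fun n => c n • LinearMap.id) ∘ₗ component

theorem weight_words {C : Type*} [AddCommGroup C] [Module R C] [Coalgebra R C] [WordGraded R C]
    (c : ℕ → R) {n : ℕ} {x : C} (hx : x ∈ words R n) : weight c x = c n • x := by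
  simp [weight, component_words n x hx]

theorem word_mem_words (l : List M) : word R l ∈ words R l.length := ⟨l, rfl, rfl⟩

theorem tmul_mem_words {C C' : Type*} [AddCommGroup C] [Module R C] [Coalgebra R C]
    [WordGraded R C] [AddCommGroup C'] [Module R C'] [Coalgebra R C'] [WordGraded R C']
    {i j : ℕ} {a : C} {b : C'} (ha : a ∈ words R i) (hb : b ∈ words R j) :
    a ⊗ₜ[R] b ∈ words R (i + j) := ⟨i, j, a, b, rfl, ha, hb, rfl⟩

theorem weight_comulT (c : ℕ → R) (u : TensorAlgebra R M) :
    weight c (comulT u) = comulT (weight c u) := by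
  have h : weight c ∘ₗ comulT = comulT ∘ₗ weight (C := TensorAlgebra R M) c :=
    linearMap_ext_word fun l => by
      simp only [LinearMap.comp_apply]
      rw [weight_words c (word_mem_words l), map_smul, comulT_word, map_sum, Finset.smul_sum]
      refine Finset.sum_congr rfl fun i hi => ?_
      rw [weight_words c (tmul_mem_words (word_mem_words _) (word_mem_words _))]
      congr 2
      have := Finset.mem_range.mp hi
      simp only [List.length_take, List.length_drop]
      omega
  exact LinearMap.congr_fun h u

theorem counit_weight {c : ℕ → R} (h0 : c 0 = 0) (u : TensorAlgebra R M) :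
    Coalgebra.counit (R := R) (weight c u) = 0 := by
  have h : Coalgebra.counit (R := R) ∘ₗ weight (C := TensorAlgebra R M) c = 0 :=
    linearMap_ext_word fun l => by
      simp only [LinearMap.comp_apply]
      rw [weight_words c (word_mem_words l), map_smul, counit_word]
      split_ifs with h
      · simp [h, h0]
      · simp
  exact LinearMap.congr_fun h u

/-- Each of the `l.length + 1` cuts is glued back to the same word. -/
theorem mul_comulT_word (l : List M) : LinearMap.mul' R (TensorAlgebra R M)
    (comulT (word R l)) = ((l.length : R) + 1) • word R l := by
  rw [comulT_word, map_sum]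
  have : ∀ i ∈ Finset.range (l.length + 1), LinearMap.mul' R (TensorAlgebra R M)
      (word R (l.take i) ⊗ₜ[R] word R (l.drop i)) = word R l := fun i _ => by
    rw [LinearMap.mul'_apply, ← word_append, List.take_append_drop]
  rw [Finset.sum_congr rfl this, Finset.sum_const, Finset.card_range, ← Nat.cast_smul_eq_nsmul R]
  simp

variable (R M) in
/-- `a ⊗ b ⊗ c ↦ a ⊗ bc - ab ⊗ c`. -/
def barBoundary : (TensorAlgebra R M ⊗[R] TensorAlgebra R M) ⊗[R] TensorAlgebra R M →ₗ[R]
    TensorAlgebra R M ⊗[R] TensorAlgebra R M :=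
  LinearMap.lTensor _ (LinearMap.mul' R _) ∘ₗ (TensorProduct.assoc R _ _ _).toLinearMap -
    LinearMap.rTensor _ (LinearMap.mul' R _)

@[simp]
theorem barBoundary_tmul (a b c : TensorAlgebra R M) :
    barBoundary R M ((a ⊗ₜ b) ⊗ₜ c) = a ⊗ₜ (b * c) - (a * b) ⊗ₜ c := by
  simp [barBoundary]

/-- The source of the factor `1 / (k - 1)`. Gluing back the cuts of the two words contributes `-(|l|
+ 1)` and `-(|l'| + 1)` times `l ⊗ l'`; the two terms with a unit contribute `+2`, and the doubly
counted middle cut `+1`. The total is `-(|l| + |l'| - 1)`, and the other terms make up the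
coboundary of the concatenation. -/
theorem barBoundary_comul_word (l l' : List M) :
    barBoundary R M (comulT (word R l) ⊗ₜ word R l' -
      (TensorProduct.assoc R _ _ _).symm (word R l ⊗ₜ comulT (word R l')) +
      (word R l ⊗ₜ word R l') ⊗ₜ 1 - (1 ⊗ₜ word R l) ⊗ₜ word R l') =
    comulT (word R l * word R l') - (word R l * word R l') ⊗ₜ 1 - 1 ⊗ₜ (word R l * word R l') -
      (((l.length + l'.length : ℕ) : R) - 1) • (word R l ⊗ₜ word R l') := by
  have h1 : barBoundary R M (comulT (word R l) ⊗ₜ word R l') =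
      comulT (word R l) * (1 ⊗ₜ word R l') - ((l.length : R) + 1) • (word R l ⊗ₜ word R l') := by
    rw [smul_tmul', ← mul_comulT_word]
    generalize comulT (word R l) = u
    induction u using TensorProduct.induction_on with
    | zero => simp
    | add a b ha hb => simp only [map_add, add_mul, add_tmul, ha, hb]; abel
    | tmul a b => simp [Algebra.TensorProduct.tmul_mul_tmul]
  have h2 : barBoundary R M ((TensorProduct.assoc R _ _ _).symm
        (word R l ⊗ₜ comulT (word R l'))) =
      ((l'.length : R) + 1) • (word R l ⊗ₜ word R l') - (word R l ⊗ₜ 1) * comulT (word R l') := by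
    rw [← tmul_smul, ← mul_comulT_word]
    generalize comulT (word R l') = u
    induction u using TensorProduct.induction_on with
    | zero => simp
    | add a b ha hb => simp only [map_add, mul_add, tmul_add, ha, hb]; abel
    | tmul a b => simp [Algebra.TensorProduct.tmul_mul_tmul]
  rw [map_sub, map_add, map_sub, h1, h2, comulT_mul]
  simp only [barBoundary_tmul, mul_one, one_mul]
  push_cast
  module

variable (D : ProductDatum R M) (c : ℕ → R)

/-- The concatenation of the factors, multiplied by `c n` in degree `n`. -/
def homotopyMap : Sh D ⊗[R] Sh D →ₗ[R] Sh D :=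
  Sh.ofT.toLinearMap ∘ₗ weight c ∘ₗ LinearMap.mul' R _ ∘ₗ
    TensorProduct.map Sh.ofT.symm.toLinearMap Sh.ofT.symm.toLinearMap

@[simp]
theorem homotopyMap_tmul (u v : TensorAlgebra R M) :
    homotopyMap D c (Sh.ofT u ⊗ₜ Sh.ofT v) = Sh.ofT (weight c (u * v)) := by
  simp [homotopyMap]

variable {c}

/-- The identity of `barBoundary_comul_word` divided by `n - 1`, where `n` is the total length,
common to all its terms. For nonempty words `n` is at least `2`. -/
theorem homotopy_word (hc : ∀ n, 2 ≤ n → c n * ((n : R) - 1) = 1) (l l' : List M)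
    (hl : l ≠ []) (hl' : l' ≠ []) :
    comulT (weight c (word R l * word R l')) - weight c (word R l * word R l') ⊗ₜ[R] 1 -
        1 ⊗ₜ[R] weight c (word R l * word R l') - word R l ⊗ₜ word R l' =
      weight c (barBoundary R M (comulT (word R l) ⊗ₜ word R l' -
        (TensorProduct.assoc R _ _ _).symm (word R l ⊗ₜ comulT (word R l')) +
        (word R l ⊗ₜ word R l') ⊗ₜ 1 - (1 ⊗ₜ word R l) ⊗ₜ word R l')) := by
  have hn : 2 ≤ l.length + l'.length := by
    have := List.length_pos_iff.mpr hl
    have := List.length_pos_iff.mpr hl'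
    omega
  have hw := word_mem_words (R := R) (l ++ l')
  rw [List.length_append] at hw
  have h1 : (1 : TensorAlgebra R M) ∈ words R 0 := ⟨[], rfl, rfl⟩
  have ha := weight_words c (tmul_mem_words hw h1)
  have hb := weight_words c (tmul_mem_words h1 hw)
  have hd := weight_words c (tmul_mem_words (word_mem_words (R := R) l) (word_mem_words (R := R) l'))
  rw [barBoundary_comul_word, map_sub, map_sub, map_sub, map_smul, weight_comulT, ← word_append,
    ha, hb, hd, weight_words c hw, zero_add, add_zero, smul_smul, mul_comm, hc _ hn, one_smul,
    smul_tmul', tmul_smul]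

theorem augProj_ofT_one : augProj R (Sh D) (Sh.ofT 1) = 0 := by
  rw [Sh.ofT_one]
  simp [augProj]

theorem augProj_ofT_word {l : List M} (hl : l ≠ []) :
    augProj R (Sh D) (Sh.ofT (word R l)) = Sh.ofT (word R l) := by
  simp [augProj, Sh.counit_ofT, counit_word, hl]

theorem linearMap_ext_ofT {N : Type*} [AddCommGroup N] [Module R N] {D D' : ProductDatum R M}
    {f g : Sh D ⊗[R] Sh D' →ₗ[R] N}
    (h : ∀ l l', f (Sh.ofT (word R l) ⊗ₜ Sh.ofT (word R l')) =
      g (Sh.ofT (word R l) ⊗ₜ Sh.ofT (word R l'))) : f = g := by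
  refine TensorProduct.ext ?_
  have h' : ((TensorProduct.mk R _ _).compr₂ f).compl₁₂ Sh.ofT.toLinearMap Sh.ofT.toLinearMap =
      ((TensorProduct.mk R _ _).compr₂ g).compl₁₂ Sh.ofT.toLinearMap Sh.ofT.toLinearMap :=
    linearMap_ext_word fun l => linearMap_ext_word fun l' => h l l'
  exact h'

variable (c) in
/-- The contracting homotopy of `Sh D`. -/
def shHomotopy (hc : ∀ n, 2 ≤ n → c n * ((n : R) - 1) = 1) :
    CoHomotopy R (Sh D) where
  h := homotopyMap D c
  k := TensorProduct.map Sh.ofT.toLinearMap Sh.ofT.toLinearMap ∘ₗ weight c ∘ₗ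
    barBoundary R M ∘ₗ TensorProduct.map
      (TensorProduct.map Sh.ofT.symm.toLinearMap Sh.ofT.symm.toLinearMap) Sh.ofT.symm.toLinearMap
  -- The maps involved use the coproduct of `Sh D` and products with units only, so the identity on
  -- words carries over whatever the product of `D` is.
  eq := by
    refine linearMap_ext_ofT fun l l' => ?_
    simp only [LinearMap.comp_apply (TensorProduct.map (augProj R (Sh D)) _), TensorProduct.map_tmul,
      LinearMap.comp_apply _ (TensorProduct.map (augProj R (Sh D)) (augProj R (Sh D)))]
    -- Empty words are killed by the projection to the augmentation ideal; only the nonempty words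
    -- of `homotopy_word` remain.
    rcases eq_or_ne l [] with rfl | hl
    · rw [word_nil, augProj_ofT_one, zero_tmul, map_zero, map_zero]
    rcases eq_or_ne l' [] with rfl | hl'
    · rw [word_nil, augProj_ofT_one, tmul_zero, map_zero, map_zero]
    rw [augProj_ofT_word D hl, augProj_ofT_word D hl']
    have h := congrArg (TensorProduct.map (Sh.ofT (D := D)).toLinearMap
      (Sh.ofT (D := D)).toLinearMap) (homotopy_word hc l l' hl hl')
    have e1 : coprodL R (Sh D) (Sh.ofT (word R l) ⊗ₜ Sh.ofT (word R l')) =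
        TensorProduct.map (TensorProduct.map Sh.ofT.toLinearMap Sh.ofT.toLinearMap)
          Sh.ofT.toLinearMap (comulT (word R l) ⊗ₜ word R l') := by
      rw [TensorProduct.map_tmul, ← Sh.comul_ofT]
      rfl
    have e2 : coprodR R (Sh D) (Sh.ofT (word R l) ⊗ₜ Sh.ofT (word R l')) =
        TensorProduct.map (TensorProduct.map Sh.ofT.toLinearMap Sh.ofT.toLinearMap)
          Sh.ofT.toLinearMap ((TensorProduct.assoc R _ _ _).symm (word R l ⊗ₜ comulT (word R l'))) := by
      have e3 : coprodR R (Sh D) (Sh.ofT (word R l) ⊗ₜ Sh.ofT (word R l')) =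
          (TensorProduct.assoc R _ _ _).symm (Sh.ofT (word R l) ⊗ₜ
            Coalgebra.comul (R := R) (Sh.ofT (word R l') : Sh D)) := rfl
      rw [e3, Sh.comul_ofT]
      generalize comulT (word R l') = u
      induction u using TensorProduct.induction_on with
      | zero => simp
      | add a b ha hb => simp only [map_add, tmul_add, ha, hb]
      | tmul a b => simp
    have e4 : ((coprodL R (Sh D)).toLinearMap - (coprodR R (Sh D)).toLinearMap +
        (slot12 R (Sh D)).toLinearMap - (slot23 R (Sh D)).toLinearMap)
          (Sh.ofT (word R l) ⊗ₜ Sh.ofT (word R l')) =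
        TensorProduct.map (TensorProduct.map Sh.ofT.toLinearMap Sh.ofT.toLinearMap)
          Sh.ofT.toLinearMap (comulT (word R l) ⊗ₜ word R l' -
        (TensorProduct.assoc R _ _ _).symm (word R l ⊗ₜ comulT (word R l')) +
        (word R l ⊗ₜ word R l') ⊗ₜ 1 - (1 ⊗ₜ word R l) ⊗ₜ word R l') := by
      rw [map_sub, map_add, map_sub, ← e1, ← e2]
      rfl
    have e5 : ∀ w, TensorProduct.map
        (TensorProduct.map (Sh.ofT (D := D)).symm.toLinearMap (Sh.ofT (D := D)).symm.toLinearMap)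
          (Sh.ofT (D := D)).symm.toLinearMap
        (TensorProduct.map (TensorProduct.map Sh.ofT.toLinearMap Sh.ofT.toLinearMap)
          Sh.ofT.toLinearMap w) = w := fun w => by
      rw [← LinearMap.comp_apply, ← TensorProduct.map_comp, ← TensorProduct.map_comp]
      simp
    simp only [LinearMap.comp_apply]
    rw [e4, e5, ← h]
    simp only [map_sub, ← Sh.comul_ofT, LinearMap.sub_apply, LinearMap.comp_apply, homotopyMap_tmul]
    rfl

end Homotopy

end ShuffleHopf

end

noncomputable section

namespace ShuffleHopf

open TensorProduct TensorAlgebra WithConv WordGraded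

/-! ### Coproducts and antipodes of the series -/

section ReversedSeries

variable {R M : Type*} [CommRing R] [AddCommGroup M] [Module R M] (D : ProductDatum R M)

/-- The identity, as an isomorphism of coalgebras with unit. -/
def shIso : CofreeIso R M (Sh D) where
  e := Sh.ofT
  comul_e := Sh.comul_ofT
  e_one := rfl
  counit_e _ := rfl

/-- Reversal of words, as an algebra morphism. -/
def revHom : Sh D.rev →ₐ[R] Sh D :=
  AlgHom.ofLinearMap (Sh.ofT.toLinearMap ∘ₗ revT R M ∘ₗ Sh.ofT.symm.toLinearMap)
    (congrArg Sh.ofT (revT_one (R := R) (M := M)))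
    (fun x y => congrArg Sh.ofT ((congrArg (revT R M)
      (D.rev_mulHom (Sh.ofT.symm x) (Sh.ofT.symm y))).trans (revT_revT _)))

theorem revHom_ofT (x : TensorAlgebra R M) : revHom D (Sh.ofT x) = Sh.ofT (revT R M x) := rfl

theorem comul_revHom (x : Sh D.rev) : Coalgebra.comul (R := R) (revHom D x) =
    TensorProduct.comm R _ _ (TensorProduct.map (revHom D).toLinearMap (revHom D).toLinearMap
      (Coalgebra.comul (R := R) x)) := by
  obtain ⟨x, rfl⟩ := Sh.ofT.surjective x
  rw [revHom_ofT, Sh.comul_ofT, Sh.comul_ofT, comulT_revT]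
  generalize comulT x = u
  induction u using TensorProduct.induction_on with
  | zero => simp
  | add a b ha hb => simp only [map_add, ha, hb]
  | tmul a b => simp [revHom_ofT]

variable {A : Type*} [Ring A] [Bialgebra R A]

variable (A) in
/-- `id ⊗ Ψ`. -/
def revRight : A ⊗[R] Sh D.rev →ₐ[R] A ⊗[R] Sh D :=
  Algebra.TensorProduct.map (AlgHom.id R A) (revHom D)

@[simp]
theorem revRight_tmul (a : A) (x : Sh D.rev) : revRight D A (a ⊗ₜ x) = a ⊗ₜ revHom D x := rfl

theorem leg_revRight {A' : Type*} [Ring A'] [Bialgebra R A'] (f : A →ₐ[R] A')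
    (u : A ⊗[R] Sh D.rev) : leg f _ (revRight D A u) = revRight D A' (leg f _ u) := by
  induction u using TensorProduct.induction_on with
  | zero => simp
  | add a b ha hb => simp only [map_add, ha, hb]
  | tmul a b => simp

theorem comulLeft_revRight {G : PowerSeries (A ⊗[R] Sh D.rev)}
    (hG : serA (leg (Bialgebra.comulAlgHom R A) _) G = prod1323 G) :
    serA (leg (Bialgebra.comulAlgHom R A) _) (serA (revRight D A) G) =
      prod1323 (serA (revRight D A) G) := by
  have h : ∀ f : A →ₐ[R] A ⊗[R] A, serA (leg f _) (serA (revRight D A) G) =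
      serA (revRight D (A ⊗[R] A)) (serA (leg f _) G) := fun f => by
    ext n; simp only [coeff_serA, leg_revRight]
  rw [prod1323, h, h, h, hG, prod1323, map_mul]

/-- Reversal is an algebra morphism which exchanges the halves of the coproduct: the two factors
keep their order, but their slots `12` and `13` are swapped. -/
theorem comulRight_revRight {G : PowerSeries (A ⊗[R] Sh D.rev)} (hG : IsComultiplicative G) :
    serA (comulR R A _) (serA (revRight D A) G) =
      serA (emb13 R A _) (serA (revRight D A) G) * serA (emb12 R A _) (serA (revRight D A) G) := by
  let σ : A ⊗[R] (Sh D.rev ⊗[R] Sh D.rev) →ₐ[R] A ⊗[R] (Sh D ⊗[R] Sh D) :=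
    Algebra.TensorProduct.map (AlgHom.id R A)
      ((Algebra.TensorProduct.comm R (Sh D) (Sh D)).toAlgHom.comp
        (Algebra.TensorProduct.map (revHom D) (revHom D)))
  have h1 : ∀ u, comulR R A _ (revRight D A u) = σ (comulR R A _ u) := fun u => by
    induction u using TensorProduct.induction_on with
    | zero => simp
    | add a b ha hb => simp only [map_add, ha, hb]
    | tmul a b =>
      rw [revRight_tmul, comulR_tmul, comulR_tmul, comul_revHom]
      rfl
  have h2 : ∀ u, emb13 R A _ (revRight D A u) = σ (emb12 R A _ u) := fun u => by
    induction u using TensorProduct.induction_on with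
    | zero => simp
    | add a b ha hb => simp only [map_add, ha, hb]
    | tmul a b => simp [σ]
  have h3 : ∀ u, emb12 R A _ (revRight D A u) = σ (emb13 R A _ u) := fun u => by
    induction u using TensorProduct.induction_on with
    | zero => simp
    | add a b ha hb => simp only [map_add, ha, hb]
    | tmul a b => simp [σ]
  have h1' : serA (comulR R A _) (serA (revRight D A) G) = serA σ (serA (comulR R A _) G) := by
    ext n; simp only [coeff_serA, h1]
  have h2' : serA (emb13 R A _) (serA (revRight D A) G) = serA σ (serA (emb12 R A _) G) := by
    ext n; simp only [coeff_serA, h2]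
  have h3' : serA (emb12 R A _) (serA (revRight D A) G) = serA σ (serA (emb13 R A _) G) := by
    ext n; simp only [coeff_serA, h3]
  rw [h1', h2', h3', ← map_mul, hG]

theorem serA_counitLeft_revRight {G : PowerSeries (A ⊗[R] Sh D.rev)}
    (hG : serA (counitLeft R A _) G = 1) :
    serA (counitLeft R A _) (serA (revRight D A) G) = 1 := by
  have h : serA (counitLeft R A _) (serA (revRight D A) G) =
      serA (revRight D A) (serA (counitLeft R A _) G) := by
    ext n; simp only [coeff_serA, counitLeft, leg_revRight]
  rw [h, hG, map_one]

theorem serA_counitRight_revRight {G : PowerSeries (A ⊗[R] Sh D.rev)}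
    (hG : serA (counitRight R A _) G = 1) :
    serA (counitRight R A _) (serA (revRight D A) G) = 1 := by
  have h : ∀ u, counitRight R A _ (revRight D A u) = revRight D A (counitRight R A _ u) :=
    fun u => by
      induction u using TensorProduct.induction_on with
      | zero => simp
      | add a b ha hb => simp only [map_add, ha, hb]
      | tmul a b =>
        obtain ⟨b, rfl⟩ := Sh.ofT.surjective b
        simp only [revRight_tmul, counitRight_tmul, revHom_ofT, Sh.counit_ofT, counit_revT,
          AlgHom.commutes]
  have h' : serA (counitRight R A _) (serA (revRight D A) G) =
      serA (revRight D A) (serA (counitRight R A _) G) := by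
    ext n; simp only [coeff_serA, h]
  rw [h', hG, map_one]

end ReversedSeries

/-! ### Inverses of the series and the antipodes. -/

section AntipodeSeries

variable {R : Type*} [CommRing R] {A : Type*} [Ring A] [HopfAlgebra R A]
  {B : Type*} [Ring B] [Bialgebra R B]

/-- Apply the antipode to the first copy of `A` in `(Δ ⊗ id)(G) = G^{(13)} G^{(23)}` and multiply
the two copies. The left side collapses to the counit, the right side to `(S ⊗ id)(G) G`. -/
theorem antipode_mul_series {G : PowerSeries (A ⊗[R] B)}
    (hG : serA (leg (Bialgebra.comulAlgHom R A) B) G = prod1323 G)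
    (hε : serA (counitLeft R A B) G = 1) :
    serL (LinearMap.rTensor B (HopfAlgebra.antipode R)) G * G = 1 := by
  let m : (A ⊗[R] A) ⊗[R] B →ₗ[R] A ⊗[R] B :=
    LinearMap.rTensor B (LinearMap.mul' R A ∘ₗ LinearMap.rTensor A (HopfAlgebra.antipode R))
  have h := serL_mul_eq m (leg (Algebra.TensorProduct.includeLeft : A →ₐ[R] A ⊗[R] A) B).toLinearMap
    (leg (Algebra.TensorProduct.includeRight : A →ₐ[R] A ⊗[R] A) B).toLinearMap
    (LinearMap.rTensor B (HopfAlgebra.antipode R)) LinearMap.id (fun u v => by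
      induction u using TensorProduct.induction_on with
      | zero => simp
      | add a b ha hb => simp only [map_add, add_mul, ha, hb]
      | tmul a b =>
        induction v using TensorProduct.induction_on with
        | zero => simp
        | add a b ha hb => simp only [map_add, mul_add, ha, hb]
        | tmul a' b' => simp [m]) G G
  rw [serL_id, serL_algHom, serL_algHom] at h
  rw [← h, ← hε]
  change serL m (prod1323 G) = _
  rw [← hG]
  ext n
  rw [coeff_serL, coeff_serA, coeff_serA]
  generalize PowerSeries.coeff n G = u
  induction u using TensorProduct.induction_on with
  | zero => simp
  | add a b ha hb => simp only [map_add, ha, hb]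
  | tmul a b => simp [m, counitLeft, HopfAlgebra.mul_antipode_rTensor_comul_apply, Algebra.ofId_apply]

/-- The same with `(id ⊗ Δ)(G) = G^{(13)} G^{(12)}` and the map `b ⊗ b' ↦ b' s(b)`. The exchanged
slots call for the skew antipode, and the inverse appears on the right. -/
theorem mul_skew_series {s : B →ₗ[R] B}
    (hs : ∀ x, LinearMap.mul' R B (TensorProduct.comm R _ _
      (LinearMap.rTensor _ s (Coalgebra.comul (R := R) x))) =
        algebraMap R _ (Coalgebra.counit (R := R) x)) {G : PowerSeries (A ⊗[R] B)}
    (hG : serA (comulR R A B) G = serA (emb13 R A B) G * serA (emb12 R A B) G)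
    (hε : serA (counitRight R A B) G = 1) :
    G * serL (LinearMap.lTensor A s) G = 1 := by
  let m : A ⊗[R] (B ⊗[R] B) →ₗ[R] A ⊗[R] B :=
    LinearMap.lTensor A (LinearMap.mul' R B ∘ₗ (TensorProduct.comm R _ _).toLinearMap ∘ₗ
      LinearMap.rTensor B s)
  have h := serL_mul_eq m (emb13 R A B).toLinearMap (emb12 R A B).toLinearMap
    LinearMap.id (LinearMap.lTensor A s) (fun u v => by
      induction u using TensorProduct.induction_on with
      | zero => simp
      | add a b ha hb => simp only [map_add, add_mul, ha, hb]
      | tmul a b =>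
        induction v using TensorProduct.induction_on with
        | zero => simp
        | add a b ha hb => simp only [map_add, mul_add, ha, hb]
        | tmul a' b' => simp [m]) G G
  rw [serL_id, serL_algHom, serL_algHom] at h
  rw [← h, ← hε, ← hG]
  ext n
  rw [coeff_serL, coeff_serA, coeff_serA]
  generalize PowerSeries.coeff n G = u
  induction u using TensorProduct.induction_on with
  | zero => simp
  | add a b ha hb => simp only [map_add, ha, hb]
  | tmul a b => simp [m, hs]

/-- A left and a right inverse of the same series coincide. -/
theorem antipode_eq_skew_series {s : B →ₗ[R] B}
    (hs : ∀ x, LinearMap.mul' R B (TensorProduct.comm R _ _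
      (LinearMap.rTensor _ s (Coalgebra.comul (R := R) x))) =
        algebraMap R _ (Coalgebra.counit (R := R) x)) {G : PowerSeries (A ⊗[R] B)}
    (hl : serA (leg (Bialgebra.comulAlgHom R A) B) G = prod1323 G)
    (hr : serA (comulR R A B) G = serA (emb13 R A B) G * serA (emb12 R A B) G)
    (hεl : serA (counitLeft R A B) G = 1) (hεr : serA (counitRight R A B) G = 1) (n : ℕ) :
    LinearMap.rTensor B (HopfAlgebra.antipode R) (PowerSeries.coeff n G) =
      LinearMap.lTensor A s (PowerSeries.coeff n G) := by
  rw [← coeff_serL, ← coeff_serL,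
    left_inv_eq_right_inv (antipode_mul_series hl hεl) (mul_skew_series hs hr hεr)]

end AntipodeSeries

/-! ### Geometric series as sums over tuples -/

section Geometric

theorem sum_antidiagonalTuple_succ {V : Type*} [AddCommMonoid V] (k n : ℕ)
    (f : (Fin (k + 1) → ℕ) → V) :
    ∑ P ∈ Finset.Nat.antidiagonalTuple (k + 1) n, f P =
      ∑ ij ∈ Finset.HasAntidiagonal.antidiagonal n,
        ∑ P ∈ Finset.Nat.antidiagonalTuple k ij.2, f (Fin.cons ij.1 P) := by
  rw [Finset.sum_sigma']
  refine Finset.sum_bij' (fun P _ => (⟨(P 0, ∑ i, Fin.tail P i), Fin.tail P⟩ :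
    Σ _ : ℕ × ℕ, Fin k → ℕ)) (fun x _ => Fin.cons x.1.1 x.2) ?_ ?_ ?_ ?_ ?_
  · intro P hP
    rw [Finset.Nat.mem_antidiagonalTuple, Fin.sum_univ_succ] at hP
    simp only [Finset.mem_sigma, Finset.HasAntidiagonal.mem_antidiagonal,
      Finset.Nat.mem_antidiagonalTuple]
    exact ⟨hP, trivial⟩
  · rintro ⟨⟨i, j⟩, P⟩ h
    simp only [Finset.mem_sigma, Finset.HasAntidiagonal.mem_antidiagonal,
      Finset.Nat.mem_antidiagonalTuple] at h
    rw [Finset.Nat.mem_antidiagonalTuple, Fin.sum_univ_succ]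
    simp [h]
  · intro P _
    simp
  · rintro ⟨⟨i, j⟩, P⟩ h
    simp only [Finset.mem_sigma, Finset.HasAntidiagonal.mem_antidiagonal,
      Finset.Nat.mem_antidiagonalTuple] at h
    simp [h.2]
  · intro P _
    simp

variable {S : Type*} [Ring S]

/-- The sum, over the tuples of positive integers with sum `n`, of the products of the
corresponding terms of a sequence. -/
def tupleSum (ρ : ℕ → S) (n : ℕ) : S :=
  ∑ k ∈ Finset.range (n + 1),
    ∑ P ∈ (Finset.Nat.antidiagonalTuple k n).filter (fun P => ∀ i, 0 < P i),
      (List.ofFn fun i => ρ (P i)).foldr (· * ·) 1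

theorem sum_prod_eq_coeff_pow (ρ : ℕ → S) (k n : ℕ) :
    ∑ P ∈ Finset.Nat.antidiagonalTuple k n, (List.ofFn fun i => ρ (P i)).prod =
      PowerSeries.coeff n (PowerSeries.mk ρ ^ k) := by
  induction k generalizing n with
  | zero =>
    rw [pow_zero, PowerSeries.coeff_one]
    cases n <;> simp
  | succ k ih =>
    rw [sum_antidiagonalTuple_succ, pow_succ', PowerSeries.coeff_mul]
    refine Finset.sum_congr rfl fun ij _ => ?_
    rw [← ih, PowerSeries.coeff_mk, Finset.mul_sum]
    refine Finset.sum_congr rfl fun P _ => ?_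
    simp

/-- Since `ρ 0 = 0`, tuples with a zero entry contribute nothing. The positivity condition can be
dropped, and the sum over `k`-tuples becomes a coefficient of a `k`-th power. -/
theorem tupleSum_eq {ρ : ℕ → S} (h0 : ρ 0 = 0) (n : ℕ) :
    tupleSum ρ n = ∑ k ∈ Finset.range (n + 1), PowerSeries.coeff n (PowerSeries.mk ρ ^ k) := by
  refine Finset.sum_congr rfl fun k _ => ?_
  rw [← sum_prod_eq_coeff_pow]
  refine Finset.sum_subset_zero_on_sdiff (Finset.filter_subset _ _) ?_ fun P _ => rfl
  intro P hP
  rw [Finset.mem_sdiff, Finset.mem_filter, not_and] at hP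
  obtain ⟨i, hi⟩ := not_forall.mp (hP.2 hP.1)
  refine List.prod_eq_zero ?_
  rw [List.mem_ofFn]
  exact ⟨i, by rw [show P i = 0 by omega, h0]⟩

theorem coeff_pow_eq_zero {ρ : ℕ → S} (h0 : ρ 0 = 0) {n k : ℕ} (h : n < k) :
    PowerSeries.coeff n (PowerSeries.mk ρ ^ k) = 0 := by
  induction k generalizing n with
  | zero => omega
  | succ k ih =>
    rw [pow_succ', PowerSeries.coeff_mul]
    refine Finset.sum_eq_zero fun ij hij => ?_
    rw [Finset.HasAntidiagonal.mem_antidiagonal] at hij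
    rcases Nat.eq_zero_or_pos ij.1 with h1 | h1
    · rw [h1, PowerSeries.coeff_mk, h0, zero_mul]
    · rw [ih (by omega), mul_zero]

theorem tupleSum_eq_of_le {ρ : ℕ → S} (h0 : ρ 0 = 0) {n N : ℕ} (h : n < N) :
    tupleSum ρ n = PowerSeries.coeff n (∑ k ∈ Finset.range N, PowerSeries.mk ρ ^ k) := by
  rw [tupleSum_eq h0, map_sum]
  refine Finset.sum_subset (Finset.range_mono h) fun k _ hk => coeff_pow_eq_zero h0 ?_
  rw [Finset.mem_range] at hk
  omega

theorem tupleSum_geometric {ρ : ℕ → S} (h0 : ρ 0 = 0) :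
    PowerSeries.mk (tupleSum ρ) = 1 + PowerSeries.mk ρ * PowerSeries.mk (tupleSum ρ) := by
  ext n
  -- The left side is expanded with `n + 2` powers and the inner one with `n + 1`; splitting off the
  -- zeroth power then matches them, the surplus powers being zero in these degrees.
  rw [PowerSeries.coeff_mk, tupleSum_eq_of_le h0 (Nat.lt_succ_of_lt (Nat.lt_succ_self n)),
    Finset.sum_range_succ', pow_zero, add_comm, map_add, map_add, PowerSeries.coeff_mul]
  congr 1
  simp only [pow_succ', ← Finset.mul_sum]
  rw [PowerSeries.coeff_mul]
  refine Finset.sum_congr rfl fun ij hij => ?_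
  rw [Finset.HasAntidiagonal.mem_antidiagonal] at hij
  rw [PowerSeries.coeff_mk _ (tupleSum ρ), tupleSum_eq_of_le h0 (N := n + 1) (by omega)]

theorem tupleSum_congr {ρ ρ' : ℕ → S} {n : ℕ} (h : ∀ j ≤ n, ρ j = ρ' j) :
    tupleSum ρ n = tupleSum ρ' n := by
  refine Finset.sum_congr rfl fun k _ => Finset.sum_congr rfl fun P hP => ?_
  rw [Finset.mem_filter, Finset.Nat.mem_antidiagonalTuple] at hP
  congr 2
  ext i
  exact h _ (hP.1 ▸ Finset.single_le_sum (fun _ _ => Nat.zero_le _) (Finset.mem_univ i))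

end Geometric

/-! ### The recursive construction -/

section Recursion

variable {R : Type*} [CommRing R] {M N : Type*} [AddCommGroup M] [Module R M] [AddCommGroup N]
  [Module R N] (D : ProductDatum R M) (E : ProductDatum R N) (c : ℕ → R)

/-- The recursion for the components of degree one. -/
def rhoStepR (ρ : ℕ → Sh D ⊗[R] TensorAlgebra R N) (n : ℕ) : Sh D ⊗[R] TensorAlgebra R N :=
  LinearMap.rTensor _ (homotopyMap D c) (sigma (shIso E.rev) (PowerSeries.mk (tupleSum ρ)) n)

/-- The step in degree `n` sees only smaller degrees, which removes the guard in the recursive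
definition of `rhoR`. -/
theorem rhoStepR_congr {ρ ρ' : ℕ → Sh D ⊗[R] TensorAlgebra R N} {n : ℕ}
    (h : ∀ j < n, ρ j = ρ' j) : rhoStepR D E c ρ n = rhoStepR D E c ρ' n := by
  rw [rhoStepR, rhoStepR, sigma, sigma]
  congr 2
  refine Finset.sum_congr rfl fun j hj => ?_
  rw [Finset.mem_Ioo] at hj
  simp only [PowerSeries.coeff_mk]
  rw [tupleSum_congr fun i hi => h i (by omega), tupleSum_congr fun i hi => h i (by omega)]

/-- The components of degree one of the solution. -/
def rhoR (r : M ⊗[R] N) : ℕ → Sh D ⊗[R] TensorAlgebra R N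
  | 0 => 0
  | 1 => TensorProduct.map (Sh.ofT.toLinearMap ∘ₗ ι R) (ι R) r
  | n + 2 => rhoStepR D E c (fun j => if _h : j < n + 2 then rhoR r j else 0) (n + 2)
termination_by n => n

theorem rhoR_zero (r : M ⊗[R] N) : rhoR D E c r 0 = 0 := by rw [rhoR]

theorem rhoR_one (r : M ⊗[R] N) :
    rhoR D E c r 1 = TensorProduct.map (Sh.ofT.toLinearMap ∘ₗ ι R) (ι R) r := by rw [rhoR]

theorem rhoR_eq (r : M ⊗[R] N) {n : ℕ} (hn : 2 ≤ n) :
    rhoR D E c r n = rhoStepR D E c (rhoR D E c r) n := by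
  obtain ⟨n, rfl⟩ := Nat.exists_eq_add_of_le' hn
  rw [rhoR]
  refine rhoStepR_congr D E c fun j hj => ?_
  rw [dif_pos hj]

/-- The solution, in the product of `Sh D` and of the tensor algebra. -/
def geomR (r : M ⊗[R] N) : PowerSeries (Sh D ⊗[R] TensorAlgebra R N) :=
  PowerSeries.mk (tupleSum (rhoR D E c r))

/-- The solution, in the product of `Sh D` and of `Sh E`. -/
def matR (r : M ⊗[R] N) : PowerSeries (Sh D ⊗[R] Sh E) :=
  serA (revRight E (Sh D)) (serL (LinearMap.lTensor (Sh D) (shIso E.rev).e.toLinearMap)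
    (geomR D E c r))

theorem lTensor_prT_rhoR (r : M ⊗[R] N) (n : ℕ) :
    LinearMap.lTensor (Sh D) (prT R N) (rhoR D E c r n) = rhoR D E c r n := by
  match n with
  | 0 => rw [rhoR_zero, map_zero]
  | 1 =>
    rw [rhoR_one]
    induction r using TensorProduct.induction_on with
    | zero => simp
    | add a b ha hb => simp only [map_add, ha, hb]
    | tmul a b => simp [prT]
  | n + 2 =>
    rw [rhoR_eq D E c r (by omega), rhoStepR, sigma]
    generalize (∑ j ∈ Finset.Ioo 0 (n + 2), _ : (Sh D ⊗[R] Sh D) ⊗[R] Sh E.rev) = w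
    induction w using TensorProduct.induction_on with
    | zero => simp
    | add a b ha hb => simp only [map_add, ha, hb]
    | tmul a b => simp [prT_prT]

variable {c}

/-- With `c 0 = 0` the homotopy never produces the empty word. This keeps the `ρ_n` in the
augmentation ideal of the first factor, as the cocycle argument and the antipode formulas require.
-/
theorem counitLeft_rhoR (h0 : c 0 = 0) (r : M ⊗[R] N) (n : ℕ) :
    counitLeft R (Sh D) (TensorAlgebra R N) (rhoR D E c r n) = 0 := by
  match n with
  | 0 => rw [rhoR_zero, map_zero]
  | 1 =>
    rw [rhoR_one]
    induction r using TensorProduct.induction_on with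
    | zero => simp
    | add a b ha hb => simp only [map_add, ha, hb, add_zero]
    | tmul a b =>
      have := counit_ι_mul (R := R) a 1
      rw [mul_one] at this
      simp [counitLeft, Sh.counit_ofT, this]
  | n + 2 =>
    rw [rhoR_eq D E c r (by omega), rhoStepR]
    generalize sigma (shIso E.rev) (PowerSeries.mk (tupleSum (rhoR D E c r))) (n + 2) = w
    induction w using TensorProduct.induction_on with
    | zero => simp
    | add a b ha hb => simp only [map_add, ha, hb, add_zero]
    | tmul a b =>
      have : Coalgebra.counit (R := R) (homotopyMap D c a) = 0 := counit_weight h0 _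
      simp [counitLeft, this]

theorem comulLeft_matR (hc : ∀ n, 2 ≤ n → c n * ((n : R) - 1) = 1) (h0 : c 0 = 0) (r : M ⊗[R] N) :
    serA (leg (Bialgebra.comulAlgHom R (Sh D)) _) (matR D E c r) = prod1323 (matR D E c r) := by
  refine comulLeft_revRight E (comul_geometric (shHomotopy D c hc) (shIso E.rev)
    (ρ := PowerSeries.mk (rhoR D E c r)) ?_ ?_ (tupleSum_geometric (rhoR_zero D E c r)) ?_ ?_ ?_)
  · rw [PowerSeries.coeff_mk, rhoR_zero]
  · ext n
    rw [coeff_serL, PowerSeries.coeff_mk, lTensor_prT_rhoR]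
  · intro n
    rw [PowerSeries.coeff_mk, counitLeft_rhoR D E h0]
  · rw [PowerSeries.coeff_mk, rhoR_one]
    induction r using TensorProduct.induction_on with
    | zero => simp
    | add a b ha hb => simp only [map_add, ha, hb]; abel
    | tmul a b =>
      simp only [TensorProduct.map_tmul, LinearMap.comp_apply, leg_tmul,
        Bialgebra.comulAlgHom_apply, LinearEquiv.coe_coe, Sh.comul_ofT, comulT_ι, map_add,
        Sh.ofT_one, add_tmul, Algebra.TensorProduct.includeLeft_apply,
        Algebra.TensorProduct.includeRight_apply]
      rw [add_comm]
  · intro n hn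
    rw [PowerSeries.coeff_mk, rhoR_eq D E c r hn]
    rfl

theorem comulRight_matR (r : M ⊗[R] N) :
    serA (comulR R (Sh D) _) (matR D E c r) =
      serA (emb13 R (Sh D) _) (matR D E c r) * serA (emb12 R (Sh D) _) (matR D E c r) := by
  refine comulRight_revRight E ((isComultiplicative_e_iff (shIso E.rev) _).2
    (geometric_comul (ρ := PowerSeries.mk (rhoR D E c r)) ?_ ?_
      (tupleSum_geometric (rhoR_zero D E c r))))
  · rw [PowerSeries.coeff_mk, rhoR_zero]
  · ext n
    rw [coeff_serL, PowerSeries.coeff_mk, lTensor_prT_rhoR]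

theorem antipode_matR (hc : ∀ n, 2 ≤ n → c n * ((n : R) - 1) = 1) (h0 : c 0 = 0) (r : M ⊗[R] N) (n : ℕ) :
    LinearMap.rTensor (Sh E) (HopfAlgebra.antipode R) (PowerSeries.coeff n (matR D E c r)) =
      LinearMap.lTensor (Sh D) (skewAntipode E) (PowerSeries.coeff n (matR D E c r)) := by
  have hpr : serL (LinearMap.lTensor (Sh D) (prT R N)) (PowerSeries.mk (rhoR D E c r)) =
      PowerSeries.mk (rhoR D E c r) := by
    ext n
    rw [coeff_serL, PowerSeries.coeff_mk, lTensor_prT_rhoR]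
  have hG := tupleSum_geometric (rhoR_zero D E c r)
  refine antipode_eq_skew_series (mul_skewAntipode E) (comulLeft_matR D E hc h0 r)
    (comulRight_matR D E r) (serA_counitLeft_revRight E ?_) (serA_counitRight_revRight E ?_) n
  · have h := counitLeft_geometric (ρ := PowerSeries.mk (rhoR D E c r))
      (fun n => by rw [PowerSeries.coeff_mk, counitLeft_rhoR D E h0]) hG
    have h' : serA (counitLeft R (Sh D) (Sh E.rev))
        (serL (LinearMap.lTensor (Sh D) (shIso E.rev).e.toLinearMap) (geomR D E c r)) =
        serL (LinearMap.lTensor (Sh D) (shIso E.rev).e.toLinearMap)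
          (serA (counitLeft R (Sh D) _) (geomR D E c r)) := by
      ext n; simp only [coeff_serL, coeff_serA, counitLeft_lTensor]
    rw [h', geomR, h]
    exact serL_one _ rfl
  · exact serA_counitRight_eq_one hpr hG

end Recursion

end ShuffleHopf

end

noncomputable section

namespace ShuffleHopf

open TensorProduct TensorAlgebra WithConv WordGraded

/-! ### The product datum attached to a family of Lie polynomials -/

section Blocks

variable {R M : Type*} [CommRing R] [AddCommGroup M] [Module R M]

/-- The `i`-th of the consecutive segments of lengths `P 0, P 1, …` of a list. -/
def segment {α : Type*} {k : ℕ} (P : Fin k → ℕ) (l : List α) (i : Fin k) : List α :=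
  (l.drop (∑ j : Fin i, P (Fin.castLE i.2.le j))).take (P i)

theorem segment_cons_zero {α : Type*} {k : ℕ} (n : ℕ) (P : Fin k → ℕ) (l : List α) :
    segment (Fin.cons n P : Fin (k + 1) → ℕ) l 0 = l.take n := by
  rw [segment, Finset.sum_eq_zero fun j _ => absurd j.2 (by simp)]
  simp

theorem segment_cons_succ {α : Type*} {k : ℕ} (n : ℕ) (P : Fin k → ℕ) (l : List α) (i : Fin k) :
    segment (Fin.cons n P : Fin (k + 1) → ℕ) l i.succ = segment P (l.drop n) i := by
  rw [segment, segment, List.drop_drop, Fin.cons_succ]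
  congr 2
  exact Fin.sum_univ_succ (n := (i : ℕ)) _

/-- The passage from the blocks of the product formula, given by an equivalence of index types, to
segments of lists, which obey a recursion by cutting off the first one. -/
theorem ofFn_blocks {α : Type*} {k n : ℕ} (P : Part k n) (x : Fin n → α) (i : Fin k) :
    List.ofFn (fun j => x (P.blocks ⟨i, j⟩)) = segment P.1 (List.ofFn x) i := by
  have hle : ∀ j : Fin (P.1 i), ∑ j : Fin i, P.1 (Fin.castLE i.2.le j) + j < n := fun j => by
    have := (P.blocks ⟨i, j⟩).2
    simpa [Part.blocks, finSigmaFinEquiv_apply] using this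
  apply List.ext_getElem
  · simp only [segment, List.length_ofFn, List.length_take, List.length_drop]
    rcases Nat.eq_zero_or_pos (P.1 i) with h | h
    · simp [h]
    · have := hle ⟨P.1 i - 1, by omega⟩
      simp only at this
      omega
  · intro j h1 h2
    simp only [segment, List.getElem_ofFn, List.getElem_take, List.getElem_drop]
    congr 1
    ext
    simp [Part.blocks, finSigmaFinEquiv_apply]

theorem comul_word_tmul_word (l l' : List M) :
    Coalgebra.comul (R := R) (word R l ⊗ₜ[R] word R l') =
      ∑ i ∈ Finset.range (l.length + 1), ∑ j ∈ Finset.range (l'.length + 1),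
        (word R (l.take i) ⊗ₜ[R] word R (l'.take j)) ⊗ₜ[R]
          (word R (l.drop i) ⊗ₜ[R] word R (l'.drop j)) := by
  rw [TensorProduct.comul_tmul, comul_eq_comulT, comul_eq_comulT, comulT_word, comulT_word,
    sum_tmul, map_sum]
  refine Finset.sum_congr rfl fun i _ => ?_
  rw [tmul_sum, map_sum]
  rfl

/-- The `k`-fold coproduct cuts both words into `k` consecutive segments, possibly empty; the
induction splits off the first pair of segments. -/
theorem convPow_word (β : TensorAlgebra R M ⊗[R] TensorAlgebra R M →ₗ[R] M) (k : ℕ)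
    (l l' : List M) :
    (toConv (ι R ∘ₗ β) ^ k) (word R l ⊗ₜ[R] word R l') =
      ∑ P ∈ Finset.Nat.antidiagonalTuple k l.length,
        ∑ Q ∈ Finset.Nat.antidiagonalTuple k l'.length,
          (List.ofFn fun i => ι R (β (word R (segment P l i) ⊗ₜ[R] word R (segment Q l' i)))).prod := by
  induction k generalizing l l' with
  | zero =>
    rw [pow_zero]
    change algebraMap R _ (Coalgebra.counit (R := R) (word R l ⊗ₜ[R] word R l')) = _
    rw [TensorProduct.counit_tmul, counit_word, counit_word]
    cases l <;> cases l' <;> simp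
  | succ k ih =>
    rw [pow_succ', LinearMap.convMul_apply, comul_word_tmul_word, map_sum, map_sum,
      sum_antidiagonalTuple_succ, Finset.Nat.sum_antidiagonal_eq_sum_range_succ_mk]
    refine Finset.sum_congr rfl fun i _ => ?_
    rw [map_sum, map_sum]
    simp only [TensorProduct.map_tmul, LinearMap.mul'_apply]
    have h : ∀ P ∈ Finset.Nat.antidiagonalTuple k (l.length - i),
        ∑ Q ∈ Finset.Nat.antidiagonalTuple (k + 1) l'.length,
          (List.ofFn fun a => ι R (β (word R (segment (Fin.cons i P : Fin (k + 1) → ℕ) l a) ⊗ₜ[R]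
            word R (segment Q l' a)))).prod =
        ∑ j ∈ Finset.range (l'.length + 1), ∑ Q ∈ Finset.Nat.antidiagonalTuple k (l'.length - j),
          ι R (β (word R (l.take i) ⊗ₜ[R] word R (l'.take j))) *
          (List.ofFn fun a => ι R (β (word R (segment P (l.drop i) a) ⊗ₜ[R]
            word R (segment Q (l'.drop j) a)))).prod := fun P _ => by
      rw [sum_antidiagonalTuple_succ, Finset.Nat.sum_antidiagonal_eq_sum_range_succ_mk]
      refine Finset.sum_congr rfl fun j _ => Finset.sum_congr rfl fun Q _ => ?_
      rw [List.ofFn_succ, List.prod_cons, segment_cons_zero, segment_cons_zero]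
      simp only [segment_cons_succ]
    rw [Finset.sum_congr rfl h, Finset.sum_comm]
    refine Finset.sum_congr rfl fun j _ => ?_
    have h' := ih (l.drop i) (l'.drop j)
    rw [List.length_drop, List.length_drop] at h'
    simp only [← Finset.mul_sum]
    rw [← h']
    rfl

theorem cofreeLin_word (β : TensorAlgebra R M ⊗[R] TensorAlgebra R M →ₗ[R] M)
    (l l' : List M) : cofreeLin β (word R l ⊗ₜ[R] word R l') =
      ∑ k ∈ Finset.range (l.length + l'.length + 1),
        (toConv (ι R ∘ₗ β) ^ k) (word R l ⊗ₜ[R] word R l') := by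
  have h := component_words (R := R) _ _
    (tmul_mem_words (word_mem_words (R := R) l) (word_mem_words (R := R) l'))
  change (Finsupp.lsum R fun n => ∑ k ∈ Finset.range (n + 1), (toConv (ι R ∘ₗ β) ^ k).ofConv)
    (component (R := R) (word R l ⊗ₜ[R] word R l')) = _
  rw [h, Finsupp.lsum_single, LinearMap.sum_apply]

end Blocks

/-! ### Linear maps on words over a commutative ring. -/

section WordMap

variable {R : Type*} [CommRing R] {M : Type*} [AddCommGroup M] [Module R M]
variable {V : Type*} [AddCommGroup V] [Module R V]

/-- The linear map on the tensor algebra given by a family of multilinear maps. -/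
def wordMap : (∀ n : ℕ, MultilinearMap R (fun _ : Fin n => M) V) →ₗ[R]
    (TensorAlgebra R M →ₗ[R] V) :=
  LinearMap.lcomp R V (TensorAlgebra.equivDirectSum (R := R) (M := M)).toLinearMap ∘ₗ
    (DFinsupp.lsum R (M := fun n => ⨂[R]^n M) (N := V)).toLinearMap ∘ₗ
      LinearMap.pi fun n => (PiTensorProduct.lift (R := R) (s := fun _ : Fin n => M)
        (E := V)).toLinearMap ∘ₗ LinearMap.proj n

theorem wordMap_tprod (f : ∀ n : ℕ, MultilinearMap R (fun _ : Fin n => M) V) (n : ℕ)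
    (x : Fin n → M) : wordMap f (TensorAlgebra.tprod R M n x) = f n x := by
  have h : TensorAlgebra.equivDirectSum (TensorAlgebra.tprod R M n x) =
      DirectSum.of (fun n => ⨂[R]^n M) n (PiTensorProduct.tprod R x) :=
    TensorAlgebra.toDirectSum_tensorPower_tprod x
  simp only [wordMap, LinearMap.comp_apply, LinearMap.lcomp_apply, AlgEquiv.toLinearMap_apply]
  rw [h]
  erw [DFinsupp.lsum_single]
  simp

/-- The linear map on pairs of words given by a family of multilinear maps. -/
def wordMap₂ (f : ∀ n m : ℕ, MultilinearMap R (fun _ : Fin n ⊕ Fin m => M) V) :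
    TensorAlgebra R M ⊗[R] TensorAlgebra R M →ₗ[R] V :=
  TensorProduct.lift <| wordMap fun n =>
    wordMap.compMultilinearMap (MultilinearMap.pi fun m => (f n m).currySum)

theorem wordMap₂_tprod (f : ∀ n m : ℕ, MultilinearMap R (fun _ : Fin n ⊕ Fin m => M) V)
    (n m : ℕ) (x : Fin n → M) (y : Fin m → M) :
    wordMap₂ f (TensorAlgebra.tprod R M n x ⊗ₜ[R] TensorAlgebra.tprod R M m y) =
      f n m (Sum.elim x y) := by
  rw [wordMap₂, TensorProduct.lift.tmul, wordMap_tprod]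
  rw [LinearMap.compMultilinearMap_apply, wordMap_tprod]
  rfl

end WordMap

/-! ### Families of Lie polynomials as product data. -/

section Family

variable {R : Type*} [CommRing R] (ω : LieFamily R)
variable {L : Type*} [LieRing L] [LieAlgebra R L]

theorem lift_comp_apply {X L' : Type*} [LieRing L'] [LieAlgebra R L'] (F : L →ₗ⁅R⁆ L')
    (f : X → L) (P : FreeLieAlgebra R X) :
    F (FreeLieAlgebra.lift R f P) = FreeLieAlgebra.lift R (F ∘ f) P := by
  have h : F.comp (FreeLieAlgebra.lift R f) = FreeLieAlgebra.lift R (F ∘ f) :=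
    FreeLieAlgebra.hom_ext fun x => by simp [FreeLieAlgebra.lift_of_apply]
  exact LieHom.congr_fun h P

theorem map_app {L' : Type*} [LieRing L'] [LieAlgebra R L'] (F : L →ₗ⁅R⁆ L') {p q : ℕ}
    (x : Fin p → L) (y : Fin q → L) : F (ω.app x y) = ω.app (F ∘ x) (F ∘ y) := by
  rw [LieFamily.app, lift_comp_apply, Sum.comp_elim]
  rfl

theorem map_blockApp {L' : Type*} [LieRing L'] [LieAlgebra R L'] (F : L →ₗ⁅R⁆ L') {p q k : ℕ}
    (P : Part k p) (Q : Part k q) (x : Fin p → L) (y : Fin q → L) :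
    F ∘ ω.blockApp P Q x y = ω.blockApp P Q (F ∘ x) (F ∘ y) :=
  funext fun _ => map_app ω F _ _

theorem app_vee {p q : ℕ} (x : Fin p → L) (y : Fin q → L) :
    ω.vee.app x y = ω.app (x ∘ Fin.rev) (y ∘ Fin.rev) := by
  change FreeLieAlgebra.lift R (Sum.elim x y) (relabel _ _) = _
  rw [relabel, lift_comp_apply]
  congr 2
  funext i
  rcases i with i | i <;> simp [FreeLieAlgebra.lift_of_apply]

variable (L) in
/-- The component of degree one of the product given by a family of Lie polynomials. -/
def shuffleβ : TensorAlgebra R L ⊗[R] TensorAlgebra R L →ₗ[R] L :=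
  wordMap₂ fun p q => evalFL L (ω p q)

theorem shuffleβ_tprod {p q : ℕ} (x : Fin p → L) (y : Fin q → L) :
    shuffleβ ω L (tprod R L p x ⊗ₜ tprod R L q y) = ω.app x y :=
  wordMap₂_tprod _ p q x y

/-- The `k`-th convolution power of the degree one component is the part of the explicit product
formula with `k` blocks. This identifies the abstract product with that of `Sh^ω`. -/
theorem cofreeLin_shuffleβ {p q : ℕ} (x : Fin p → L) (y : Fin q → L) :
    cofreeLin (shuffleβ ω L) (tprod R L p x ⊗ₜ tprod R L q y) =
      ∑ k ∈ Finset.range (p + q + 1), ∑ P : Part k p, ∑ Q : Part k q,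
        tprod R L k (ω.blockApp P Q x y) := by
  rw [← word_ofFn, ← word_ofFn, cofreeLin_word, List.length_ofFn, List.length_ofFn]
  refine Finset.sum_congr rfl fun k _ => ?_
  rw [convPow_word, List.length_ofFn, List.length_ofFn, ← Finset.sum_coe_sort]
  refine Finset.sum_congr rfl fun P _ => ?_
  rw [← Finset.sum_coe_sort]
  refine Finset.sum_congr rfl fun Q _ => ?_
  rw [tprod_apply]
  congr 2
  funext i
  rw [← ofFn_blocks P, ← ofFn_blocks Q, word_ofFn, word_ofFn, shuffleβ_tprod]
  rfl

theorem tmul_ext_tprod {N : Type*} [AddCommGroup N] [Module R N] {M M' : Type*} [AddCommGroup M]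
    [Module R M] [AddCommGroup M'] [Module R M']
    {f g : TensorAlgebra R M ⊗[R] TensorAlgebra R M' →ₗ[R] N}
    (h : ∀ p q (x : Fin p → M) (y : Fin q → M'), f (tprod R M p x ⊗ₜ tprod R M' q y) =
      g (tprod R M p x ⊗ₜ tprod R M' q y)) : f = g := by
  refine TensorProduct.ext (linearMap_ext_word fun l => linearMap_ext_word fun l' => ?_)
  rw [← List.ofFn_get l, ← List.ofFn_get l', word_ofFn, word_ofFn]
  exact h _ _ _ _

/-- Passing to `ω^∨` evaluates the Lie polynomials on reversed words, so its product is the one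
conjugated by reversal and needs no separate proof of associativity. -/
theorem shuffleβ_vee : shuffleβ ω.vee L =
    shuffleβ ω L ∘ₗ TensorProduct.map (revT R L) (revT R L) := by
  have hrev : ∀ {n : ℕ} (x : Fin n → L),
      revT R L (tprod R L n x) = tprod R L n (x ∘ Fin.rev) := fun {n} x => by
    rw [← word_ofFn, ← word_ofFn, revT_word]
    congr 1
    apply List.ext_getElem
    · simp
    · intro i h1 h2
      simp only [List.getElem_reverse, List.getElem_ofFn, List.length_ofFn, Function.comp_apply]
      congr 1
      ext
      simp [Fin.val_rev]
      omega
  refine tmul_ext_tprod fun p q x y => ?_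
  rw [LinearMap.comp_apply, TensorProduct.map_tmul, hrev, hrev, shuffleβ_tprod, shuffleβ_tprod,
    app_vee]

variable {ω}

theorem prL_tprod {n : ℕ} (x : Fin n → L) (hn : n ≠ 1) : prL (tprod R L n x) = 0 := by
  rw [← word_ofFn]
  match n, x, hn with
  | 0, _, _ => simp
  | n + 2, x, _ => rw [List.ofFn_succ, List.ofFn_succ, word_cons, word_cons, prL_ι_mul,
      counit_ι_mul, zero_smul]

theorem tprod_one' (x : Fin 1 → L) : tprod R L 1 x = ι R (x 0) := by simp [tprod_apply]

theorem shuffleβ_one_tmul (hω : ω.IsShuffleFamily) (y : TensorAlgebra R L) :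
    shuffleβ ω L (1 ⊗ₜ y) = prL y := by
  have h : shuffleβ ω L ∘ₗ TensorProduct.mk R _ _ 1 = prL := by
    refine linearMap_ext_word fun l => ?_
    obtain ⟨q, y, rfl⟩ : ∃ (q : ℕ) (y : Fin q → L), l = List.ofFn y :=
      ⟨_, l.get, (List.ofFn_get l).symm⟩
    have h1 : (1 : TensorAlgebra R L) = tprod R L 0 Fin.elim0 := by simp [tprod_apply]
    rw [LinearMap.comp_apply, mk_apply, h1, word_ofFn, shuffleβ_tprod, LieFamily.app]
    rcases eq_or_ne q 1 with rfl | hq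
    · rw [hω.zero_one, FreeLieAlgebra.lift_of_apply, tprod_one', prL_ι]
      rfl
    · rw [hω.right_zero q hq, prL_tprod y hq]
      simp
  exact LinearMap.congr_fun h y

theorem shuffleβ_tmul_one (hω : ω.IsShuffleFamily) (x : TensorAlgebra R L) :
    shuffleβ ω L (x ⊗ₜ 1) = prL x := by
  have h : shuffleβ ω L ∘ₗ (TensorProduct.mk R _ _).flip 1 = prL := by
    refine linearMap_ext_word fun l => ?_
    obtain ⟨p, x, rfl⟩ : ∃ (p : ℕ) (x : Fin p → L), l = List.ofFn x :=
      ⟨_, l.get, (List.ofFn_get l).symm⟩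
    have h1 : (1 : TensorAlgebra R L) = tprod R L 0 Fin.elim0 := by simp [tprod_apply]
    rw [LinearMap.comp_apply, LinearMap.flip_apply, mk_apply, h1, word_ofFn, shuffleβ_tprod,
      LieFamily.app]
    rcases eq_or_ne p 1 with rfl | hp
    · rw [hω.one_zero, FreeLieAlgebra.lift_of_apply, tprod_one', prL_ι]
      rfl
    · rw [hω.left_zero p hp, prL_tprod x hp]
      simp
  exact LinearMap.congr_fun h x

/-- The empty tuple cannot have the positive sum `p`, so the term `k = 0` is an empty sum. -/
theorem sum_range_eq_sum_Icc {V : Type*} [AddCommMonoid V] {p q : ℕ} (hp : 0 < p) (n : ℕ)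
    (f : ∀ k, Part k p → Part k q → V) :
    ∑ k ∈ Finset.range (n + 1), ∑ P : Part k p, ∑ Q : Part k q, f k P Q =
      ∑ k ∈ Finset.Icc 1 n, ∑ P : Part k p, ∑ Q : Part k q, f k P Q := by
  symm
  refine Finset.sum_subset (fun k hk => ?_) fun k hk hk' => ?_
  · rw [Finset.mem_Icc] at hk
    exact Finset.mem_range.mpr (by omega)
  · rw [Finset.mem_range] at hk
    rw [Finset.mem_Icc] at hk'
    obtain rfl : k = 0 := by omega
    refine Finset.sum_eq_zero fun P _ => ?_
    have := Finset.Nat.mem_antidiagonalTuple.mp P.2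
    simp at this
    omega

/-- The axiom is an identity in a free Lie algebra; the morphism sending the generators to the given
letters transports it to `L`. -/
theorem shuffleβ_assoc_tprod (hω : ω.IsShuffleFamily) {p q r : ℕ} (hp : 0 < p) (hq : 0 < q)
    (hr : 0 < r) (x : Fin p → L) (y : Fin q → L) (z : Fin r → L) :
    shuffleβ ω L (cofreeLin (shuffleβ ω L) (tprod R L p x ⊗ₜ tprod R L q y) ⊗ₜ tprod R L r z) =
      shuffleβ ω L (tprod R L p x ⊗ₜ
        cofreeLin (shuffleβ ω L) (tprod R L q y ⊗ₜ tprod R L r z)) := by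
  rw [cofreeLin_shuffleβ, cofreeLin_shuffleβ, sum_range_eq_sum_Icc hp, sum_range_eq_sum_Icc hq]
  simp only [sum_tmul, tmul_sum, map_sum, shuffleβ_tprod]
  let F : FreeLieAlgebra R (Fin p ⊕ Fin q ⊕ Fin r) →ₗ⁅R⁆ L :=
    FreeLieAlgebra.lift R (Sum.elim x (Sum.elim y z))
  have h := congrArg F (hω.assoc p q r hp hq hr)
  simp only [map_sum, map_app, map_blockApp] at h
  have hx : F ∘ (fun i => FreeLieAlgebra.of R (Sum.inl i)) = x :=
    funext fun i => FreeLieAlgebra.lift_of_apply _ _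
  have hy : F ∘ (fun i => FreeLieAlgebra.of R (Sum.inr (Sum.inl i))) = y :=
    funext fun i => FreeLieAlgebra.lift_of_apply _ _
  have hz : F ∘ (fun i => FreeLieAlgebra.of R (Sum.inr (Sum.inr i))) = z :=
    funext fun i => FreeLieAlgebra.lift_of_apply _ _
  rw [hx, hy, hz] at h
  exact h

/-- The axiom on `ω` covers nonempty words; when one of the words is empty, the unit laws suffice.
-/
theorem shuffleβ_assoc (hω : ω.IsShuffleFamily) (x y z : TensorAlgebra R L) :
    shuffleβ ω L (cofreeLin (shuffleβ ω L) (x ⊗ₜ y) ⊗ₜ z) =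
      shuffleβ ω L (x ⊗ₜ cofreeLin (shuffleβ ω L) (y ⊗ₜ z)) := by
  have hl := shuffleβ_one_tmul (L := L) hω
  have hr := shuffleβ_tmul_one (L := L) hω
  have h1 : shuffleβ ω L (1 ⊗ₜ 1) = 0 := by rw [hl, prL_one]
  have h : shuffleβ ω L ∘ₗ LinearMap.rTensor _ (cofreeLin (shuffleβ ω L)) =
      shuffleβ ω L ∘ₗ LinearMap.lTensor _ (cofreeLin (shuffleβ ω L)) ∘ₗ
        (TensorProduct.assoc R _ _ _).toLinearMap := by
    refine TensorProduct.ext (TensorProduct.ext (linearMap_ext_word fun l₁ =>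
      linearMap_ext_word fun l₂ => linearMap_ext_word fun l₃ => ?_))
    change shuffleβ ω L (cofreeLin (shuffleβ ω L) (word R l₁ ⊗ₜ word R l₂) ⊗ₜ word R l₃) =
      shuffleβ ω L (word R l₁ ⊗ₜ cofreeLin (shuffleβ ω L) (word R l₂ ⊗ₜ word R l₃))
    rcases eq_or_ne l₁ [] with rfl | h₁
    · rw [word_nil, cofreeLin_one_tmul hl, hl, prL_cofreeLin h1]
    rcases eq_or_ne l₂ [] with rfl | h₂
    · rw [word_nil, cofreeLin_tmul_one hr, cofreeLin_one_tmul hl]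
    rcases eq_or_ne l₃ [] with rfl | h₃
    · rw [word_nil, cofreeLin_tmul_one hr, hr, prL_cofreeLin h1]
    rw [← List.ofFn_get l₁, ← List.ofFn_get l₂, ← List.ofFn_get l₃, word_ofFn, word_ofFn, word_ofFn]
    exact shuffleβ_assoc_tprod hω (List.length_pos_iff.mpr h₁) (List.length_pos_iff.mpr h₂)
      (List.length_pos_iff.mpr h₃) _ _ _
  exact LinearMap.congr_fun h ((x ⊗ₜ y) ⊗ₜ z)

variable (L) in
/-- The product on the tensor algebra of a Lie algebra given by a family of Lie polynomials. -/
def shuffleDatum (hω : ω.IsShuffleFamily) : ProductDatum R L where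
  β := shuffleβ ω L
  one_tmul := shuffleβ_one_tmul hω
  tmul_one := shuffleβ_tmul_one hω
  assoc := shuffleβ_assoc hω

theorem shuffleDatum_rev_β (hω : ω.IsShuffleFamily) :
    (shuffleDatum L hω).rev.β = shuffleβ ω.vee L :=
  (shuffleβ_vee ω).symm

end Family

end ShuffleHopf

end

noncomputable section

namespace ShuffleHopf

open TensorProduct TensorAlgebra

/-! ### Formal series as modules over the ring of formal series -/

section SeriesAlgebra

variable {K : Type*} [Field K] {V : Type*} [Ring V] [Algebra K V] {W : Type*} [Ring W] [Algebra K W]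

theorem map_algebraMap_commute (c : K⟦X⟧) (F : V⟦X⟧) :
    PowerSeries.map (algebraMap K V) c * F = F * PowerSeries.map (algebraMap K V) c := by
  ext n
  rw [PowerSeries.coeff_mul, PowerSeries.coeff_mul, ← Finset.Nat.sum_antidiagonal_swap]
  refine Finset.sum_congr rfl fun ij _ => ?_
  simp [Algebra.commutes]

variable (K V) in
/-- The structure of algebra over `K[[ħ]]` on `V[[ħ]]`. -/
abbrev seriesAlgebra : Algebra K⟦X⟧ V⟦X⟧ :=
  (PowerSeries.map (algebraMap K V)).toAlgebra' map_algebraMap_commute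

attribute [local instance] seriesAlgebra

theorem series_smul_def (c : K⟦X⟧) (F : V⟦X⟧) :
    c • F = PowerSeries.map (algebraMap K V) c * F := rfl

theorem coeff_series_smul (c : K⟦X⟧) (F : V⟦X⟧) (n : ℕ) : PowerSeries.coeff n (c • F) =
    ∑ ij ∈ Finset.HasAntidiagonal.antidiagonal n,
      PowerSeries.coeff ij.1 c • PowerSeries.coeff ij.2 F := by
  rw [series_smul_def, PowerSeries.coeff_mul]
  exact Finset.sum_congr rfl fun ij _ => by rw [PowerSeries.coeff_map, Algebra.smul_def]

theorem isScalarTower_series : IsScalarTower K K⟦X⟧ V⟦X⟧ := ⟨fun a c F => by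
  ext n
  simp only [coeff_series_smul, PowerSeries.coeff_smul, smul_assoc, Finset.smul_sum]⟩

attribute [local instance] isScalarTower_series

variable (K V) in
/-- The inclusion of `V` in `V[[ħ]]`, as an algebra morphism. -/
def constAlg : V →ₐ[K] V⟦X⟧ :=
  AlgHom.ofLinearMap const (map_one (PowerSeries.C (R := V))) (map_mul (PowerSeries.C (R := V)))

variable (K V) in
/-- The natural map `K[[ħ]] ⊗ V → V[[ħ]]`, as an algebra morphism. -/
def toSeriesAlg : K⟦X⟧ ⊗[K] V →ₐ[K⟦X⟧] V⟦X⟧ :=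
  Algebra.TensorProduct.lift (Algebra.ofId K⟦X⟧ V⟦X⟧) (constAlg K V)
    (fun c _ => Algebra.commutes c _)

theorem toSeries_tmul (c : K⟦X⟧) (v : V) : toSeries (c ⊗ₜ[K] v) = c • (const (K := K) v : V⟦X⟧) := by
  ext n
  rw [series_smul_def]
  change _ = PowerSeries.coeff n (_ * PowerSeries.C v)
  rw [PowerSeries.coeff_mul_C]
  simp [toSeries, Algebra.smul_def]

theorem toSeries_eq (z : K⟦X⟧ ⊗[K] V) : toSeries z = toSeriesAlg K V z := by
  induction z using TensorProduct.induction_on with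
  | zero => simp
  | add a b ha hb => rw [map_add, map_add, ha, hb]
  | tmul c v => rw [toSeries_tmul]; rfl

theorem coeff_const (v : V) (n : ℕ) :
    PowerSeries.coeff n (const (K := K) v : V⟦X⟧) = if n = 0 then v else 0 :=
  PowerSeries.coeff_C n v

theorem coeff_mapSer (f : V →ₗ[K] W) (F : V⟦X⟧) (n : ℕ) :
    PowerSeries.coeff n (mapSer f F) = f (PowerSeries.coeff n F) := by simp [mapSer]

theorem mapSer_smul (f : V →ₗ[K] W) (c : K⟦X⟧) (F : V⟦X⟧) :
    mapSer f (c • F) = c • mapSer f F := by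
  ext n
  simp [coeff_mapSer, coeff_series_smul]

theorem mapSer_const (f : V →ₗ[K] W) (v : V) : mapSer f (const (K := K) v) = const (K := K) (f v) := by
  ext n
  rw [coeff_mapSer]
  rw [coeff_const, coeff_const]
  split_ifs <;> simp

theorem mapSer_mapSer {U : Type*} [Ring U] [Algebra K U] (g : W →ₗ[K] U) (f : V →ₗ[K] W)
    (F : V⟦X⟧) : mapSer g (mapSer f F) = mapSer (g ∘ₗ f) F := by
  ext n
  simp [coeff_mapSer]

theorem coeff_hExt (f : V →ₗ[K] W⟦X⟧) (F : V⟦X⟧) (n : ℕ) : PowerSeries.coeff n (hExt f F) =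
    ∑ ij ∈ Finset.HasAntidiagonal.antidiagonal n,
      PowerSeries.coeff ij.2 (f (PowerSeries.coeff ij.1 F)) := by simp [hExt]

theorem sum_antidiagonal_assoc {N : Type*} [AddCommMonoid N] (n : ℕ) (f : ℕ → ℕ → ℕ → N) :
    ∑ x ∈ Finset.HasAntidiagonal.antidiagonal n, ∑ y ∈ Finset.HasAntidiagonal.antidiagonal x.1,
        f y.1 y.2 x.2 =
      ∑ x ∈ Finset.HasAntidiagonal.antidiagonal n, ∑ y ∈ Finset.HasAntidiagonal.antidiagonal x.2,
        f x.1 y.1 y.2 := by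
  rw [Finset.sum_sigma', Finset.sum_sigma']
  refine Finset.sum_nbij' (fun x => ⟨(x.2.1, x.2.2 + x.1.2), (x.2.2, x.1.2)⟩)
    (fun x => ⟨(x.1.1 + x.2.1, x.2.2), (x.1.1, x.2.1)⟩) ?_ ?_ ?_ ?_ ?_
  · rintro ⟨⟨i, j⟩, ⟨k, l⟩⟩ h
    simp only [Finset.mem_sigma, Finset.HasAntidiagonal.mem_antidiagonal] at h ⊢
    exact ⟨by omega, trivial⟩
  · rintro ⟨⟨i, j⟩, ⟨k, l⟩⟩ h
    simp only [Finset.mem_sigma, Finset.HasAntidiagonal.mem_antidiagonal] at h ⊢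
    exact ⟨by omega, trivial⟩
  · rintro ⟨⟨i, j⟩, ⟨k, l⟩⟩ h
    simp only [Finset.mem_sigma, Finset.HasAntidiagonal.mem_antidiagonal] at h
    obtain ⟨h₁, rfl⟩ := h
    rfl
  · rintro ⟨⟨i, j⟩, ⟨k, l⟩⟩ h
    simp only [Finset.mem_sigma, Finset.HasAntidiagonal.mem_antidiagonal] at h
    obtain ⟨h₁, rfl⟩ := h
    rfl
  · rintro ⟨⟨i, j⟩, ⟨k, l⟩⟩ h
    rfl

theorem hExt_smul (f : V →ₗ[K] W⟦X⟧) (c : K⟦X⟧) (F : V⟦X⟧) : hExt f (c • F) = c • hExt f F := by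
  ext n
  simp only [coeff_hExt, coeff_series_smul, map_sum, map_smul, PowerSeries.coeff_smul,
    Finset.smul_sum]
  exact sum_antidiagonal_assoc n fun i j k =>
    PowerSeries.coeff i c • PowerSeries.coeff k (f (PowerSeries.coeff j F))

theorem hExt_hExt {U : Type*} [Ring U] [Algebra K U] (g : W →ₗ[K] U⟦X⟧) (f : V →ₗ[K] W⟦X⟧)
    (F : V⟦X⟧) : hExt g (hExt f F) = hExt (hExt g ∘ₗ f) F := by
  ext n
  simp only [coeff_hExt, map_sum, LinearMap.comp_apply]
  exact sum_antidiagonal_assoc n fun i j k =>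
    PowerSeries.coeff k (g (PowerSeries.coeff j (f (PowerSeries.coeff i F))))

theorem hExt_const (f : V →ₗ[K] W⟦X⟧) (v : V) : hExt f (const (K := K) v) = f v := by
  ext n
  rw [coeff_hExt, Finset.sum_eq_single (0, n)]
  · rw [coeff_const, if_pos rfl]
  · rintro ⟨i, j⟩ h hne
    rw [Finset.HasAntidiagonal.mem_antidiagonal] at h
    have hi : i ≠ 0 := by
      rintro rfl
      exact hne (by simp_all)
    rw [coeff_const, if_neg hi, map_zero, map_zero]
  · simp

theorem hExt_const_id (F : V⟦X⟧) : hExt (const (K := K)) F = F := by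
  ext n
  rw [coeff_hExt, Finset.sum_eq_single (n, 0)]
  · rw [coeff_const, if_pos rfl]
  · rintro ⟨i, j⟩ h hne
    rw [Finset.HasAntidiagonal.mem_antidiagonal] at h
    have hj : j ≠ 0 := by
      rintro rfl
      exact hne (by simp_all)
    rw [coeff_const, if_neg hj]
  · simp

theorem coeff_hTensor (F : V⟦X⟧) (G : W⟦X⟧) (n : ℕ) :
    PowerSeries.coeff n (hTensor (F ⊗ₜ[K] G)) =
      ∑ ij ∈ Finset.HasAntidiagonal.antidiagonal n,
        PowerSeries.coeff ij.1 F ⊗ₜ[K] PowerSeries.coeff ij.2 G := by simp [hTensor]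

theorem hTensor_const (v : V) (w : W) :
    hTensor ((const (K := K) v : V⟦X⟧) ⊗ₜ[K] (const (K := K) w : W⟦X⟧)) =
      const (K := K) (v ⊗ₜ[K] w) := by
  ext n
  rw [coeff_hTensor]
  rw [coeff_const]
  rcases n with _ | n
  · simp [coeff_const]
  · rw [if_neg (by omega)]
    refine Finset.sum_eq_zero fun ij h => ?_
    rw [Finset.HasAntidiagonal.mem_antidiagonal] at h
    rw [coeff_const, coeff_const]
    split_ifs <;> simp_all

theorem hTensor_smul_left (c : K⟦X⟧) (F : V⟦X⟧) (G : W⟦X⟧) :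
    hTensor ((c • F) ⊗ₜ[K] G) = c • hTensor (F ⊗ₜ[K] G) := by
  ext n
  simp only [coeff_hTensor, coeff_series_smul, sum_tmul, Finset.smul_sum, smul_tmul']
  exact sum_antidiagonal_assoc n fun i j k =>
    (PowerSeries.coeff i c • PowerSeries.coeff j F) ⊗ₜ[K] PowerSeries.coeff k G

theorem hTensor_smul_right (c : K⟦X⟧) (F : V⟦X⟧) (G : W⟦X⟧) :
    hTensor (F ⊗ₜ[K] (c • G)) = c • hTensor (F ⊗ₜ[K] G) := by
  ext n
  simp only [coeff_hTensor, coeff_series_smul, tmul_sum, Finset.smul_sum]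
  rw [← sum_antidiagonal_assoc n fun i j k =>
    PowerSeries.coeff i F ⊗ₜ[K] (PowerSeries.coeff j c • PowerSeries.coeff k G),
    ← sum_antidiagonal_assoc n fun i j k =>
    PowerSeries.coeff i c • (PowerSeries.coeff j F ⊗ₜ[K] PowerSeries.coeff k G)]
  refine Finset.sum_congr rfl fun x _ => ?_
  rw [← Finset.Nat.sum_antidiagonal_swap]
  refine Finset.sum_congr rfl fun y _ => ?_
  simp

theorem mapSer_hTensor {V' W' : Type*} [Ring V'] [Algebra K V'] [Ring W'] [Algebra K W']
    (f : V →ₗ[K] V') (g : W →ₗ[K] W') (F : V⟦X⟧) (G : W⟦X⟧) :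
    mapSer (TensorProduct.map f g) (hTensor (F ⊗ₜ[K] G)) =
      hTensor (mapSer f F ⊗ₜ[K] mapSer g G) := by
  ext n
  simp [coeff_hTensor, coeff_mapSer]

theorem mapSer_assoc {U : Type*} [Ring U] [Algebra K U] (F : V⟦X⟧) (G : W⟦X⟧) (H : U⟦X⟧) :
    mapSer (TensorProduct.assoc K V W U).toLinearMap (hTensor (hTensor (F ⊗ₜ[K] G) ⊗ₜ[K] H)) =
      hTensor (F ⊗ₜ[K] hTensor (G ⊗ₜ[K] H)) := by
  ext n
  simp only [coeff_hTensor, coeff_mapSer, sum_tmul, tmul_sum, map_sum]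
  exact sum_antidiagonal_assoc n fun i j k => PowerSeries.coeff i F ⊗ₜ[K]
    (PowerSeries.coeff j G ⊗ₜ[K] PowerSeries.coeff k H)

theorem mapSer_conc {M : Type*} [AddCommGroup M] [Module K M] (F G : (TensorAlgebra K M)⟦X⟧) :
    mapSer (conc K M) (hTensor (F ⊗ₜ[K] G)) = F * G := by
  ext n
  simp [coeff_hTensor, coeff_mapSer, PowerSeries.coeff_mul, conc]

theorem mapSer_mk_one (G : W⟦X⟧) :
    mapSer (TensorProduct.mk K V W 1) G = hTensor ((1 : V⟦X⟧) ⊗ₜ[K] G) := by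
  ext n
  rw [coeff_mapSer, coeff_hTensor, Finset.sum_eq_single (0, n)]
  · simp
  · rintro ⟨i, j⟩ h hne
    rw [Finset.HasAntidiagonal.mem_antidiagonal] at h
    have hi : i ≠ 0 := by
      rintro rfl
      exact hne (by simp_all)
    rw [PowerSeries.coeff_one, if_neg hi, zero_tmul]
  · simp

theorem mapSer_mk_flip_one (F : V⟦X⟧) :
    mapSer ((TensorProduct.mk K V W).flip 1) F = hTensor (F ⊗ₜ[K] (1 : W⟦X⟧)) := by
  ext n
  rw [coeff_mapSer, coeff_hTensor, Finset.sum_eq_single (n, 0)]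
  · simp
  · rintro ⟨i, j⟩ h hne
    rw [Finset.HasAntidiagonal.mem_antidiagonal] at h
    have hj : j ≠ 0 := by
      rintro rfl
      exact hne (by simp_all)
    rw [PowerSeries.coeff_one, if_neg hj, tmul_zero]
  · simp

theorem mapSer_id (F : V⟦X⟧) : mapSer (LinearMap.id : V →ₗ[K] V) F = F := by
  ext n
  simp [coeff_mapSer]

variable (V W) in
/-- The map `hTensor`, as a bilinear map over `K[[ħ]]`. -/
def hTensorBilin : V⟦X⟧ →ₗ[K⟦X⟧] W⟦X⟧ →ₗ[K⟦X⟧] (V ⊗[K] W)⟦X⟧ :=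
  LinearMap.mk₂ K⟦X⟧ (fun F G => hTensor (F ⊗ₜ[K] G))
    (fun F F' G => by rw [add_tmul, map_add]) hTensor_smul_left
    (fun F G G' => by rw [tmul_add, map_add]) hTensor_smul_right

/-- The map `mapSer f`, linear over `K[[ħ]]`. -/
def mapSerLin (f : V →ₗ[K] W) : V⟦X⟧ →ₗ[K⟦X⟧] W⟦X⟧ where
  toFun := mapSer f
  map_add' := map_add _
  map_smul' := mapSer_smul f

/-- The map `hExt f`, linear over `K[[ħ]]`. -/
def hExtLin (f : V →ₗ[K] W⟦X⟧) : V⟦X⟧ →ₗ[K⟦X⟧] W⟦X⟧ where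
  toFun := hExt f
  map_add' := map_add _
  map_smul' := hExt_smul f

/-- The map `hMul μ`, as a bilinear map over `K[[ħ]]`. -/
def hMulBilin (μ : V ⊗[K] V →ₗ[K] V⟦X⟧) : V⟦X⟧ →ₗ[K⟦X⟧] V⟦X⟧ →ₗ[K⟦X⟧] V⟦X⟧ :=
  (hTensorBilin V V).compr₂ (hExtLin μ)

theorem hMul_const (μ : V ⊗[K] V →ₗ[K] V⟦X⟧) (v w : V) :
    hMul μ ((const (K := K) v : V⟦X⟧) ⊗ₜ[K] (const (K := K) w : V⟦X⟧)) = μ (v ⊗ₜ[K] w) := by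
  rw [hMul, LinearMap.comp_apply, hTensor_const, hExt_const]

/-- An algebra over `K[[ħ]]`, spanned by elements which are mapped to `V`, with a morphism to
`V[[ħ]]` with a deformed multiplication. -/
structure SeriesModel (K V A : Type*) [Field K] [Ring V] [Algebra K V] [Ring A]
    [Algebra K⟦X⟧ A] where
  μ : V ⊗[K] V →ₗ[K] V⟦X⟧
  Φ : A →ₗ[K⟦X⟧] V⟦X⟧
  span : Submodule.span K⟦X⟧ {x | ∃ v : V, Φ x = const (K := K) v} = ⊤
  map_one : Φ 1 = 1
  map_mul : ∀ x y, Φ (x * y) = hMul μ (Φ x ⊗ₜ[K] Φ y)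

namespace SeriesModel

variable {A : Type*} [Ring A] [Algebra K⟦X⟧ A] {B : Type*} [Ring B] [Algebra K⟦X⟧ B]

/-- Identities linear over `K[[ħ]]` need only be checked on elements which map to constants. On
those, the extended maps `hExt`, `hTensor` and `hMul` reduce to the maps over `K`. -/
theorem linearMap_ext (m : SeriesModel K V A) {N : Type*} [AddCommGroup N] [Module K⟦X⟧ N]
    {f g : A →ₗ[K⟦X⟧] N} (h : ∀ x v, m.Φ x = const (K := K) v → f x = g x) : f = g :=
  LinearMap.ext_on m.span fun x ⟨v, hv⟩ => h x v hv

variable (m : SeriesModel K V A) (m' : SeriesModel K W B)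

/-- The tensor product of the maps to series. -/
def tensorΦ : A ⊗[K⟦X⟧] B →ₗ[K⟦X⟧] (V ⊗[K] W)⟦X⟧ :=
  TensorProduct.lift ((hTensorBilin V W).compl₁₂ m.Φ m'.Φ)

theorem tensorΦ_tmul (a : A) (b : B) :
    m.tensorΦ m' (a ⊗ₜ b) = hTensor (m.Φ a ⊗ₜ[K] m'.Φ b) := rfl

theorem span_tensor : Submodule.span K⟦X⟧ {x | ∃ v : V ⊗[K] W,
    m.tensorΦ m' x = const (K := K) v} = ⊤ := by
  refine eq_top_iff.mpr ?_
  rw [← TensorProduct.map₂_mk_top_top_eq_top, ← m.span, ← m'.span, Submodule.map₂_span_span]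
  refine Submodule.span_mono ?_
  rintro _ ⟨a, ⟨v, hv⟩, b, ⟨w, hw⟩, rfl⟩
  exact ⟨v ⊗ₜ w, (m.tensorΦ_tmul m' a b).trans (by rw [hv, hw, hTensor_const])⟩

/-- The tensor product of two models. -/
def tensor : SeriesModel K (V ⊗[K] W) (A ⊗[K⟦X⟧] B) where
  μ := tensorMul m.μ m'.μ
  Φ := m.tensorΦ m'
  span := m.span_tensor m'
  map_one := by
    rw [Algebra.TensorProduct.one_def, tensorΦ_tmul, m.map_one, m'.map_one]
    exact hTensor_const (1 : V) (1 : W)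
  map_mul x y := by
    have h : ((LinearMap.mul K⟦X⟧ (A ⊗[K⟦X⟧] B)).compr₂ (m.tensorΦ m')) =
        (hMulBilin (tensorMul m.μ m'.μ)).compl₁₂ (m.tensorΦ m') (m.tensorΦ m') := by
      -- For constants, both sides are the product of the two deformed multiplications, with the
      -- middle factors exchanged as in `tensorMul`.
      refine TensorProduct.ext (m.linearMap_ext fun a v hv => m'.linearMap_ext fun b w hw =>
        TensorProduct.ext (m.linearMap_ext fun a' v' hv' => m'.linearMap_ext fun b' w' hw' => ?_))
      change m.tensorΦ m' ((a ⊗ₜ b) * (a' ⊗ₜ b')) =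
        hMul (tensorMul m.μ m'.μ) (m.tensorΦ m' (a ⊗ₜ b) ⊗ₜ[K] m.tensorΦ m' (a' ⊗ₜ b'))
      rw [Algebra.TensorProduct.tmul_mul_tmul, tensorΦ_tmul, tensorΦ_tmul, tensorΦ_tmul, m.map_mul,
        m'.map_mul, hv, hw, hv', hw', hTensor_const, hTensor_const, hMul_const, hMul_const,
        hMul_const]
      rfl
    exact LinearMap.congr_fun₂ h x y

theorem tensor_Φ_tmul (a : A) (b : B) :
    (m.tensor m').Φ (a ⊗ₜ b) = hTensor (m.Φ a ⊗ₜ[K] m'.Φ b) := rfl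

theorem map_foldr (l : List A) : m.Φ (l.foldr (· * ·) 1) =
    (l.map m.Φ).foldr (fun F G => hMul m.μ (F ⊗ₜ[K] G)) 1 := by
  induction l with
  | nil => exact m.map_one
  | cons a l ih => rw [List.foldr_cons, m.map_mul, ih, List.map_cons, List.foldr_cons]

end SeriesModel

end SeriesAlgebra

end ShuffleHopf

end

noncomputable section

namespace ShuffleHopf

open TensorProduct TensorAlgebra WordGraded

/-! ### Words with coefficients in formal series -/

section SeriesWords

variable {K : Type*} [Field K] {𝔤 : Type*} [AddCommGroup 𝔤] [Module K 𝔤]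

attribute [local instance] seriesAlgebra
attribute [local instance] isScalarTower_series

variable (K 𝔤) in
/-- The natural map from the tensor algebra of `K[[ħ]] ⊗ 𝔤` to `T(𝔤)[[ħ]]`. -/
def serMap : TensorAlgebra K⟦X⟧ (K⟦X⟧ ⊗[K] 𝔤) →ₐ[K⟦X⟧] (TensorAlgebra K 𝔤)⟦X⟧ :=
  TensorAlgebra.lift K⟦X⟧ ((toSeriesAlg K (TensorAlgebra K 𝔤)).toLinearMap ∘ₗ
    (TensorAlgebra.ι K (M := 𝔤)).baseChange K⟦X⟧)

theorem serMap_ι (z : K⟦X⟧ ⊗[K] 𝔤) : serMap K 𝔤 (ι K⟦X⟧ z) =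
    toSeriesAlg K (TensorAlgebra K 𝔤) (LinearMap.lTensor K⟦X⟧ (ι K) z) :=
  TensorAlgebra.lift_ι_apply _ _

theorem serMap_ι_one_tmul (x : 𝔤) :
    serMap K 𝔤 (ι K⟦X⟧ ((1 : K⟦X⟧) ⊗ₜ[K] x)) = const (K := K) (ι K x) := by
  rw [serMap_ι, ← toSeries_eq, LinearMap.lTensor_tmul, toSeries_tmul, one_smul]

theorem serMap_tprod {n : ℕ} (x : Fin n → 𝔤) :
    serMap K 𝔤 (tprod K⟦X⟧ (K⟦X⟧ ⊗[K] 𝔤) n fun i => (1 : K⟦X⟧) ⊗ₜ[K] x i) =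
      const (K := K) (tprod K 𝔤 n x) := by
  rw [TensorAlgebra.tprod_apply, TensorAlgebra.tprod_apply, map_list_prod, List.map_ofFn]
  change _ = constAlg K _ (List.ofFn _).prod
  rw [map_list_prod, List.map_ofFn]
  congr 2
  funext i
  exact serMap_ι_one_tmul (x i)

theorem span_tprod_one_tmul : Submodule.span K⟦X⟧ {u : TensorAlgebra K⟦X⟧ (K⟦X⟧ ⊗[K] 𝔤) |
    ∃ (n : ℕ) (x : Fin n → 𝔤), u = tprod K⟦X⟧ _ n fun i => (1 : K⟦X⟧) ⊗ₜ[K] x i} = ⊤ := by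
  refine eq_top_iff.mpr fun u h => ?_
  clear h
  induction u using left_induction with
  | one => exact Submodule.subset_span ⟨0, Fin.elim0, by simp [TensorAlgebra.tprod_apply]⟩
  | add u v hu hv => exact add_mem hu hv
  | smul a u hu => exact Submodule.smul_mem _ a hu
  | letter_mul z v hv =>
    induction z using TensorProduct.induction_on with
    | zero => simp
    | add a b ha hb => rw [map_add, add_mul]; exact add_mem ha hb
    | tmul c y =>
      have hc : c ⊗ₜ[K] y = c • ((1 : K⟦X⟧) ⊗ₜ[K] y) := by rw [smul_tmul', smul_eq_mul, mul_one]
      rw [hc, map_smul, smul_mul_assoc]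
      refine Submodule.smul_mem _ c ?_
      induction hv using Submodule.span_induction with
      | zero => simp
      | add a b _ _ ha hb => rw [mul_add]; exact add_mem ha hb
      | smul c a _ ha => rw [mul_smul_comm]; exact Submodule.smul_mem _ c ha
      | mem a ha =>
        obtain ⟨n, x, rfl⟩ := ha
        refine Submodule.subset_span ⟨n + 1, Fin.cons y x, ?_⟩
        rw [TensorAlgebra.tprod_apply, TensorAlgebra.tprod_apply, List.ofFn_succ, List.prod_cons]
        simp

theorem linearMap_ext_one_tmul {N : Type*} [AddCommMonoid N] [Module K⟦X⟧ N]
    {f g : TensorAlgebra K⟦X⟧ (K⟦X⟧ ⊗[K] 𝔤) →ₗ[K⟦X⟧] N}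
    (h : ∀ (n : ℕ) (x : Fin n → 𝔤), f (tprod K⟦X⟧ _ n fun i => (1 : K⟦X⟧) ⊗ₜ[K] x i) =
      g (tprod K⟦X⟧ _ n fun i => (1 : K⟦X⟧) ⊗ₜ[K] x i)) : f = g :=
  LinearMap.ext_on span_tprod_one_tmul (by rintro _ ⟨n, x, rfl⟩; exact h n x)

/-- A linear map which is compatible on words with a linear map over `K` is compatible with its
extension to series. -/
theorem serMap_map {W : Type*} [Ring W] [Algebra K W] {N : Type*} [AddCommMonoid N] [Module K⟦X⟧ N]
    (f : TensorAlgebra K⟦X⟧ (K⟦X⟧ ⊗[K] 𝔤) →ₗ[K⟦X⟧] N) (Φ : N →ₗ[K⟦X⟧] W⟦X⟧)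
    (g : TensorAlgebra K 𝔤 →ₗ[K] W)
    (h : ∀ (n : ℕ) (x : Fin n → 𝔤), Φ (f (tprod K⟦X⟧ _ n fun i => (1 : K⟦X⟧) ⊗ₜ[K] x i)) =
      const (K := K) (g (tprod K 𝔤 n x))) (u : TensorAlgebra K⟦X⟧ (K⟦X⟧ ⊗[K] 𝔤)) :
    Φ (f u) = mapSer g (serMap K 𝔤 u) := by
  have h' : Φ ∘ₗ f = mapSerLin g ∘ₗ (serMap K 𝔤).toLinearMap :=
    linearMap_ext_one_tmul fun n x => by
      refine (h n x).trans ?_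
      change _ = mapSer g (serMap K 𝔤 _)
      rw [serMap_tprod, mapSer_const]
  exact LinearMap.congr_fun h' u

theorem prT_tprod {R M : Type*} [CommRing R] [AddCommGroup M] [Module R M] (n : ℕ)
    (x : Fin n → M) : prT R M (tprod R M n x) = if n = 1 then tprod R M n x else 0 := by
  rw [← word_ofFn, prT_word, List.length_ofFn]

theorem serMap_prT (u : TensorAlgebra K⟦X⟧ (K⟦X⟧ ⊗[K] 𝔤)) :
    serMap K 𝔤 (prT _ _ u) = mapSer (prOne K 𝔤) (serMap K 𝔤 u) := by
  refine serMap_map (prT _ _) (serMap K 𝔤).toLinearMap _ (fun n x => ?_) u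
  rw [prOne, wordLift_tprod, prT_tprod]
  split_ifs
  · exact serMap_tprod x
  · simp

theorem revT_tprod {R M : Type*} [CommRing R] [AddCommGroup M] [Module R M] {n : ℕ}
    (x : Fin n → M) : revT R M (tprod R M n x) = tprod R M n (x ∘ Fin.rev) := by
  rw [← word_ofFn, ← word_ofFn, revT_word]
  congr 1
  apply List.ext_getElem
  · simp
  · intro i h1 h2
    simp only [List.getElem_reverse, List.getElem_ofFn, List.length_ofFn, Function.comp_apply]
    congr 1
    ext
    simp [Fin.val_rev]
    omega

theorem serMap_revT (u : TensorAlgebra K⟦X⟧ (K⟦X⟧ ⊗[K] 𝔤)) :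
    serMap K 𝔤 (revT _ _ u) = mapSer (wordRev K 𝔤) (serMap K 𝔤 u) := by
  refine serMap_map (revT _ _) (serMap K 𝔤).toLinearMap _ (fun n x => ?_) u
  rw [wordRev, wordLift_tprod, revT_tprod]
  exact serMap_tprod (x ∘ Fin.rev)

variable (K) in
/-- The coefficients `1 / (n - 1)`. -/
def homotopyCoeff (n : ℕ) : K⟦X⟧ := if 2 ≤ n then PowerSeries.C (((n : K) - 1)⁻¹) else 0

theorem homotopyCoeff_zero : homotopyCoeff K 0 = 0 := by simp [homotopyCoeff]

/-- Characteristic zero enters through this lemma: `n - 1` has to be invertible for all `n ≥ 2`. -/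
theorem homotopyCoeff_mul [CharZero K] (n : ℕ) (hn : 2 ≤ n) :
    homotopyCoeff K n * ((n : K⟦X⟧) - 1) = 1 := by
  have h : ((n : K) - 1) ≠ 0 := by
    rw [sub_ne_zero]
    exact_mod_cast (by omega : n ≠ 1)
  rw [homotopyCoeff, if_pos hn]
  have h' : ((n : K⟦X⟧) - 1) = PowerSeries.C ((n : K) - 1) := by simp
  rw [h', ← map_mul, inv_mul_cancel₀ h, map_one]

theorem serMap_weight (u : TensorAlgebra K⟦X⟧ (K⟦X⟧ ⊗[K] 𝔤)) :
    serMap K 𝔤 (weight (homotopyCoeff K) u) = mapSer (degWeight K 𝔤) (serMap K 𝔤 u) := by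
  refine serMap_map (weight (homotopyCoeff K)) (serMap K 𝔤).toLinearMap _ (fun n x => ?_) u
  have hw := word_mem_words (R := K⟦X⟧) (List.ofFn fun i => (1 : K⟦X⟧) ⊗ₜ[K] x i)
  rw [List.length_ofFn, word_ofFn] at hw
  rw [weight_words _ hw, map_smul, AlgHom.toLinearMap_apply, serMap_tprod, degWeight,
    wordLift_tprod, homotopyCoeff]
  split_ifs
  · rw [smul_apply, map_smul]
    ext m
    rw [coeff_series_smul, Finset.sum_eq_single (0, m)]
    · simp
    · rintro ⟨i, j⟩ h hne
      rw [Finset.HasAntidiagonal.mem_antidiagonal] at h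
      have hi : i ≠ 0 := by
        rintro rfl
        exact hne (by simp_all)
      rw [PowerSeries.coeff_C, if_neg hi, zero_smul]
    · simp
  · simp

variable (K 𝔤) in
/-- The map from tensor products of tensor algebras to series. -/
def serMap₂ (𝔥 : Type*) [AddCommGroup 𝔥] [Module K 𝔥] :
    TensorAlgebra K⟦X⟧ (K⟦X⟧ ⊗[K] 𝔤) ⊗[K⟦X⟧] TensorAlgebra K⟦X⟧ (K⟦X⟧ ⊗[K] 𝔥) →ₗ[K⟦X⟧]
      (TensorAlgebra K 𝔤 ⊗[K] TensorAlgebra K 𝔥)⟦X⟧ :=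
  TensorProduct.lift ((hTensorBilin (K := K) _ _).compl₁₂ (serMap K 𝔤).toLinearMap
    (serMap K 𝔥).toLinearMap)

theorem serMap₂_tmul {𝔥 : Type*} [AddCommGroup 𝔥] [Module K 𝔥]
    (u : TensorAlgebra K⟦X⟧ (K⟦X⟧ ⊗[K] 𝔤)) (v : TensorAlgebra K⟦X⟧ (K⟦X⟧ ⊗[K] 𝔥)) :
    serMap₂ K 𝔤 𝔥 (u ⊗ₜ v) = hTensor (serMap K 𝔤 u ⊗ₜ[K] serMap K 𝔥 v) := rfl

theorem take_ofFn {α : Type*} {n : ℕ} (x : Fin n → α) {i : ℕ} (hi : i ≤ n) :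
    (List.ofFn x).take i = List.ofFn fun j : Fin i => x (Fin.castLE hi j) := by
  apply List.ext_getElem
  · simp [hi]
  · intro j h1 h2
    simp

theorem drop_ofFn {α : Type*} {n : ℕ} (x : Fin n → α) {i : ℕ} (hi : i ≤ n) :
    (List.ofFn x).drop i = List.ofFn fun j : Fin (n - i) =>
      x (Fin.cast (Nat.add_sub_of_le hi) (Fin.natAdd i j)) := by
  apply List.ext_getElem
  · simp
  · intro j h1 h2
    simp

theorem comulT_tprod {R M : Type*} [CommRing R] [AddCommGroup M] [Module R M] {n : ℕ}
    (x : Fin n → M) : comulT (tprod R M n x) = ∑ i : Fin (n + 1),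
      (tprod R M i fun j => x (Fin.castLE (Nat.le_of_lt_succ i.2) j)) ⊗ₜ[R]
        (tprod R M (n - i) fun j =>
          x (Fin.cast (Nat.add_sub_of_le (Nat.le_of_lt_succ i.2)) (Fin.natAdd i j))) := by
  rw [← word_ofFn, comulT_word, List.length_ofFn, Finset.sum_range]
  refine Finset.sum_congr rfl fun i _ => ?_
  rw [take_ofFn x (Nat.le_of_lt_succ i.2), drop_ofFn x (Nat.le_of_lt_succ i.2), word_ofFn,
    word_ofFn]

theorem decon_tprod {n : ℕ} (x : Fin n → 𝔤) : decon K 𝔤 (tprod K 𝔤 n x) = ∑ i : Fin (n + 1),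
      (tprod K 𝔤 i fun j => x (Fin.castLE (Nat.le_of_lt_succ i.2) j)) ⊗ₜ[K]
        (tprod K 𝔤 (n - i) fun j =>
          x (Fin.cast (Nat.add_sub_of_le (Nat.le_of_lt_succ i.2)) (Fin.natAdd i j))) := by
  rw [decon, wordLift_tprod, sum_apply]
  refine Finset.sum_congr rfl fun i _ => ?_
  rw [MultilinearMap.domDomCongr_apply, MultilinearMap.domCoprod_apply]
  rfl

theorem serMap₂_comulT (u : TensorAlgebra K⟦X⟧ (K⟦X⟧ ⊗[K] 𝔤)) :
    serMap₂ K 𝔤 𝔤 (comulT u) = mapSer (decon K 𝔤) (serMap K 𝔤 u) := by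
  refine serMap_map comulT (serMap₂ K 𝔤 𝔤) _ (fun n x => ?_) u
  rw [comulT_tprod, decon_tprod, map_sum, map_sum]
  refine Finset.sum_congr rfl fun i _ => ?_
  rw [serMap₂_tmul, serMap_tprod, serMap_tprod, hTensor_const]

end SeriesWords

/-! ### The shuffle and concatenation products as models of formal series. -/

section SeriesSh

variable {K : Type*} [Field K] {𝔤 : Type*} [LieRing 𝔤] [LieAlgebra K 𝔤]

attribute [local instance] seriesAlgebra
attribute [local instance] isScalarTower_series

/-- Both sides are the same sum over blocks, with the Lie polynomials evaluated at the letters `1 ⊗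
x_i` and `1 ⊗ y_j` of `K[[ħ]] ⊗ 𝔤`. -/
theorem serMap_shuffle (ω : LieFamily K⟦X⟧) {p q : ℕ} (x : Fin p → 𝔤) (y : Fin q → 𝔤) :
    serMap K 𝔤 (cofreeLin (shuffleβ ω (K⟦X⟧ ⊗[K] 𝔤))
      ((tprod K⟦X⟧ _ p fun i => (1 : K⟦X⟧) ⊗ₜ[K] x i) ⊗ₜ
        (tprod K⟦X⟧ _ q fun i => (1 : K⟦X⟧) ⊗ₜ[K] y i))) =
      shMul ω 𝔤 (tprod K 𝔤 p x ⊗ₜ tprod K 𝔤 q y) := by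
  rw [cofreeLin_shuffleβ, shMul, LinearMap.comp_apply, wordLift₂_tprod, shuffleWord, toSeries_eq]
  simp only [map_sum, sum_apply]
  refine Finset.sum_congr rfl fun k _ => Finset.sum_congr rfl fun P _ =>
    Finset.sum_congr rfl fun Q _ => ?_
  rw [TensorAlgebra.tprod_apply, map_list_prod, List.map_ofFn, MultilinearMap.domDomCongr_apply]
  change _ = toSeriesAlg K _ (List.ofFn _).prod
  rw [map_list_prod, List.map_ofFn]
  congr 2
  funext β
  rw [Function.comp_apply, serMap_ι]
  change _ = toSeriesAlg K _ (LinearMap.lTensor K⟦X⟧ (ι K) _)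
  congr 2
  change FreeLieAlgebra.lift _ _ _ = FreeLieAlgebra.lift _ _ _
  congr 2
  funext i
  rcases i with i | i <;> rfl

/-- The model of `T(𝔤)[[ħ]]` with the product given by a family of Lie polynomials. -/
def shModel (ω : LieFamily K⟦X⟧) (D : ProductDatum K⟦X⟧ (K⟦X⟧ ⊗[K] 𝔤))
    (hD : D.β = shuffleβ ω (K⟦X⟧ ⊗[K] 𝔤)) : SeriesModel K (TensorAlgebra K 𝔤) (Sh D) where
  μ := shMul ω 𝔤
  Φ := (serMap K 𝔤).toLinearMap ∘ₗ Sh.ofT.symm.toLinearMap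
  span := by
    refine eq_top_iff.mpr (le_trans (span_tprod_one_tmul (K := K) (𝔤 := 𝔤)).ge
      (Submodule.span_mono ?_))
    rintro _ ⟨n, x, rfl⟩
    exact ⟨_, serMap_tprod x⟩
  map_one := map_one (serMap K 𝔤)
  map_mul x y := by
    have h : ((LinearMap.mul K⟦X⟧ (Sh D)).compr₂
        ((serMap K 𝔤).toLinearMap ∘ₗ Sh.ofT.symm.toLinearMap)).compl₁₂ Sh.ofT.toLinearMap
          Sh.ofT.toLinearMap =
        (hMulBilin (shMul ω 𝔤)).compl₁₂ (serMap K 𝔤).toLinearMap (serMap K 𝔤).toLinearMap := by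
      refine linearMap_ext_one_tmul fun n x => linearMap_ext_one_tmul fun m y => ?_
      change serMap K 𝔤 (cofreeLin D.β (_ ⊗ₜ _)) = hMul (shMul ω 𝔤) (serMap K 𝔤 _ ⊗ₜ[K] serMap K 𝔤 _)
      rw [hD, serMap_tprod, serMap_tprod, hMul_const]
      exact serMap_shuffle ω x y
    exact LinearMap.congr_fun₂ h (Sh.ofT.symm x) (Sh.ofT.symm y)

theorem shModel_Φ (ω : LieFamily K⟦X⟧) (D : ProductDatum K⟦X⟧ (K⟦X⟧ ⊗[K] 𝔤))
    (hD : D.β = shuffleβ ω (K⟦X⟧ ⊗[K] 𝔤)) (x : TensorAlgebra K⟦X⟧ (K⟦X⟧ ⊗[K] 𝔤)) :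
    (shModel ω D hD).Φ (Sh.ofT x) = serMap K 𝔤 x := rfl

variable (K 𝔤) in
/-- The model of `T(𝔤)[[ħ]]` with the concatenation product. -/
def concModel : SeriesModel K (TensorAlgebra K 𝔤) (TensorAlgebra K⟦X⟧ (K⟦X⟧ ⊗[K] 𝔤)) where
  μ := const ∘ₗ conc K 𝔤
  Φ := (serMap K 𝔤).toLinearMap
  span := by
    refine eq_top_iff.mpr (le_trans (span_tprod_one_tmul (K := K) (𝔤 := 𝔤)).ge
      (Submodule.span_mono ?_))
    rintro _ ⟨n, x, rfl⟩
    exact ⟨_, serMap_tprod x⟩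
  map_one := map_one (serMap K 𝔤)
  map_mul x y := by
    rw [AlgHom.toLinearMap_apply, map_mul, ← mapSer_conc]
    change _ = hExt _ (hTensor _)
    ext n
    rw [coeff_mapSer, coeff_hExt, Finset.sum_eq_single (n, 0)]
    · simp [coeff_const]
    · rintro ⟨i, j⟩ h hne
      rw [Finset.HasAntidiagonal.mem_antidiagonal] at h
      have hj : j ≠ 0 := by
        rintro rfl
        exact hne (by simp_all)
      rw [LinearMap.comp_apply, coeff_const, if_neg hj]
    · simp

end SeriesSh

end ShuffleHopf

end

noncomputable section

namespace ShuffleHopf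

open TensorProduct TensorAlgebra WordGraded

/-! ### Comparison with formal series -/

section ModelMaps

variable {K : Type*} [Field K] {V : Type*} [Ring V] [Algebra K V] {W : Type*} [Ring W] [Algebra K W]

attribute [local instance] seriesAlgebra
attribute [local instance] isScalarTower_series

variable {A : Type*} [Ring A] [Algebra K⟦X⟧ A] {B : Type*} [Ring B] [Algebra K⟦X⟧ B]
  (m : SeriesModel K V A) (m' : SeriesModel K W B)

namespace SeriesModel

theorem Φ_inL (u : A ⊗[K⟦X⟧] B) :
    (m.tensor (m.tensor m')).Φ (Algebra.TensorProduct.assoc K⟦X⟧ K⟦X⟧ K⟦X⟧ A A B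
      (leg (Algebra.TensorProduct.includeLeft : A →ₐ[K⟦X⟧] A ⊗[K⟦X⟧] A) B u)) =
      mapSer (ins13 K V V W) ((m.tensor m').Φ u) := by
  induction u using TensorProduct.induction_on with
  | zero => simp
  | add a b ha hb => simp only [map_add, ha, hb]
  | tmul a b =>
    rw [leg_tmul, Algebra.TensorProduct.includeLeft_apply, Algebra.TensorProduct.assoc_tmul,
      tensor_Φ_tmul, tensor_Φ_tmul, tensor_Φ_tmul, m.map_one, ins13, LinearMap.lTensor,
      mapSer_hTensor, mapSer_id, mapSer_mk_one]

theorem Φ_inR (u : A ⊗[K⟦X⟧] B) :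
    (m.tensor (m.tensor m')).Φ (Algebra.TensorProduct.assoc K⟦X⟧ K⟦X⟧ K⟦X⟧ A A B
      (leg (Algebra.TensorProduct.includeRight : A →ₐ[K⟦X⟧] A ⊗[K⟦X⟧] A) B u)) =
      mapSer (ins23 K V V W) ((m.tensor m').Φ u) := by
  induction u using TensorProduct.induction_on with
  | zero => simp
  | add a b ha hb => simp only [map_add, ha, hb]
  | tmul a b =>
    rw [leg_tmul, Algebra.TensorProduct.includeRight_apply, Algebra.TensorProduct.assoc_tmul,
      tensor_Φ_tmul, tensor_Φ_tmul, m.map_one, ins23, mapSer_mk_one]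

theorem Φ_emb13 (u : A ⊗[K⟦X⟧] B) :
    (m.tensor (m'.tensor m')).Φ (emb13 K⟦X⟧ A B u) =
      mapSer (ins13 K V W W) ((m.tensor m').Φ u) := by
  induction u using TensorProduct.induction_on with
  | zero => simp
  | add a b ha hb => simp only [map_add, ha, hb]
  | tmul a b =>
    rw [emb13_tmul, tensor_Φ_tmul, tensor_Φ_tmul, tensor_Φ_tmul, m'.map_one, ins13,
      LinearMap.lTensor, mapSer_hTensor, mapSer_id, mapSer_mk_one]

theorem Φ_emb12 (u : A ⊗[K⟦X⟧] B) :
    (m.tensor (m'.tensor m')).Φ (emb12 K⟦X⟧ A B u) =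
      mapSer (ins12 K V W W) ((m.tensor m').Φ u) := by
  induction u using TensorProduct.induction_on with
  | zero => simp
  | add a b ha hb => simp only [map_add, ha, hb]
  | tmul a b =>
    rw [emb12_tmul, tensor_Φ_tmul, tensor_Φ_tmul, tensor_Φ_tmul, m'.map_one, ins12,
      LinearMap.lTensor, mapSer_hTensor, mapSer_id, mapSer_mk_flip_one]

end SeriesModel

theorem mapSer_assoc_symm {U : Type*} [Ring U] [Algebra K U] (F : V⟦X⟧) (G : W⟦X⟧) (H : U⟦X⟧) :
    mapSer (TensorProduct.assoc K V W U).symm.toLinearMap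
      (hTensor (F ⊗ₜ[K] hTensor (G ⊗ₜ[K] H))) = hTensor (hTensor (F ⊗ₜ[K] G) ⊗ₜ[K] H) := by
  rw [← mapSer_assoc, mapSer_mapSer]
  ext n
  simp [coeff_mapSer]

end ModelMaps

theorem tupleSum_one {S : Type*} [Ring S] {ρ : ℕ → S} (h0 : ρ 0 = 0) : tupleSum ρ 1 = ρ 1 := by
  have h := congrArg (PowerSeries.coeff 1) (tupleSum_geometric h0)
  rw [map_add, PowerSeries.coeff_mk, PowerSeries.coeff_one, PowerSeries.coeff_mul,
    Finset.Nat.antidiagonal_succ] at h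
  rw [h]
  simp [h0, tupleSum]

/-! ### Transfer of the recursion and of the coproduct formulas to formal series. -/

section Transfer

variable {K : Type*} [Field K] {𝔞 : Type*} [LieRing 𝔞] [LieAlgebra K 𝔞]
  {𝔟 : Type*} [LieRing 𝔟] [LieAlgebra K 𝔟] {ω : LieFamily K⟦X⟧}

attribute [local instance] seriesAlgebra
attribute [local instance] isScalarTower_series

variable (𝔞) in
/-- The bialgebra attached to a family of Lie polynomials, before completion. -/
abbrev ShSer (hω : ω.IsShuffleFamily) : Type _ := Sh (shuffleDatum (K⟦X⟧ ⊗[K] 𝔞) hω)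

variable (𝔞) in
/-- The model given by a family of Lie polynomials. -/
abbrev familyModel (hω : ω.IsShuffleFamily) :
    SeriesModel K (TensorAlgebra K 𝔞) (ShSer 𝔞 hω) := shModel ω _ rfl

variable (𝔞) in
/-- The model given by the opposite family. -/
abbrev veeModel (hω : ω.IsShuffleFamily) :
    SeriesModel K (TensorAlgebra K 𝔞) (Sh (shuffleDatum (K⟦X⟧ ⊗[K] 𝔞) hω).rev) :=
  shModel ω.vee _ (shuffleDatum_rev_β hω)

variable (hω : ω.IsShuffleFamily)

/-- The map to series, for the product of the shuffle and concatenation models. -/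
abbrev mixedΦ : ShSer 𝔞 hω ⊗[K⟦X⟧] TensorAlgebra K⟦X⟧ (K⟦X⟧ ⊗[K] 𝔟) →ₗ[K⟦X⟧]
    (TensorAlgebra K 𝔞 ⊗[K] TensorAlgebra K 𝔟)⟦X⟧ :=
  ((familyModel 𝔞 hω).tensor (concModel K 𝔟)).Φ

theorem mixedΦ_tupleSum
    (ρ : ℕ → ShSer 𝔞 hω ⊗[K⟦X⟧] TensorAlgebra K⟦X⟧ (K⟦X⟧ ⊗[K] 𝔟)) (n : ℕ) :
    mixedΦ hω (tupleSum ρ n) = rPrimeOf ω (fun j => mixedΦ hω (ρ j)) n := by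
  rw [tupleSum, rPrimeOf, map_sum]
  refine Finset.sum_congr rfl fun k _ => ?_
  rw [map_sum]
  refine Finset.sum_congr rfl fun P _ => ?_
  rw [SeriesModel.map_foldr, List.map_ofFn]
  rfl

theorem veeΦ_lTensor (u : ShSer 𝔞 hω ⊗[K⟦X⟧] TensorAlgebra K⟦X⟧ (K⟦X⟧ ⊗[K] 𝔟)) :
    ((familyModel 𝔞 hω).tensor (veeModel 𝔟 hω)).Φ (LinearMap.lTensor _
      (shIso (shuffleDatum (K⟦X⟧ ⊗[K] 𝔟) hω).rev).e.toLinearMap u) = mixedΦ hω u := by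
  induction u using TensorProduct.induction_on with
  | zero => simp
  | add a b ha hb => simp only [map_add, ha, hb]
  | tmul a b => rfl

/-- The homotopy over `K[[ħ]]` becomes concatenation followed by `degWeight`. The two tensor
products are bracketed differently, which accounts for the associator. -/
theorem mixedΦ_homotopy (w : (ShSer 𝔞 hω ⊗[K⟦X⟧] ShSer 𝔞 hω) ⊗[K⟦X⟧]
      Sh (shuffleDatum (K⟦X⟧ ⊗[K] 𝔟) hω).rev) :
    mixedΦ hω (LinearMap.rTensor _ (homotopyMap _ (homotopyCoeff K)) (LinearMap.lTensor _
      (prT _ _ ∘ₗ (shIso (shuffleDatum (K⟦X⟧ ⊗[K] 𝔟) hω).rev).e.symm.toLinearMap) w)) =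
    mapSer (TensorProduct.map (degWeight K 𝔞 ∘ₗ conc K 𝔞) (prOne K 𝔟) ∘ₗ
      (TensorProduct.assoc K (TensorAlgebra K 𝔞) (TensorAlgebra K 𝔞)
        (TensorAlgebra K 𝔟)).symm.toLinearMap)
      (((familyModel 𝔞 hω).tensor ((familyModel 𝔞 hω).tensor (veeModel 𝔟 hω))).Φ
        (Algebra.TensorProduct.assoc K⟦X⟧ K⟦X⟧ K⟦X⟧ _ _ _ w)) := by
  induction w using TensorProduct.induction_on with
  | zero => simp
  | add a b ha hb => simp only [map_add, ha, hb]
  | tmul a b =>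
    induction a using TensorProduct.induction_on with
    | zero => simp
    | add a a' ha hb => simp only [map_add, add_tmul, ha, hb]
    | tmul a a' =>
      obtain ⟨a, rfl⟩ := Sh.ofT.surjective a
      obtain ⟨a', rfl⟩ := Sh.ofT.surjective a'
      obtain ⟨b, rfl⟩ := Sh.ofT.surjective b
      rw [Algebra.TensorProduct.assoc_tmul, SeriesModel.tensor_Φ_tmul, SeriesModel.tensor_Φ_tmul,
        ← mapSer_mapSer (K := K) (W := (TensorAlgebra K 𝔞 ⊗[K] TensorAlgebra K 𝔞) ⊗[K] TensorAlgebra K 𝔟)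
          (TensorProduct.map (degWeight K 𝔞 ∘ₗ conc K 𝔞) (prOne K 𝔟)), mapSer_assoc_symm, mapSer_hTensor,
        ← mapSer_mapSer (degWeight K 𝔞) (conc K 𝔞), mapSer_conc,
        shModel_Φ]
      change _ = hTensor (mapSer _ (serMap K 𝔞 a * serMap K 𝔞 a') ⊗ₜ[K] _)
      rw [← map_mul, ← serMap_weight, ← serMap_prT,
        LinearMap.lTensor_tmul, LinearMap.rTensor_tmul, homotopyMap_tmul]
      rfl

theorem mixedΦ_rhoStepR
    (ρ : ℕ → ShSer 𝔞 hω ⊗[K⟦X⟧] TensorAlgebra K⟦X⟧ (K⟦X⟧ ⊗[K] 𝔟)) (n : ℕ) :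
    mixedΦ hω (rhoStepR _ (shuffleDatum (K⟦X⟧ ⊗[K] 𝔟) hω) (homotopyCoeff K) ρ n) =
      rhoStep ω (fun j => mixedΦ hω (ρ j)) n := by
  rw [rhoStepR, sigma, mixedΦ_homotopy, rhoStep, map_sum, map_sum]
  congr 1
  refine Finset.sum_congr rfl fun j _ => ?_
  rw [map_mul, SeriesModel.map_mul, SeriesModel.Φ_inL, SeriesModel.Φ_inR, veeΦ_lTensor,
    veeΦ_lTensor, PowerSeries.coeff_mk, PowerSeries.coeff_mk, mixedΦ_tupleSum, mixedΦ_tupleSum]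
  rfl

variable (K 𝔞 𝔟) in
/-- Extension of scalars. -/
def extScalars : 𝔞 ⊗[K] 𝔟 →ₗ[K] (K⟦X⟧ ⊗[K] 𝔞) ⊗[K⟦X⟧] (K⟦X⟧ ⊗[K] 𝔟) :=
  TensorProduct.lift (LinearMap.mk₂ K (fun a b => ((1 : K⟦X⟧) ⊗ₜ[K] a) ⊗ₜ ((1 : K⟦X⟧) ⊗ₜ[K] b))
    (fun a a' b => by rw [tmul_add, add_tmul])
    (fun c a b => by rw [tmul_smul]; rfl)
    (fun a b b' => by rw [tmul_add, tmul_add])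
    (fun c a b => by rw [tmul_smul, tmul_smul]))

theorem extScalars_tmul (a : 𝔞) (b : 𝔟) :
    extScalars K 𝔞 𝔟 (a ⊗ₜ b) = ((1 : K⟦X⟧) ⊗ₜ[K] a) ⊗ₜ ((1 : K⟦X⟧) ⊗ₜ[K] b) := rfl

theorem mixedΦ_one (r : 𝔞 ⊗[K] 𝔟) :
    mixedΦ hω (TensorProduct.map (Sh.ofT.toLinearMap ∘ₗ ι K⟦X⟧) (ι K⟦X⟧) (extScalars K 𝔞 𝔟 r)) =
      inclR r := by
  induction r using TensorProduct.induction_on with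
  | zero => simp [inclR]
  | add a b ha hb =>
    rw [map_add, map_add, map_add, ha, hb]
    simp only [inclR, map_add]
  | tmul a b =>
    rw [extScalars_tmul, TensorProduct.map_tmul, SeriesModel.tensor_Φ_tmul]
    change hTensor (serMap K 𝔞 (ι K⟦X⟧ _) ⊗ₜ[K] serMap K 𝔟 (ι K⟦X⟧ _)) = _
    rw [serMap_ι_one_tmul, serMap_ι_one_tmul, hTensor_const]
    rfl

/-- The components of degree one are mapped to those of the completed algebras. -/
theorem mixedΦ_rhoR (r : 𝔞 ⊗[K] 𝔟) (n : ℕ) :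
    mixedΦ hω (rhoR _ (shuffleDatum (K⟦X⟧ ⊗[K] 𝔟) hω) (homotopyCoeff K) (extScalars K 𝔞 𝔟 r) n) =
      rho ω r n := by
  induction n using Nat.strong_induction_on with
  | _ n ih =>
    match n, ih with
    | 0, _ => rw [rhoR_zero, map_zero, rho]
    | 1, _ => rw [rhoR_one, mixedΦ_one, rho]
    | n + 2, ih =>
      rw [rhoR, mixedΦ_rhoStepR, rho]
      congr 1
      funext j
      split_ifs with h
      · exact ih j h
      · exact map_zero _

variable (𝔞 𝔟) in
/-- The map to series, for the product of two shuffle models. -/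
abbrev shΦ : ShSer 𝔞 hω ⊗[K⟦X⟧] ShSer 𝔟 hω →ₗ[K⟦X⟧]
    (TensorAlgebra K 𝔞 ⊗[K] TensorAlgebra K 𝔟)⟦X⟧ :=
  ((familyModel 𝔞 hω).tensor (familyModel 𝔟 hω)).Φ

theorem shΦ_revRight (u : ShSer 𝔞 hω ⊗[K⟦X⟧] Sh (shuffleDatum (K⟦X⟧ ⊗[K] 𝔟) hω).rev) :
    shΦ 𝔞 𝔟 hω (revRight _ _ u) = mapSer (LinearMap.lTensor _ (wordRev K 𝔟))
      (((familyModel 𝔞 hω).tensor (veeModel 𝔟 hω)).Φ u) := by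
  induction u using TensorProduct.induction_on with
  | zero => simp
  | add a b ha hb => simp only [map_add, ha, hb]
  | tmul a b =>
    obtain ⟨b, rfl⟩ := Sh.ofT.surjective b
    rw [revRight_tmul, SeriesModel.tensor_Φ_tmul, SeriesModel.tensor_Φ_tmul, LinearMap.lTensor,
      mapSer_hTensor, mapSer_id, revHom_ofT, shModel_Φ, ← serMap_revT]
    rfl

/-- The series over `K[[ħ]]` which is mapped to the elements `R_n`. -/
abbrev matSer (r : 𝔞 ⊗[K] 𝔟) : PowerSeries (ShSer 𝔞 hω ⊗[K⟦X⟧] ShSer 𝔟 hω) :=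
  matR _ _ (homotopyCoeff K) (extScalars K 𝔞 𝔟 r)

/-- The bridge between the two settings: every identity proved for the coefficients of `matR`
becomes one for the `R_n` once the operations involved are carried through `shΦ` and its analogues.
-/
theorem shΦ_matSer (r : 𝔞 ⊗[K] 𝔟) (n : ℕ) :
    shΦ 𝔞 𝔟 hω (PowerSeries.coeff n (matSer hω r)) = rMat ω r n := by
  rw [matSer, matR, coeff_serA, shΦ_revRight, coeff_serL, veeΦ_lTensor, geomR, PowerSeries.coeff_mk,
    mixedΦ_tupleSum, rMat, rPrime]
  congr 2
  funext j
  exact mixedΦ_rhoR hω r j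

theorem shΦ_comulLeft (u : ShSer 𝔞 hω ⊗[K⟦X⟧] ShSer 𝔟 hω) :
    ((familyModel 𝔞 hω).tensor ((familyModel 𝔞 hω).tensor (familyModel 𝔟 hω))).Φ
      (Algebra.TensorProduct.assoc K⟦X⟧ K⟦X⟧ K⟦X⟧ _ _ _
        (leg (Bialgebra.comulAlgHom K⟦X⟧ _) _ u)) = comulLeft (shΦ 𝔞 𝔟 hω u) := by
  have hadd : ∀ F G : (TensorAlgebra K 𝔞 ⊗[K] TensorAlgebra K 𝔟)⟦X⟧,
      comulLeft (F + G) = comulLeft F + comulLeft G := fun F G => map_add _ F G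
  induction u using TensorProduct.induction_on with
  | zero => simp [comulLeft]
  | add a b ha hb => simp only [map_add, ha, hb, hadd]
  | tmul a b =>
    obtain ⟨a, rfl⟩ := Sh.ofT.surjective a
    obtain ⟨b, rfl⟩ := Sh.ofT.surjective b
    have h : ∀ w, ((familyModel 𝔞 hω).tensor
        ((familyModel 𝔞 hω).tensor (familyModel 𝔟 hω))).Φ
        (Algebra.TensorProduct.assoc K⟦X⟧ K⟦X⟧ K⟦X⟧ _ _ _
          (TensorProduct.map Sh.ofT.toLinearMap Sh.ofT.toLinearMap w ⊗ₜ Sh.ofT b)) =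
        mapSer (TensorProduct.assoc K _ _ _).toLinearMap
          (hTensor (serMap₂ K 𝔞 𝔞 w ⊗ₜ[K] serMap K 𝔟 b)) := fun w => by
      induction w using TensorProduct.induction_on with
      | zero => simp
      | add w w' h h' => simp only [map_add, add_tmul, h, h']
      | tmul x y =>
        rw [TensorProduct.map_tmul, Algebra.TensorProduct.assoc_tmul, SeriesModel.tensor_Φ_tmul,
          SeriesModel.tensor_Φ_tmul, serMap₂_tmul, mapSer_assoc]
        rfl
    rw [leg_tmul, Bialgebra.comulAlgHom_apply, Sh.comul_ofT, h, serMap₂_comulT, comulLeft,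
      ← mapSer_mapSer (K := K) (W := (TensorAlgebra K 𝔞 ⊗[K] TensorAlgebra K 𝔞) ⊗[K] TensorAlgebra K 𝔟)
        (TensorProduct.assoc K _ _ _).toLinearMap, SeriesModel.tensor_Φ_tmul,
      LinearMap.rTensor, mapSer_hTensor, mapSer_id]
    rfl

theorem shΦ_comulRight (u : ShSer 𝔞 hω ⊗[K⟦X⟧] ShSer 𝔟 hω) :
    ((familyModel 𝔞 hω).tensor ((familyModel 𝔟 hω).tensor (familyModel 𝔟 hω))).Φ
      (comulR K⟦X⟧ _ _ u) = comulRight (shΦ 𝔞 𝔟 hω u) := by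
  have hadd : ∀ F G : (TensorAlgebra K 𝔞 ⊗[K] TensorAlgebra K 𝔟)⟦X⟧,
      comulRight (F + G) = comulRight F + comulRight G := fun F G => map_add _ F G
  induction u using TensorProduct.induction_on with
  | zero => simp [comulRight]
  | add a b ha hb => simp only [map_add, ha, hb, hadd]
  | tmul a b =>
    obtain ⟨a, rfl⟩ := Sh.ofT.surjective a
    obtain ⟨b, rfl⟩ := Sh.ofT.surjective b
    have h : ∀ w, ((familyModel 𝔟 hω).tensor (familyModel 𝔟 hω)).Φ
        (TensorProduct.map Sh.ofT.toLinearMap Sh.ofT.toLinearMap w) = serMap₂ K 𝔟 𝔟 w :=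
      fun w => by
        induction w using TensorProduct.induction_on with
        | zero => simp
        | add w w' h h' => simp only [map_add, h, h']
        | tmul x y => rfl
    rw [comulR_tmul, Sh.comul_ofT, SeriesModel.tensor_Φ_tmul, h, serMap₂_comulT, comulRight,
      SeriesModel.tensor_Φ_tmul, LinearMap.lTensor, mapSer_hTensor, mapSer_id]
    rfl

set_option maxHeartbeats 1000000 in
theorem comulLeft_rMat [CharZero K]
    (hω : ω.IsShuffleFamily) (r : 𝔞 ⊗[K] 𝔟) (n : ℕ) : comulLeft (rMat ω r n) =
    ∑ k ∈ Finset.range (n + 1), mulAAB ω ω (mapSer (ins13 K _ _ _) (rMat ω r k))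
      (mapSer (ins23 K _ _ _) (rMat ω r (n - k))) := by
  have h := congrArg (PowerSeries.coeff n) (comulLeft_matR (shuffleDatum (K⟦X⟧ ⊗[K] 𝔞) hω)
    (shuffleDatum (K⟦X⟧ ⊗[K] 𝔟) hω) homotopyCoeff_mul homotopyCoeff_zero (extScalars K 𝔞 𝔟 r))
  have h' := congrArg (fun z =>
    ((familyModel 𝔞 hω).tensor ((familyModel 𝔞 hω).tensor (familyModel 𝔟 hω))).Φ
      (Algebra.TensorProduct.assoc K⟦X⟧ K⟦X⟧ K⟦X⟧ _ _ _ z)) h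
  simp only [coeff_serA] at h'
  rw [shΦ_comulLeft, shΦ_matSer, prod1323, PowerSeries.coeff_mul,
    Finset.Nat.sum_antidiagonal_eq_sum_range_succ_mk, map_sum, map_sum] at h'
  rw [h']
  refine Finset.sum_congr rfl fun k _ => ?_
  rw [map_mul, SeriesModel.map_mul, coeff_serA, coeff_serA, SeriesModel.Φ_inL, SeriesModel.Φ_inR,
    shΦ_matSer, shΦ_matSer]
  rfl

theorem comulRight_rMat (hω : ω.IsShuffleFamily) (r : 𝔞 ⊗[K] 𝔟) (n : ℕ) : comulRight (rMat ω r n) =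
    ∑ k ∈ Finset.range (n + 1), mulABB ω ω (mapSer (ins13 K _ _ _) (rMat ω r k))
      (mapSer (ins12 K _ _ _) (rMat ω r (n - k))) := by
  have h := congrArg (PowerSeries.coeff n) (comulRight_matR (shuffleDatum (K⟦X⟧ ⊗[K] 𝔞) hω)
    (shuffleDatum (K⟦X⟧ ⊗[K] 𝔟) hω) (c := homotopyCoeff K) (extScalars K 𝔞 𝔟 r))
  have h' := congrArg
    ((familyModel 𝔞 hω).tensor ((familyModel 𝔟 hω).tensor (familyModel 𝔟 hω))).Φ h
  simp only [coeff_serA] at h'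
  rw [shΦ_comulRight, shΦ_matSer, PowerSeries.coeff_mul,
    Finset.Nat.sum_antidiagonal_eq_sum_range_succ_mk, map_sum] at h'
  rw [h']
  refine Finset.sum_congr rfl fun k _ => ?_
  rw [SeriesModel.map_mul, coeff_serA, coeff_serA, SeriesModel.Φ_emb13, SeriesModel.Φ_emb12,
    shΦ_matSer, shΦ_matSer]
  rfl

theorem wordRev_one : wordRev K 𝔟 1 = 1 := by
  have h := wordLift_tprod (fun n => (tprod K 𝔟 n).domDomCongr Fin.revPerm) 0 Fin.elim0
  simpa [TensorAlgebra.tprod_apply, wordRev] using h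

theorem wordRev_ι (b : 𝔟) : wordRev K 𝔟 (ι K b) = ι K b := by
  have h := wordLift_tprod (fun n => (tprod K 𝔟 n).domDomCongr Fin.revPerm) 1 fun _ => b
  simpa [TensorAlgebra.tprod_apply, wordRev] using h

theorem rMat_zero (r : 𝔞 ⊗[K] 𝔟) : rMat ω r 0 = 1 := by
  have h : rPrimeOf ω (rho ω r) 0 = 1 := by simp [rPrimeOf]
  rw [rMat, rPrime, h]
  change mapSer _ (const (K := K) (1 ⊗ₜ 1)) = _
  rw [mapSer_const, LinearMap.lTensor_tmul, wordRev_one]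
  rfl

theorem rMat_one (hω : ω.IsShuffleFamily) (r : 𝔞 ⊗[K] 𝔟) : rMat ω r 1 = inclR r := by
  have h : rPrimeOf ω (rho ω r) 1 = inclR r := by
    have h₁ := mixedΦ_tupleSum hω
      (rhoR _ (shuffleDatum (K⟦X⟧ ⊗[K] 𝔟) hω) (homotopyCoeff K) (extScalars K 𝔞 𝔟 r)) 1
    simp only [mixedΦ_rhoR] at h₁
    rw [← h₁, tupleSum_one (rhoR_zero _ _ _ _), mixedΦ_rhoR, rho]
  rw [rMat, rPrime, h, inclR, mapSer_const]
  congr 1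
  rw [LinearMap.lTensor, ← LinearMap.comp_apply, ← TensorProduct.map_comp]
  congr 2
  exact LinearMap.ext wordRev_ι

end Transfer

end ShuffleHopf

end

noncomputable section

namespace ShuffleHopf

open TensorProduct TensorAlgebra WordGraded

/-! ### The antipode of the completed algebra -/

section Apply

variable {K : Type*} [Field K] {𝔞 : Type*} [LieRing 𝔞] [LieAlgebra K 𝔞]
  {𝔟 : Type*} [LieRing 𝔟] [LieAlgebra K 𝔟]

attribute [local instance] seriesAlgebra
attribute [local instance] isScalarTower_series

variable {A : Type*} [Ring A] [Algebra K⟦X⟧ A] {B : Type*} [Ring B] [Algebra K⟦X⟧ B]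
  (m : SeriesModel K (TensorAlgebra K 𝔞) A) (m' : SeriesModel K (TensorAlgebra K 𝔟) B)

theorem applyLeft_map {g : A →ₗ[K⟦X⟧] A} {f : TensorAlgebra K 𝔞 →ₗ[K] (TensorAlgebra K 𝔞)⟦X⟧}
    (h : ∀ x, m.Φ (g x) = hExt f (m.Φ x)) (u : A ⊗[K⟦X⟧] B) :
    (m.tensor m').Φ (LinearMap.rTensor B g u) = applyLeft f ((m.tensor m').Φ u) := by
  have h' : (m.tensor m').Φ ∘ₗ LinearMap.rTensor B g =
      hExtLin (hTensor ∘ₗ TensorProduct.map f const) ∘ₗ (m.tensor m').Φ := by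
    refine TensorProduct.ext (m.linearMap_ext fun a v hv => m'.linearMap_ext fun b w hw => ?_)
    change (m.tensor m').Φ (g a ⊗ₜ b) = hExt _ ((m.tensor m').Φ (a ⊗ₜ b))
    rw [SeriesModel.tensor_Φ_tmul, SeriesModel.tensor_Φ_tmul, h, hv, hw, hTensor_const, hExt_const,
      hExt_const]
    rfl
  exact LinearMap.congr_fun h' u

theorem applyRight_map {g : B →ₗ[K⟦X⟧] B} {f : TensorAlgebra K 𝔟 →ₗ[K] (TensorAlgebra K 𝔟)⟦X⟧}
    (h : ∀ x, m'.Φ (g x) = hExt f (m'.Φ x)) (u : A ⊗[K⟦X⟧] B) :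
    (m.tensor m').Φ (LinearMap.lTensor A g u) = applyRight f ((m.tensor m').Φ u) := by
  have h' : (m.tensor m').Φ ∘ₗ LinearMap.lTensor A g =
      hExtLin (hTensor ∘ₗ TensorProduct.map const f) ∘ₗ (m.tensor m').Φ := by
    refine TensorProduct.ext (m.linearMap_ext fun a v hv => m'.linearMap_ext fun b w hw => ?_)
    change (m.tensor m').Φ (a ⊗ₜ g b) = hExt _ ((m.tensor m').Φ (a ⊗ₜ b))
    rw [SeriesModel.tensor_Φ_tmul, SeriesModel.tensor_Φ_tmul, h, hv, hw, hTensor_const, hExt_const,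
      hExt_const]
    rfl
  exact LinearMap.congr_fun h' u

end Apply

/-! ### The antipode and its inverse on formal series. -/

section Antipode

variable {K : Type*} [Field K] {𝔤 : Type*} [LieRing 𝔤] [LieAlgebra K 𝔤] {ω : LieFamily K⟦X⟧}

attribute [local instance] seriesAlgebra
attribute [local instance] isScalarTower_series

variable (hω : ω.IsShuffleFamily)

theorem familyModel_tprod {n : ℕ} (x : Fin n → 𝔤) :
    (familyModel 𝔤 hω).Φ (Sh.ofT (tprod K⟦X⟧ (K⟦X⟧ ⊗[K] 𝔤) n fun i => (1 : K⟦X⟧) ⊗ₜ[K] x i)) =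
      const (K := K) (tprod K 𝔤 n x) :=
  serMap_tprod x

theorem antipode_tprod_zero (x : Fin 0 → 𝔤) : antipode ω 𝔤 (tprod K 𝔤 0 x) = 1 := by
  rw [antipode, wordLift_tprod, antipodeWord]
  rfl

theorem antipode_tprod_succ (n : ℕ) (x : Fin (n + 1) → 𝔤) :
    antipode ω 𝔤 (tprod K 𝔤 (n + 1) x) = -∑ i : Fin (n + 1),
      hMul (shMul ω 𝔤) (antipode ω 𝔤
        (tprod K 𝔤 i fun j => x (Fin.castLE i.2.le j)) ⊗ₜ[K]
          const (K := K) (tprod K 𝔤 (n + 1 - i) fun j =>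
            x (Fin.cast (Nat.add_sub_of_le i.2.le) (Fin.natAdd i j)))) := by
  rw [antipode, wordLift_tprod, antipodeWord, neg_apply, sum_apply]
  refine congrArg Neg.neg (Finset.sum_congr rfl fun i _ => ?_)
  rw [MultilinearMap.domDomCongr_apply, LinearMap.compMultilinearMap_apply,
    MultilinearMap.domCoprod_apply, wordLift_tprod]
  rfl

theorem tprod_eq_one {R M : Type*} [CommRing R] [AddCommGroup M] [Module R M] {n : ℕ} (h : n = 0)
    (x : Fin n → M) : tprod R M n x = 1 := by
  subst h
  simp [TensorAlgebra.tprod_apply]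

/-- The antipode axiom on a nonempty word, solved for the cut whose second piece is empty. This is
the recursion that defines the antipode on series, so the two agree by induction on length. -/
theorem antipode_ofT_tprod_succ {R M : Type*} [CommRing R] [AddCommGroup M] [Module R M]
    (D : ProductDatum R M) (n : ℕ) (x : Fin (n + 1) → M) :
    HopfAlgebra.antipode R (Sh.ofT (D := D) (tprod R M (n + 1) x)) = -∑ i : Fin (n + 1),
      HopfAlgebra.antipode R (Sh.ofT (D := D) (tprod R M i fun j => x (Fin.castLE i.2.le j))) *
        Sh.ofT (D := D) (tprod R M (n + 1 - i) fun j =>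
          x (Fin.cast (Nat.add_sub_of_le i.2.le) (Fin.natAdd i j))) := by
  have hc := HopfAlgebra.mul_antipode_rTensor_comul_apply (R := R)
    (Sh.ofT (D := D) (tprod R M (n + 1) x))
  rw [Sh.comul_ofT, comulT_tprod, Sh.counit_ofT] at hc
  simp only [map_sum, TensorProduct.map_tmul, LinearEquiv.coe_coe, LinearMap.rTensor_tmul,
    LinearMap.mul'_apply] at hc
  rw [Fin.sum_univ_castSucc, tprod_eq_one (show n + 1 - (Fin.last (n + 1) : ℕ) = 0 from Nat.sub_self (n + 1))]
    at hc
  have h0 : Coalgebra.counit (R := R) (tprod R M (n + 1) x) = 0 := by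
    rw [← word_ofFn, counit_word, if_neg (by simp)]
  rw [h0, map_zero, add_comm] at hc
  have h1 : Sh.ofT (D := D) (1 : TensorAlgebra R M) = 1 := rfl
  rw [h1, mul_one] at hc
  exact eq_neg_of_add_eq_zero_left hc

theorem familyModel_antipode_tprod (n : ℕ) (x : Fin n → 𝔤) :
    (familyModel 𝔤 hω).Φ (HopfAlgebra.antipode K⟦X⟧
      (Sh.ofT (tprod K⟦X⟧ (K⟦X⟧ ⊗[K] 𝔤) n fun i => (1 : K⟦X⟧) ⊗ₜ[K] x i))) =
      antipode ω 𝔤 (tprod K 𝔤 n x) := by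
  induction n using Nat.strong_induction_on with
  | _ n ih =>
    match n, x, ih with
    | 0, x, ih =>
      rw [antipode_tprod_zero, tprod_eq_one rfl]
      have h1 : HopfAlgebra.antipode K⟦X⟧ (1 : ShSer 𝔤 hω) = 1 := HopfAlgebra.antipode_one
      exact (congrArg _ h1).trans (familyModel 𝔤 hω).map_one
    | n + 1, x, ih =>
      rw [antipode_tprod_succ, antipode_ofT_tprod_succ, map_neg, map_sum]
      refine congrArg Neg.neg (Finset.sum_congr rfl fun i _ => ?_)
      rw [SeriesModel.map_mul, ih i i.2 fun j => x (Fin.castLE i.2.le j)]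
      exact congrArg (fun z => hMul (shMul ω 𝔤) (_ ⊗ₜ[K] z)) (familyModel_tprod hω (n := n + 1 - i)
        fun j => x (Fin.cast (Nat.add_sub_of_le i.2.le) (Fin.natAdd i j)))

theorem familyModel_antipode (u : ShSer 𝔤 hω) :
    (familyModel 𝔤 hω).Φ (HopfAlgebra.antipode K⟦X⟧ u) =
      hExt (antipode ω 𝔤) ((familyModel 𝔤 hω).Φ u) := by
  have h : ((familyModel 𝔤 hω).Φ ∘ₗ HopfAlgebra.antipode K⟦X⟧) ∘ₗ Sh.ofT.toLinearMap =
      (hExtLin (antipode ω 𝔤) ∘ₗ (familyModel 𝔤 hω).Φ) ∘ₗ Sh.ofT.toLinearMap := by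
    refine linearMap_ext_one_tmul fun n x => (familyModel_antipode_tprod hω n x).trans ?_
    change _ = hExt _ ((familyModel 𝔤 hω).Φ (Sh.ofT _))
    rw [familyModel_tprod, hExt_const]
  exact LinearMap.congr_fun h (Sh.ofT.symm u)

variable (𝔤) in
/-- The inverse of the antipode, restricted to `T(𝔤)`. -/
def skewSeries : TensorAlgebra K 𝔤 →ₗ[K] (TensorAlgebra K 𝔤)⟦X⟧ :=
  wordLift fun n => ((((familyModel 𝔤 hω).Φ ∘ₗ skewAntipode (shuffleDatum (K⟦X⟧ ⊗[K] 𝔤) hω) ∘ₗ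
    Sh.ofT.toLinearMap).compMultilinearMap
      (tprod K⟦X⟧ (K⟦X⟧ ⊗[K] 𝔤) n)).restrictScalars K).compLinearMap
        fun _ => TensorProduct.mk K K⟦X⟧ 𝔤 1

theorem familyModel_skewAntipode (u : ShSer 𝔤 hω) :
    (familyModel 𝔤 hω).Φ (skewAntipode _ u) =
      hExt (skewSeries 𝔤 hω) ((familyModel 𝔤 hω).Φ u) := by
  have h : ((familyModel 𝔤 hω).Φ ∘ₗ skewAntipode _) ∘ₗ Sh.ofT.toLinearMap =
      (hExtLin (skewSeries 𝔤 hω) ∘ₗ (familyModel 𝔤 hω).Φ) ∘ₗ Sh.ofT.toLinearMap := by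
    refine linearMap_ext_one_tmul fun n x => ?_
    change (familyModel 𝔤 hω).Φ (skewAntipode _ (Sh.ofT _)) =
      hExt _ ((familyModel 𝔤 hω).Φ (Sh.ofT _))
    rw [familyModel_tprod, hExt_const, skewSeries, wordLift_tprod]
    rfl
  exact LinearMap.congr_fun h (Sh.ofT.symm u)

/-- Two maps of a model which are inverse to one another extend to inverse maps of series. -/
theorem SeriesModel.hExt_hExt_eq {V A : Type*} [Ring V] [Algebra K V] [Ring A] [Algebra K⟦X⟧ A]
    (m : SeriesModel K V A) (hm : ∀ v, ∃ x, m.Φ x = const (K := K) v) {s t : A → A}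
    {f g : V →ₗ[K] V⟦X⟧}
    (hs : ∀ x, m.Φ (s x) = hExt f (m.Φ x)) (ht : ∀ x, m.Φ (t x) = hExt g (m.Φ x))
    (hst : ∀ x, s (t x) = x) (F : V⟦X⟧) : hExt f (hExt g F) = F := by
  have h : hExt f ∘ₗ g = const (K := K) := by
    refine LinearMap.ext fun v => ?_
    obtain ⟨x, hx⟩ := hm v
    -- Every constant lifts to the model, where the two maps are inverse to one another.
    rw [LinearMap.comp_apply, ← hExt_const g, ← hx, ← ht, ← hs, hst]
  rw [hExt_hExt, h, hExt_const_id]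

theorem familyModel_surjective (v : TensorAlgebra K 𝔤) :
    ∃ x, (familyModel 𝔤 hω).Φ x = const (K := K) v := by
  suffices h : ∃ x, serMap K 𝔤 x = const (K := K) v from
    let ⟨x, hx⟩ := h
    ⟨Sh.ofT x, hx⟩
  induction v using left_induction with
  | one => exact ⟨1, map_one _⟩
  | add u v hu hv =>
    obtain ⟨x, hx⟩ := hu
    obtain ⟨y, hy⟩ := hv
    exact ⟨x + y, by rw [map_add, map_add, hx, hy]⟩
  | smul a u hu =>
    obtain ⟨x, hx⟩ := hu
    exact ⟨algebraMap K K⟦X⟧ a • x, by rw [map_smul, map_smul, hx, algebraMap_smul]⟩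
  | letter_mul z v hv =>
    obtain ⟨x, hx⟩ := hv
    refine ⟨ι K⟦X⟧ ((1 : K⟦X⟧) ⊗ₜ[K] z) * x, ?_⟩
    rw [map_mul, serMap_ι_one_tmul, hx]
    exact (map_mul (constAlg K _) _ _).symm

variable (𝔤) in
/-- The antipode of the completed algebra, as a linear equivalence. -/
def antipodeEquiv : (TensorAlgebra K 𝔤)⟦X⟧ ≃ₗ[K] (TensorAlgebra K 𝔤)⟦X⟧ :=
  LinearEquiv.ofLinearMap (hExt (antipode ω 𝔤)) (hExt (skewSeries 𝔤 hω))
    (LinearMap.ext ((familyModel 𝔤 hω).hExt_hExt_eq (familyModel_surjective hω)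
      (familyModel_antipode hω) (familyModel_skewAntipode hω) (antipode_skewAntipode _)))
    (LinearMap.ext ((familyModel 𝔤 hω).hExt_hExt_eq (familyModel_surjective hω)
      (familyModel_skewAntipode hω) (familyModel_antipode hω) (skewAntipode_antipode _)))

variable {𝔞 : Type*} [LieRing 𝔞] [LieAlgebra K 𝔞] {𝔟 : Type*} [LieRing 𝔟] [LieAlgebra K 𝔟]

theorem applyLeft_antipode_rMat [CharZero K] (hω : ω.IsShuffleFamily) (r : 𝔞 ⊗[K] 𝔟) (n : ℕ) :
    applyLeft (antipode ω 𝔞) (rMat ω r n) =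
      applyRight ((antipodeEquiv 𝔟 hω).symm.toLinearMap ∘ₗ const) (rMat ω r n) := by
  have h := antipode_matR (shuffleDatum (K⟦X⟧ ⊗[K] 𝔞) hω)
    (shuffleDatum (K⟦X⟧ ⊗[K] 𝔟) hω) homotopyCoeff_mul homotopyCoeff_zero (extScalars K 𝔞 𝔟 r) n
  have h' : (antipodeEquiv 𝔟 hω).symm.toLinearMap ∘ₗ const (K := K) = skewSeries 𝔟 hω :=
    LinearMap.ext fun v => hExt_const _ v
  rw [h', ← shΦ_matSer hω, ← applyRight_map _ _ (familyModel_skewAntipode hω),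
    ← applyLeft_map _ _ (familyModel_antipode hω)]
  exact congrArg (shΦ 𝔞 𝔟 hω) h

end Antipode

end ShuffleHopf

end

noncomputable section

namespace ShuffleHopf

open TensorProduct TensorAlgebra WordGraded

/-! ### Functoriality -/

section Functoriality

variable {R : Type*} [CommRing R]

section Linear

variable {M M' : Type*} [AddCommGroup M] [Module R M] [AddCommGroup M'] [Module R M']
  (φ : M →ₗ[R] M')

/-- The morphism of tensor algebras induced by a linear map. -/
def tMap : TensorAlgebra R M →ₐ[R] TensorAlgebra R M' := TensorAlgebra.lift R (ι R ∘ₗ φ)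

theorem tMap_ι (x : M) : tMap φ (ι R x) = ι R (φ x) := TensorAlgebra.lift_ι_apply _ _

theorem tMap_word (l : List M) : tMap φ (word R l) = word R (l.map φ) := by
  induction l with
  | nil => exact map_one _
  | cons x l ih => rw [word_cons, map_mul, ih, tMap_ι, List.map_cons, word_cons]

theorem tMap_tprod {n : ℕ} (x : Fin n → M) : tMap φ (tprod R M n x) = tprod R M' n (φ ∘ x) := by
  rw [← word_ofFn, tMap_word, List.map_ofFn, word_ofFn]

theorem tMap_weight (c : ℕ → R) (u : TensorAlgebra R M) :
    tMap φ (weight c u) = weight c (tMap φ u) := by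
  have h : (tMap φ).toLinearMap ∘ₗ weight c = weight c ∘ₗ (tMap φ).toLinearMap := by
    refine linearMap_ext_word fun l => ?_
    change tMap φ (weight c (word R l)) = weight c (tMap φ (word R l))
    rw [weight_words c (word_mem_words l), map_smul, tMap_word,
      weight_words c (word_mem_words _), List.length_map]
  exact LinearMap.congr_fun h u

theorem tMap_prT (u : TensorAlgebra R M) : tMap φ (prT R M u) = prT R M' (tMap φ u) := by
  have h : (tMap φ).toLinearMap ∘ₗ prT R M = prT R M' ∘ₗ (tMap φ).toLinearMap := by
    refine linearMap_ext_word fun l => ?_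
    change tMap φ (prT R M (word R l)) = prT R M' (tMap φ (word R l))
    rw [tMap_word, prT_word, prT_word, List.length_map]
    split_ifs
    · exact tMap_word φ l
    · exact map_zero _
  exact LinearMap.congr_fun h u

end Linear

variable {L L' : Type*} [LieRing L] [LieAlgebra R L] [LieRing L'] [LieAlgebra R L']
  (ω : LieFamily R) (φ : L →ₗ⁅R⁆ L')

/-- Morphisms of Lie algebras commute with the evaluation of Lie polynomials, hence with every block
of the product. -/
theorem tMap_cofreeLin (u v : TensorAlgebra R L) :
    tMap (φ : L →ₗ[R] L') (cofreeLin (shuffleβ ω L) (u ⊗ₜ v)) =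
      cofreeLin (shuffleβ ω L') (tMap (φ : L →ₗ[R] L') u ⊗ₜ tMap (φ : L →ₗ[R] L') v) := by
  have h : (tMap (φ : L →ₗ[R] L')).toLinearMap ∘ₗ cofreeLin (shuffleβ ω L) =
      cofreeLin (shuffleβ ω L') ∘ₗ TensorProduct.map (tMap (φ : L →ₗ[R] L')).toLinearMap
        (tMap (φ : L →ₗ[R] L')).toLinearMap := by
    refine tmul_ext_tprod fun p q x y => ?_
    change tMap (φ : L →ₗ[R] L') (cofreeLin (shuffleβ ω L) (_ ⊗ₜ _)) = cofreeLin (shuffleβ ω L')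
      (tMap (φ : L →ₗ[R] L') _ ⊗ₜ tMap (φ : L →ₗ[R] L') _)
    rw [tMap_tprod, tMap_tprod, cofreeLin_shuffleβ, cofreeLin_shuffleβ]
    simp only [map_sum]
    refine Finset.sum_congr rfl fun k _ => Finset.sum_congr rfl fun P _ =>
      Finset.sum_congr rfl fun Q _ => ?_
    rw [tMap_tprod]
    exact congrArg _ (map_blockApp ω φ P Q x y)
  exact LinearMap.congr_fun h (u ⊗ₜ v)

theorem Sh.ofT_mul_ofT {D : ProductDatum R L} (u v : TensorAlgebra R L) :
    (Sh.ofT u * Sh.ofT v : Sh D) = Sh.ofT (cofreeLin D.β (u ⊗ₜ v)) := rfl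

variable (hω : ω.IsShuffleFamily)

variable {ω} in
/-- The morphism of bialgebras induced by a morphism of Lie algebras. -/
def shMap : Sh (shuffleDatum L hω) →ₐ[R] Sh (shuffleDatum L' hω) :=
  AlgHom.ofLinearMap (Sh.ofT.toLinearMap ∘ₗ (tMap (φ : L →ₗ[R] L')).toLinearMap ∘ₗ
    Sh.ofT.symm.toLinearMap) (map_one (tMap (φ : L →ₗ[R] L')))
    fun x y => tMap_cofreeLin ω φ (Sh.ofT.symm x) (Sh.ofT.symm y)

end Functoriality

/-! ### The recursion as a sum of values of a bilinear map. -/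

section Step

variable {R : Type*} [CommRing R] {M N : Type*} [AddCommGroup M] [Module R M] [AddCommGroup N]
  [Module R N] (D : ProductDatum R M) (E : ProductDatum R N) (c : ℕ → R)

/-- The bilinear map which defines the recursion for the components of degree one. -/
def stepLin : Sh D ⊗[R] TensorAlgebra R N →ₗ[R] Sh D ⊗[R] TensorAlgebra R N →ₗ[R]
    Sh D ⊗[R] TensorAlgebra R N :=
  ((LinearMap.mul R ((Sh D ⊗[R] Sh D) ⊗[R] Sh E.rev)).compl₁₂
    ((leg Algebra.TensorProduct.includeLeft (Sh E.rev)).toLinearMap ∘ₗ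
      LinearMap.lTensor (Sh D) (shIso E.rev).e.toLinearMap)
    ((leg Algebra.TensorProduct.includeRight (Sh E.rev)).toLinearMap ∘ₗ
      LinearMap.lTensor (Sh D) (shIso E.rev).e.toLinearMap)).compr₂
    (LinearMap.rTensor _ (homotopyMap D c) ∘ₗ
      LinearMap.lTensor (Sh D ⊗[R] Sh D) (prT R N ∘ₗ (shIso E.rev).e.symm.toLinearMap))

theorem stepLin_tmul (x x' : TensorAlgebra R M) (y y' : TensorAlgebra R N) :
    stepLin D E c (Sh.ofT x ⊗ₜ y) (Sh.ofT x' ⊗ₜ y') =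
      Sh.ofT (weight c (x * x')) ⊗ₜ prT R N (cofreeLin E.rev.β (y ⊗ₜ y')) := by
  rw [← homotopyMap_tmul]
  change LinearMap.rTensor _ (homotopyMap D c) (LinearMap.lTensor (Sh D ⊗[R] Sh D)
    (prT R N ∘ₗ (shIso E.rev).e.symm.toLinearMap)
    (leg (Algebra.TensorProduct.includeLeft : Sh D →ₐ[R] Sh D ⊗[R] Sh D) (Sh E.rev)
      (Sh.ofT x ⊗ₜ (shIso E.rev).e y) *
    leg (Algebra.TensorProduct.includeRight : Sh D →ₐ[R] Sh D ⊗[R] Sh D) (Sh E.rev)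
      (Sh.ofT x' ⊗ₜ (shIso E.rev).e y'))) = _
  rw [leg_tmul, leg_tmul, Algebra.TensorProduct.tmul_mul_tmul,
    Algebra.TensorProduct.includeLeft_apply, Algebra.TensorProduct.includeRight_apply,
    Algebra.TensorProduct.tmul_mul_tmul, mul_one, one_mul]
  rfl

/-- A form of the recursion suited to universality: `stepLin` is bilinear, natural in the Lie
algebras, and additive on multidegrees. -/
theorem rhoStepR_eq_sum (ρ : ℕ → Sh D ⊗[R] TensorAlgebra R N) (n : ℕ) :
    rhoStepR D E c ρ n =
      ∑ j ∈ Finset.Ioo 0 n, stepLin D E c (tupleSum ρ j) (tupleSum ρ (n - j)) := by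
  rw [rhoStepR, sigma, map_sum, map_sum]
  refine Finset.sum_congr rfl fun j _ => ?_
  rw [PowerSeries.coeff_mk, PowerSeries.coeff_mk]
  rfl

end Step

end ShuffleHopf

end

noncomputable section

namespace ShuffleHopf

open TensorProduct TensorAlgebra WordGraded

/-! ### Multihomogeneous words in free Lie algebras -/

section Multidegree

theorem bilin_mem_of_mem_span {R M N P : Type*} [CommRing R] [AddCommGroup M] [Module R M]
    [AddCommGroup N] [Module R N] [AddCommGroup P] [Module R P] (f : M →ₗ[R] N →ₗ[R] P)
    {s : Set M} {t : Set N} {Q : Submodule R P} (h : ∀ a ∈ s, ∀ b ∈ t, f a b ∈ Q) {u : M}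
    (hu : u ∈ Submodule.span R s) {v : N} (hv : v ∈ Submodule.span R t) : f u v ∈ Q := by
  have h' : Submodule.map₂ f (Submodule.span R s) (Submodule.span R t) ≤ Q := by
    rw [Submodule.map₂_span_span, Submodule.span_le]
    rintro _ ⟨a, ha, b, hb, rfl⟩
    exact h a ha b hb
  exact h' (Submodule.apply_mem_map₂ f hu hv)

universe u

variable {R : Type u} [CommRing R] {X : Type}

/-- Substitution in a bracketed word. -/
def subst {Y : Type} (g : X → FreeMagma Y) : FreeMagma X → FreeMagma Y
  | .of i => g i
  | .mul a b => .mul (subst g a) (subst g b)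

theorem leaves_subst {Y : Type} (g : X → FreeMagma Y) (w : FreeMagma X) :
    leaves (subst g w) = ((leaves w).map fun i => leaves (g i)).sum := by
  induction w using FreeMagma.rec with
  | of i => exact (Multiset.sum_singleton (leaves (g i))).symm
  | mul a b iha ihb =>
    change leaves (subst g a) + leaves (subst g b) = _
    rw [iha, ihb, leaves, Multiset.map_add, Multiset.sum_add]

theorem lift_lieMonomial {Y : Type} (g : X → FreeMagma Y) (w : FreeMagma X) :
    FreeLieAlgebra.lift R (fun i => lieMonomial R (g i)) (lieMonomial R w) =
      lieMonomial R (subst g w) := by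
  induction w using FreeMagma.rec with
  | of i => exact FreeLieAlgebra.lift_of_apply _ i
  | mul a b iha ihb =>
    change FreeLieAlgebra.lift R _ ⁅lieMonomial R a, lieMonomial R b⁆ = ⁅lieMonomial R (subst g a), lieMonomial R (subst g b)⁆
    rw [LieHom.map_lie, iha, ihb]

variable (R) in
/-- The part of multidegree `S` of the free Lie algebra. -/
def mlLie (S : Multiset X) : Submodule R (FreeLieAlgebra R X) :=
  Submodule.span R (lieMonomial R '' {w | leaves w = S})

/-- Each generator occurs exactly once in the monomials of `B`, so substitution adds up the letters
of all substituted words. -/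
theorem lift_mem_mlLie {Y : Type} [Fintype Y] (g : Y → FreeMagma X) (B : FL R Y) :
    FreeLieAlgebra.lift R (fun i => lieMonomial R (g i)) (B : FreeLieAlgebra R Y) ∈
      mlLie R (∑ i, leaves (g i)) := by
  have h : FL R Y ≤ (mlLie R (∑ i, leaves (g i))).comap
      ((FreeLieAlgebra.lift R fun i => lieMonomial R (g i)) : _ →ₗ[R] _) := by
    refine Submodule.span_le.mpr ?_
    rintro _ ⟨w, hw, rfl⟩
    refine Submodule.subset_span ⟨subst g w, ?_, (lift_lieMonomial g w).symm⟩
    have hw' : leaves w = (Finset.univ : Finset Y).val := hw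
    change leaves _ = _
    rw [leaves_subst, hw']
    rfl
  exact h B.2

variable (R) in
/-- The part of multidegree `S` of the tensor algebra of the free Lie algebra. -/
def mlWords (S : Multiset X) : Submodule R (TensorAlgebra R (FreeLieAlgebra R X)) :=
  Submodule.span R {u | ∃ l : List (FreeMagma X), (l.map leaves).sum = S ∧
    u = word R (l.map (lieMonomial R))}

theorem word_mem_mlWords (l : List (FreeMagma X)) :
    word R (l.map (lieMonomial R)) ∈ mlWords R (l.map leaves).sum :=
  Submodule.subset_span ⟨l, rfl, rfl⟩

theorem one_mem_mlWords : (1 : TensorAlgebra R (FreeLieAlgebra R X)) ∈ mlWords R (0 : Multiset X) :=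
  word_mem_mlWords []

theorem mul_mem_mlWords {S T : Multiset X} {u v : TensorAlgebra R (FreeLieAlgebra R X)}
    (hu : u ∈ mlWords R S) (hv : v ∈ mlWords R T) : u * v ∈ mlWords R (S + T) := by
  refine bilin_mem_of_mem_span (LinearMap.mul R _) ?_ hu hv
  rintro _ ⟨l, rfl, rfl⟩ _ ⟨l', rfl, rfl⟩
  rw [LinearMap.mul_apply', ← word_append, ← List.map_append, ← List.sum_append, ← List.map_append]
  exact word_mem_mlWords _

theorem ι_mem_mlWords {S : Multiset X} {x : FreeLieAlgebra R X} (hx : x ∈ mlLie R S) :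
    ι R x ∈ mlWords R S := by
  have h : mlLie R S ≤ (mlWords R S).comap (ι R) := by
    refine Submodule.span_le.mpr ?_
    rintro _ ⟨w, rfl, rfl⟩
    have h := word_mem_mlWords (R := R) [w]
    simpa [word] using h
  exact h hx

theorem tprod_mem_mlWords {k : ℕ} {S : Fin k → Multiset X} {x : Fin k → FreeLieAlgebra R X}
    (hx : ∀ i, x i ∈ mlLie R (S i)) : tprod R _ k x ∈ mlWords R (∑ i, S i) := by
  rw [TensorAlgebra.tprod_apply]
  induction k with
  | zero => exact one_mem_mlWords
  | succ k ih =>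
    rw [List.ofFn_succ, List.prod_cons, Fin.sum_univ_succ]
    exact mul_mem_mlWords (ι_mem_mlWords (hx 0)) (ih fun i => hx i.succ)

/-- The blocks distribute the letters of the two words without loss or repetition, and the Lie
polynomials are multilinear, so the product preserves the total content. -/
theorem cofreeLin_mem_mlWords (ω : LieFamily R) {S T : Multiset X}
    {u v : TensorAlgebra R (FreeLieAlgebra R X)} (hu : u ∈ mlWords R S) (hv : v ∈ mlWords R T) :
    cofreeLin (shuffleβ ω _) (u ⊗ₜ v) ∈ mlWords R (S + T) := by
  refine bilin_mem_of_mem_span ((TensorProduct.mk R _ _).compr₂ (cofreeLin (shuffleβ ω _))) ?_ hu hv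
  rintro _ ⟨l, rfl, rfl⟩ _ ⟨l', rfl, rfl⟩
  change cofreeLin (shuffleβ ω _) (_ ⊗ₜ _) ∈ _
  obtain ⟨p, x, rfl⟩ : ∃ (p : ℕ) (x : Fin p → FreeMagma X), l = List.ofFn x :=
    ⟨_, l.get, (List.ofFn_get l).symm⟩
  obtain ⟨q, y, rfl⟩ : ∃ (q : ℕ) (y : Fin q → FreeMagma X), l' = List.ofFn y :=
    ⟨_, l'.get, (List.ofFn_get l').symm⟩
  simp only [List.map_ofFn, List.sum_ofFn, word_ofFn, cofreeLin_shuffleβ]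
  refine sum_mem fun k _ => sum_mem fun P _ => sum_mem fun Q _ => ?_
  have h : ∑ i, (leaves ∘ x) i + ∑ i, (leaves ∘ y) i = ∑ β : Fin k,
      ∑ i : Fin (P.1 β) ⊕ Fin (Q.1 β), leaves (Sum.elim (fun i => x (P.blocks ⟨β, i⟩))
        (fun i => y (Q.blocks ⟨β, i⟩)) i) := by
    simp only [Fintype.sum_sum_type, Finset.sum_add_distrib, Sum.elim_inl, Sum.elim_inr]
    rw [← Equiv.sum_comp P.blocks, ← Equiv.sum_comp Q.blocks, Fintype.sum_sigma,
      Fintype.sum_sigma]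
    rfl
  rw [h]
  refine tprod_mem_mlWords fun β => ?_
  have h' := lift_mem_mlLie (R := R) (Sum.elim (fun i => x (P.blocks ⟨β, i⟩))
    (fun i => y (Q.blocks ⟨β, i⟩))) (ω (P.1 β) (Q.1 β))
  convert h' using 1
  refine congrArg (fun f => FreeLieAlgebra.lift R f (ω (P.1 β) (Q.1 β)).1) ?_
  funext i
  rcases i with i | i <;> rfl

theorem weight_mem_mlWords (c : ℕ → R) {S : Multiset X} {u : TensorAlgebra R (FreeLieAlgebra R X)}
    (hu : u ∈ mlWords R S) : weight c u ∈ mlWords R S := by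
  have h : mlWords R S ≤ (mlWords R S).comap (weight c) := by
    refine Submodule.span_le.mpr ?_
    rintro _ ⟨l, rfl, rfl⟩
    change weight c (word R (l.map (lieMonomial R))) ∈ mlWords R _
    rw [weight_words c (word_mem_words _)]
    exact Submodule.smul_mem _ _ (word_mem_mlWords l)
  exact h hu

variable (R) in
/-- The part of multidegree `S` of `FL(X)`, viewed in words of length one. -/
def mlLetters (S : Multiset X) : Submodule R (TensorAlgebra R (FreeLieAlgebra R X)) :=
  Submodule.span R {u | ∃ w : FreeMagma X, leaves w = S ∧ u = ι R (lieMonomial R w)}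

theorem prT_mem_mlLetters {S : Multiset X} {u : TensorAlgebra R (FreeLieAlgebra R X)}
    (hu : u ∈ mlWords R S) : prT R _ u ∈ mlLetters R S := by
  have h : mlWords R S ≤ (mlLetters R S).comap (prT R _) := by
    refine Submodule.span_le.mpr ?_
    rintro _ ⟨l, rfl, rfl⟩
    change prT R _ (word R (l.map (lieMonomial R))) ∈ mlLetters R _
    rw [prT_word]
    split_ifs with hl
    · rw [List.length_map, List.length_eq_one_iff] at hl
      obtain ⟨w, rfl⟩ := hl
      exact Submodule.subset_span ⟨w, by simp, by simp [word]⟩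
    · exact zero_mem _
  exact h hu

theorem mlLetters_le (S : Multiset X) : mlLetters R S ≤ mlWords R S := by
  refine Submodule.span_le.mpr ?_
  rintro _ ⟨w, rfl, rfl⟩
  exact ι_mem_mlWords (Submodule.subset_span ⟨w, rfl, rfl⟩)

theorem relabel_mem_mlWords {Y : Type} (e : X → Y) {S : Multiset X}
    {u : TensorAlgebra R (FreeLieAlgebra R X)} (hu : u ∈ mlWords R S) :
    tMap ((relabel e : FreeLieAlgebra R X →ₗ⁅R⁆ FreeLieAlgebra R Y) :
      FreeLieAlgebra R X →ₗ[R] FreeLieAlgebra R Y) u ∈ mlWords R (S.map e) := by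
  have h : mlWords R S ≤ (mlWords R (S.map e)).comap
      (tMap ((relabel e : FreeLieAlgebra R X →ₗ⁅R⁆ FreeLieAlgebra R Y) :
      FreeLieAlgebra R X →ₗ[R] FreeLieAlgebra R Y)).toLinearMap := by
    refine Submodule.span_le.mpr ?_
    rintro _ ⟨l, rfl, rfl⟩
    change tMap ((relabel e : FreeLieAlgebra R X →ₗ⁅R⁆ FreeLieAlgebra R Y) :
      FreeLieAlgebra R X →ₗ[R] FreeLieAlgebra R Y) (word R (l.map (lieMonomial R))) ∈ mlWords R _
    have hl : (l.map (lieMonomial R)).map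
        ((relabel e : FreeLieAlgebra R X →ₗ⁅R⁆ FreeLieAlgebra R Y) :
      FreeLieAlgebra R X →ₗ[R] FreeLieAlgebra R Y) =
        (l.map (FreeMagma.map e)).map (lieMonomial R) := by
      rw [List.map_map, List.map_map]
      exact List.map_congr_left fun w _ => relabel_lieMonomial e w
    rw [tMap_word, hl]
    refine Submodule.subset_span ⟨l.map (FreeMagma.map e), ?_, rfl⟩
    rw [← Multiset.coe_mapAddMonoidHom, map_list_sum, List.map_map, List.map_map]
    congr 1
    exact List.map_congr_left fun w _ => leaves_map e w
  exact h hu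

end Multidegree

end ShuffleHopf

end

noncomputable section

namespace ShuffleHopf

open TensorProduct TensorAlgebra WordGraded

/-! ### Universal families -/

section Pairs

universe u

variable {R : Type u} [CommRing R] {ω : LieFamily R} (hω : ω.IsShuffleFamily) {X : Type}

variable (X) in
/-- The algebra in which universal formulas with letters in `X` are written. -/
abbrev UnivAlg : Type u :=
  Sh (shuffleDatum (FreeLieAlgebra R X) hω) ⊗[R] TensorAlgebra R (FreeLieAlgebra R X)

/-- The elements of multidegree `S` in both factors. -/
def mlPairs (S : Multiset X) : Submodule R (UnivAlg hω X) :=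
  Submodule.span R {z | ∃ u ∈ mlWords R S, ∃ v ∈ mlWords R S, z = Sh.ofT u ⊗ₜ v}

theorem tmul_mem_mlPairs {S : Multiset X} {u v : TensorAlgebra R (FreeLieAlgebra R X)}
    (hu : u ∈ mlWords R S) (hv : v ∈ mlWords R S) :
    (Sh.ofT u ⊗ₜ v : UnivAlg hω X) ∈ mlPairs hω S :=
  Submodule.subset_span ⟨u, hu, v, hv, rfl⟩

theorem one_mem_mlPairs : (1 : UnivAlg hω X) ∈ mlPairs hω (0 : Multiset X) :=
  tmul_mem_mlPairs hω one_mem_mlWords one_mem_mlWords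

variable {hω}

theorem mul_mem_mlPairs {S T : Multiset X} {z z' : UnivAlg hω X} (hz : z ∈ mlPairs hω S)
    (hz' : z' ∈ mlPairs hω T) : z * z' ∈ mlPairs hω (S + T) := by
  refine bilin_mem_of_mem_span (LinearMap.mul R (UnivAlg hω X)) ?_ hz hz'
  rintro _ ⟨u, hu, v, hv, rfl⟩ _ ⟨u', hu', v', hv', rfl⟩
  rw [LinearMap.mul_apply', Algebra.TensorProduct.tmul_mul_tmul, Sh.ofT_mul_ofT]
  exact tmul_mem_mlPairs hω (cofreeLin_mem_mlWords ω hu hu') (mul_mem_mlWords hv hv')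

theorem stepLin_mem_mlPairs (c : ℕ → R) {S T : Multiset X} {z z' : UnivAlg hω X}
    (hz : z ∈ mlPairs hω S) (hz' : z' ∈ mlPairs hω T) :
    stepLin _ (shuffleDatum (FreeLieAlgebra R X) hω) c z z' ∈ mlPairs hω (S + T) := by
  refine bilin_mem_of_mem_span (stepLin _ (shuffleDatum (FreeLieAlgebra R X) hω) c) ?_ hz hz'
  rintro _ ⟨u, hu, v, hv, rfl⟩ _ ⟨u', hu', v', hv', rfl⟩
  rw [stepLin_tmul, shuffleDatum_rev_β]
  exact tmul_mem_mlPairs hω (weight_mem_mlWords c (mul_mem_mlWords hu hu'))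
    (mlLetters_le _ (prT_mem_mlLetters (cofreeLin_mem_mlWords ω.vee hv hv')))

end Pairs

/-! ### Functoriality in a pair of Lie algebras. -/

section PairMap

variable {R : Type*} [CommRing R] {ω : LieFamily R} (hω : ω.IsShuffleFamily)
  {L₁ : Type*} [LieRing L₁] [LieAlgebra R L₁] {L₁' : Type*} [LieRing L₁'] [LieAlgebra R L₁']
  {L₂ : Type*} [LieRing L₂] [LieAlgebra R L₂] {L₂' : Type*} [LieRing L₂'] [LieAlgebra R L₂']
  {L₃ : Type*} [LieRing L₃] [LieAlgebra R L₃] {L₃' : Type*} [LieRing L₃'] [LieAlgebra R L₃']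

/-- The morphism induced by a pair of morphisms of Lie algebras. -/
def pairMap (φ : L₁ →ₗ⁅R⁆ L₂) (ψ : L₁' →ₗ⁅R⁆ L₂') :
    Sh (shuffleDatum L₁ hω) ⊗[R] TensorAlgebra R L₁' →ₐ[R]
      Sh (shuffleDatum L₂ hω) ⊗[R] TensorAlgebra R L₂' :=
  Algebra.TensorProduct.map (shMap φ hω) (tMap (ψ : L₁' →ₗ[R] L₂'))

variable {hω}

theorem pairMap_tmul (φ : L₁ →ₗ⁅R⁆ L₂) (ψ : L₁' →ₗ⁅R⁆ L₂') (u : TensorAlgebra R L₁)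
    (v : TensorAlgebra R L₁') : pairMap hω φ ψ (Sh.ofT u ⊗ₜ v) =
      Sh.ofT (tMap (φ : L₁ →ₗ[R] L₂) u) ⊗ₜ tMap (ψ : L₁' →ₗ[R] L₂') v := rfl

theorem pairMap_stepLin (φ : L₁ →ₗ⁅R⁆ L₂) (ψ : L₁' →ₗ⁅R⁆ L₂') (c : ℕ → R)
    (z z' : Sh (shuffleDatum L₁ hω) ⊗[R] TensorAlgebra R L₁') :
    pairMap hω φ ψ (stepLin _ (shuffleDatum L₁' hω) c z z') =
      stepLin _ (shuffleDatum L₂' hω) c (pairMap hω φ ψ z) (pairMap hω φ ψ z') := by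
  induction z using TensorProduct.induction_on with
  | zero => simp
  | add a b ha hb => simp only [map_add, LinearMap.add_apply, ha, hb]
  | tmul x y =>
    induction z' using TensorProduct.induction_on with
    | zero => simp
    | add a b ha hb => simp only [map_add, ha, hb]
    | tmul x' y' =>
      obtain ⟨x, rfl⟩ := Sh.ofT.surjective x
      obtain ⟨x', rfl⟩ := Sh.ofT.surjective x'
      rw [stepLin_tmul, pairMap_tmul, pairMap_tmul, pairMap_tmul, stepLin_tmul, tMap_weight,
        map_mul, tMap_prT, shuffleDatum_rev_β, shuffleDatum_rev_β, tMap_cofreeLin]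

theorem tMap_tMap (φ : L₁ →ₗ⁅R⁆ L₂) (ψ : L₂ →ₗ⁅R⁆ L₃) (u : TensorAlgebra R L₁) :
    tMap (ψ : L₂ →ₗ[R] L₃) (tMap (φ : L₁ →ₗ[R] L₂) u) = tMap (ψ.comp φ : L₁ →ₗ[R] L₃) u := by
  have h : (tMap (ψ : L₂ →ₗ[R] L₃)).toLinearMap ∘ₗ (tMap (φ : L₁ →ₗ[R] L₂)).toLinearMap =
      (tMap (ψ.comp φ : L₁ →ₗ[R] L₃)).toLinearMap := by
    refine linearMap_ext_word fun l => ?_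
    change tMap (ψ : L₂ →ₗ[R] L₃) (tMap (φ : L₁ →ₗ[R] L₂) _) = tMap (ψ.comp φ : L₁ →ₗ[R] L₃) _
    rw [tMap_word, tMap_word, tMap_word, List.map_map]
    rfl
  exact LinearMap.congr_fun h u

theorem pairMap_pairMap (φ : L₁ →ₗ⁅R⁆ L₂) (ψ : L₂ →ₗ⁅R⁆ L₃) (φ' : L₁' →ₗ⁅R⁆ L₂')
    (ψ' : L₂' →ₗ⁅R⁆ L₃') (z : Sh (shuffleDatum L₁ hω) ⊗[R] TensorAlgebra R L₁') :
    pairMap hω ψ ψ' (pairMap hω φ φ' z) = pairMap hω (ψ.comp φ) (ψ'.comp φ') z := by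
  induction z using TensorProduct.induction_on with
  | zero => simp
  | add a b ha hb => simp only [map_add, ha, hb]
  | tmul x y =>
    obtain ⟨x, rfl⟩ := Sh.ofT.surjective x
    rw [pairMap_tmul, pairMap_tmul, pairMap_tmul, tMap_tMap, tMap_tMap]

end PairMap

/-! ### Families of elements given by universal formulas. -/

section Families

universe u v w

/-- Two Lie algebras with a finite family of elements of each of them. -/
structure PairData (R : Type u) [CommRing R] where
  La : Type v
  Lb : Type w
  [lieRingA : LieRing La]
  [lieAlgebraA : LieAlgebra R La]
  [lieRingB : LieRing Lb]
  [lieAlgebraB : LieAlgebra R Lb]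
  I : Type
  [fintype : Fintype I]
  a : I → La
  b : I → Lb

attribute [instance] PairData.lieRingA PairData.lieAlgebraA PairData.lieRingB
  PairData.lieAlgebraB PairData.fintype

variable {R : Type u} [CommRing R] {ω : LieFamily R} (hω : ω.IsShuffleFamily)

/-- The algebra attached to a pair of Lie algebras. -/
abbrev PairData.Alg (d : PairData.{u, v, w} R) : Type _ :=
  Sh (shuffleDatum d.La hω) ⊗[R] TensorAlgebra R d.Lb

/-- The evaluation of a universal formula. -/
def PairData.eval (d : PairData.{u, v, w} R) {X : Type} (s : X → d.I) :
    UnivAlg hω X →ₐ[R] d.Alg hω :=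
  pairMap hω (FreeLieAlgebra.lift R (d.a ∘ s)) (FreeLieAlgebra.lift R (d.b ∘ s))

theorem PairData.eval_tmul (d : PairData.{u, v, w} R) {X : Type} (s : X → d.I)
    (u v : TensorAlgebra R (FreeLieAlgebra R X)) : d.eval hω s (Sh.ofT u ⊗ₜ v) =
      Sh.ofT (tMap (FreeLieAlgebra.lift R (d.a ∘ s) : FreeLieAlgebra R X →ₗ[R] d.La) u) ⊗ₜ
        tMap (FreeLieAlgebra.lift R (d.b ∘ s) : FreeLieAlgebra R X →ₗ[R] d.Lb) v := rfl

/-- The renaming of letters. -/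
def relabelPair {X Y : Type} (e : X → Y) : UnivAlg hω X →ₐ[R] UnivAlg hω Y :=
  pairMap hω (relabel e) (relabel e)

theorem relabelPair_mem {X Y : Type} (e : X → Y) {S : Multiset X} {z : UnivAlg hω X}
    (hz : z ∈ mlPairs hω S) : relabelPair hω e z ∈ mlPairs hω (S.map e) := by
  have h : mlPairs hω S ≤ (mlPairs hω (S.map e)).comap (relabelPair hω e).toLinearMap := by
    refine Submodule.span_le.mpr ?_
    rintro _ ⟨u, hu, v, hv, rfl⟩
    exact tmul_mem_mlPairs hω (relabel_mem_mlWords e hu) (relabel_mem_mlWords e hv)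
  exact h hz

theorem lift_comp_relabel {X Y : Type} (e : X → Y) {L : Type*} [LieRing L] [LieAlgebra R L]
    (f : Y → L) :
    (FreeLieAlgebra.lift R f).comp (relabel e) = FreeLieAlgebra.lift R (f ∘ e) :=
  FreeLieAlgebra.hom_ext fun i => by simp [relabel, FreeLieAlgebra.lift_of_apply]

theorem eval_relabelPair (d : PairData.{u, v, w} R) {X Y : Type} (e : X → Y) (s : Y → d.I)
    (z : UnivAlg hω X) : d.eval hω s (relabelPair hω e z) = d.eval hω (s ∘ e) z := by
  rw [PairData.eval, relabelPair, pairMap_pairMap, PairData.eval]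
  rw [lift_comp_relabel, lift_comp_relabel]
  rfl

/-- A family of elements `F(a, b)`, for all finite families `a`, `b` of elements of Lie algebras,
is universal of degree `n` if it is given by a sum over `n`-tuples of indices of the values of a
formula, multilinear in `n` letters. -/
def IsUniv (n : ℕ) (F : ∀ d : PairData.{u, v, w} R, d.Alg hω) : Prop :=
  ∃ z ∈ mlPairs hω (Finset.univ : Finset (Fin n)).val, ∀ d : PairData.{u, v, w} R,
    F d = ∑ s : Fin n → d.I, d.eval hω s z

namespace IsUniv

variable {hω} {n m : ℕ} {F G : ∀ d : PairData.{u, v, w} R, d.Alg hω}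

theorem zero : IsUniv hω n (fun d : PairData.{u, v, w} R => (0 : d.Alg hω)) :=
  ⟨0, zero_mem _, fun d => by simp⟩

theorem add (hF : IsUniv hω n F) (hG : IsUniv hω n G) : IsUniv hω n (fun d => F d + G d) := by
  obtain ⟨z, hz, hF⟩ := hF
  obtain ⟨z', hz', hG⟩ := hG
  exact ⟨z + z', add_mem hz hz', fun d => by simp only [hF, hG, map_add, Finset.sum_add_distrib]⟩

theorem sum {ι : Type*} (s : Finset ι) {F : ι → ∀ d : PairData.{u, v, w} R, d.Alg hω}
    (h : ∀ i ∈ s, IsUniv hω n (F i)) : IsUniv hω n (fun d => ∑ i ∈ s, F i d) := by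
  classical
  induction s using Finset.induction_on with
  | empty => exact zero
  | insert i s hi ih =>
    simp only [Finset.sum_insert hi]
    exact (h i (Finset.mem_insert_self i s)).add
      (ih fun j hj => h j (Finset.mem_insert_of_mem hj))

theorem one : IsUniv hω 0 (fun d : PairData.{u, v, w} R => (1 : d.Alg hω)) :=
  ⟨1, one_mem_mlPairs hω, fun d => by simp⟩

theorem univ_fin_add (n m : ℕ) : (Finset.univ : Finset (Fin (n + m))).val =
    (Finset.univ : Finset (Fin n)).val.map (Fin.castAdd m) +
      (Finset.univ : Finset (Fin m)).val.map (Fin.natAdd n) := by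
  rw [← Finset.map_univ_equiv finSumFinEquiv, ← Finset.univ_disjSum_univ, Finset.map_val,
    Finset.val_disjSum, Multiset.disjSum, Multiset.map_add, Multiset.map_map, Multiset.map_map]
  rfl

/-- Closure of universal families under natural operations. -/
theorem bilin {B : ∀ d : PairData.{u, v, w} R, d.Alg hω →ₗ[R] d.Alg hω →ₗ[R] d.Alg hω}
    (B₀ : ∀ X : Type, UnivAlg hω X →ₗ[R] UnivAlg hω X →ₗ[R] UnivAlg hω X)
    (hB : ∀ (X : Type) (d : PairData.{u, v, w} R) (s : X → d.I) (z z' : UnivAlg hω X),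
      d.eval hω s (B₀ X z z') = B d (d.eval hω s z) (d.eval hω s z'))
    (hB₀ : ∀ (X : Type) (S T : Multiset X) (z z' : UnivAlg hω X), z ∈ mlPairs hω S →
      z' ∈ mlPairs hω T → B₀ X z z' ∈ mlPairs hω (S + T))
    (hF : IsUniv hω n F) (hG : IsUniv hω m G) :
    IsUniv hω (n + m) (fun d => B d (F d) (G d)) := by
  obtain ⟨z, hz, hF⟩ := hF
  obtain ⟨z', hz', hG⟩ := hG
  -- The two formulas are written in disjoint sets of letters, the first `n` and the last `m`. The
  -- sum over `(n + m)`-tuples then splits into the product of the two sums.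
  refine ⟨B₀ _ (relabelPair hω (Fin.castAdd m) z) (relabelPair hω (Fin.natAdd n) z'), ?_,
    fun d => ?_⟩
  · rw [univ_fin_add]
    exact hB₀ _ _ _ _ _ (relabelPair_mem hω _ hz) (relabelPair_mem hω _ hz')
  · beta_reduce
    rw [hF, hG, map_sum (B d), LinearMap.sum_apply, ← Equiv.sum_comp (Fin.appendEquiv n m),
      Fintype.sum_prod_type]
    refine Finset.sum_congr rfl fun s _ => ?_
    rw [map_sum]
    refine Finset.sum_congr rfl fun t _ => ?_
    rw [hB, eval_relabelPair, eval_relabelPair]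
    congr 3
    · congr 1
      funext i
      simp [Fin.appendEquiv]
    · funext i
      simp [Fin.appendEquiv]

theorem mul (hF : IsUniv hω n F) (hG : IsUniv hω m G) :
    IsUniv hω (n + m) (fun d => F d * G d) :=
  bilin (B := fun d => LinearMap.mul R (d.Alg hω)) (fun X => LinearMap.mul R (UnivAlg hω X))
    (fun X d s z z' => map_mul (d.eval hω s) z z') (fun X S T z z' => mul_mem_mlPairs) hF hG

theorem step (c : ℕ → R) (hF : IsUniv hω n F) (hG : IsUniv hω m G) :
    IsUniv hω (n + m) (fun d => stepLin _ (shuffleDatum d.Lb hω) c (F d) (G d)) :=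
  bilin (B := fun d => stepLin _ (shuffleDatum d.Lb hω) c)
    (fun X => stepLin _ (shuffleDatum (FreeLieAlgebra R X) hω) c)
    (fun X d s z z' => pairMap_stepLin _ _ c z z')
    (fun X S T z z' => stepLin_mem_mlPairs c) hF hG

theorem foldr {ρ : ∀ d : PairData.{u, v, w} R, ℕ → d.Alg hω} {k : ℕ} (P : Fin k → ℕ)
    (h : ∀ i, IsUniv hω (P i) (fun d => ρ d (P i))) :
    IsUniv hω (∑ i, P i) (fun d => (List.ofFn fun i => ρ d (P i)).foldr (· * ·) 1) := by
  induction k with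
  | zero => exact one
  | succ k ih =>
    simp only [List.ofFn_succ, List.foldr_cons, Fin.sum_univ_succ]
    exact (h 0).mul (ih (fun i => P i.succ) fun i => h i.succ)

theorem tupleSum {ρ : ∀ d : PairData.{u, v, w} R, ℕ → d.Alg hω} {n : ℕ}
    (h : ∀ j ≤ n, IsUniv hω j (fun d => ρ d j)) :
    IsUniv hω n (fun d => ShuffleHopf.tupleSum (ρ d) n) := by
  refine sum _ fun k _ => sum _ fun P hP => ?_
  rw [Finset.mem_filter, Finset.Nat.mem_antidiagonalTuple] at hP
  rw [← hP.1]
  refine foldr P fun i => h _ ?_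
  rw [← hP.1]
  exact Finset.single_le_sum (fun _ _ => Nat.zero_le _) (Finset.mem_univ i)

-- The base case is the formula `x ⊗ y` in one letter, and the recursion uses only products,
-- `stepLin` and finite sums, under which universal families are closed.
variable (hω) in
theorem rhoR (c : ℕ → R) (n : ℕ) : IsUniv hω n (fun d : PairData.{u, v, w} R =>
    ShuffleHopf.rhoR _ (shuffleDatum d.Lb hω) c (∑ i, d.a i ⊗ₜ[R] d.b i) n) := by
  induction n using Nat.strong_induction_on with
  | _ n ih =>
    match n, ih with
    | 0, _ =>
      simp only [rhoR_zero]
      exact zero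
    | 1, _ =>
      simp only [rhoR_one]
      refine ⟨Sh.ofT (ι R (FreeLieAlgebra.of R 0)) ⊗ₜ ι R (FreeLieAlgebra.of R 0), ?_, fun d => ?_⟩
      · have h : ι R (FreeLieAlgebra.of R (0 : Fin 1)) ∈
            mlWords R (Finset.univ : Finset (Fin 1)).val :=
          ι_mem_mlWords (Submodule.subset_span ⟨.of 0, rfl, rfl⟩)
        exact tmul_mem_mlPairs hω h h
      · beta_reduce
        rw [map_sum, ← Equiv.sum_comp (Equiv.funUnique (Fin 1) d.I).symm]
        refine Finset.sum_congr rfl fun i _ => ?_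
        rw [PairData.eval_tmul, tMap_ι, tMap_ι]
        simp [FreeLieAlgebra.lift_of_apply]
    | n + 2, ih =>
      simp only [rhoR_eq _ _ _ _ (Nat.le_add_left 2 n), rhoStepR_eq_sum]
      refine sum _ fun j hj => ?_
      rw [Finset.mem_Ioo] at hj
      have hn : n + 2 = j + (n + 2 - j) := by omega
      conv => arg 2; rw [hn]
      exact step c (tupleSum fun i hi => ih i (by omega)) (tupleSum fun i hi => ih i (by omega))

end IsUniv

end Families

end ShuffleHopf

end

noncomputable section

namespace ShuffleHopf

open TensorProduct TensorAlgebra WordGraded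

/-! ### From universal families to tensor products of free Lie algebras -/

section Letters

universe u v w

variable {R : Type u} [CommRing R] {ω : LieFamily R} (hω : ω.IsShuffleFamily)

variable (R) in
/-- The elements of multidegree `S` in both factors, of degree one in the second factor. -/
def letterPairs {X : Type} (S : Multiset X) : Submodule R (UnivAlg hω X) :=
  Submodule.span R {z | ∃ (l : List (FreeMagma X)) (w : FreeMagma X), (l.map leaves).sum = S ∧
    leaves w = S ∧ z = Sh.ofT (word R (l.map (lieMonomial R))) ⊗ₜ ι R (lieMonomial R w)}

theorem prT_mem_letterPairs {X : Type} {S : Multiset X} {z : UnivAlg hω X}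
    (hz : z ∈ mlPairs hω S) :
    LinearMap.lTensor _ (prT R (FreeLieAlgebra R X)) z ∈ letterPairs R hω S := by
  have h : mlPairs hω S ≤ (letterPairs R hω S).comap
      (LinearMap.lTensor _ (prT R (FreeLieAlgebra R X))) := by
    refine Submodule.span_le.mpr ?_
    rintro _ ⟨u, hu, v, hv, rfl⟩
    have hv' := prT_mem_mlLetters hv
    rw [mlLetters] at hv'
    change Sh.ofT u ⊗ₜ prT R _ v ∈ letterPairs R hω S
    refine bilin_mem_of_mem_span (v := prT R _ v) ((TensorProduct.mk R (Sh (shuffleDatum (FreeLieAlgebra R X) hω))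
      (TensorAlgebra R (FreeLieAlgebra R X))).comp Sh.ofT.toLinearMap) ?_ hu hv'
    rintro _ ⟨l, hl, rfl⟩ _ ⟨w, hw, rfl⟩
    exact Submodule.subset_span ⟨l, w, hl, hw, rfl⟩
  exact h hz

theorem eval_lTensor_prT (d : PairData.{u, v, w} R) {X : Type} (s : X → d.I) (z : UnivAlg hω X) :
    d.eval hω s (LinearMap.lTensor _ (prT R (FreeLieAlgebra R X)) z) =
      LinearMap.lTensor _ (prT R d.Lb) (d.eval hω s z) := by
  induction z using TensorProduct.induction_on with
  | zero => simp
  | add a b ha hb => simp only [map_add, ha, hb]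
  | tmul x y =>
    obtain ⟨x, rfl⟩ := Sh.ofT.surjective x
    rw [LinearMap.lTensor_tmul, PairData.eval_tmul, PairData.eval_tmul, LinearMap.lTensor_tmul,
      tMap_prT]

/-- Since `ρ_n` has length one in the second factor and evaluation commutes with the projection to
that length, the universal formula may be projected without changing its values. -/
theorem exists_letterPairs (c : ℕ → R) (n : ℕ) :
    ∃ z ∈ letterPairs R hω (Finset.univ : Finset (Fin n)).val, ∀ d : PairData.{u, v, w} R,
      rhoR _ (shuffleDatum d.Lb hω) c (∑ i, d.a i ⊗ₜ[R] d.b i) n = ∑ s, d.eval hω s z := by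
  obtain ⟨z, hz, h⟩ := IsUniv.rhoR.{u, v, w} hω c n
  refine ⟨_, prT_mem_letterPairs hω hz, fun d => ?_⟩
  have hd := h d
  beta_reduce at hd
  rw [← lTensor_prT_rhoR, hd, map_sum]
  exact Finset.sum_congr rfl fun s _ => (eval_lTensor_prT hω d s z).symm

theorem map_map_magma {X Y Z : Type} (f : X → Y) (f' : Y → Z) (w : FreeMagma X) :
    FreeMagma.map f' (FreeMagma.map f w) = FreeMagma.map (fun i => f' (f i)) w := by
  induction w using FreeMagma.rec with
  | of i => rfl
  | mul a b iha ihb => exact congrArg₂ FreeMagma.mul iha ihb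

theorem map_val_eq_sum {X Y : Type*} (s : Finset X) (f : X → Y) :
    s.val.map f = ∑ x ∈ s, ({f x} : Multiset Y) := by
  rw [← Multiset.sum_map_singleton (s.val.map f), Multiset.map_map]
  rfl

/-- Every bracketed word comes from a bracketed word where each letter occurs exactly once. -/
theorem exists_multilinear {X : Type} (w : FreeMagma X) : ∃ (m : ℕ) (w' : FreeMagma (Fin m))
    (g : Fin m → X), 0 < m ∧ leaves w' = (Finset.univ : Finset (Fin m)).val ∧
      FreeMagma.map g w' = w := by
  induction w using FreeMagma.rec with
  | of i => exact ⟨1, .of 0, fun _ => i, one_pos, rfl, rfl⟩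
  | mul a b iha ihb =>
    obtain ⟨m, a, g, hm, ha, rfl⟩ := iha
    obtain ⟨m', b, g', -, hb, rfl⟩ := ihb
    refine ⟨m + m', .mul (FreeMagma.map (Fin.castAdd m') a) (FreeMagma.map (Fin.natAdd m) b),
      Fin.append g g', by omega, ?_, ?_⟩
    · rw [leaves, leaves_map, leaves_map, ha, hb, IsUniv.univ_fin_add]
    · change FreeMagma.mul (FreeMagma.map _ (FreeMagma.map _ a))
        (FreeMagma.map _ (FreeMagma.map _ b)) = FreeMagma.mul _ _
      rw [map_map_magma, map_map_magma, funext (Fin.append_left g g' : ∀ i, _),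
        funext (Fin.append_right g g' : ∀ i, _)]

theorem lift_map_lieMonomial {X Y : Type} {L : Type*} [LieRing L] [LieAlgebra R L] (f : Y → L)
    (e : X → Y) (w : FreeMagma X) : FreeLieAlgebra.lift R f (lieMonomial R (FreeMagma.map e w)) =
      FreeLieAlgebra.lift R (f ∘ e) (lieMonomial R w) := by
  rw [← relabel_lieMonomial, ← lift_comp_relabel]
  rfl

/-- A word of bracketed words in which each letter of `Fin n` occurs exactly once comes from
multilinear bracketed words by a bijection of letters. -/
theorem exists_blocks {n : ℕ} (l : List (FreeMagma (Fin n)))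
    (hl : (l.map leaves).sum = (Finset.univ : Finset (Fin n)).val) :
    ∃ (k : ℕ) (P : Fin k → ℕ) (x : ∀ i, FreeMagma (Fin (P i)))
      (e : (Σ i, Fin (P i)) ≃ Fin n), (∀ i, 0 < P i) ∧
      (∀ i, leaves (x i) = (Finset.univ : Finset (Fin (P i))).val) ∧
      l = List.ofFn fun i => FreeMagma.map (fun j => e ⟨i, j⟩) (x i) := by
  choose m w g hm hw hg using fun w : FreeMagma (Fin n) => exists_multilinear w
  obtain ⟨k, y, rfl⟩ : ∃ (k : ℕ) (y : Fin k → FreeMagma (Fin n)), l = List.ofFn y :=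
    ⟨_, l.get, (List.ofFn_get l).symm⟩
  let G : (Σ i, Fin (m (y i))) → Fin n := fun p => g (y p.1) p.2
  -- Every entry of the word is a relabelled multilinear bracket, and together the labels use each
  -- letter of `Fin n` exactly once. The labelling is thus surjective, and bijective by counting.
  have hG : (Finset.univ : Finset (Σ i, Fin (m (y i)))).val.map G =
      (Finset.univ : Finset (Fin n)).val := by
    rw [← hl, List.map_ofFn, List.sum_ofFn, map_val_eq_sum, Fintype.sum_sigma]
    refine Finset.sum_congr rfl fun i _ => ?_
    rw [← map_val_eq_sum, ← hw (y i), Function.comp_apply]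
    conv_rhs => rw [← hg (y i), leaves_map]
  have hsurj : Function.Surjective G := fun j => by
    have hj : j ∈ (Finset.univ : Finset (Fin n)).val := Finset.mem_univ j
    rw [← hG, Multiset.mem_map] at hj
    obtain ⟨p, -, hp⟩ := hj
    exact ⟨p, hp⟩
  have hcard : Fintype.card (Σ i, Fin (m (y i))) = Fintype.card (Fin n) := by
    have h := congrArg Multiset.card hG
    rwa [Multiset.card_map] at h
  refine ⟨k, fun i => m (y i), fun i => w (y i), Equiv.ofBijective G
    ((Fintype.bijective_iff_surjective_and_card G).mpr ⟨hsurj, hcard⟩), fun i => hm _,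
    fun i => hw _, ?_⟩
  congr 1
  funext i
  exact (hg (y i)).symm

end Letters

end ShuffleHopf

end

noncomputable section

namespace ShuffleHopf

open TensorProduct TensorAlgebra WordGraded

/-! ### Universal formulas for the components of degree one -/

section Universality

universe v w

variable {K : Type*} [Field K] {𝔞 : Type*} [LieRing 𝔞] [LieAlgebra K 𝔞]
  {𝔟 : Type*} [LieRing 𝔟] [LieAlgebra K 𝔟] {ω : LieFamily K⟦X⟧}

attribute [local instance] seriesAlgebra
attribute [local instance] isScalarTower_series

theorem mapSer_mul {V W : Type*} [Ring V] [Algebra K V] [Ring W] [Algebra K W] (f : V →ₐ[K] W)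
    (F G : V⟦X⟧) : mapSer f.toLinearMap (F * G) = mapSer f.toLinearMap F * mapSer f.toLinearMap G := by
  ext n
  simp [coeff_mapSer, PowerSeries.coeff_mul]

theorem mapSer_list_prod {V W : Type*} [Ring V] [Algebra K V] [Ring W] [Algebra K W]
    (f : V →ₐ[K] W) (l : List V⟦X⟧) :
    (l.map (mapSer f.toLinearMap)).prod = mapSer f.toLinearMap l.prod := by
  induction l with
  | nil =>
    change 1 = mapSer f.toLinearMap (const (K := K) 1)
    rw [mapSer_const, AlgHom.toLinearMap_apply, map_one]
    rfl
  | cons F l ih => rw [List.map_cons, List.prod_cons, List.prod_cons, mapSer_mul, ih]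

theorem hTensor_one_mul {V W : Type*} [Ring V] [Algebra K V] [Ring W] [Algebra K W] (F : V⟦X⟧)
    (G : W⟦X⟧) : mapSer ((TensorProduct.mk K V W).flip 1) F * mapSer (TensorProduct.mk K V W 1) G =
      hTensor (F ⊗ₜ[K] G) := by
  ext n
  simp [PowerSeries.coeff_mul, coeff_mapSer, coeff_hTensor]

theorem toSeriesAlg_baseChange {V : Type*} [Ring V] [Algebra K V] (f : TensorAlgebra K 𝔞 →ₗ[K] V)
    (z : K⟦X⟧ ⊗[K] 𝔞) : toSeriesAlg K V ((f ∘ₗ ι K).baseChange K⟦X⟧ z) =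
      mapSer f (serMap K 𝔞 (ι K⟦X⟧ z)) := by
  rw [← toSeries_eq, serMap_ι, ← toSeries_eq]
  induction z using TensorProduct.induction_on with
  | zero => simp
  | add a b ha hb => simp only [map_add, ha, hb]
  | tmul c x =>
    rw [LinearMap.baseChange_tmul, LinearMap.lTensor_tmul, toSeries_tmul, toSeries_tmul,
      mapSer_smul, mapSer_const]
    rfl

/-- On pure tensors the letters from `𝔞` multiply in the first factor by concatenation, and the
single letter from `𝔟` occupies the second. -/
theorem toSeries_kappaTerm {k : ℕ} (P : Fin k → ℕ) (a : (Σ i : Fin k, Fin (P i)) → 𝔞)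
    (b : (Σ i : Fin k, Fin (P i)) → 𝔟) (x : ∀ i, FL K⟦X⟧ (Fin (P i)))
    (y : FL K⟦X⟧ (Σ i : Fin k, Fin (P i))) :
    toSeries (kappaTerm P a b (PiTensorProduct.tprod K⟦X⟧ x ⊗ₜ y)) =
      hTensor (serMap K 𝔞 (tprod K⟦X⟧ _ k fun i => polyApp (fun j => a ⟨i, j⟩) (x i)) ⊗ₜ[K]
        serMap K 𝔟 (ι K⟦X⟧ (polyApp b y))) := by
  rw [kappaTerm, TensorProduct.lift.tmul, LinearMap.compl₁₂_apply, LinearMap.mul_apply',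
    PiTensorProduct.lift.tprod, toSeries_eq, map_mul, LinearMap.comp_apply, toSeriesAlg_baseChange,
    MultilinearMap.compLinearMap_apply, MultilinearMap.mkPiAlgebraFin_apply, map_list_prod,
    List.map_ofFn, TensorAlgebra.tprod_apply, map_list_prod, List.map_ofFn, ← hTensor_one_mul]
  congr 1
  have h := mapSer_list_prod (Algebra.TensorProduct.includeLeft :
    TensorAlgebra K 𝔞 →ₐ[K] TensorAlgebra K 𝔞 ⊗[K] TensorAlgebra K 𝔟)
    (List.ofFn ((serMap K 𝔞) ∘ fun i => ι K⟦X⟧ (polyApp (fun j => a ⟨i, j⟩) (x i))))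
  refine Eq.trans ?_ h
  rw [List.map_ofFn]
  congr 2
  funext i
  exact toSeriesAlg_baseChange _ _

theorem polyApp_genFL {Y : Type*} [Fintype Y] (x : Y) (h : ∀ y : Y, y = x) (f : Y → 𝔞) :
    polyApp f (genFL K⟦X⟧ x h) = (1 : K⟦X⟧) ⊗ₜ[K] f x :=
  FreeLieAlgebra.lift_of_apply _ _

section Kappa

variable {I : Type} [Fintype I] (a : I → 𝔞) (b : I → 𝔟) {k : ℕ} (P : Fin k → ℕ)

theorem toSeries_smul {V : Type*} [Ring V] [Algebra K V] (c : K⟦X⟧) (z : K⟦X⟧ ⊗[K] V) :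
    toSeries (c • z) = c • (toSeries z : V⟦X⟧) := by
  rw [toSeries_eq, toSeries_eq, map_smul]

theorem kappa_zero : kappa a b P (0 : UnivSpace K P) = 0 := by simp [kappa]

theorem kappa_add (x y : UnivSpace K P) : kappa a b P (x + y) = kappa a b P x + kappa a b P y := by
  simp [kappa, Finset.sum_add_distrib]

theorem kappa_smul (c : K⟦X⟧) (x : UnivSpace K P) : kappa a b P (c • x) = c • kappa a b P x := by
  simp only [kappa, map_smul, toSeries_smul]
  exact (Finset.smul_sum (r := c) (s := Finset.univ)
    (f := fun s => (toSeries (kappaTerm P (a ∘ s) (b ∘ s) x) :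
      (TensorAlgebra K 𝔞 ⊗[K] TensorAlgebra K 𝔟)⟦X⟧))).symm

theorem kappa_univOne : kappa a b (fun _ : Fin 1 => 1) (univOne K) =
    inclR (∑ i, a i ⊗ₜ[K] b i) := by
  let e : (Σ _ : Fin 1, Fin 1) ≃ Fin 1 := Equiv.sigmaUnique _ _
  rw [kappa, ← Equiv.sum_comp ((Equiv.funUnique (Fin 1) I).symm.trans
    (Equiv.arrowCongr e.symm (Equiv.refl I))), inclR, map_sum, map_sum]
  refine Finset.sum_congr rfl fun i _ => ?_
  rw [univOne, toSeries_kappaTerm]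
  simp only [polyApp_genFL]
  have h := serMap_tprod (K := K) fun _ : Fin 1 => a i
  have h' : tprod K 𝔞 1 (fun _ => a i) = ι K (a i) := by simp [TensorAlgebra.tprod_apply]
  rw [h'] at h
  refine (congrArg₂ (fun F G => hTensor (F ⊗ₜ[K] G)) h (serMap_ι_one_tmul (b i))).trans ?_
  exact hTensor_const _ _

end Kappa

/-- The data attached to finite families of elements, after extension of scalars. -/
@[reducible]
def serData {I : Type} [Fintype I] (a : I → 𝔞) (b : I → 𝔟) : PairData K⟦X⟧ where
  La := K⟦X⟧ ⊗[K] 𝔞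
  Lb := K⟦X⟧ ⊗[K] 𝔟
  I := I
  a i := 1 ⊗ₜ a i
  b i := 1 ⊗ₜ b i

variable (hω : ω.IsShuffleFamily)

/-- The entries of the word become the factors in `FL_{n_i}` after relabelling by the bijection of
`exists_blocks`, and the bracket in the second factor is pulled back along the same bijection. The
element is chosen before the Lie algebras, so it does not depend on them. -/
theorem mixedΦ_eval_generator {n : ℕ} (hn : 1 ≤ n) (l : List (FreeMagma (Fin n)))
    (w : FreeMagma (Fin n)) (hl : (l.map leaves).sum = (Finset.univ : Finset (Fin n)).val)
    (hw : leaves w = (Finset.univ : Finset (Fin n)).val) :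
    ∃ k ∈ Finset.Icc 1 n, ∃ P ∈ (Finset.Nat.antidiagonalTuple k n).filter (fun P => ∀ i, 0 < P i),
      ∃ x : UnivSpace K P, ∀ {𝔞 : Type v} {𝔟 : Type w} [LieRing 𝔞] [LieAlgebra K 𝔞] [LieRing 𝔟]
        [LieAlgebra K 𝔟] {I : Type} [Fintype I] (a : I → 𝔞) (b : I → 𝔟),
        mixedΦ hω (∑ s, (serData (K := K) a b).eval hω s
          (Sh.ofT (word K⟦X⟧ (l.map (lieMonomial K⟦X⟧))) ⊗ₜ ι K⟦X⟧ (lieMonomial K⟦X⟧ w))) =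
        kappa a b P x := by
  obtain ⟨k, P, y, e, hP, hy, rfl⟩ := exists_blocks l hl
  have hsum : ∑ i, P i = n := by
    have h := Fintype.card_congr e
    simpa using h
  have hk : k ≤ n := by
    rw [← hsum]
    calc k = ∑ _i : Fin k, 1 := by simp
      _ ≤ ∑ i, P i := Finset.sum_le_sum fun i _ => hP i
  have hk' : 1 ≤ k := by
    rcases Nat.eq_zero_or_pos k with rfl | h
    · simp at hsum
      omega
    · exact h
  have hw' : lieMonomial K⟦X⟧ (FreeMagma.map e.symm w) ∈ FL K⟦X⟧ (Σ i, Fin (P i)) := by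
    refine Submodule.subset_span ⟨FreeMagma.map e.symm w, ?_, rfl⟩
    change leaves _ = _
    rw [leaves_map, hw, ← Finset.map_univ_equiv e.symm]
    rfl
  refine ⟨k, Finset.mem_Icc.mpr ⟨hk', hk⟩, P, Finset.mem_filter.mpr
    ⟨Finset.Nat.mem_antidiagonalTuple.mpr hsum, hP⟩,
    PiTensorProduct.tprod K⟦X⟧ (fun i => (⟨lieMonomial K⟦X⟧ (y i),
      Submodule.subset_span ⟨y i, hy i, rfl⟩⟩ : FL K⟦X⟧ (Fin (P i)))) ⊗ₜ
      (⟨lieMonomial K⟦X⟧ (FreeMagma.map e.symm w), hw'⟩ : FL K⟦X⟧ (Σ i, Fin (P i))), ?_⟩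
  intro 𝔞 𝔟 _ _ _ _ I _ a b
  -- Families of indices over `Fin n` and over the pairs (block, position) correspond through `e`.
  rw [kappa, map_sum, ← Equiv.sum_comp (Equiv.arrowCongr e.symm (Equiv.refl I))]
  refine Finset.sum_congr rfl fun s _ => ?_
  rw [toSeries_kappaTerm, PairData.eval_tmul, SeriesModel.tensor_Φ_tmul, tMap_ι, tMap_word,
    List.map_ofFn, List.map_ofFn, word_ofFn]
  have hb : FreeLieAlgebra.lift K⟦X⟧ ((serData (K := K) a b).b ∘ s) (lieMonomial K⟦X⟧ w) =
      polyApp (b ∘ Equiv.arrowCongr e.symm (Equiv.refl I) s)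
        ⟨lieMonomial K⟦X⟧ (FreeMagma.map e.symm w), hw'⟩ := by
    refine Eq.trans ?_ (lift_map_lieMonomial _ e.symm w).symm
    congr 2
    funext j
    simp
  have ha : ((FreeLieAlgebra.lift K⟦X⟧ ((serData (K := K) a b).a ∘ s) :
      FreeLieAlgebra K⟦X⟧ (Fin n) →ₗ[K⟦X⟧] K⟦X⟧ ⊗[K] 𝔞) ∘ lieMonomial K⟦X⟧ ∘
        fun i => FreeMagma.map (fun j => e ⟨i, j⟩) (y i)) =
      fun i => polyApp (fun j => (a ∘ Equiv.arrowCongr e.symm (Equiv.refl I) s) ⟨i, j⟩)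
        ⟨lieMonomial K⟦X⟧ (y i), Submodule.subset_span ⟨y i, hy i, rfl⟩⟩ :=
    funext fun i => lift_map_lieMonomial _ _ (y i)
  exact congrArg₂ (fun u v => hTensor (serMap K 𝔞 (tprod K⟦X⟧ _ k u) ⊗ₜ[K]
    serMap K 𝔟 (ι K⟦X⟧ v))) ha hb

theorem exists_sum_kappa {n : ℕ} (hn : 1 ≤ n) (z : UnivAlg hω (Fin n))
    (hz : z ∈ letterPairs K⟦X⟧ hω (Finset.univ : Finset (Fin n)).val) :
    ∃ Λ : ∀ q : (Σ k : ℕ, Fin k → ℕ), UnivSpace K q.2,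
      ∀ {𝔞 : Type v} {𝔟 : Type w} [LieRing 𝔞] [LieAlgebra K 𝔞] [LieRing 𝔟]
        [LieAlgebra K 𝔟] {I : Type} [Fintype I] (a : I → 𝔞) (b : I → 𝔟),
        mixedΦ hω (∑ s, (serData (K := K) a b).eval hω s z) =
          ∑ q ∈ (Finset.Icc 1 n).sigma fun k =>
            (Finset.Nat.antidiagonalTuple k n).filter (fun P => ∀ i, 0 < P i),
              kappa a b q.2 (Λ q) := by
  induction hz using Submodule.span_induction with
  | zero => exact ⟨0, fun a b => by simp [kappa_zero]⟩
  | add x y _ _ hx hy =>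
    obtain ⟨Λ, hΛ⟩ := hx
    obtain ⟨Λ', hΛ'⟩ := hy
    refine ⟨Λ + Λ', fun a b => ?_⟩
    simp only [map_add, Finset.sum_add_distrib, hΛ, hΛ', Pi.add_apply, kappa_add]
  | smul c x _ hx =>
    obtain ⟨Λ, hΛ⟩ := hx
    refine ⟨c • Λ, fun a b => ?_⟩
    simp only [Pi.smul_apply, kappa_smul, map_smul]
    rw [← Finset.smul_sum, map_smul, hΛ]
    exact Finset.smul_sum (r := c) (f := fun q : (Σ k : ℕ, Fin k → ℕ) => kappa a b q.2 (Λ q))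
  | mem x hx =>
    obtain ⟨l, w, hl, hw, rfl⟩ := hx
    obtain ⟨k, hk, P, hP, x, hx⟩ := mixedΦ_eval_generator hω hn l w hl hw
    -- A generator contributes to a single tuple of block sizes.
    refine ⟨Pi.single ⟨k, P⟩ x, fun a b => ?_⟩
    rw [hx, Finset.sum_eq_single ⟨k, P⟩, Pi.single_eq_same]
    · intro q _ hq
      rw [Pi.single_eq_of_ne hq, kappa_zero]
    · intro h
      exact absurd (Finset.mem_sigma.mpr ⟨hk, hP⟩) h

/-- The components of degree one are given by universal formulas. -/
theorem exists_universal (hω : ω.IsShuffleFamily) :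
    ∃ Λ : ∀ (k : ℕ) (n : Fin k → ℕ), UnivSpace K n, Λ 1 (fun _ => 1) = univOne K ∧
      ∀ {𝔞 : Type v} {𝔟 : Type w} [LieRing 𝔞] [LieAlgebra K 𝔞] [LieRing 𝔟] [LieAlgebra K 𝔟]
        {I : Type} [Fintype I] (a : I → 𝔞) (b : I → 𝔟) (n : ℕ), 1 ≤ n →
        rho ω (∑ i, a i ⊗ₜ[K] b i) n =
          ∑ k ∈ Finset.Icc 1 n,
            ∑ P ∈ (Finset.Nat.antidiagonalTuple k n).filter (fun P => ∀ i, 0 < P i),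
              kappa a b P (Λ k P) := by
  have H : ∀ n : ℕ, ∃ Λ : ∀ q : (Σ k : ℕ, Fin k → ℕ), UnivSpace K q.2,
      (n = 1 → Λ ⟨1, fun _ => 1⟩ = univOne K) ∧
      ∀ {𝔞 : Type v} {𝔟 : Type w} [LieRing 𝔞] [LieAlgebra K 𝔞] [LieRing 𝔟]
        [LieAlgebra K 𝔟] {I : Type} [Fintype I] (a : I → 𝔞) (b : I → 𝔟), 1 ≤ n →
        rho ω (∑ i, a i ⊗ₜ[K] b i) n =
          ∑ q ∈ (Finset.Icc 1 n).sigma fun k =>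
            (Finset.Nat.antidiagonalTuple k n).filter (fun P => ∀ i, 0 < P i),
              kappa a b q.2 (Λ q) := fun n => by
    -- Degree one is treated apart so that the coefficient is exactly `x_1 ⊗ y_1`; in higher degree
    -- any coefficients obtained from the universal formula will do.
    rcases Nat.lt_or_ge n 2 with hn | hn
    · refine ⟨Pi.single ⟨1, fun _ => 1⟩ (univOne K), fun _ => Pi.single_eq_same _ _,
        fun a b hn' => ?_⟩
      obtain rfl : n = 1 := by omega
      rw [rho, Finset.sum_eq_single (⟨1, fun _ => 1⟩ : Σ k : ℕ, Fin k → ℕ), Pi.single_eq_same, kappa_univOne]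
      · intro q _ hq
        rw [Pi.single_eq_of_ne hq, kappa_zero]
      · intro h
        exact (h (Finset.mem_sigma.mpr ⟨Finset.mem_Icc.mpr ⟨le_rfl, le_rfl⟩, Finset.mem_filter.mpr
          ⟨Finset.Nat.mem_antidiagonalTuple.mpr (Fin.sum_univ_one _), fun _ => one_pos⟩⟩)).elim
    · obtain ⟨z, hz, h⟩ := exists_letterPairs hω (homotopyCoeff K) n
      obtain ⟨Λ, hΛ⟩ := exists_sum_kappa hω (by omega) z hz
      refine ⟨Λ, fun h => by omega, fun a b _ => ?_⟩
      rw [← hΛ, ← mixedΦ_rhoR hω, map_sum]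
      exact congrArg _ (h (serData a b))
  choose Λ h1 h using H
  -- The choices made for different `n` do not interfere: a tuple is used only in the degree equal
  -- to its sum.
  refine ⟨fun k P => Λ (∑ i, P i) ⟨k, P⟩, h1 _ (by simp), fun a b n hn => ?_⟩
  rw [h n a b hn, Finset.sum_sigma]
  refine Finset.sum_congr rfl fun k _ => Finset.sum_congr rfl fun P hP => ?_
  rw [Finset.mem_filter, Finset.Nat.mem_antidiagonalTuple] at hP
  rw [← hP.1]

end Universality

end ShuffleHopf

end

theorem mainTheorem7 {K : Type*} [Field K] [CharZero K]
    (ω : ShuffleHopf.LieFamily K⟦X⟧) (hω : ω.IsShuffleFamily) :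
    (∃ Λ : ∀ (k : ℕ) (n : Fin k → ℕ), ShuffleHopf.UnivSpace K n,
      Λ 1 (fun _ => 1) = ShuffleHopf.univOne K ∧
      ∀ {𝔞 𝔟 : Type*} [LieRing 𝔞] [LieAlgebra K 𝔞] [LieRing 𝔟] [LieAlgebra K 𝔟]
        {I : Type} [Fintype I] (a : I → 𝔞) (b : I → 𝔟) (n : ℕ), 1 ≤ n →
        ShuffleHopf.rho ω (∑ i, a i ⊗ₜ[K] b i) n =
          ∑ k ∈ Finset.Icc 1 n,
            ∑ P ∈ (Finset.Nat.antidiagonalTuple k n).filter (fun P => ∀ i, 0 < P i),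
              ShuffleHopf.kappa a b P (Λ k P)) ∧
    ∀ {𝔞 𝔟 : Type*} [LieRing 𝔞] [LieAlgebra K 𝔞] [LieRing 𝔟] [LieAlgebra K 𝔟]
      (r : 𝔞 ⊗[K] 𝔟),
      ShuffleHopf.rMat ω r 0 = 1 ∧
      ShuffleHopf.rMat ω r 1 = ShuffleHopf.inclR r ∧
      (∀ n : ℕ, ShuffleHopf.comulLeft (ShuffleHopf.rMat ω r n) =
        ∑ k ∈ Finset.range (n + 1),
          ShuffleHopf.mulAAB ω ω
            (ShuffleHopf.mapSer (ShuffleHopf.ins13 K _ _ _) (ShuffleHopf.rMat ω r k))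
            (ShuffleHopf.mapSer (ShuffleHopf.ins23 K _ _ _) (ShuffleHopf.rMat ω r (n - k)))) ∧
      (∀ n : ℕ, ShuffleHopf.comulRight (ShuffleHopf.rMat ω r n) =
        ∑ k ∈ Finset.range (n + 1),
          ShuffleHopf.mulABB ω ω
            (ShuffleHopf.mapSer (ShuffleHopf.ins13 K _ _ _) (ShuffleHopf.rMat ω r k))
            (ShuffleHopf.mapSer (ShuffleHopf.ins12 K _ _ _) (ShuffleHopf.rMat ω r (n - k)))) ∧
      ∃ S : (TensorAlgebra K 𝔟)⟦X⟧ ≃ₗ[K] (TensorAlgebra K 𝔟)⟦X⟧,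
        (∀ u, S u = ShuffleHopf.hExt (ShuffleHopf.antipode ω 𝔟) u) ∧
        ∀ n : ℕ, ShuffleHopf.applyLeft (ShuffleHopf.antipode ω 𝔞) (ShuffleHopf.rMat ω r n) =
          ShuffleHopf.applyRight (S.symm.toLinearMap ∘ₗ ShuffleHopf.const)
            (ShuffleHopf.rMat ω r n) :=
  ⟨ShuffleHopf.exists_universal hω, fun r =>
    ⟨ShuffleHopf.rMat_zero r, ShuffleHopf.rMat_one hω r, ShuffleHopf.comulLeft_rMat hω r,
      ShuffleHopf.comulRight_rMat hω r, ShuffleHopf.antipodeEquiv _ hω, fun _ => rfl,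
      ShuffleHopf.applyLeft_antipode_rMat hω r⟩⟩
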